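/- **Definitions.** $\mathcal C_0$-manifolds are smooth manifolds, $\mathcal C_0$-maps are smooth maps. For $L$ compact, write $C_\varepsilon(L)=[0,\varepsilon)\times L/(\{0\}\times L)$. Write $\alpha(b,r)=o_2(r^k)$ if $\partial_r^j\alpha=o(r^{k-j})$ as $r\downarrow0$ for $j=0,1,2$, locally uniformly in $b$. Inductively, a $\mathcal C_m$-manifold $M$ ($m\ge1$) is a topological space that is the disjoint union of strata $\mathcal C_0,\dots,\mathcal C_m$, such that: * $\mathcal C_0$ (the smooth stratum) is open and a smooth $n$-manifold, possibly with boundary. Every point of $\mathcal C_k$, $k\ge1$, lies in a $\mathcal C_k$-neighbourhood: an open set identified with $\mathbb R^h\times C_\varepsilon(L)$, where the link $L$ is a compact $\mathcal C_{k-1}$-manifold without boundary, $n=h+1+\dim L$. The point lies on $\mathbb R^h\times\{0\}$; the points of $\mathbb R^h\times\{0\}$ are in $\mathcal C_k$, and for $r>0$ the point $(b,r,x)$ is in the stratum of the same index as $x\in L$. The identification is a diffeomorphism on the smooth strata. * Transition functions between overlapping $\mathcal C_k$-neighbourhoods have the form $(b,r,x)\mapsto(\psi(b),\varphi(b,r),f(b,x))$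 with $\psi,\varphi$ smooth away from $r=0$, $\varphi(b,r)=a(b)r+o_2(r)$, $a>0$, and $f$ a $\mathcal C_{k-1}$-map. (A $\mathcal C_k$-map preserves the strata, is smooth on the smooth stratum, and is of this form between $\mathcal C_j$-neighbourhoods, with $f$ a $\mathcal C_{j-1}$-map.) * There are Riemannian metrics $g_{\mathcal C_k}$ on the strata $\mathcal C_k$, $k\ge 1$, and $g$ on $\mathcal C_0$ such that in each $\mathcal C_k$-neighbourhood $$g=\pi^*g_{\mathcal C_k}\oplus(\partial_r\beta)(b,r)^2dr^2\oplus\beta(b,r)^2g_L(b)+o_2(r^2),$$ where $\pi$ is the projection to the base, $\beta$ is smooth for $r>0$, $\beta(b,r)=a(b)r+o_2(r)$ with $a>0$, and $g_L(b)$ is a family of metrics on $L$ such that $\mathbb R^h\times L$ with the metric $\pi^*g_{\mathcal C_k}\oplus g_L$ is a $\mathcal C_{k-1}$-manifold. The error is measured with respect to $\pi^*g_{\mathcal C_k}\oplus dr^2\oplus g_L(b)$, uniformly in $x\in L$ and locally uniformly in $b$. A manifold with iterated asymptotically conical singularities (IACS manifold) is a $\mathcal C_m$-manifold for some $m$; its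 singular stratum is $\mathcal C=\bigcup_{k\ge1}\mathcal C_k$. For $p\in\mathcal C_0$, $d_{\mathcal C}(p)=\operatorname{dist}(p,\mathcal C)$ is the infimum of the $g$-lengths of paths from $p$ to $\mathcal C$ (with $1/d_{\mathcal C}(p)=0$ if there is none). For a Hermitian vector bundle $E\to\mathcal C_0$ with Hermitian connection $\nabla$, let $C_c^\infty(M,E)$ be the smooth compactly supported sections vanishing near $\mathcal C$, and $H^1(M,E)$ its completion for $\|\sigma\|_{H^1}=(\|\sigma\|_{L^2}^2+\|\nabla\sigma\|_{L^2}^2)^{1/2}$, with its natural map to $L^2(M,E)$. **Proposition.** Let $M$ be a compact Hausdorff IACS manifold, all of whose links (including the links of links, which are links of nearby singular points) have dimension at least $2$. Then $d_{\mathcal C}>0$ on the smooth stratum, and there is a constant $C$, depending only on $M$ with its IACS structure and metric, such that for every Hermitian vector bundle $E$ with Hermitian connection over the smooth stratum, multiplication by $1/d_{\mathcal C}$ defines a bounded linear operator $H^1(M,E)\to L^2(M,E)$ of operator norm at most $C$. -/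

import Mathlib

open Set Filter Topology MeasureTheory Bundle
open scoped Manifold ContDiff ENNReal NNReal

universe u w

noncomputable section

namespace IACS

/-! ### Riemannian geometry on smooth manifolds -/

section Riemannian

variable {n : ℕ} {H : Type*} [TopologicalSpace H]
  (I : ModelWithCorners ℝ (EuclideanSpace ℝ (Fin n)) H)
  {R : Type*} [TopologicalSpace R] [ChartedSpace H R] [IsManifold I ∞ R]

/-- Smooth Riemannian metrics on a manifold modelled on `I`, where the model vector space `E` is
arbitrary. -/
abbrev Metric {E : Type*} [NormedAddCommGroup E] [NormedSpace ℝ E] {H : Type*} [TopologicalSpace H]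
    (I : ModelWithCorners ℝ E H) (R : Type*) [TopologicalSpace R] [ChartedSpace H R]
    [IsManifold I ∞ R] :=
  ContMDiffRiemannianMetric (IB := I) (n := ∞) (F := E) (E := fun x : R ↦ TangentSpace I x)

variable {I}

/-- The `i`-th coordinate vector of the preferred chart at `x`, as a tangent vector at `x`. -/
def coordVec (x : R) (i : Fin n) : TangentSpace I x :=
  (EuclideanSpace.single i (1 : ℝ) : EuclideanSpace ℝ (Fin n))

/-- The Gram matrix `g_ij(y)` of the metric in the chart at `x₀`, at the coordinate point `y`. -/
def chartGram (g : Metric I R) (x₀ : R) (y : EuclideanSpace ℝ (Fin n)) :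
    Matrix (Fin n) (Fin n) ℝ :=
  let dφ := mfderivWithin 𝓘(ℝ, EuclideanSpace ℝ (Fin n)) I (extChartAt I x₀).symm (range I) y
  Matrix.of fun i j ↦ g.inner ((extChartAt I x₀).symm y)
    (dφ (EuclideanSpace.single i (1 : ℝ) : EuclideanSpace ℝ (Fin n)))
    (dφ (EuclideanSpace.single j (1 : ℝ) : EuclideanSpace ℝ (Fin n)))

/-- The Riemannian volume measure on the domain of the chart at `x₀`, extended by zero:
`√(det g_ij) dy` transported by the inverse chart. -/
def chartVolume [MeasurableSpace R] (g : Metric I R) (x₀ : R) : Measure R :=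
  ((volume.restrict (extChartAt I x₀).target).withDensity
    fun y ↦ ENNReal.ofReal (√(chartGram g x₀ y).det)).map (extChartAt I x₀).symm

/-- The Riemannian volume measure: the smallest measure that dominates the chart expressions.
(These agree on overlaps, so on a second countable manifold this is the measure which is
`√(det g_ij) dy` in every chart.) -/
def riemVolume [MeasurableSpace R] (g : Metric I R) : Measure R := ⨆ x₀ : R, chartVolume g x₀

/-- The squared Hilbert–Schmidt norm `∑ g^{ij} ⟨D eᵢ, D eⱼ⟩` of a linear map
`D : T_x R → W` with respect to the metric `g` on `T_x R` and the inner product of `W`. -/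
def hsNormSq (g : Metric I R) (x : R) {W : Type*} [NormedAddCommGroup W] [InnerProductSpace ℝ W]
    (D : TangentSpace I x →L[ℝ] W) : ℝ :=
  let G : Matrix (Fin n) (Fin n) ℝ :=
    Matrix.of fun i j ↦ g.inner x (coordVec (I := I) x i) (coordVec (I := I) x j)
  ∑ i, ∑ j, G⁻¹ i j * inner ℝ (D (coordVec x i)) (D (coordVec x j))

/-- The length of the path `γ` restricted to `[0,1)`. -/
def pathLength (g : Metric I R) (γ : ℝ → R) : ℝ≥0∞ :=
  ∫⁻ t in Ioo (0 : ℝ) 1, ENNReal.ofReal (√(g.inner (γ t)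
    (mfderiv 𝓘(ℝ, ℝ) I γ t (1 : ℝ)) (mfderiv 𝓘(ℝ, ℝ) I γ t (1 : ℝ))))

end Riemannian

/-! ### Hermitian bundles with connection, and their sections -/

attribute [local instance] InnerProductSpace.complexToReal

section Bundles

variable {n : ℕ} {H : Type*} [TopologicalSpace H]
  (I : ModelWithCorners ℝ (EuclideanSpace ℝ (Fin n)) H)
  (R : Type*) [TopologicalSpace R] [ChartedSpace H R] [IsManifold I ∞ R]

/-- A smooth Hermitian vector bundle of finite rank with a Hermitian connection: a smooth real
vector bundle whose fibres are complex inner product spaces, with smooth multiplication by `i` and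
smoothly varying inner product, and a smooth, complex linear, metric covariant derivative. -/
structure HermitianBundle where
  F : Type w
  [normF : NormedAddCommGroup F]
  [spaceF : NormedSpace ℝ F]
  [finF : FiniteDimensional ℝ F]
  V : R → Type w
  [topTotal : TopologicalSpace (TotalSpace F V)]
  [normV : ∀ x, NormedAddCommGroup (V x)]
  [innerV : ∀ x, InnerProductSpace ℂ (V x)]
  [fiber : FiberBundle F V]
  [vector : VectorBundle ℝ F V]
  [smooth : ContMDiffVectorBundle ∞ F V I]
  [smoothMetric : IsContMDiffRiemannianBundle I ∞ F V]
  smooth_I : ∀ σ : Π x, V x,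
    ContMDiff I (I.prod 𝓘(ℝ, F)) ∞ (fun x ↦ TotalSpace.mk' F x (σ x)) →
    ContMDiff I (I.prod 𝓘(ℝ, F)) ∞ (fun x ↦ TotalSpace.mk' F x (Complex.I • σ x))
  conn : CovariantDerivative I F V
  [smoothConn : conn.ContMDiffCovariantDerivative ∞]
  conn_metric : conn.IsMetricCompatible
  conn_I : ∀ (σ : Π x, V x) (x : R),
    MDifferentiableAt I (I.prod 𝓘(ℝ, F)) (fun y ↦ TotalSpace.mk' F y (σ y)) x →
    ∀ X : TangentSpace I x, conn (fun y ↦ Complex.I • σ y) x X = Complex.I • conn σ x X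

attribute [instance] HermitianBundle.normF HermitianBundle.spaceF HermitianBundle.finF
  HermitianBundle.topTotal HermitianBundle.normV HermitianBundle.innerV HermitianBundle.fiber
  HermitianBundle.vector HermitianBundle.smooth HermitianBundle.smoothMetric
  HermitianBundle.smoothConn

namespace HermitianBundle

variable {I R} (𝓔 : HermitianBundle.{w} I R)

/-- Sections of the bundle, with no regularity. -/
abbrev Sec := Π x : R, 𝓔.V x

/-- A section as a map to the total space. -/
def graph (s : 𝓔.Sec) (x : R) : TotalSpace 𝓔.F 𝓔.V := TotalSpace.mk' 𝓔.F x (s x)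

/-- Smooth sections with compact support in the manifold `R`. -/
def IsTest (σ : 𝓔.Sec) : Prop :=
  ContMDiff I (I.prod 𝓘(ℝ, 𝓔.F)) ∞ (𝓔.graph σ) ∧ ∃ K : Set R, IsCompact K ∧ ∀ x ∉ K, σ x = 0

variable [MeasurableSpace R] (g : Metric I R)

/-- The `L²`-norm, possibly infinite. -/
def l2Norm (s : 𝓔.Sec) : ℝ≥0∞ := (∫⁻ x, ‖s x‖ₑ ^ 2 ∂(riemVolume g)) ^ (1 / 2 : ℝ)

/-- `s` is a (representative of an) element of `L²`: it is almost everywhere equal to a Borel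
measurable section, and `|s|²` is integrable. -/
def MemL2 (s : 𝓔.Sec) : Prop :=
  @AEMeasurable R (TotalSpace 𝓔.F 𝓔.V) (borel _) _ (𝓔.graph s) (riemVolume g) ∧ 𝓔.l2Norm g s < ⊤

/-- The `H¹`-norm `(‖σ‖² + ‖∇σ‖²)^{1/2}` with `L²`-norms on the right. -/
def h1Norm (σ : 𝓔.Sec) : ℝ≥0∞ :=
  (∫⁻ x, ‖σ x‖ₑ ^ 2 ∂(riemVolume g) +
    ∫⁻ x, ENNReal.ofReal (hsNormSq g x (𝓔.conn σ x)) ∂(riemVolume g)) ^ (1 / 2 : ℝ)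

/-- A sequence of test sections that is Cauchy for the `H¹`-norm, that is, a representative of an
element of the completion `H¹`. -/
def IsH1Cauchy (u : ℕ → 𝓔.Sec) : Prop :=
  (∀ k, 𝓔.IsTest (u k)) ∧
    Tendsto (fun p : ℕ × ℕ ↦ 𝓔.h1Norm g (u p.1 - u p.2)) atTop (𝓝 0)

/-- `s ∈ H¹` with norm `N`: the section `s ∈ L²` is the image, under the inclusion of `H¹` into
`L²`, of the element of the completion `H¹` that is represented by the `H¹`-Cauchy sequence `u` of
test sections, and `N` is the norm of this element. -/
structure RepresentsH1 (u : ℕ → 𝓔.Sec) (s : 𝓔.Sec) (N : ℝ≥0∞) : Prop where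
  cauchy : 𝓔.IsH1Cauchy g u
  memL2 : 𝓔.MemL2 g s
  tendsto_l2 : Tendsto (fun k ↦ 𝓔.l2Norm g (u k - s)) atTop (𝓝 0)
  tendsto_norm : Tendsto (fun k ↦ 𝓔.h1Norm g (u k)) atTop (𝓝 N)

end HermitianBundle

end Bundles
/-! ### Cones and stratified spaces -/

/-- On `[0, ε) × L`, the relation that crushes `{0} × L` to a point. -/
def coneSetoid (ε : ℝ) (L : Type u) : Setoid (Ico (0 : ℝ) ε × L) where
  r a b := a = b ∨ ((a.1 : ℝ) = 0 ∧ (b.1 : ℝ) = 0)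
  iseqv := by
    refine ⟨fun _ ↦ Or.inl rfl, ?_, ?_⟩
    · rintro a b (h | h)
      exacts [Or.inl h.symm, Or.inr h.symm]
    · rintro a b c (rfl | h) (rfl | h')
      exacts [Or.inl rfl, Or.inr h', Or.inr h, Or.inr ⟨h.1, h'.2⟩]

/-- The open cone `C_ε(L) = [0, ε) × L / {0} × L`, with the quotient topology. -/
def OpenCone (ε : ℝ) (L : Type u) : Type u := Quotient (coneSetoid ε L)

instance (ε : ℝ) (L : Type u) [TopologicalSpace L] : TopologicalSpace (OpenCone ε L) :=
  inferInstanceAs (TopologicalSpace (Quotient (coneSetoid ε L)))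

/-- The point `[r, x]` of the cone, for `r ∈ [0, ε)` (and the apex for all other `r`). -/
def OpenCone.mk (ε : Ioi (0 : ℝ)) {L : Type u} (r : ℝ) (x : L) : OpenCone (ε : ℝ) L :=
  open Classical in
  Quotient.mk (coneSetoid ε L)
    (if hr : r ∈ Ico (0 : ℝ) ε then ⟨r, hr⟩ else ⟨0, le_rfl, ε.2⟩, x)

/-- A topological space partitioned into a smooth stratum `{depth = 0}`, which is a smooth manifold
of dimension `dim` (possibly with boundary, depending on the model `I`), and the sets
`{depth = k}`, `k ≥ 1`, which will be the strata `𝒞_k`. -/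
structure StratSpace where
  dim : ℕ
  carrier : Type u
  [top : TopologicalSpace carrier]
  depth : carrier → ℕ
  isOpen_smooth : IsOpen {p | depth p = 0}
  H : Type
  [topH : TopologicalSpace H]
  I : ModelWithCorners ℝ (EuclideanSpace ℝ (Fin dim)) H
  [charted : ChartedSpace H {p : carrier // depth p = 0}]
  [smooth : IsManifold I ∞ {p : carrier // depth p = 0}]

attribute [instance] StratSpace.top StratSpace.topH

/-- The smooth stratum. -/
abbrev StratSpace.Reg (X : StratSpace.{u}) : Type u := {p : X.carrier // X.depth p = 0}

instance (X : StratSpace.{u}) : ChartedSpace X.H X.Reg := X.charted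

instance (X : StratSpace.{u}) : IsManifold X.I ∞ X.Reg := X.smooth

instance (X : StratSpace.{u}) : MeasurableSpace X.Reg := borel _

instance (X : StratSpace.{u}) : BorelSpace X.Reg := ⟨rfl⟩

/-- The singular stratum `𝒞`, the union of the strata `𝒞_k` with `k ≥ 1`. -/
def StratSpace.sing (X : StratSpace.{u}) : Set X.carrier := {p | X.depth p ≠ 0}

/-- The distance to the singular stratum: the infimum of the lengths of the paths that start at `p`,
run in the smooth stratum during `[0, 1)` and end in the singular stratum at time `1`
(`∞` if there is no such path). -/
def singDist {X : StratSpace.{u}} (g : Metric X.I X.Reg) (p : X.Reg) : ℝ≥0∞ :=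
  ⨅ (γ : ℝ → X.Reg) (_ : γ 0 = p ∧ ContMDiffOn 𝓘(ℝ, ℝ) X.I 1 γ (Ico 0 1) ∧
    ∃ q ∈ X.sing, Tendsto (fun t ↦ (γ t : X.carrier)) (𝓝[<] 1) (𝓝 q)), pathLength g γ

/-- Riemannian metrics on `P × (smooth stratum of X)`, for a vector space `P`. -/
abbrev ProdMetric (P : Type) [NormedAddCommGroup P] [NormedSpace ℝ P] (X : StratSpace.{u}) :=
  Metric (𝓘(ℝ, P).prod X.I) (P × X.Reg)

/-- Riemannian metrics on a vector space `P`, seen as a manifold. -/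
abbrev BaseMetric (P : Type) [NormedAddCommGroup P] [NormedSpace ℝ P] := Metric 𝓘(ℝ, P) P

/-! ### The asymptotic form of maps and metrics near the singular strata -/

/-- `α(b, r) = o₂(r ^ k)` at the base point `b₀`: for `j ≤ 2`, the `j`-th `r`-derivative is
`o(r ^ (k - j))` as `r ↓ 0`, locally uniformly in `b`. -/
def IsLittleO₂ {B : Type} [TopologicalSpace B] (α : B → ℝ → ℝ) (k : ℕ) (b₀ : B) : Prop :=
  ∀ j ≤ 2, (fun q : B × ℝ ↦ q.2 ^ j * iteratedDeriv j (α q.1) q.2)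
    =o[𝓝 b₀ ×ˢ 𝓝[>] 0] fun q ↦ q.2 ^ k

section ConicMetric

variable {B : Type} [NormedAddCommGroup B] [NormedSpace ℝ B] {L : StratSpace.{u}}

/-- The model metric `π^* g_B ⊕ β'(b,r)² dr² ⊕ β(b,r)² g_L(b)` at `(b, r, x)`. Here `gL` is the
metric `g_B ⊕ g_L` on `B × L`, so that `g_L(b)` is its restriction to `{b} × L`. -/
def coneModel (gB : BaseMetric B) (gL : ProdMetric B L) (β : B → ℝ → ℝ) (b : B) (r : ℝ) (x : L.Reg)
    (V W : B × ℝ × EuclideanSpace ℝ (Fin L.dim)) : ℝ :=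
  gB.inner b V.1 W.1 + deriv (β b) r ^ 2 * (V.2.1 * W.2.1) +
    β b r ^ 2 * gL.inner (b, x) ((0 : B), V.2.2) ((0 : B), W.2.2)

/-- The squared length of a tangent vector at `(b, r, x)` for `π^* g_B ⊕ dr² ⊕ g_L(b)`. -/
def refNormSq (gB : BaseMetric B) (gL : ProdMetric B L) (b : B) (x : L.Reg)
    (V : B × ℝ × EuclideanSpace ℝ (Fin L.dim)) : ℝ :=
  gB.inner b V.1 V.1 + V.2.1 ^ 2 + gL.inner (b, x) ((0 : B), V.2.2) ((0 : B), V.2.2)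

/-- The pullback of the metric `G` on `N` under `Φ : B × ℝ × L.Reg → N`. -/
def pullbackForm {E : Type*} [NormedAddCommGroup E] [NormedSpace ℝ E] {H : Type*}
    [TopologicalSpace H] {J : ModelWithCorners ℝ E H} {N : Type*} [TopologicalSpace N]
    [ChartedSpace H N] [IsManifold J ∞ N] (G : Metric J N) (Φ : B × ℝ × L.Reg → N)
    (b : B) (r : ℝ) (x : L.Reg) (V W : B × ℝ × EuclideanSpace ℝ (Fin L.dim)) : ℝ :=
  let dΦ := mfderiv (𝓘(ℝ, B).prod (𝓘(ℝ, ℝ).prod L.I)) J Φ (b, r, x)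
  G.inner (Φ (b, r, x)) (dΦ V) (dΦ W)

/-- In the coordinates `Φ : B × (0, ε) × L.Reg → N`, the metric `G` has the form
`π^* g_B ⊕ β'(b,r)² dr² ⊕ β(b,r)² g_L(b) + o₂(r²)`, where `gL = π^* g_B ⊕ g_L` is a metric on
`B × L.Reg`, and `β(b,r) = a(b) r + o₂(r)` with `a > 0`. The error term is measured with respect to
`π^* g_B ⊕ dr² ⊕ g_L(b)`, uniformly over the link and locally uniformly over the base; its
`r`-derivatives are taken with `b`, `x` and the components of the tangent vectors fixed. -/
def IsConicForm {E : Type*} [NormedAddCommGroup E] [NormedSpace ℝ E] {H : Type*}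
    [TopologicalSpace H] {J : ModelWithCorners ℝ E H} {N : Type*} [TopologicalSpace N]
    [ChartedSpace H N] [IsManifold J ∞ N] (G : Metric J N) (Φ : B × ℝ × L.Reg → N) (ε : ℝ)
    (gB : BaseMetric B) (gL : ProdMetric B L) : Prop :=
  (∀ (b : B) (x : L.Reg) (τ τ' : B) (ξ ξ' : EuclideanSpace ℝ (Fin L.dim)),
    gL.inner (b, x) (τ, ξ) (τ', ξ') =
      gB.inner b τ τ' + gL.inner (b, x) ((0 : B), ξ) ((0 : B), ξ')) ∧
  ∃ (β : B → ℝ → ℝ) (a : B → ℝ),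
    ContDiffOn ℝ ∞ (fun q : B × ℝ ↦ β q.1 q.2) (univ ×ˢ Ioo 0 ε) ∧
    (∀ b, 0 < a b ∧ IsLittleO₂ (fun b r ↦ β b r - a b * r) 1 b) ∧
    ∀ b₀ : B, ∀ j ≤ 2, ∀ δ > 0, ∀ᶠ q : B × ℝ in 𝓝 b₀ ×ˢ 𝓝[>] 0,
      ∀ (x : L.Reg) (V W : B × ℝ × EuclideanSpace ℝ (Fin L.dim)),
        |q.2 ^ j * iteratedDeriv j (fun r ↦ pullbackForm G Φ q.1 r x V W -
          coneModel gB gL β q.1 r x V W) q.2| ≤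
        δ * q.2 ^ 2 * (√(refNormSq gB gL q.1 x V) * √(refNormSq gB gL q.1 x W))

end ConicMetric

/-! ### Manifolds with iterated asymptotically conical singularities -/

/-- The notions that are defined by induction on the depth `m`:
* `Str X`: the structures of a `𝒞_m`-manifold on `X` (topology and smooth structure);
* `IsMap A A' P D F`: on `D ⊆ P × X`, the map `F` is a `𝒞_m`-map to `Y`, where `P` is a vector space
  of smooth parameters;
* `IsProdMetric A P G`: with the metric `G`, the product `P × X` is a `𝒞_m`-manifold;
* `IsMetric A g`: with the metric `g`, the space `X` is a `𝒞_m`-manifold;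
* `LinkDimGE A d`: all links of `X` (the links of the links included, which are the links of nearby
  singular points of `X`) have dimension at least `d`. -/
structure Level where
  Str : StratSpace.{u} → Type (u + 1)
  IsMap : ∀ {X Y : StratSpace.{u}}, Str X → Str Y →
    ∀ (P : Type) [NormedAddCommGroup P] [NormedSpace ℝ P],
      Set (P × X.carrier) → (P × X.carrier → Y.carrier) → Prop
  IsProdMetric : ∀ {X : StratSpace.{u}}, Str X →
    ∀ (P : Type) [NormedAddCommGroup P] [NormedSpace ℝ P], ProdMetric P X → Prop
  IsMetric : ∀ {X : StratSpace.{u}}, Str X → Metric X.I X.Reg → Prop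
  LinkDimGE : ∀ {X : StratSpace.{u}}, Str X → ℕ → Prop

/-- On `D`, the map `F` sends smooth points to smooth points, and it is smooth there. -/
def IsSmoothOnReg {X Y : StratSpace.{u}} (P : Type) [NormedAddCommGroup P] [NormedSpace ℝ P]
    (D : Set (P × X.carrier)) (F : P × X.carrier → Y.carrier) : Prop :=
  ∃ F₀ : P × X.Reg → Y.Reg, (∀ z : P × X.Reg, (z.1, z.2.1) ∈ D → F (z.1, z.2.1) = F₀ z) ∧
    ContMDiffOn (𝓘(ℝ, P).prod X.I) Y.I ∞ F₀ {z | (z.1, z.2.1) ∈ D}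

/-- A `𝒞_k`-neighbourhood in `X`, `k = depth`: an open subset that is identified with
`ℝ^h × C_ε(L)`, where the link `L` is a closed `𝒞_{k-1}`-manifold (a closed space with a structure
of level `Λ` and points of depth `< k` only). The points of `ℝ^h × {apex}` are the points of depth
`k`, and the identification is a diffeomorphism from `ℝ^h × (0, ε) × L.Reg` to an open subset of
the smooth stratum. -/
structure ConeChart (Λ : Level.{u}) (X : StratSpace.{u}) where
  depth : ℕ
  h : ℕ
  ε : Ioi (0 : ℝ)
  link : StratSpace.{u}
  str : Λ.Str link
  link_nonempty : Nonempty link.carrier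
  link_compact : CompactSpace link.carrier
  link_t2 : T2Space link.carrier
  link_boundaryless : BoundarylessManifold link.I link.Reg
  dim_eq : X.dim = h + 1 + link.dim
  toFun : EuclideanSpace ℝ (Fin h) × OpenCone (ε : ℝ) link.carrier → X.carrier
  isOpenEmbedding : IsOpenEmbedding toFun
  link_depth_lt : ∀ x, link.depth x < depth
  depth_apex : ∀ b x, X.depth (toFun (b, OpenCone.mk ε 0 x)) = depth
  depth_off_apex : ∀ b, ∀ r ∈ Ioo (0 : ℝ) ε, ∀ x,
    X.depth (toFun (b, OpenCone.mk ε r x)) = link.depth x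
  reg : EuclideanSpace ℝ (Fin h) × ℝ × link.Reg → X.Reg
  reg_eq : ∀ b, ∀ r ∈ Ioo (0 : ℝ) ε, ∀ x : link.Reg,
    (reg (b, r, x) : X.carrier) = toFun (b, OpenCone.mk ε r x.1)
  reg_diffeo : IsLocalDiffeomorphOn
    ((𝓘(ℝ, EuclideanSpace ℝ (Fin h))).prod (𝓘(ℝ, ℝ).prod link.I)) X.I ∞ reg
    (univ ×ˢ (Ioo (0 : ℝ) ε ×ˢ univ))

/-- The point with coordinates `(b, r, x)`. -/
def ConeChart.pt {Λ : Level.{u}} {X : StratSpace.{u}} (c : ConeChart Λ X)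
    (b : EuclideanSpace ℝ (Fin c.h)) (r : ℝ) (x : c.link.carrier) : X.carrier :=
  c.toFun (b, OpenCone.mk c.ε r x)

/-- On `U ⊆ B × [0, ∞) × L`, wherever the map `T` takes values in the chart `c'`, it has the form
`T(b, r, x) = (ψ(b), φ(b, r), f(b, x))` in this chart, where `ψ` and `φ` are smooth away from
`r = 0`, `φ(b, r) = a(b) r + o₂(r)` near `r = 0` with `a > 0`, and `f` is a map of level `Λ`. -/
def HasConicForm (Λ : Level.{u}) {L Y : StratSpace.{u}} (strL : Λ.Str L)
    (B : Type) [NormedAddCommGroup B] [NormedSpace ℝ B]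
    (U : Set (B × ℝ × L.carrier)) (T : B × ℝ × L.carrier → Y.carrier) (c' : ConeChart Λ Y) : Prop :=
  let W : Set (B × ℝ × L.carrier) := {z ∈ U | T z ∈ range c'.toFun}
  ∃ (ψ : B → EuclideanSpace ℝ (Fin c'.h)) (φ : B → ℝ → ℝ) (f : B × L.carrier → c'.link.carrier)
    (a : B → ℝ),
    (∀ b r x, (b, r, x) ∈ W → φ b r ∈ Ico (0 : ℝ) c'.ε ∧ T (b, r, x) = c'.pt (ψ b) (φ b r) (f (b, x))) ∧
    ContDiffOn ℝ ∞ ψ {b | ∃ r x, (b, r, x) ∈ W} ∧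
    ContDiffOn ℝ ∞ (fun q : B × ℝ ↦ φ q.1 q.2) {q | 0 < q.2 ∧ ∃ x, (q.1, q.2, x) ∈ W} ∧
    (∀ b, (∃ x, (b, 0, x) ∈ W) → 0 < a b ∧ IsLittleO₂ (fun b r ↦ φ b r - a b * r) 1 b) ∧
    Λ.IsMap strL c'.str B {z | ∃ r > 0, (z.1, r, z.2) ∈ W} f

/-- The structure of a `𝒞_{m+1}`-manifold: points of depth at most `m + 1`, and an atlas of
`𝒞_k`-neighbourhoods covering the singular stratum, such that the transition functions between
`𝒞_k`-neighbourhoods have the conic form. (The smooth charts are those of the smooth stratum.) -/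
structure ConeAtlas (Λ : Level.{u}) (m : ℕ) (X : StratSpace.{u}) where
  charts : Set (ConeChart Λ X)
  depth_le : ∀ p, X.depth p ≤ m + 1
  cover : ∀ p ∈ X.sing, ∃ c ∈ charts, c.depth = X.depth p ∧ ∃ b x, c.pt b 0 x = p
  transition : ∀ c ∈ charts, ∀ c' ∈ charts, c.depth = c'.depth →
    HasConicForm Λ c.str (EuclideanSpace ℝ (Fin c.h)) {z | z.2.1 ∈ Ico (0 : ℝ) c.ε}
      (fun z ↦ c.pt z.1 z.2.1 z.2.2) c'

/-- `ψ` is near `b₀` the base component of the transition function from `c` to `c'`. -/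
def IsBaseTransition {Λ : Level.{u}} {X : StratSpace.{u}} (c c' : ConeChart Λ X)
    (ψ : EuclideanSpace ℝ (Fin c.h) → EuclideanSpace ℝ (Fin c'.h))
    (b₀ : EuclideanSpace ℝ (Fin c.h)) : Prop :=
  ∀ᶠ b in 𝓝 b₀, ∀ x x', c.pt b 0 x = c'.pt (ψ b) 0 x'

/-- Smooth manifolds (without singular points) and smooth maps. -/
def levelZero : Level.{u} where
  Str X := {_s : PUnit.{u + 2} // ∀ p, X.depth p = 0}
  IsMap _ _ P _ _ D F := IsSmoothOnReg P D F
  IsProdMetric _ _ _ _ _ := True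
  IsMetric _ _ := True
  LinkDimGE _ _ := True

/-- The inductive step from `𝒞_m`-manifolds to `𝒞_{m+1}`-manifolds. In the conditions on metrics,
the `gB c` are the expressions of metrics on the strata `𝒞_k` in the charts; `gL` is the metric
`π^* g_B ⊕ g_L` on (base) × (link). -/
def levelSucc (Λ : Level.{u}) (m : ℕ) : Level.{u} where
  Str X := ConeAtlas Λ m X
  IsMap {X Y} A A' P _ _ D F :=
    (∀ z ∈ D, Y.depth (F z) = X.depth z.2) ∧ IsSmoothOnReg P D F ∧
    ∀ c ∈ A.charts, ∀ c' ∈ A'.charts, c.depth = c'.depth →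
      HasConicForm Λ c.str (P × EuclideanSpace ℝ (Fin c.h))
        {z | z.2.1 ∈ Ico (0 : ℝ) c.ε ∧ (z.1.1, c.pt z.1.2 z.2.1 z.2.2) ∈ D}
        (fun z ↦ F (z.1.1, c.pt z.1.2 z.2.1 z.2.2)) c'
  IsProdMetric {X} A P _ _ G :=
    ∃ gB : ∀ c : ConeChart Λ X, BaseMetric (P × EuclideanSpace ℝ (Fin c.h)),
      (∀ c ∈ A.charts, ∀ c' ∈ A.charts, c.depth = c'.depth → ∀ ψ b, IsBaseTransition c c' ψ b →
        ∀ (t τ τ' : P) (v v' : EuclideanSpace ℝ (Fin c.h)),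
          (gB c).inner (t, b) (τ, v) (τ', v') =
            (gB c').inner (t, ψ b) (τ, fderiv ℝ ψ b v) (τ', fderiv ℝ ψ b v')) ∧
      ∀ c ∈ A.charts, ∃ gL : ProdMetric (P × EuclideanSpace ℝ (Fin c.h)) c.link,
        IsConicForm G (fun z ↦ (z.1.1, c.reg (z.1.2, z.2.1, z.2.2))) c.ε (gB c) gL ∧
        Λ.IsProdMetric c.str (P × EuclideanSpace ℝ (Fin c.h)) gL
  IsMetric {X} A g :=
    ∃ gB : ∀ c : ConeChart Λ X, BaseMetric (EuclideanSpace ℝ (Fin c.h)),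
      (∀ c ∈ A.charts, ∀ c' ∈ A.charts, c.depth = c'.depth → ∀ ψ b, IsBaseTransition c c' ψ b →
        ∀ v v' : EuclideanSpace ℝ (Fin c.h),
          (gB c).inner b v v' = (gB c').inner (ψ b) (fderiv ℝ ψ b v) (fderiv ℝ ψ b v')) ∧
      ∀ c ∈ A.charts, ∃ gL : ProdMetric (EuclideanSpace ℝ (Fin c.h)) c.link,
        IsConicForm g c.reg c.ε (gB c) gL ∧
        Λ.IsProdMetric c.str (EuclideanSpace ℝ (Fin c.h)) gL
  LinkDimGE A d := ∀ c ∈ A.charts, d ≤ c.link.dim ∧ Λ.LinkDimGE c.str d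

/-- The notions for `𝒞_m`-manifolds. -/
def level : ℕ → Level.{u}
  | 0 => levelZero
  | m + 1 => levelSucc (level m) m

/-- A manifold with iterated asymptotically conical singularities (a `𝒞_m`-manifold for some `m`),
possibly with boundary in the smooth stratum. -/
structure IACSManifold where
  depth : ℕ
  space : StratSpace.{u}
  str : (level.{u} depth).Str space
  metric : Metric space.I space.Reg
  isMetric : (level depth).IsMetric str metric

namespace IACSManifold

variable (M : IACSManifold.{u})

/-- All links of `M` have dimension at least `d`. -/
def LinkDimGE (d : ℕ) : Prop := (level M.depth).LinkDimGE M.str d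

/-- The distance `d_𝒞` to the singular stratum. -/
def singDist (p : M.space.Reg) : ℝ≥0∞ := IACS.singDist M.metric p

/-- Multiplication of a section by `1 / d_𝒞` (which is `0` where `d_𝒞 = ∞`). -/
def divDist (𝓔 : HermitianBundle.{w} M.space.I M.space.Reg) (s : 𝓔.Sec) : 𝓔.Sec :=
  fun p ↦ (M.singDist p)⁻¹.toReal • s p

end IACSManifold

end IACS

end

/-! The distance `d` to the singular stratum is neither smooth nor explicit, so it is replaced by a
Hardy weight (`IsHardyWeightOn`): a C¹ function `0 < w ≤ 1` with bounded gradient that tends to `0`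
at the singular points and satisfies `∫ u²/w² ≤ C ∫ (u² + |du|²)` for compactly supported C¹
functions `u` on the smooth stratum. Instead of `|du|²` any measurable upper bound `e` is allowed,
which is the form in which restrictions to slices and norms of sections supply it.

A Hardy weight on the whole singular stratum gives the theorem. Integrating `dw` along a path that
ends in the singular stratum yields `w ≤ K d` (`IsHardyWeightOn.le_singDist`), so `d > 0` and `1/d ≤
K/w`. Kato's inequality `|d|σ|| ≤ |∇σ|` transfers the scalar inequality to sections of every bundle
with the same constant (`IsHardyWeightOn.hardy_section`). Fatou's lemma along almost everywhere
convergent subsequences carries the estimate to the completion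
(`HermitianBundle.RepresentsH1.smul`).

Weights are built by induction on the depth, starting from `w = 1` on a smooth manifold. Near a
singular point the metric is comparable to `|db|² + dr² + r² p`, where `p` is the link metric frozen
at one base point. If `w_L` is a weight on the link, then `r w_L(x)`, cut off to `1` away from the
point, is a weight near the point. Indeed the volume is comparable to `db ⊗ rˡ dr ⊗ vol_p`, and the
link derivative of `u` is bounded by `r |du|`. Hence the inequality on the link, applied for fixed
`b` and `r`, bounds `∫ u²/(r w_L)²` by a multiple of the integral of `r^(l-2) u² + rˡ |du|²`. The
first term is absorbed by Hardy's inequality in the variable `r` with exponent `l - 2 ≥ 0`; this is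
where links of dimension at least `2` are needed (`hardy_one_dim`, `lintegral_cone_le`,
`IsConeParam.hardy`). Compactness leaves finitely many such weights, and `(1/w₁ + 1/w₂)⁻¹` combines
two of them (`IsHardyWeightOn.union`).

Two supporting facts carry much of the work. Link metrics are only given as restrictions of a metric
on base times link, and freezing the base point requires that these restrictions be comparable
uniformly on the link, also near its own singular points. This is a separate induction on the depth
(`exists_sliceForm_equiv`). The frozen metrics are used only as continuous fields of positive forms
(`IsContForm`), and comparable forms have comparable volume measures because their Gram determinants
are comparable (`IsConeParam.volume_comparison`). Finally, `1/d` is measurable because the starting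
point of a path can be moved at little cost, so that the sets `d < c` are open
(`isOpen_singDist_lt`). -/

noncomputable section

namespace IACS

/-! ### Gram determinants of bilinear forms. -/

section FormDet

variable {n : ℕ}

/-- A bilinear form is symmetric and positive definite. -/
structure IsPosForm {E : Type*} [NormedAddCommGroup E] [NormedSpace ℝ E]
    (Q : E →L[ℝ] E →L[ℝ] ℝ) : Prop where
  symm : ∀ v w, Q v w = Q w v
  pos : ∀ v, v ≠ 0 → 0 < Q v v

/-- The Gram matrix of a bilinear form on `ℝⁿ`. -/
def formMatrix (Q : EuclideanSpace ℝ (Fin n) →L[ℝ] EuclideanSpace ℝ (Fin n) →L[ℝ] ℝ) :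
    Matrix (Fin n) (Fin n) ℝ :=
  Matrix.of fun i j ↦ Q (EuclideanSpace.single i 1) (EuclideanSpace.single j 1)

/-- The determinant of the Gram matrix of a bilinear form on `ℝⁿ`. -/
def formDet (Q : EuclideanSpace ℝ (Fin n) →L[ℝ] EuclideanSpace ℝ (Fin n) →L[ℝ] ℝ) : ℝ :=
  (formMatrix Q).det

theorem sum_smul_single (v : EuclideanSpace ℝ (Fin n)) :
    v = ∑ i, v i • EuclideanSpace.single i (1 : ℝ) := by
  ext j
  simp [Pi.single_apply]

theorem form_apply_eq (Q : EuclideanSpace ℝ (Fin n) →L[ℝ] EuclideanSpace ℝ (Fin n) →L[ℝ] ℝ)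
    (v w : EuclideanSpace ℝ (Fin n)) :
    Q v w = (v : Fin n → ℝ) ⬝ᵥ (formMatrix Q).mulVec (w : Fin n → ℝ) := by
  conv_lhs => rw [sum_smul_single v, sum_smul_single w]
  simp only [map_sum, map_smul, sum_apply, smul_apply,
    dotProduct, Matrix.mulVec, formMatrix, Matrix.of_apply, smul_eq_mul, Finset.mul_sum]
  rw [Finset.sum_comm]
  refine Finset.sum_congr rfl fun i _ ↦ Finset.sum_congr rfl fun j _ ↦ ?_
  ring

theorem IsPosForm.posDef {Q : EuclideanSpace ℝ (Fin n) →L[ℝ] EuclideanSpace ℝ (Fin n) →L[ℝ] ℝ}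
    (hQ : IsPosForm Q) : (formMatrix Q).PosDef := by
  refine Matrix.PosDef.of_dotProduct_mulVec_pos ?_ fun x hx ↦ ?_
  · ext i j
    simp [formMatrix, hQ.symm]
  · have := hQ.pos (WithLp.toLp 2 x) (by simpa using hx)
    rw [form_apply_eq] at this
    simpa using this

/-- Write `B = SᵀS` with `S` invertible. The matrix `M = S⁻ᵀ A S⁻¹` has eigenvalues in `[0, C]`,
because an eigenvector pulled back by `S⁻¹` has `B`-norm one, and `det A = det M * det B`. The case
of forms in `formDet_le` turns pointwise comparison of metrics into comparison of volume densities.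
-/
theorem det_le_of_forall_le {A B : Matrix (Fin n) (Fin n) ℝ} (hA : A.PosDef) (hB : B.PosDef)
    {C : ℝ} (h : ∀ v, v ⬝ᵥ A.mulVec v ≤ C * (v ⬝ᵥ B.mulVec v)) : A.det ≤ C ^ n * B.det := by
  obtain ⟨S, hS, hBS⟩ : ∃ S : Matrix (Fin n) (Fin n) ℝ, IsUnit S ∧ B = S.transpose * S := by
    obtain ⟨S, hS⟩ : ∃ S, B = star S * S := by
      open scoped MatrixOrder in
      exact CStarAlgebra.nonneg_iff_eq_star_mul_self.1 hB.posSemidef.nonneg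
    have : B = S.transpose * S := by
      rwa [Matrix.star_eq_conjTranspose, Matrix.conjTranspose_eq_transpose_of_trivial] at hS
    refine ⟨S, ?_, this⟩
    rw [Matrix.isUnit_iff_isUnit_det, isUnit_iff_ne_zero]
    intro h0
    have := hB.det_pos
    rw [hS, Matrix.det_mul, h0, mul_zero] at this
    exact lt_irrefl _ this
  have hdet : IsUnit S.det := (Matrix.isUnit_iff_isUnit_det S).1 hS
  set M := S⁻¹.transpose * A * S⁻¹ with hM
  have hMA : A = S.transpose * M * S := by
    have h1 : S.transpose * S⁻¹.transpose = 1 := by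
      rw [← Matrix.transpose_mul, Matrix.nonsing_inv_mul _ hdet, Matrix.transpose_one]
    calc A = (S.transpose * S⁻¹.transpose) * A * (S⁻¹ * S) := by
            rw [h1, Matrix.nonsing_inv_mul _ hdet]; simp
      _ = _ := by simp only [hM, Matrix.mul_assoc]
  have hMherm : M.IsHermitian := by
    have := hA.1
    rw [hM]
    exact Matrix.isHermitian_conjTranspose_mul_mul S⁻¹ this
  have hMv : ∀ v, v ⬝ᵥ M.mulVec v = S⁻¹.mulVec v ⬝ᵥ A.mulVec (S⁻¹.mulVec v) := by
    intro v
    rw [hM, ← Matrix.mulVec_mulVec, ← Matrix.mulVec_mulVec, Matrix.dotProduct_mulVec,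
      Matrix.vecMul_transpose]
  have hBv : ∀ v, S⁻¹.mulVec v ⬝ᵥ B.mulVec (S⁻¹.mulVec v) = v ⬝ᵥ v := by
    intro v
    rw [hBS, ← Matrix.mulVec_mulVec, Matrix.dotProduct_mulVec, Matrix.vecMul_transpose,
      Matrix.mulVec_mulVec, Matrix.mul_nonsing_inv _ hdet, Matrix.one_mulVec]
  have heig : ∀ i, hMherm.eigenvalues i ≤ C := by
    intro i
    set v : Fin n → ℝ := (hMherm.eigenvectorBasis i : Fin n → ℝ) with hv
    have h1 : v ⬝ᵥ v = 1 := by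
      have h2 : ‖hMherm.eigenvectorBasis i‖ = 1 := hMherm.eigenvectorBasis.orthonormal.1 i
      have := EuclideanSpace.real_norm_sq_eq (hMherm.eigenvectorBasis i)
      rw [h2] at this
      simp only [dotProduct, hv, ← sq]
      linarith
    have h3 : v ⬝ᵥ M.mulVec v = hMherm.eigenvalues i := by
      rw [hv, hMherm.mulVec_eigenvectorBasis i, dotProduct_smul, ← hv, h1]
      simp
    have := h (S⁻¹.mulVec v)
    rw [hBv, ← hMv, h1, h3] at this
    linarith
  have hpos : ∀ i, 0 ≤ hMherm.eigenvalues i := by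
    have : M.PosSemidef := by
      rw [hM]
      exact hA.posSemidef.conjTranspose_mul_mul_same S⁻¹
    exact this.eigenvalues_nonneg
  have hdM : M.det ≤ C ^ n := by
    rw [hMherm.det_eq_prod_eigenvalues]
    calc (∏ i, ((hMherm.eigenvalues i : ℝ) : ℝ)) ≤ ∏ _i : Fin n, C :=
          Finset.prod_le_prod (fun i _ ↦ hpos i) fun i _ ↦ heig i
      _ = C ^ n := by simp
  calc A.det = M.det * B.det := by
        rw [hMA, hBS]; simp only [Matrix.det_mul, Matrix.det_transpose]; ring
    _ ≤ C ^ n * B.det := mul_le_mul_of_nonneg_right hdM hB.det_pos.le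

theorem formDet_le {Q Q' : EuclideanSpace ℝ (Fin n) →L[ℝ] EuclideanSpace ℝ (Fin n) →L[ℝ] ℝ}
    (hQ : IsPosForm Q) (hQ' : IsPosForm Q') {C : ℝ} (h : ∀ v, Q v v ≤ C * Q' v v) :
    formDet Q ≤ C ^ n * formDet Q' := by
  refine det_le_of_forall_le hQ.posDef hQ'.posDef fun v ↦ ?_
  have := h (WithLp.toLp 2 v)
  rwa [form_apply_eq, form_apply_eq] at this

theorem formDet_comp (Q : EuclideanSpace ℝ (Fin n) →L[ℝ] EuclideanSpace ℝ (Fin n) →L[ℝ] ℝ)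
    (L : EuclideanSpace ℝ (Fin n) →L[ℝ] EuclideanSpace ℝ (Fin n)) :
    formDet (Q.bilinearComp L L) = L.det ^ 2 * formDet Q := by
  set b := (EuclideanSpace.basisFun (Fin n) ℝ).toBasis
  set A := LinearMap.toMatrix b b (L : EuclideanSpace ℝ (Fin n) →ₗ[ℝ] EuclideanSpace ℝ (Fin n))
  have hA : L.det = A.det := by
    rw [LinearMap.det_toMatrix]
  have hAij : ∀ i j, A i j = L (EuclideanSpace.single j 1) i := by
    intro i j
    simp [A, LinearMap.toMatrix_apply, b]
  have : formMatrix (Q.bilinearComp L L) = A.transpose * formMatrix Q * A := by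
    ext i j
    simp only [formMatrix, Matrix.of_apply, ContinuousLinearMap.bilinearComp_apply]
    rw [form_apply_eq]
    simp only [dotProduct, Matrix.mulVec, Matrix.mul_apply, Matrix.transpose_apply, hAij,
      formMatrix, Finset.mul_sum, Finset.sum_mul]
    rw [Finset.sum_comm]
    refine Finset.sum_congr rfl fun k _ ↦ Finset.sum_congr rfl fun l _ ↦ ?_
    ring
  rw [formDet, this, Matrix.det_mul, Matrix.det_mul, Matrix.det_transpose, hA, formDet]
  ring

theorem continuous_formDet :
    Continuous (formDet : (EuclideanSpace ℝ (Fin n) →L[ℝ] EuclideanSpace ℝ (Fin n) →L[ℝ] ℝ) → ℝ) := by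
  unfold formDet
  refine Continuous.matrix_det ?_
  refine continuous_matrix fun i j ↦ ?_
  simp only [formMatrix, Matrix.of_apply]
  fun_prop

theorem sqrt_formDet_comp (Q : EuclideanSpace ℝ (Fin n) →L[ℝ] EuclideanSpace ℝ (Fin n) →L[ℝ] ℝ)
    (L : EuclideanSpace ℝ (Fin n) →L[ℝ] EuclideanSpace ℝ (Fin n)) :
    √(formDet (Q.bilinearComp L L)) = |L.det| * √(formDet Q) := by
  rw [formDet_comp, Real.sqrt_mul (sq_nonneg _), Real.sqrt_sq_eq_abs]

end FormDet

/-! ### Continuous fields of positive forms, and their expressions in charts. -/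

section Forms

variable {E : Type*} [NormedAddCommGroup E] [NormedSpace ℝ E] {H : Type*} [TopologicalSpace H]
  {I : ModelWithCorners ℝ E H} {R : Type*} [TopologicalSpace R] [ChartedSpace H R]

variable (I) in
/-- The differential of the inverse of the chart at `x₀`. -/
def dsymm (x₀ : R) (y : E) : E →L[ℝ] E :=
  mfderivWithin 𝓘(ℝ, E) I (extChartAt I x₀).symm (range I) y

variable (I) in
/-- The differential of the chart at `x₀`. -/
def dchart (x₀ x : R) : E →L[ℝ] E := mfderiv I 𝓘(ℝ, E) (extChartAt I x₀) x

variable (I) in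
/-- The expression of a field of bilinear forms on the tangent spaces in the chart at `x₀`. -/
def chartForm (q : R → E →L[ℝ] E →L[ℝ] ℝ) (x₀ : R) (y : E) : E →L[ℝ] E →L[ℝ] ℝ :=
  (q ((extChartAt I x₀).symm y)).bilinearComp (dsymm I x₀ y) (dsymm I x₀ y)

theorem chartForm_apply (q : R → E →L[ℝ] E →L[ℝ] ℝ) (x₀ : R) (y v w : E) :
    chartForm I q x₀ y v w = q ((extChartAt I x₀).symm y) (dsymm I x₀ y v) (dsymm I x₀ y w) := rfl

variable (I) in
/-- A continuous field of positive definite symmetric forms. -/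
structure IsContForm (q : R → E →L[ℝ] E →L[ℝ] ℝ) : Prop where
  isPosForm : ∀ x, IsPosForm (q x)
  continuousOn : ∀ x₀, ContinuousOn (chartForm I q x₀) (extChartAt I x₀).target

variable [IsManifold I ∞ R]

theorem dchart_comp_dsymm {x₀ : R} {y : E} (hy : y ∈ (extChartAt I x₀).target) (v : E) :
    dchart I x₀ ((extChartAt I x₀).symm y) (dsymm I x₀ y v) = v := by
  have : IsManifold I 1 R := IsManifold.of_le (n := ∞) (by norm_cast)
  exact congr($(mfderiv_extChartAt_comp_mfderivWithin_extChartAt_symm hy) v)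

theorem dsymm_comp_dchart {x₀ x : R} (hx : x ∈ (extChartAt I x₀).source) (v : E) :
    dsymm I x₀ (extChartAt I x₀ x) (dchart I x₀ x v) = v := by
  have : IsManifold I 1 R := IsManifold.of_le (n := ∞) (by norm_cast)
  exact congr($(mfderivWithin_extChartAt_symm_comp_mfderiv_extChartAt' (I := I) hx) v)

theorem dsymm_injective {x₀ : R} {y : E} (hy : y ∈ (extChartAt I x₀).target) :
    Function.Injective (dsymm I x₀ y) :=
  Function.LeftInverse.injective (dchart_comp_dsymm hy)

theorem dsymm_eq_symmL {x₀ x : R} (hx : x ∈ (chartAt H x₀).source) (v : E) :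
    dsymm I x₀ (extChartAt I x₀ x) v =
      (trivializationAt E (TangentSpace I) x₀).symm x v := by
  have : IsManifold I 1 R := IsManifold.of_le (n := ∞) (by norm_cast)
  rw [← Bundle.Trivialization.symmL_apply (R := ℝ) _ (by simpa using hx)]
  exact congr($((TangentBundle.symmL_trivializationAt (I := I) (𝕜 := ℝ) hx).symm) v)

theorem IsPosForm.comp {E' : Type*} [NormedAddCommGroup E'] [NormedSpace ℝ E']
    {Q : E →L[ℝ] E →L[ℝ] ℝ} (hQ : IsPosForm Q) {L : E' →L[ℝ] E} (hL : Function.Injective L) :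
    IsPosForm (Q.bilinearComp L L) where
  symm v w := hQ.symm _ _
  pos v hv := hQ.pos _ fun h ↦ hv (hL (by rw [map_zero]; exact h))

theorem IsContForm.isPosForm_chartForm {q : R → E →L[ℝ] E →L[ℝ] ℝ} (hq : IsContForm I q) {x₀ : R}
    {y : E} (hy : y ∈ (extChartAt I x₀).target) : IsPosForm (chartForm I q x₀ y) :=
  (hq.isPosForm _).comp (dsymm_injective hy)

/-- The forms of a metric, on the model vector space. -/
def Metric.form (g : Metric I R) (x : R) : E →L[ℝ] E →L[ℝ] ℝ := g.inner x

theorem Metric.isPosForm (g : Metric I R) (x : R) : IsPosForm (g.form x) :=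
  ⟨g.symm x, g.pos x⟩

/-- The metric is smooth as a section of a bundle of forms, so it is continuous when evaluated on
sections that are constant in a local trivialization; `dsymm_eq_symmL` identifies these with the
images of constant vectors under the differential of the inverse chart. -/
theorem Metric.continuousOn_form (g : Metric I R) (x₀ : R) (v w : E) :
    ContinuousOn (fun x ↦ g.form x (dsymm I x₀ (extChartAt I x₀ x) v)
      (dsymm I x₀ (extChartAt I x₀ x) w)) (chartAt H x₀).source := by
  have : IsManifold I 1 R := IsManifold.of_le (n := ∞) (by norm_cast)
  set e := trivializationAt E (TangentSpace I) x₀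
  have hsec : ∀ v : E, ContMDiffOn I (I.prod 𝓘(ℝ, E)) 0
      (fun x ↦ TotalSpace.mk' E x (e.symm x v : TangentSpace I x)) (chartAt H x₀).source := by
    intro v
    have h1 := (Bundle.Trivialization.contMDiffOn_symm (IB := I) (n := 0) e).comp
      (t := e.target) (s := (chartAt H x₀).source) (f := fun x : R ↦ (x, v))
      (contMDiffOn_id.prodMk contMDiffOn_const) (fun x hx ↦ by simpa [e, e.mem_target] using hx)
    refine h1.congr fun x hx ↦ ?_
    exact e.mk_symm (by simpa [e] using hx) v
  intro x hx
  have h : ContMDiffWithinAt I (I.prod 𝓘(ℝ)) 0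
      (fun m ↦ TotalSpace.mk' ℝ (E := Bundle.Trivial R ℝ) m
        (g.inner m (e.symm m v : TangentSpace I m) (e.symm m w : TangentSpace I m)))
      (chartAt H x₀).source x := by
    apply ContMDiffWithinAt.clm_bundle_apply₂ (F₁ := E) (F₂ := E)
    · exact ((g.contMDiff.of_le (n := ∞) (m := 0) (by simp)).contMDiffAt).contMDiffWithinAt
    · exact hsec v x hx
    · exact hsec w x hx
  simp only [contMDiffWithinAt_totalSpace] at h
  refine h.2.continuousWithinAt.congr (fun y hy ↦ ?_) ?_
  · rw [dsymm_eq_symmL hy, dsymm_eq_symmL hy]; rfl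
  · rw [dsymm_eq_symmL hx, dsymm_eq_symmL hx]; rfl

theorem Metric.isContForm [FiniteDimensional ℝ E] (g : Metric I R) : IsContForm I g.form where
  isPosForm := g.isPosForm
  continuousOn x₀ := by
    rw [continuousOn_clm_apply]
    intro v
    rw [continuousOn_clm_apply]
    intro w
    have h := (g.continuousOn_form x₀ v w).comp (continuousOn_extChartAt_symm x₀) 
      (fun y hy ↦ by simpa using (extChartAt I x₀).map_target hy)
    refine h.congr fun y hy ↦ ?_
    simp only [chartForm_apply, Function.comp_apply, (extChartAt I x₀).right_inv hy]

end Forms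

/-! ### The volume measure of a field of forms, and its expression in a parametrization. -/

section Volume

variable {n : ℕ} {H : Type*} [TopologicalSpace H]
  (I : ModelWithCorners ℝ (EuclideanSpace ℝ (Fin n)) H)
  {R : Type*} [TopologicalSpace R] [ChartedSpace H R]

/-- The volume density of a field of forms in a chart, transported to the manifold. -/
def chartVol [MeasurableSpace R]
    (q : R → EuclideanSpace ℝ (Fin n) →L[ℝ] EuclideanSpace ℝ (Fin n) →L[ℝ] ℝ) (x₀ : R) :
    Measure R :=
  ((volume.restrict (extChartAt I x₀).target).withDensity
    fun y ↦ ENNReal.ofReal (√(formDet (chartForm I q x₀ y)))).map (extChartAt I x₀).symm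

/-- The volume measure of a field of forms. -/
def formVol [MeasurableSpace R]
    (q : R → EuclideanSpace ℝ (Fin n) →L[ℝ] EuclideanSpace ℝ (Fin n) →L[ℝ] ℝ) :
    Measure R := ⨆ x₀ : R, chartVol I q x₀

variable {I}

theorem measurableSet_extChartAt_target (x₀ : R) : MeasurableSet (extChartAt I x₀).target := by
  rw [extChartAt_target]
  exact ((chartAt H x₀).open_target.preimage I.continuous_symm).measurableSet.inter
    I.isClosed_range.measurableSet

/-- The volume density on the target of a chart is integrated against by Lebesgue measure. -/
theorem chartVol_restrict_image [T2Space R] [IsManifold I ∞ R] [MeasurableSpace R] [BorelSpace R]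
    {q : R → EuclideanSpace ℝ (Fin n) →L[ℝ] EuclideanSpace ℝ (Fin n) →L[ℝ] ℝ}
    {s : Set (EuclideanSpace ℝ (Fin n))} (hs : MeasurableSet s)
    {Ψ : EuclideanSpace ℝ (Fin n) → R}
    {Ψ' : EuclideanSpace ℝ (Fin n) → EuclideanSpace ℝ (Fin n) →L[ℝ] EuclideanSpace ℝ (Fin n)}
    (hΨ : ∀ y ∈ s, HasMFDerivWithinAt 𝓘(ℝ, EuclideanSpace ℝ (Fin n)) I Ψ s y (Ψ' y))
    (inj : InjOn Ψ s) (x₀ : R) (hsub : MapsTo Ψ s (extChartAt I x₀).source)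
    (himg : MeasurableSet (Ψ '' s)) :
    (chartVol I q x₀).restrict (Ψ '' s) =
      ((volume.restrict s).withDensity fun y ↦
        ENNReal.ofReal (√(formDet ((q (Ψ y)).bilinearComp (Ψ' y) (Ψ' y))))).map Ψ := by
  have hcont : ContinuousOn Ψ s := fun y hy ↦ (hΨ y hy).continuousWithinAt
  have hpre : ∀ A : Set R, MeasurableSet A → MeasurableSet (s ∩ Ψ ⁻¹' A) := by
    intro A hA
    have h1 : MeasurableSet (s.domRestrict Ψ ⁻¹' A) :=
      (continuousOn_iff_continuous_domRestrict.1 hcont).measurable hA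
    have := hs.subtype_image h1
    convert this using 1
    ext y
    simp only [mem_inter_iff, mem_preimage, mem_image, Subtype.exists, exists_and_right,
      exists_eq_right, domRestrict_apply]
    tauto
  set φ := extChartAt I x₀
  -- Read in the chart at `x₀`, the parametrization becomes an injective map between subsets of
  -- Euclidean space, to which the change of variables formula applies.
  set f := fun y ↦ φ (Ψ y)
  set f' := fun y ↦ (dchart I x₀ (Ψ y)).comp (Ψ' y)
  have hf' : ∀ y ∈ s, HasFDerivWithinAt f (f' y) s y := by
    intro y hy
    have h1 : HasMFDerivAt I 𝓘(ℝ, EuclideanSpace ℝ (Fin n)) φ (Ψ y) (dchart I x₀ (Ψ y)) := by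
      have : IsManifold I 1 R := IsManifold.of_le (n := ∞) (by norm_cast)
      exact (mdifferentiableAt_extChartAt (by simpa [φ] using hsub hy)).hasMFDerivAt
    exact (h1.comp_hasMFDerivWithinAt y (hΨ y hy)).hasFDerivWithinAt
  have hfinj : InjOn f s := fun y hy z hz h ↦ inj hy hz (φ.injOn (hsub hy) (hsub hz) h)
  have hfimg : ∀ A : Set R, φ.symm ⁻¹' (A ∩ Ψ '' s) ∩ φ.target = f '' (s ∩ Ψ ⁻¹' A) := by
    intro A
    ext y
    constructor
    · rintro ⟨⟨hA, z, hz, hzy⟩, hy⟩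
      refine ⟨z, ⟨hz, ?_⟩, ?_⟩
      · rw [mem_preimage, hzy]; exact hA
      · simp only [f, hzy]; exact φ.right_inv hy
    · rintro ⟨z, ⟨hz, hzA⟩, rfl⟩
      have : φ.symm (f z) = Ψ z := φ.left_inv (hsub hz)
      exact ⟨by rw [mem_preimage, this]; exact ⟨hzA, z, hz, rfl⟩, φ.map_source (hsub hz)⟩
  have hsymm : AEMeasurable φ.symm (volume.restrict φ.target) :=
    (continuousOn_extChartAt_symm x₀).aemeasurable (measurableSet_extChartAt_target x₀)
  ext A hA
  rw [Measure.restrict_apply hA, chartVol, Measure.map_apply_of_aemeasurable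
    (hsymm.mono_ac (withDensity_absolutelyContinuous _ _)) (hA.inter himg), withDensity_apply',
    Measure.restrict_restrict' (measurableSet_extChartAt_target x₀), hfimg,
    lintegral_image_eq_lintegral_abs_det_fderiv_mul volume (hpre A hA)
      (fun y hy ↦ (hf' y hy.1).mono inter_subset_left) (hfinj.mono inter_subset_left),
    Measure.map_apply_of_aemeasurable
      ((hcont.aemeasurable hs).mono_ac (withDensity_absolutelyContinuous _ _)) hA,
    withDensity_apply', Measure.restrict_restrict' hs, inter_comm]
  refine setLIntegral_congr_fun (by rw [inter_comm]; exact hpre A hA) fun y hy ↦ ?_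
  have hy : y ∈ s := hy.2
  -- The Jacobian is absorbed into the determinant of the pulled back form; there the differentials
  -- of the chart and of its inverse cancel, so the density no longer depends on the chart.
  rw [← ENNReal.ofReal_mul (abs_nonneg _), ← sqrt_formDet_comp]
  have hsy : φ.symm (f y) = Ψ y := φ.left_inv (hsub hy)
  have : (chartForm I q x₀ (f y)).bilinearComp (f' y) (f' y) =
      (q (Ψ y)).bilinearComp (Ψ' y) (Ψ' y) := by
    ext v w
    have h2 : ∀ v, dsymm I x₀ (f y) (f' y v) = Ψ' y v := fun v ↦
      dsymm_comp_dchart (hsub hy) (Ψ' y v)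
    simp only [ContinuousLinearMap.bilinearComp_apply, chartForm_apply, h2]
    rw [show (extChartAt I x₀).symm (f y) = Ψ y from hsy]
  rw [this]

theorem chartVol_compl_source [MeasurableSpace R] [BorelSpace R]
    (q : R → EuclideanSpace ℝ (Fin n) →L[ℝ] EuclideanSpace ℝ (Fin n) →L[ℝ] ℝ) (x₀ : R) :
    chartVol I q x₀ (extChartAt I x₀).sourceᶜ = 0 := by
  have hsymm : AEMeasurable (extChartAt I x₀).symm (volume.restrict (extChartAt I x₀).target) :=
    (continuousOn_extChartAt_symm x₀).aemeasurable (measurableSet_extChartAt_target x₀)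
  rw [chartVol, Measure.map_apply_of_aemeasurable
    (hsymm.mono_ac (withDensity_absolutelyContinuous _ _))
    (isOpen_extChartAt_source x₀).measurableSet.compl]
  refine withDensity_absolutelyContinuous _ _ ?_
  rw [Measure.restrict_apply' (measurableSet_extChartAt_target x₀)]
  refine measure_mono_null (t := ∅) (fun y hy ↦ ?_) measure_empty
  exact hy.1 ((extChartAt I x₀).map_target hy.2)

/-- On the overlap of two charts, `chartVol_restrict_image` computes both chart measures from the
same parametrization, the inverse of the chart at `x₁`. They therefore agree there, and the chart
measure at `x₁` has no mass outside its own chart. -/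
theorem chartVol_restrict_source [T2Space R] [IsManifold I ∞ R] [MeasurableSpace R] [BorelSpace R]
    (q : R → EuclideanSpace ℝ (Fin n) →L[ℝ] EuclideanSpace ℝ (Fin n) →L[ℝ] ℝ) (x₀ x₁ : R) :
    (chartVol I q x₁).restrict (extChartAt I x₀).source ≤ chartVol I q x₀ := by
  set φ := extChartAt I x₁
  set A := (extChartAt I x₀).source ∩ φ.source
  have hA : IsOpen A := (isOpen_extChartAt_source x₀).inter (isOpen_extChartAt_source x₁)
  set s := φ.target ∩ φ.symm ⁻¹' A
  have hs : MeasurableSet s := by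
    have := (continuousOn_extChartAt_symm (I := I) x₁)
    obtain ⟨U, hU, hUs⟩ := (continuousOn_iff'.1 this) A hA
    have : s = U ∩ φ.target := by rw [← hUs, inter_comm]
    rw [this]
    exact hU.measurableSet.inter (measurableSet_extChartAt_target x₁)
  have himg : φ.symm '' s = A := by
    ext x
    constructor
    · rintro ⟨y, hy, rfl⟩; exact hy.2
    · intro hx
      refine ⟨φ x, ⟨φ.map_source hx.2, ?_⟩, φ.left_inv hx.2⟩
      rw [mem_preimage, φ.left_inv hx.2]; exact hx
  have hΨ : ∀ y ∈ s, HasMFDerivWithinAt 𝓘(ℝ, EuclideanSpace ℝ (Fin n)) I φ.symm s y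
      (dsymm I x₁ (y : EuclideanSpace ℝ (Fin n)) :) := by
    intro y hy
    have : IsManifold I 1 R := IsManifold.of_le (n := ∞) (by norm_cast)
    exact (mdifferentiableWithinAt_extChartAt_symm hy.1).hasMFDerivWithinAt.mono
      (inter_subset_left.trans (extChartAt_target_subset_range x₁))
  have inj : InjOn φ.symm s := φ.symm.injOn.mono inter_subset_left
  have h0 := chartVol_restrict_image (q := q) hs hΨ inj x₀ (fun y hy ↦ hy.2.1)
    (by rw [himg]; exact hA.measurableSet)
  have h1 := chartVol_restrict_image (q := q) hs hΨ inj x₁ (fun y hy ↦ hy.2.2)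
    (by rw [himg]; exact hA.measurableSet)
  rw [himg] at h0 h1
  have h2 : (chartVol I q x₁).restrict (extChartAt I x₀).source =
      (chartVol I q x₁).restrict A := by
    refine Measure.restrict_congr_set ?_
    refine (inter_ae_eq_left_of_ae_eq_univ ?_).symm
    rw [ae_eq_univ]
    exact chartVol_compl_source q x₁
  rw [h2, h1, ← h0]
  exact Measure.restrict_le_self

/-- Each chart measure is at most the one at `x₀` inside the chart domain and at most the supremum
outside. The sum of these two bounds is a measure that dominates all chart measures, hence also
their supremum. -/
theorem formVol_restrict_source [T2Space R] [IsManifold I ∞ R] [MeasurableSpace R] [BorelSpace R]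
    (q : R → EuclideanSpace ℝ (Fin n) →L[ℝ] EuclideanSpace ℝ (Fin n) →L[ℝ] ℝ) (x₀ : R) :
    (formVol I q).restrict (extChartAt I x₀).source = chartVol I q x₀ := by
  set U := (extChartAt I x₀).source
  have hU : MeasurableSet U := (isOpen_extChartAt_source x₀).measurableSet
  have hle : ∀ x, chartVol I q x ≤ formVol I q := fun x ↦ le_iSup (chartVol I q) x
  have hres : (chartVol I q x₀).restrict U = chartVol I q x₀ := by
    rw [Measure.restrict_eq_self_of_ae_mem]
    exact chartVol_compl_source q x₀
  refine le_antisymm ?_ ?_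
  · have h1 : formVol I q ≤ chartVol I q x₀ + (formVol I q).restrict Uᶜ := by
      refine iSup_le fun x₁ ↦ ?_
      rw [← Measure.restrict_add_restrict_compl (μ := chartVol I q x₁) hU]
      gcongr
      · exact chartVol_restrict_source q x₀ x₁
      · exact hle x₁
    have h2 := Measure.restrict_mono (le_refl U) h1
    rw [Measure.restrict_add, Measure.restrict_restrict hU, inter_compl_self,
      Measure.restrict_empty, add_zero, hres] at h2
    exact h2
  · rw [← hres]
    exact Measure.restrict_mono le_rfl (hle x₀)

/-- The volume measure on the image of a parametrization. -/
theorem formVol_restrict_image [T2Space R] [IsManifold I ∞ R] [MeasurableSpace R] [BorelSpace R]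
    {q : R → EuclideanSpace ℝ (Fin n) →L[ℝ] EuclideanSpace ℝ (Fin n) →L[ℝ] ℝ}
    {s : Set (EuclideanSpace ℝ (Fin n))} (hs : MeasurableSet s)
    {Ψ : EuclideanSpace ℝ (Fin n) → R}
    {Ψ' : EuclideanSpace ℝ (Fin n) → EuclideanSpace ℝ (Fin n) →L[ℝ] EuclideanSpace ℝ (Fin n)}
    (hΨ : ∀ y ∈ s, HasMFDerivWithinAt 𝓘(ℝ, EuclideanSpace ℝ (Fin n)) I Ψ s y (Ψ' y))
    (inj : InjOn Ψ s) (x₀ : R) (hsub : MapsTo Ψ s (extChartAt I x₀).source)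
    (himg : MeasurableSet (Ψ '' s)) :
    (formVol I q).restrict (Ψ '' s) =
      ((volume.restrict s).withDensity fun y ↦
        ENNReal.ofReal (√(formDet ((q (Ψ y)).bilinearComp (Ψ' y) (Ψ' y))))).map Ψ := by
  rw [← chartVol_restrict_image hs hΨ inj x₀ hsub himg, ← formVol_restrict_source q x₀,
    Measure.restrict_restrict himg, inter_eq_left.2 hsub.image_subset]

theorem sFinite_chartVol [MeasurableSpace R]
    (q : R → EuclideanSpace ℝ (Fin n) →L[ℝ] EuclideanSpace ℝ (Fin n) →L[ℝ] ℝ) (x₀ : R) :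
    SFinite (chartVol I q x₀) := by
  unfold chartVol; infer_instance

theorem isLocallyFiniteMeasure_formVol [T2Space R] [IsManifold I ∞ R]
    [MeasurableSpace R] [BorelSpace R]
    {q : R → EuclideanSpace ℝ (Fin n) →L[ℝ] EuclideanSpace ℝ (Fin n) →L[ℝ] ℝ}
    (hq : IsContForm I q) : IsLocallyFiniteMeasure (formVol I q) := by
  refine ⟨fun x ↦ ?_⟩
  set φ := extChartAt I x
  set ρ := fun y ↦ √(formDet (chartForm I q x y))
  have hρ : ContinuousOn ρ φ.target :=
    (continuous_formDet.comp_continuousOn (hq.continuousOn x)).sqrt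
  have h1 := (hρ (φ x) (mem_extChartAt_target x)).eventually
    (gt_mem_nhds (lt_add_one (ρ (φ x))))
  rw [eventually_nhdsWithin_iff, Metric.eventually_nhds_iff] at h1
  obtain ⟨δ, hδ, h1⟩ := h1
  set U := φ.source ∩ φ ⁻¹' (Metric.ball (φ x) δ)
  have hU : IsOpen U := (continuousOn_extChartAt (I := I) x).isOpen_inter_preimage
    (isOpen_extChartAt_source x) Metric.isOpen_ball
  refine ⟨U, hU.mem_nhds ⟨mem_extChartAt_source x, Metric.mem_ball_self hδ⟩, ?_⟩
  have h2 : formVol I q U = chartVol I q x U := by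
    rw [← formVol_restrict_source q x, Measure.restrict_apply hU.measurableSet,
      inter_eq_left.2 inter_subset_left]
  have hsymm : AEMeasurable φ.symm (volume.restrict φ.target) :=
    (continuousOn_extChartAt_symm x).aemeasurable (measurableSet_extChartAt_target x)
  rw [h2, chartVol, Measure.map_apply_of_aemeasurable
    (hsymm.mono_ac (withDensity_absolutelyContinuous _ _)) hU.measurableSet, withDensity_apply',
    Measure.restrict_restrict' (measurableSet_extChartAt_target x)]
  have hsub : φ.symm ⁻¹' U ∩ φ.target ⊆ Metric.ball (φ x) δ ∩ φ.target := by
    rintro y ⟨hy, hyt⟩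
    refine ⟨?_, hyt⟩
    have := hy.2
    rwa [mem_preimage, φ.right_inv hyt] at this
  calc _ ≤ ∫⁻ y in Metric.ball (φ x) δ ∩ φ.target, ENNReal.ofReal (ρ y) :=
        lintegral_mono_set hsub
    _ ≤ ∫⁻ y in Metric.ball (φ x) δ ∩ φ.target, ENNReal.ofReal (ρ (φ x) + 1) := by
        refine setLIntegral_mono' (Metric.isOpen_ball.measurableSet.inter
          (measurableSet_extChartAt_target x)) fun y hy ↦ ENNReal.ofReal_le_ofReal ?_
        exact (h1 (Metric.mem_ball.1 hy.1) hy.2).le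
    _ ≤ ENNReal.ofReal (ρ (φ x) + 1) * volume (Metric.ball (φ x) δ) := by
        rw [setLIntegral_const]
        gcongr
        exact inter_subset_left
    _ < ⊤ := ENNReal.mul_lt_top ENNReal.ofReal_lt_top measure_ball_lt_top

end Volume

/-! ### Comparison of measures on countable covers. -/

section MeasureComparison

/-- The inequality is checked on the disjoint pieces of the cover obtained by `disjointed`, and
summed. -/
theorem measure_le_of_restrict_le {α : Type*} [MeasurableSpace α] {μ ν : Measure α} {O : ℕ → Set α}
    (hO : ∀ i, MeasurableSet (O i)) (hcov : ν (⋃ i, O i)ᶜ = 0)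
    (h : ∀ i, ν.restrict (O i) ≤ μ.restrict (O i)) : ν ≤ μ := by
  refine Measure.le_iff.2 fun A hA ↦ ?_
  have hm : ∀ i, MeasurableSet (disjointed O i) := fun i ↦ .disjointed hO i
  have hAm : ∀ i, MeasurableSet (A ∩ disjointed O i) := fun i ↦ hA.inter (hm i)
  have hd : Pairwise fun i j ↦ Disjoint (A ∩ disjointed O i) (A ∩ disjointed O j) :=
    fun i j hij ↦ (disjoint_disjointed O hij).mono inter_subset_right inter_subset_right
  have h1 : ν A = ν (⋃ i, A ∩ disjointed O i) := by
    rw [← inter_iUnion, iUnion_disjointed, measure_inter_conull hcov]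
  rw [h1, measure_iUnion hd hAm]
  calc ∑' i, ν (A ∩ disjointed O i) ≤ ∑' i, μ (A ∩ disjointed O i) := by
        refine ENNReal.tsum_le_tsum fun i ↦ ?_
        have := Measure.le_iff.1 (h i) _ (hAm i)
        rwa [Measure.restrict_eq_self _ (inter_subset_right.trans (disjointed_subset O i)),
          Measure.restrict_eq_self _ (inter_subset_right.trans (disjointed_subset O i))] at this
    _ = μ (⋃ i, A ∩ disjointed O i) := (measure_iUnion hd hAm).symm
    _ ≤ μ A := measure_mono (iUnion_subset fun i ↦ inter_subset_left)

end MeasureComparison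

section Volume

variable {n : ℕ} {H : Type*} [TopologicalSpace H]
  {I : ModelWithCorners ℝ (EuclideanSpace ℝ (Fin n)) H}
  {R : Type*} [TopologicalSpace R] [ChartedSpace H R]

theorem exists_seq_extChartAt_source (I : ModelWithCorners ℝ (EuclideanSpace ℝ (Fin n)) H) (R : Type*)
    [TopologicalSpace R] [ChartedSpace H R] [SecondCountableTopology R] [Nonempty R] :
    ∃ x : ℕ → R, ⋃ i, (extChartAt I (x i)).source = univ := by
  obtain ⟨t, htc, ht⟩ := TopologicalSpace.countable_cover_nhds
    fun x : R ↦ extChartAt_source_mem_nhds (I := I) x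
  have hne : t.Nonempty := by
    by_contra h
    rw [not_nonempty_iff_eq_empty] at h
    simp [h] at ht
    exact (univ_nonempty (α := R)).ne_empty ht.symm
  obtain ⟨x, hx⟩ := htc.exists_eq_range hne
  exact ⟨x, by rw [← ht, hx, biUnion_range]⟩

/-- The volume measure on the image of a parametrization. -/
theorem formVol_restrict_range [T2Space R] [SecondCountableTopology R] [IsManifold I ∞ R]
    [MeasurableSpace R] [BorelSpace R]
    {q : R → EuclideanSpace ℝ (Fin n) →L[ℝ] EuclideanSpace ℝ (Fin n) →L[ℝ] ℝ}
    {s : Set (EuclideanSpace ℝ (Fin n))} (hs : MeasurableSet s)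
    {Ψ : EuclideanSpace ℝ (Fin n) → R}
    {Ψ' : EuclideanSpace ℝ (Fin n) → EuclideanSpace ℝ (Fin n) →L[ℝ] EuclideanSpace ℝ (Fin n)}
    (hΨ : ∀ y ∈ s, HasMFDerivWithinAt 𝓘(ℝ, EuclideanSpace ℝ (Fin n)) I Ψ s y (Ψ' y))
    (inj : InjOn Ψ s) (himg : MeasurableSet (Ψ '' s)) :
    (formVol I q).restrict (Ψ '' s) =
      ((volume.restrict s).withDensity fun y ↦
        ENNReal.ofReal (√(formDet ((q (Ψ y)).bilinearComp (Ψ' y) (Ψ' y))))).map Ψ := by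
  rcases isEmpty_or_nonempty R with hR | hR
  · exact Subsingleton.elim _ _
  obtain ⟨x, hx⟩ := exists_seq_extChartAt_source I R
  have hcont : ContinuousOn Ψ s := fun y hy ↦ (hΨ y hy).continuousWithinAt
  have hae : AEMeasurable Ψ ((volume.restrict s).withDensity fun y ↦
        ENNReal.ofReal (√(formDet ((q (Ψ y)).bilinearComp (Ψ' y) (Ψ' y))))) :=
    (hcont.aemeasurable hs).mono_ac (withDensity_absolutelyContinuous _ _)
  rw [Measure.ext_iff_of_iUnion_eq_univ hx]
  intro i
  set O := (extChartAt I (x i)).source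
  have hO : IsOpen O := isOpen_extChartAt_source (x i)
  have hsi : MeasurableSet (s ∩ Ψ ⁻¹' O) := by
    obtain ⟨U, hU, hUs⟩ := (continuousOn_iff'.1 hcont) O hO
    rw [inter_comm, hUs]
    exact hU.measurableSet.inter hs
  have himgi : Ψ '' (s ∩ Ψ ⁻¹' O) = O ∩ Ψ '' s := by rw [image_inter_preimage, inter_comm]
  have key := formVol_restrict_image (q := q) (Ψ' := Ψ') hsi
    (fun y hy ↦ (hΨ y hy.1).mono inter_subset_left) (inj.mono inter_subset_left) (x i)
    (fun y hy ↦ hy.2) (by rw [himgi]; exact hO.measurableSet.inter himg)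
  rw [Measure.restrict_restrict hO.measurableSet, ← himgi, key]
  ext A hA
  rw [Measure.restrict_apply hA, Measure.map_apply_of_aemeasurable hae (hA.inter hO.measurableSet),
    Measure.map_apply_of_aemeasurable (((hcont.mono inter_subset_left).aemeasurable hsi).mono_ac
      (withDensity_absolutelyContinuous _ _)) hA, withDensity_apply', withDensity_apply',
    Measure.restrict_restrict' hsi, Measure.restrict_restrict' hs]
  congr 2
  ext y
  simp only [mem_inter_iff, mem_preimage]
  tauto

end Volume

/-! ### The model form of a cone and the volume near a conical point. -/

section Split

variable {n h l : ℕ}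

/-- A linear identification `ℝⁿ ≃ ℝʰ × ℝ × ℝˡ`, which maps the coordinates to the coordinates. -/
def splitEquiv (σ : Fin n ≃ Fin h ⊕ Unit ⊕ Fin l) : EuclideanSpace ℝ (Fin n) ≃L[ℝ]
    EuclideanSpace ℝ (Fin h) × ℝ × EuclideanSpace ℝ (Fin l) :=
  LinearEquiv.toContinuousLinearEquiv
  { toFun z := (WithLp.toLp 2 fun i ↦ z (σ.symm (.inl i)), z (σ.symm (.inr (.inl ()))),
      WithLp.toLp 2 fun j ↦ z (σ.symm (.inr (.inr j))))
    invFun w := WithLp.toLp 2 fun k ↦ match σ k with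
      | .inl i => w.1 i
      | .inr (.inl _) => w.2.1
      | .inr (.inr j) => w.2.2 j
    map_add' _ _ := rfl
    map_smul' _ _ := rfl
    left_inv z := by
      ext k
      rcases hk : σ k with i | i | j
      all_goals
        simp only [hk]
        rw [show σ.symm _ = k from σ.symm_apply_eq.2 hk.symm]
    right_inv w := by simp }

theorem splitEquiv_apply (σ : Fin n ≃ Fin h ⊕ Unit ⊕ Fin l) (z : EuclideanSpace ℝ (Fin n)) :
    splitEquiv σ z = (WithLp.toLp 2 fun i ↦ z (σ.symm (.inl i)), z (σ.symm (.inr (.inl ()))),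
      WithLp.toLp 2 fun j ↦ z (σ.symm (.inr (.inr j)))) := rfl

/-- The form `|db|² + dr² + r² p`. -/
def coneForm (r : ℝ) (p : EuclideanSpace ℝ (Fin l) →L[ℝ] EuclideanSpace ℝ (Fin l) →L[ℝ] ℝ) :
    (EuclideanSpace ℝ (Fin h) × ℝ × EuclideanSpace ℝ (Fin l)) →L[ℝ]
    (EuclideanSpace ℝ (Fin h) × ℝ × EuclideanSpace ℝ (Fin l)) →L[ℝ] ℝ :=
  (innerSL ℝ).bilinearComp (.fst ℝ _ _) (.fst ℝ _ _) +
  (innerSL ℝ).bilinearComp ((ContinuousLinearMap.fst ℝ _ _).comp (.snd ℝ _ _))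
    ((ContinuousLinearMap.fst ℝ _ _).comp (.snd ℝ _ _)) +
  r ^ 2 • p.bilinearComp ((ContinuousLinearMap.snd ℝ _ _).comp (.snd ℝ _ _))
    ((ContinuousLinearMap.snd ℝ _ _).comp (.snd ℝ _ _))

theorem coneForm_apply (r : ℝ)
    (p : EuclideanSpace ℝ (Fin l) →L[ℝ] EuclideanSpace ℝ (Fin l) →L[ℝ] ℝ)
    (V W : EuclideanSpace ℝ (Fin h) × ℝ × EuclideanSpace ℝ (Fin l)) :
    coneForm r p V W = inner ℝ V.1 W.1 + inner ℝ V.2.1 W.2.1 + r ^ 2 * p V.2.2 W.2.2 := rfl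

theorem coneForm_self (r : ℝ)
    (p : EuclideanSpace ℝ (Fin l) →L[ℝ] EuclideanSpace ℝ (Fin l) →L[ℝ] ℝ)
    (V : EuclideanSpace ℝ (Fin h) × ℝ × EuclideanSpace ℝ (Fin l)) :
    coneForm r p V V = ‖V.1‖ ^ 2 + V.2.1 ^ 2 + r ^ 2 * p V.2.2 V.2.2 := by
  rw [coneForm_apply, real_inner_self_eq_norm_sq, real_inner_self_eq_norm_sq, Real.norm_eq_abs,
    sq_abs]

theorem IsPosForm.coneForm {r : ℝ} (hr : r ≠ 0)
    {p : EuclideanSpace ℝ (Fin l) →L[ℝ] EuclideanSpace ℝ (Fin l) →L[ℝ] ℝ} (hp : IsPosForm p) :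
    IsPosForm (coneForm (h := h) r p) where
  symm V W := by
    simp only [coneForm_apply, hp.symm V.2.2 W.2.2, real_inner_comm]
  pos V hV := by
    rw [coneForm_self]
    have h1 := sq_nonneg ‖V.1‖
    have h2 := sq_nonneg V.2.1
    have hr2 : 0 < r ^ 2 := by positivity
    have h3 : 0 ≤ p V.2.2 V.2.2 := by
      by_cases h0 : V.2.2 = 0
      · simp [h0]
      · exact (hp.pos _ h0).le
    by_contra hcon
    have h4 := mul_nonneg hr2.le h3
    have e1 : ‖V.1‖ ^ 2 = 0 := by linarith
    have e2 : V.2.1 ^ 2 = 0 := by linarith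
    have e3 : r ^ 2 * p V.2.2 V.2.2 = 0 := by linarith
    have f1 : V.1 = 0 := by simpa using e1
    have f2 : V.2.1 = 0 := by simpa using e2
    have f3 : V.2.2 = 0 := by
      by_contra h0
      exact absurd e3 (mul_pos hr2 (hp.pos _ h0)).ne'
    exact hV (Prod.ext f1 (Prod.ext f2 f3))

/-- In the split coordinates the Gram matrix is block diagonal with blocks `1`, `1` and `r² p`; the
last block has size `l`, whence the factor `(rˡ)²`, whose square root is the density of a cone. -/
theorem formDet_coneForm (σ : Fin n ≃ Fin h ⊕ Unit ⊕ Fin l) (r : ℝ)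
    (p : EuclideanSpace ℝ (Fin l) →L[ℝ] EuclideanSpace ℝ (Fin l) →L[ℝ] ℝ) :
    formDet ((coneForm (h := h) r p).bilinearComp (splitEquiv σ : EuclideanSpace ℝ (Fin n) →L[ℝ] _)
      (splitEquiv σ : EuclideanSpace ℝ (Fin n) →L[ℝ] _)) = (r ^ l) ^ 2 * formDet p := by
  have h0 : (formMatrix ((coneForm (h := h) r p).bilinearComp
      (splitEquiv σ : EuclideanSpace ℝ (Fin n) →L[ℝ] _)
      (splitEquiv σ : EuclideanSpace ℝ (Fin n) →L[ℝ] _))).submatrix σ.symm σ.symm =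
      Matrix.fromBlocks 1 0 0 (Matrix.fromBlocks 1 0 0 (r ^ 2 • formMatrix p)) := by
    have e1 : ∀ i, splitEquiv σ (EuclideanSpace.single (σ.symm (.inl i)) 1) =
        (EuclideanSpace.single i 1, 0, 0) := by
      intro i
      rw [splitEquiv_apply]
      ext j <;> simp
    have e2 : ∀ i, splitEquiv σ (EuclideanSpace.single (σ.symm (.inr (.inl i))) 1) =
        (0, 1, 0) := by
      intro i
      rw [splitEquiv_apply]
      ext j <;> simp
    have e3 : ∀ i, splitEquiv σ (EuclideanSpace.single (σ.symm (.inr (.inr i))) 1) =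
        (0, 0, EuclideanSpace.single i 1) := by
      intro i
      rw [splitEquiv_apply]
      ext j <;> simp
    have e0 : ∀ a b : Fin h, inner ℝ (EuclideanSpace.single a (1 : ℝ))
        (EuclideanSpace.single b (1 : ℝ)) = (1 : Matrix (Fin h) (Fin h) ℝ) a b := by
      intro a b
      rw [EuclideanSpace.inner_single_left]
      simp [Matrix.one_apply]
    ext a b
    rcases a with a | a | a <;> rcases b with b | b | b <;>
      simp [formMatrix, e1, e2, e3, coneForm_apply, e0]
  rw [formDet, ← Matrix.det_submatrix_equiv_self σ.symm, h0, Matrix.det_fromBlocks_zero₂₁,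
    Matrix.det_fromBlocks_zero₂₁, Matrix.det_smul, formDet]
  simp only [Matrix.det_one, one_mul, Fintype.card_fin]
  ring

end Split

theorem hasMFDerivWithinAt_clm {E F : Type*} [NormedAddCommGroup E]
    [NormedSpace ℝ E] [NormedAddCommGroup F] [NormedSpace ℝ F] (L : E →L[ℝ] F) (s : Set E) (x : E) :
    HasMFDerivWithinAt 𝓘(ℝ, E) 𝓘(ℝ, F) L s x L :=
  L.hasFDerivWithinAt.hasMFDerivWithinAt

section ConeParam

variable {n h l : ℕ} {H HL : Type*} [TopologicalSpace H] [TopologicalSpace HL]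
  {I : ModelWithCorners ℝ (EuclideanSpace ℝ (Fin n)) H}
  {J : ModelWithCorners ℝ (EuclideanSpace ℝ (Fin l)) HL}
  {R : Type*} [TopologicalSpace R] [ChartedSpace H R]
  {S : Type*} [TopologicalSpace S] [ChartedSpace HL S]

variable (I J) in
/-- The differential of a map from `ℝʰ × ℝ × S`, on the model vector spaces. -/
def coneDeriv (Φ : EuclideanSpace ℝ (Fin h) × ℝ × S → R) (z : EuclideanSpace ℝ (Fin h) × ℝ × S) :
    EuclideanSpace ℝ (Fin h) × ℝ × EuclideanSpace ℝ (Fin l) →L[ℝ] EuclideanSpace ℝ (Fin n) :=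
  mfderiv (𝓘(ℝ, EuclideanSpace ℝ (Fin h)).prod (𝓘(ℝ, ℝ).prod J)) I Φ z

variable (S) in
/-- The domain `U × (0, ρ) × S` of a parametrization of a neighbourhood of a conical point. -/
def coneDomain (U : Set (EuclideanSpace ℝ (Fin h))) (ρ : ℝ) :
    Set (EuclideanSpace ℝ (Fin h) × ℝ × S) := U ×ˢ Ioo 0 ρ ×ˢ univ

variable (I J) in
/-- A diffeomorphism `Φ` from `U × (0, ρ) × S` to an open set in which the form `q` is comparable
to `|db|² + dr² + r² p`. -/
structure IsConeParam (q : R → EuclideanSpace ℝ (Fin n) →L[ℝ] EuclideanSpace ℝ (Fin n) →L[ℝ] ℝ)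
    (p : S → EuclideanSpace ℝ (Fin l) →L[ℝ] EuclideanSpace ℝ (Fin l) →L[ℝ] ℝ)
    (Φ : EuclideanSpace ℝ (Fin h) × ℝ × S → R) (U : Set (EuclideanSpace ℝ (Fin h))) (ρ C : ℝ) :
    Prop where
  isOpen : IsOpen U
  contMDiffAt : ∀ z ∈ coneDomain S U ρ,
    ContMDiffAt (𝓘(ℝ, EuclideanSpace ℝ (Fin h)).prod (𝓘(ℝ, ℝ).prod J)) I ∞ Φ z
  injOn : InjOn Φ (coneDomain S U ρ)
  isOpen_image : ∀ V ⊆ coneDomain S U ρ, IsOpen V → IsOpen (Φ '' V)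
  pos : 0 < C
  le_form : ∀ z ∈ coneDomain S U ρ, ∀ V, coneForm z.2.1 (p z.2.2) V V ≤
    C * q (Φ z) (coneDeriv I J Φ z V) (coneDeriv I J Φ z V)
  form_le : ∀ z ∈ coneDomain S U ρ, ∀ V,
    q (Φ z) (coneDeriv I J Φ z V) (coneDeriv I J Φ z V) ≤ C * coneForm z.2.1 (p z.2.2) V V

variable (J) in
/-- The measure `db ⊗ rˡ dr ⊗ vol_p` on `U × (0, ρ) × S`. -/
def coneMeasure [MeasurableSpace S]
    (p : S → EuclideanSpace ℝ (Fin l) →L[ℝ] EuclideanSpace ℝ (Fin l) →L[ℝ] ℝ)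
    (U : Set (EuclideanSpace ℝ (Fin h))) (ρ : ℝ) : Measure (EuclideanSpace ℝ (Fin h) × ℝ × S) :=
  (volume.restrict U).prod (((volume.restrict (Ioo 0 ρ)).withDensity
    fun r ↦ ENNReal.ofReal (r ^ l)).prod (formVol J p))

theorem isOpen_coneDomain {U : Set (EuclideanSpace ℝ (Fin h))} (hU : IsOpen U) (ρ : ℝ) :
    IsOpen (coneDomain S U ρ) := hU.prod (isOpen_Ioo.prod isOpen_univ)

/-- The inverse of a chart, modified to be measurable. -/
def measSymm (J : ModelWithCorners ℝ (EuclideanSpace ℝ (Fin l)) HL) (x₁ : S) :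
    EuclideanSpace ℝ (Fin l) → S :=
  open Classical in (extChartAt J x₁).target.piecewise (extChartAt J x₁).symm fun _ ↦ x₁

theorem measSymm_eq {x₁ : S} {y : EuclideanSpace ℝ (Fin l)} (hy : y ∈ (extChartAt J x₁).target) :
    measSymm J x₁ y = (extChartAt J x₁).symm y := by
  classical
  rw [measSymm, piecewise_eq_of_mem _ _ _ hy]

theorem measurable_measSymm [MeasurableSpace S] [BorelSpace S] (x₁ : S) :
    Measurable (measSymm J x₁) := by
  classical
  exact (continuousOn_extChartAt_symm x₁).measurable_piecewise continuousOn_const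
    (measurableSet_extChartAt_target x₁)

theorem chartVol_eq_map_measSymm [MeasurableSpace S] [BorelSpace S]
    (p : S → EuclideanSpace ℝ (Fin l) →L[ℝ] EuclideanSpace ℝ (Fin l) →L[ℝ] ℝ) (x₁ : S) :
    chartVol J p x₁ = ((volume.restrict (extChartAt J x₁).target).withDensity
      fun y ↦ ENNReal.ofReal (√(formDet (chartForm J p x₁ y)))).map (measSymm J x₁) := by
  refine Measure.map_congr ?_
  refine (withDensity_absolutelyContinuous _ _).ae_le ?_
  filter_upwards [ae_restrict_mem (measurableSet_extChartAt_target x₁)] with y hy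
  exact (measSymm_eq hy).symm

variable [IsManifold I ∞ R] [IsManifold J ∞ S]
  {q : R → EuclideanSpace ℝ (Fin n) →L[ℝ] EuclideanSpace ℝ (Fin n) →L[ℝ] ℝ}
  {p : S → EuclideanSpace ℝ (Fin l) →L[ℝ] EuclideanSpace ℝ (Fin l) →L[ℝ] ℝ}
  {Φ : EuclideanSpace ℝ (Fin h) × ℝ × S → R} {U : Set (EuclideanSpace ℝ (Fin h))} {ρ C : ℝ}

omit [IsManifold I ∞ R] [IsManifold J ∞ S] in
theorem IsConeParam.continuousOn (hΦ : IsConeParam I J q p Φ U ρ C) :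
    ContinuousOn Φ (coneDomain S U ρ) :=
  fun z hz ↦ (hΦ.contMDiffAt z hz).continuousAt.continuousWithinAt

/-- In a chart of the link, the volume measure is comparable to the measure `rˡ √(det p)`. -/
theorem IsConeParam.restrict_chart [T2Space R] [SecondCountableTopology R] [MeasurableSpace R]
    [BorelSpace R] (hΦ : IsConeParam I J q p Φ U ρ C) (hq : IsContForm I q) (hp : IsContForm J p)
    (σ : Fin n ≃ Fin h ⊕ Unit ⊕ Fin l) (x₁ : S) :
    ∃ μ : Measure (EuclideanSpace ℝ (Fin h) × ℝ × EuclideanSpace ℝ (Fin l)),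
    μ = ((volume.map (splitEquiv σ)).restrict (U ×ˢ Ioo 0 ρ ×ˢ (extChartAt J x₁).target)).withDensity
        (fun w ↦ ENNReal.ofReal (w.2.1 ^ l * √(formDet (chartForm J p x₁ w.2.2)))) ∧
    (formVol I q).restrict (Φ '' (U ×ˢ Ioo 0 ρ ×ˢ (extChartAt J x₁).source)) ≤
      ENNReal.ofReal (√(C ^ n)) • μ.map (fun w ↦ Φ (w.1, w.2.1, measSymm J x₁ w.2.2)) ∧
    μ.map (fun w ↦ Φ (w.1, w.2.1, measSymm J x₁ w.2.2)) ≤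
      ENNReal.ofReal (√(C ^ n)) •
      (formVol I q).restrict (Φ '' (U ×ˢ Ioo 0 ρ ×ˢ (extChartAt J x₁).source)) := by
  set e := splitEquiv σ
  set φ := extChartAt J x₁
  set T : Set (EuclideanSpace ℝ (Fin h) × ℝ × EuclideanSpace ℝ (Fin l)) :=
    U ×ˢ Ioo 0 ρ ×ˢ φ.target
  have hT : MeasurableSet T := hΦ.isOpen.measurableSet.prod
    (measurableSet_Ioo.prod (measurableSet_extChartAt_target x₁))
  set s := e ⁻¹' T
  have hs : MeasurableSet s := e.continuous.measurable hT
  set F : EuclideanSpace ℝ (Fin h) × ℝ × EuclideanSpace ℝ (Fin l) → R :=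
    fun w ↦ Φ (w.1, w.2.1, measSymm J x₁ w.2.2)
  set Ψ : EuclideanSpace ℝ (Fin n) → R := fun z ↦ F (e z)
  have hmem : ∀ z ∈ s, ((e z).1, (e z).2.1, measSymm J x₁ (e z).2.2) ∈ coneDomain S U ρ :=
    fun z hz ↦ ⟨hz.1, hz.2.1, mem_univ _⟩
  set π₁ := (ContinuousLinearMap.fst ℝ _ _).comp
          (e : EuclideanSpace ℝ (Fin n) →L[ℝ] EuclideanSpace ℝ (Fin h) × ℝ × EuclideanSpace ℝ (Fin l))
  set π₂ := ((ContinuousLinearMap.fst ℝ _ _).comp (.snd ℝ _ _)).comp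
          (e : EuclideanSpace ℝ (Fin n) →L[ℝ] EuclideanSpace ℝ (Fin h) × ℝ × EuclideanSpace ℝ (Fin l))
  set π₃ := ((ContinuousLinearMap.snd ℝ _ _).comp (.snd ℝ _ _)).comp
          (e : EuclideanSpace ℝ (Fin n) →L[ℝ] EuclideanSpace ℝ (Fin h) × ℝ × EuclideanSpace ℝ (Fin l))
  set Ψ' : EuclideanSpace ℝ (Fin n) → EuclideanSpace ℝ (Fin n) →L[ℝ] EuclideanSpace ℝ (Fin n) :=
    fun z ↦ (coneDeriv I J Φ ((e z).1, (e z).2.1, measSymm J x₁ (e z).2.2)).comp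
      (π₁.prod
        (π₂.prod
        ((dsymm J x₁ (e z).2.2).comp π₃)))
  have hΨ'_apply : ∀ z v, Ψ' z v = coneDeriv I J Φ ((e z).1, (e z).2.1, measSymm J x₁ (e z).2.2)
      ((e v).1, (e v).2.1, dsymm J x₁ (e z).2.2 (e v).2.2) := fun _ _ ↦ rfl
  have hΨ : ∀ z ∈ s, HasMFDerivWithinAt 𝓘(ℝ, EuclideanSpace ℝ (Fin n)) I Ψ s z (Ψ' z) := by
    intro z hz
    have : IsManifold J 1 S := IsManifold.of_le (n := ∞) (by norm_cast)
    have h1 := ((hΦ.contMDiffAt _ (hmem z hz)).mdifferentiableAt (by simp)).hasMFDerivAt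
    have h2 : HasMFDerivWithinAt 𝓘(ℝ, EuclideanSpace ℝ (Fin n)) J
        (fun z ↦ measSymm J x₁ (e z).2.2) s z ((dsymm J x₁ (e z).2.2).comp
          π₃) := by
      have h3 : HasMFDerivWithinAt 𝓘(ℝ, EuclideanSpace ℝ (Fin l)) J φ.symm (range J) (e z).2.2
          (dsymm J x₁ ((e z).2.2 : EuclideanSpace ℝ (Fin l)) :) :=
        (mdifferentiableWithinAt_extChartAt_symm hz.2.2).hasMFDerivWithinAt
      have h4 : HasMFDerivWithinAt 𝓘(ℝ, EuclideanSpace ℝ (Fin n)) 𝓘(ℝ, EuclideanSpace ℝ (Fin l))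
          (fun z ↦ (e z).2.2) s z π₃ :=
        hasMFDerivWithinAt_clm π₃ _ _
      refine (h3.comp z h4 (show s ⊆ (fun z ↦ (e z).2.2) ⁻¹' range J from
        fun w hw ↦ extChartAt_target_subset_range x₁ hw.2.2)).congr_of_eventuallyEq
        ?_ ?_
      · filter_upwards [self_mem_nhdsWithin] with w hw
        exact measSymm_eq hw.2.2
      · exact measSymm_eq hz.2.2
    have h5 : HasMFDerivWithinAt 𝓘(ℝ, EuclideanSpace ℝ (Fin n)) 𝓘(ℝ, EuclideanSpace ℝ (Fin h))
          (fun z ↦ (e z).1) s z π₁ :=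
        hasMFDerivWithinAt_clm π₁ _ _
    have h6 : HasMFDerivWithinAt 𝓘(ℝ, EuclideanSpace ℝ (Fin n)) 𝓘(ℝ, ℝ)
          (fun z ↦ (e z).2.1) s z π₂ :=
        hasMFDerivWithinAt_clm π₂ _ _
    exact h1.comp_hasMFDerivWithinAt z (h5.prodMk (h6.prodMk h2))
  have hinj : InjOn Ψ s := by
    intro z hz z' hz' h
    have h1 := hΦ.injOn (hmem z hz) (hmem z' hz') h
    rw [measSymm_eq hz.2.2, measSymm_eq hz'.2.2, Prod.mk.injEq, Prod.mk.injEq] at h1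
    exact e.injective (Prod.ext h1.1 (Prod.ext h1.2.1 (φ.symm.injOn hz.2.2 hz'.2.2 h1.2.2)))
  have himg : Ψ '' s = Φ '' (U ×ˢ Ioo 0 ρ ×ˢ φ.source) := by
    ext x
    constructor
    · rintro ⟨z, hz, rfl⟩
      refine ⟨_, ⟨hz.1, hz.2.1, ?_⟩, rfl⟩
      simp only [measSymm_eq hz.2.2]
      exact φ.map_target hz.2.2
    · rintro ⟨⟨b, r, y⟩, ⟨hb, hr, hy⟩, rfl⟩
      refine ⟨e.symm (b, r, φ y), ?_, ?_⟩
      · simp only [s, mem_preimage, e.apply_symm_apply]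
        exact ⟨hb, hr, φ.map_source hy⟩
      · simp only [Ψ, F, e.apply_symm_apply]
        rw [measSymm_eq (φ.map_source hy)]
        exact congrArg (fun y ↦ Φ (b, r, y)) (φ.left_inv hy)
  have himgo : IsOpen (Ψ '' s) := by
    rw [himg]
    exact hΦ.isOpen_image _ (fun z hz ↦ ⟨hz.1, hz.2.1, mem_univ _⟩)
      (hΦ.isOpen.prod (isOpen_Ioo.prod (isOpen_extChartAt_source x₁)))
  have key := formVol_restrict_range (q := q) (Ψ' := Ψ') hs hΨ hinj himgo.measurableSet
  set μ := ((volume.map e).restrict T).withDensity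
        (fun w ↦ ENNReal.ofReal (w.2.1 ^ l * √(formDet (chartForm J p x₁ w.2.2))))
  have hcont : ContinuousOn Ψ s := fun y hy ↦ (hΨ y hy).continuousWithinAt
  -- This is `μ` before the coordinates are split. The volume measure of `q` is known as a
  -- push-forward under `Ψ`, so the comparison takes place between densities on `s`.
  set κ := (volume.restrict s).withDensity
    (fun z ↦ ENNReal.ofReal ((e z).2.1 ^ l * √(formDet (chartForm J p x₁ (e z).2.2))))
  have hΨκ : AEMeasurable Ψ κ := (hcont.aemeasurable hs).mono_ac (withDensity_absolutelyContinuous _ _)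
  have hκe : κ.map e = μ := by
    ext A hA
    rw [Measure.map_apply e.continuous.measurable hA, withDensity_apply', withDensity_apply',
      Measure.restrict_restrict' hs, Measure.restrict_restrict' hT]
    change _ = ∫⁻ w in A ∩ T, _ ∂(volume.map e.toHomeomorph.toMeasurableEquiv)
    rw [MeasurableEquiv.restrict_map, lintegral_map_equiv]
    rfl
  have hμ : μ.map F = κ.map Ψ := by
    have hF : AEMeasurable F (κ.map e) :=
      (aemeasurable_map_equiv_iff e.toHomeomorph.toMeasurableEquiv).2 hΨκ
    rw [← hκe, AEMeasurable.map_map_of_aemeasurable hF e.continuous.measurable.aemeasurable]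
    rfl
  -- Positivity of the pulled back form is read off from its lower bound by the positive cone form,
  -- so injectivity of the differential of `Φ` need not be shown.
  have hdens : ∀ z ∈ s, IsPosForm ((q (Ψ z)).bilinearComp (Ψ' z) (Ψ' z)) ∧
    IsPosForm ((coneForm (h := h) (e z).2.1 (chartForm J p x₁ (e z).2.2)).bilinearComp
      (e : EuclideanSpace ℝ (Fin n) →L[ℝ] _) (e : EuclideanSpace ℝ (Fin n) →L[ℝ] _)) ∧
      (∀ v, ((q (Ψ z)).bilinearComp (Ψ' z) (Ψ' z)) v v ≤ C *
        ((coneForm (h := h) (e z).2.1 (chartForm J p x₁ (e z).2.2)).bilinearComp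
      (e : EuclideanSpace ℝ (Fin n) →L[ℝ] _) (e : EuclideanSpace ℝ (Fin n) →L[ℝ] _)) v v) ∧
      (∀ v, 
        ((coneForm (h := h) (e z).2.1 (chartForm J p x₁ (e z).2.2)).bilinearComp
      (e : EuclideanSpace ℝ (Fin n) →L[ℝ] _) (e : EuclideanSpace ℝ (Fin n) →L[ℝ] _)) v v ≤
        C * ((q (Ψ z)).bilinearComp (Ψ' z) (Ψ' z)) v v) := by
    intro z hz
    have hM : IsPosForm ((coneForm (h := h) (e z).2.1 (chartForm J p x₁ (e z).2.2)).bilinearComp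
        (e : EuclideanSpace ℝ (Fin n) →L[ℝ] _) (e : EuclideanSpace ℝ (Fin n) →L[ℝ] _)) :=
      ((hp.isPosForm_chartForm hz.2.2).coneForm hz.2.1.1.ne').comp e.injective
    have hMV : ∀ v, ((coneForm (h := h) (e z).2.1 (chartForm J p x₁ (e z).2.2)).bilinearComp
        (e : EuclideanSpace ℝ (Fin n) →L[ℝ] _) (e : EuclideanSpace ℝ (Fin n) →L[ℝ] _)) v v =
        coneForm (h := h) (e z).2.1 (p (measSymm J x₁ (e z).2.2))
          ((e v).1, (e v).2.1, dsymm J x₁ (e z).2.2 (e v).2.2)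
          ((e v).1, (e v).2.1, dsymm J x₁ (e z).2.2 (e v).2.2) := by
      intro v
      rw [measSymm_eq hz.2.2]
      rfl
    have h1 := fun v ↦ hΦ.form_le _ (hmem z hz) ((e v).1, (e v).2.1, dsymm J x₁ (e z).2.2 (e v).2.2)
    have h2 := fun v ↦ hΦ.le_form _ (hmem z hz) ((e v).1, (e v).2.1, dsymm J x₁ (e z).2.2 (e v).2.2)
    have h4 : ∀ v, ((coneForm (h := h) (e z).2.1 (chartForm J p x₁ (e z).2.2)).bilinearComp
      (e : EuclideanSpace ℝ (Fin n) →L[ℝ] _) (e : EuclideanSpace ℝ (Fin n) →L[ℝ] _)) v v ≤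
        C * ((q (Ψ z)).bilinearComp (Ψ' z) (Ψ' z)) v v := fun v ↦ by rw [hMV]; exact h2 v
    refine ⟨⟨fun v w ↦ (hq.isPosForm _).symm _ _, fun v hv ↦ ?_⟩, hM, fun v ↦ by rw [hMV]; exact h1 v,
      h4⟩
    exact pos_of_mul_pos_right ((hM.pos v hv).trans_le (h4 v)) hΦ.pos.le
  have hr : ∀ z ∈ s, 0 ≤ (e z).2.1 ^ l := fun z hz ↦ pow_nonneg hz.2.1.1.le _
  have hsq : ∀ z ∈ s, (e z).2.1 ^ l * √(formDet (chartForm J p x₁ (e z).2.2)) =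
      √(formDet ((coneForm (h := h) (e z).2.1 (chartForm J p x₁ (e z).2.2)).bilinearComp
      (e : EuclideanSpace ℝ (Fin n) →L[ℝ] _) (e : EuclideanSpace ℝ (Fin n) →L[ℝ] _))) := by
    intro z hz
    rw [formDet_coneForm, Real.sqrt_mul (sq_nonneg _), Real.sqrt_sq (hr z hz)]
  have hCn : 0 ≤ C ^ n := pow_nonneg hΦ.pos.le n
  refine ⟨μ, rfl, ?_, ?_⟩
  · rw [hμ, ← himg, key, ← Measure.map_smul, ← withDensity_smul' _ _ ENNReal.ofReal_ne_top]
    refine Measure.map_mono_of_aemeasurable (withDensity_mono ?_) ?_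
    · filter_upwards [ae_restrict_mem hs] with z hz
      obtain ⟨hQ, hM, h1, -⟩ := hdens z hz
      simp only [Pi.smul_apply, smul_eq_mul]
      rw [← ENNReal.ofReal_mul (Real.sqrt_nonneg _), hsq z hz, ← Real.sqrt_mul hCn]
      exact ENNReal.ofReal_le_ofReal (Real.sqrt_le_sqrt (formDet_le hQ hM h1))
    · exact (hcont.aemeasurable hs).mono_ac (withDensity_absolutelyContinuous _ _)
  · rw [hμ, ← himg, key, ← Measure.map_smul, ← withDensity_smul' _ _ ENNReal.ofReal_ne_top]
    refine Measure.map_mono_of_aemeasurable (withDensity_mono ?_) ?_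
    · filter_upwards [ae_restrict_mem hs] with z hz
      obtain ⟨hQ, hM, -, h1⟩ := hdens z hz
      simp only [Pi.smul_apply, smul_eq_mul]
      rw [← ENNReal.ofReal_mul (Real.sqrt_nonneg _), hsq z hz, ← Real.sqrt_mul hCn]
      exact ENNReal.ofReal_le_ofReal (Real.sqrt_le_sqrt (formDet_le hM hQ h1))
    · exact (hcont.aemeasurable hs).mono_ac (withDensity_absolutelyContinuous _ _)

end ConeParam

/-- Injectivity on a set of full measure makes the preimage of `f '' D₁` equal to `D₁` up to a null
set. -/
theorem map_restrict_image {α β : Type*} [MeasurableSpace α] [MeasurableSpace β] {μ : Measure α}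
    {f : α → β} {D D₁ : Set α} (hf : AEMeasurable f μ) (hD : μ Dᶜ = 0) (hinj : InjOn f D)
    (hD₁ : D₁ ⊆ D) (hm : MeasurableSet D₁) (himg : MeasurableSet (f '' D₁)) :
    (μ.map f).restrict (f '' D₁) = (μ.restrict D₁).map f := by
  ext A hA
  rw [Measure.restrict_apply hA, Measure.map_apply_of_aemeasurable hf (hA.inter himg),
    Measure.map_apply_of_aemeasurable hf.restrict hA, Measure.restrict_apply' hm]
  refine measure_congr ?_
  filter_upwards [compl_mem_ae_iff.2 hD] with x hx
  have hx : x ∈ D := by simpa using hx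
  refine propext ⟨fun ⟨h1, y, hy, hyx⟩ ↦ ⟨h1, ?_⟩, fun ⟨h1, h2⟩ ↦ ⟨h1, x, h2, rfl⟩⟩
  rwa [← hinj (hD₁ hy) hx hyx]

section ConeParam

variable {n h l : ℕ} {H HL : Type*} [TopologicalSpace H] [TopologicalSpace HL]
  {I : ModelWithCorners ℝ (EuclideanSpace ℝ (Fin n)) H}
  {J : ModelWithCorners ℝ (EuclideanSpace ℝ (Fin l)) HL}
  {R : Type*} [TopologicalSpace R] [ChartedSpace H R]
  {S : Type*} [TopologicalSpace S] [ChartedSpace HL S]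

variable [IsManifold I ∞ R] [IsManifold J ∞ S]
  {q : R → EuclideanSpace ℝ (Fin n) →L[ℝ] EuclideanSpace ℝ (Fin n) →L[ℝ] ℝ}
  {p : S → EuclideanSpace ℝ (Fin l) →L[ℝ] EuclideanSpace ℝ (Fin l) →L[ℝ] ℝ}
  {Φ : EuclideanSpace ℝ (Fin h) × ℝ × S → R} {U : Set (EuclideanSpace ℝ (Fin h))} {ρ C : ℝ}

omit [IsManifold J ∞ S] in
theorem coneMeasure_restrict [MeasurableSpace S] [SFinite (formVol J p)] (hU : MeasurableSet U)
    (A : Set S) :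
    (coneMeasure J p U ρ).restrict (U ×ˢ Ioo 0 ρ ×ˢ A) = (volume.restrict U).prod
      (((volume.restrict (Ioo 0 ρ)).withDensity fun r ↦ ENNReal.ofReal (r ^ l)).prod
        ((formVol J p).restrict A)) := by
  rw [coneMeasure, ← Measure.prod_restrict, ← Measure.prod_restrict, Measure.restrict_restrict hU,
    inter_self, restrict_withDensity measurableSet_Ioo, Measure.restrict_restrict measurableSet_Ioo,
    inter_self]

omit [IsManifold J ∞ S] in
theorem coneMeasure_compl_coneDomain [MeasurableSpace S] [SFinite (formVol J p)]
    (hU : MeasurableSet U) :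
    coneMeasure J p U ρ (coneDomain S U ρ)ᶜ = 0 := by
  have h := coneMeasure_restrict (J := J) (p := p) (ρ := ρ) hU univ
  rw [Measure.restrict_univ] at h
  change _ = coneMeasure J p U ρ at h
  have hD : MeasurableSet (coneDomain S U ρ) :=
    hU.prod (measurableSet_Ioo.prod MeasurableSet.univ)
  rw [← h, Measure.restrict_apply hD.compl]
  exact measure_mono_null (fun z hz ↦ hz.1 hz.2) (measure_empty)

omit [IsManifold I ∞ R] [IsManifold J ∞ S] in
theorem IsConeParam.aemeasurable [SecondCountableTopology S] [MeasurableSpace S] [BorelSpace S]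
    [MeasurableSpace R] [BorelSpace R] [SFinite (formVol J p)]
    (hΦ : IsConeParam I J q p Φ U ρ C) : AEMeasurable Φ (coneMeasure J p U ρ) := by
  rw [← Measure.restrict_eq_self_of_ae_mem (s := coneDomain S U ρ) (μ := coneMeasure J p U ρ)
    (coneMeasure_compl_coneDomain hΦ.isOpen.measurableSet)]
  exact hΦ.continuousOn.aemeasurable (isOpen_coneDomain hΦ.isOpen ρ).measurableSet

omit [IsManifold I ∞ R] in
-- By Fubini's theorem, Lebesgue measure with density `rˡ √(det p)` splits as `db ⊗ rˡ dr ⊗ vol_p`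
-- in a chart of the link. The factor `c` compares the two Haar measures on the coordinate space,
-- before and after splitting.
theorem IsConeParam.map_restrict_chart [T2Space S] [SecondCountableTopology S] [MeasurableSpace S]
    [BorelSpace S] [T2Space R] [SecondCountableTopology R] [MeasurableSpace R]
    [BorelSpace R] (hΦ : IsConeParam I J q p Φ U ρ C) (hp : IsContForm J p)
    (σ : Fin n ≃ Fin h ⊕ Unit ⊕ Fin l) {c : ℝ≥0∞}
    (hc : (volume : Measure (EuclideanSpace ℝ (Fin n))).map (splitEquiv σ) = c • volume) (x₁ : S) :
    (((volume.map (splitEquiv σ)).restrict (U ×ˢ Ioo 0 ρ ×ˢ (extChartAt J x₁).target)).withDensity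
        (fun w ↦ ENNReal.ofReal (w.2.1 ^ l * √(formDet (chartForm J p x₁ w.2.2))))).map
      (fun w ↦ Φ (w.1, w.2.1, measSymm J x₁ w.2.2)) =
    c • ((coneMeasure J p U ρ).map Φ).restrict
      (Φ '' (U ×ˢ Ioo 0 ρ ×ˢ (extChartAt J x₁).source)) := by
  have := isLocallyFiniteMeasure_formVol hp
  have hsf := sFinite_chartVol (I := J) p x₁
  set φ := extChartAt J x₁
  have hae : AEMeasurable Φ (coneMeasure J p U ρ) := hΦ.aemeasurable
  have hD₁ : U ×ˢ Ioo 0 ρ ×ˢ φ.source ⊆ coneDomain S U ρ := fun z hz ↦ ⟨hz.1, hz.2.1, mem_univ _⟩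
  rw [map_restrict_image hae (coneMeasure_compl_coneDomain hΦ.isOpen.measurableSet) hΦ.injOn hD₁
    (hΦ.isOpen.measurableSet.prod (measurableSet_Ioo.prod (isOpen_extChartAt_source x₁).measurableSet))
    (hΦ.isOpen_image _ hD₁
      (hΦ.isOpen.prod (isOpen_Ioo.prod (isOpen_extChartAt_source x₁)))).measurableSet]
  have h1 : (coneMeasure J p U ρ).restrict (U ×ˢ Ioo 0 ρ ×ˢ φ.source) =
      (volume.restrict U).prod (((volume.restrict (Ioo 0 ρ)).withDensity
        fun r ↦ ENNReal.ofReal (r ^ l)).prod (chartVol J p x₁)) := by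
    rw [coneMeasure_restrict hΦ.isOpen.measurableSet,
      formVol_restrict_source]
  have h2 : ((volume : Measure (EuclideanSpace ℝ (Fin h) × ℝ × EuclideanSpace ℝ (Fin l))).restrict
      (U ×ˢ Ioo 0 ρ ×ˢ φ.target)).withDensity
        (fun w ↦ ENNReal.ofReal (w.2.1 ^ l * √(formDet (chartForm J p x₁ w.2.2)))) =
      (volume.restrict U).prod (((volume.restrict (Ioo 0 ρ)).withDensity
        fun r ↦ ENNReal.ofReal (r ^ l)).prod ((volume.restrict φ.target).withDensity
      fun y ↦ ENNReal.ofReal (√(formDet (chartForm J p x₁ y))))) := by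
    have hm : AEMeasurable (fun y ↦ ENNReal.ofReal (√(formDet (chartForm J p x₁ y))))
        (volume.restrict φ.target) :=
      ENNReal.measurable_ofReal.comp_aemeasurable
        ((continuous_formDet.comp_continuousOn (hp.continuousOn x₁)).sqrt.aemeasurable
          (measurableSet_extChartAt_target x₁))
    rw [prod_withDensity₀ (by fun_prop) hm, prod_withDensity_right₀, Measure.volume_eq_prod,
      Measure.volume_eq_prod, ← Measure.prod_restrict, ← Measure.prod_restrict]
    · refine withDensity_congr_ae ?_
      rw [Measure.prod_restrict, Measure.prod_restrict]
      filter_upwards [ae_restrict_mem (hΦ.isOpen.measurableSet.prod (measurableSet_Ioo.prod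
        (measurableSet_extChartAt_target x₁)))] with w hw
      exact ENNReal.ofReal_mul (pow_nonneg hw.2.1.1.le _)
    · exact AEMeasurable.mul (by fun_prop) hm.comp_snd
  have h3 : (volume.restrict U).prod (((volume.restrict (Ioo 0 ρ)).withDensity
        fun r ↦ ENNReal.ofReal (r ^ l)).prod (chartVol J p x₁)) =
        ((volume.restrict U).prod (((volume.restrict (Ioo 0 ρ)).withDensity
        fun r ↦ ENNReal.ofReal (r ^ l)).prod ((volume.restrict φ.target).withDensity
      fun y ↦ ENNReal.ofReal (√(formDet (chartForm J p x₁ y)))))).map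
        (Prod.map id (Prod.map id (measSymm J x₁))) := by
    rw [chartVol_eq_map_measSymm, ← Measure.map_prod_map _ _ measurable_id
      (measurable_id.prodMap (measurable_measSymm x₁)), ← Measure.map_prod_map _ _ measurable_id
      (measurable_measSymm x₁), Measure.map_id, Measure.map_id]
  rw [hc, Measure.restrict_smul, withDensity_smul_measure, Measure.map_smul, h2, h1, h3]
  congr 1
  rw [AEMeasurable.map_map_of_aemeasurable]
  · rfl
  · rw [← h3, ← h1]
    exact hae.restrict
  · exact (measurable_id.prodMap (measurable_id.prodMap (measurable_measSymm x₁))).aemeasurable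

/-- The volume measure is comparable to `db ⊗ rˡ dr ⊗ vol_p` near a conical point. -/
theorem IsConeParam.volume_comparison [T2Space S] [SecondCountableTopology S] [MeasurableSpace S]
    [BorelSpace S] [T2Space R] [SecondCountableTopology R] [MeasurableSpace R]
    [BorelSpace R] (hΦ : IsConeParam I J q p Φ U ρ C) (hq : IsContForm I q) (hp : IsContForm J p)
    (hn : n = h + 1 + l) :
    ∃ K : ℝ≥0, (formVol I q).restrict (Φ '' coneDomain S U ρ) ≤ K • (coneMeasure J p U ρ).map Φ ∧
      (coneMeasure J p U ρ).map Φ ≤ K • formVol I q := by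
  have := isLocallyFiniteMeasure_formVol hp
  rcases isEmpty_or_nonempty S with hS | hS
  · have hD : coneDomain S U ρ = ∅ := by
      ext z
      exact (hS.false z.2.2).elim
    have h0 : coneMeasure J p U ρ = 0 := by
      rw [← Measure.measure_univ_eq_zero]
      convert coneMeasure_compl_coneDomain (J := J) (p := p) (ρ := ρ) hΦ.isOpen.measurableSet
      rw [hD, compl_empty]
    refine ⟨0, ?_, ?_⟩
    · simp [hD]
    · simp [h0]
  obtain ⟨x, hx⟩ := exists_seq_extChartAt_source J S
  obtain ⟨σ⟩ : Nonempty (Fin n ≃ Fin h ⊕ Unit ⊕ Fin l) := by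
    refine ⟨Fintype.equivOfCardEq ?_⟩
    simp [hn, add_assoc]
  -- By uniqueness of Haar measure; only finiteness and positivity of the factor matter.
  obtain ⟨c, hc0, hct, hc⟩ : ∃ c : ℝ≥0∞, c ≠ 0 ∧ c ≠ ⊤ ∧
      (volume : Measure (EuclideanSpace ℝ (Fin n))).map (splitEquiv σ) = c • volume := by
    have : Measure.IsAddHaarMeasure
        ((volume : Measure (EuclideanSpace ℝ (Fin n))).map (splitEquiv σ)) :=
      (splitEquiv σ).isAddHaarMeasure_map volume
    have h1 : (volume : Measure (ℝ × EuclideanSpace ℝ (Fin l))).IsAddHaarMeasure := by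
      rw [Measure.volume_eq_prod]; infer_instance
    have h1' : SFinite (volume : Measure (ℝ × EuclideanSpace ℝ (Fin l))) := by
      rw [Measure.volume_eq_prod]; infer_instance
    have h2 : (volume : Measure (EuclideanSpace ℝ (Fin h) × ℝ ×
        EuclideanSpace ℝ (Fin l))).IsAddHaarMeasure :=
      Measure.prod.instIsAddHaarMeasure volume volume
    refine ⟨_, ?_, ENNReal.coe_ne_top, Measure.isAddLeftInvariant_eq_smul
      ((volume : Measure (EuclideanSpace ℝ (Fin n))).map (splitEquiv σ)) volume⟩
    exact ENNReal.coe_ne_zero.2 (Measure.addHaarScalarFactor_pos_of_isAddHaarMeasure _ _).ne'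
  set K₀ := ENNReal.ofReal (√(C ^ n))
  -- The upper bound needs `K₀ c` and the lower bound `c⁻¹ K₀`; the sum serves both.
  set K : ℝ≥0 := (K₀ * c + c⁻¹ * K₀).toNNReal
  have hK : (K : ℝ≥0∞) = K₀ * c + c⁻¹ * K₀ := by
    refine ENNReal.coe_toNNReal (ENNReal.add_ne_top.2 ⟨?_, ?_⟩)
    · exact ENNReal.mul_ne_top ENNReal.ofReal_ne_top hct
    · exact ENNReal.mul_ne_top (ENNReal.inv_ne_top.2 hc0) ENNReal.ofReal_ne_top
  set O : ℕ → Set R := fun i ↦ Φ '' (U ×ˢ Ioo 0 ρ ×ˢ (extChartAt J (x i)).source)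
  have hsub : ∀ i, U ×ˢ Ioo 0 ρ ×ˢ (extChartAt J (x i)).source ⊆ coneDomain S U ρ :=
    fun i z hz ↦ ⟨hz.1, hz.2.1, mem_univ _⟩
  have hO : ∀ i, MeasurableSet (O i) := fun i ↦ (hΦ.isOpen_image _ (hsub i)
    (hΦ.isOpen.prod (isOpen_Ioo.prod (isOpen_extChartAt_source (x i))))).measurableSet
  have hOU : ⋃ i, O i = Φ '' coneDomain S U ρ := by
    rw [← image_iUnion]
    congr 1
    ext z
    have : z.2.2 ∈ ⋃ i, (extChartAt J (x i)).source := hx ▸ mem_univ _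
    simp only [mem_iUnion, mem_prod, coneDomain, mem_univ, and_true] at this ⊢
    constructor
    · rintro ⟨i, h1, h2, -⟩; exact ⟨h1, h2⟩
    · rintro ⟨h1, h2⟩; exact this.imp fun i hi ↦ ⟨h1, h2, hi⟩
  have hD : MeasurableSet (Φ '' coneDomain S U ρ) := by
    rw [← hOU]; exact MeasurableSet.iUnion hO
  set μ := formVol I q
  set ν := (coneMeasure J p U ρ).map Φ
  have key : ∀ i, μ.restrict (O i) ≤ K₀ • c • ν.restrict (O i) ∧
      c • ν.restrict (O i) ≤ K₀ • μ.restrict (O i) := by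
    intro i
    obtain ⟨κ, rfl, h1, h2⟩ := hΦ.restrict_chart hq hp σ (x i)
    rw [hΦ.map_restrict_chart hp σ hc] at h1 h2
    exact ⟨h1, h2⟩
  refine ⟨K, ?_, ?_⟩
  · refine measure_le_of_restrict_le hO ?_ fun i ↦ ?_
    · rw [hOU, Measure.restrict_apply hD.compl, compl_inter_self, measure_empty]
    · rw [Measure.restrict_restrict (hO i), inter_eq_left.2 (hOU ▸ subset_iUnion O i),
        Measure.restrict_smul]
      refine (key i).1.trans ?_
      refine Measure.le_iff.2 fun A _ ↦ ?_
      simp only [Measure.smul_apply, smul_eq_mul]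
      rw [ENNReal.smul_def, hK, smul_eq_mul, ← mul_assoc]
      gcongr
      exact le_self_add
  · refine measure_le_of_restrict_le hO ?_ fun i ↦ ?_
    · rw [hOU, Measure.map_apply_of_aemeasurable hΦ.aemeasurable hD.compl]
      refine measure_mono_null ?_
        (coneMeasure_compl_coneDomain (J := J) (p := p) (ρ := ρ) hΦ.isOpen.measurableSet)
      exact fun z hz hzD ↦ hz ⟨z, hzD, rfl⟩
    · have h2 := (key i).2
      rw [Measure.restrict_smul]
      refine Measure.le_iff.2 fun A hA ↦ ?_
      have h3 := Measure.le_iff.1 h2 A hA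
      simp only [Measure.smul_apply, smul_eq_mul] at h3 ⊢
      rw [ENNReal.smul_def, hK, smul_eq_mul]
      calc ν.restrict (O i) A = c⁻¹ * (c * ν.restrict (O i) A) := by
            rw [← mul_assoc, ENNReal.inv_mul_cancel hc0 hct, one_mul]
        _ ≤ c⁻¹ * (K₀ * μ.restrict (O i) A) := by gcongr
        _ ≤ (K₀ * c + c⁻¹ * K₀) * μ.restrict (O i) A := by
            rw [← mul_assoc]; gcongr; exact le_add_self

end ConeParam

/-! ### Hardy's inequality on an interval. -/

section HardyOneDim

/-- Hardy's inequality on `[δ, s]` with a boundary term, for a function that vanishes at `δ`. -/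
theorem hardy_interval (k : ℕ) {δ s : ℝ} (hδ : 0 < δ) (hδs : δ ≤ s) {v v' : ℝ → ℝ}
    (hv : ∀ r ∈ Icc δ s, HasDerivAt v (v' r) r) (hv' : ContinuousOn v' (Icc δ s)) (h0 : v δ = 0) :
    ∫ r in δ..s, r ^ k * v r ^ 2 ≤
      2 * (s ^ (k + 1) * v s ^ 2) + 4 * ∫ r in δ..s, r ^ (k + 2) * v' r ^ 2 := by
  have hvc : ContinuousOn v (Icc δ s) := fun r hr ↦ (hv r hr).continuousAt.continuousWithinAt
  have hint : ∀ f : ℝ → ℝ, ContinuousOn f (Icc δ s) → IntervalIntegrable f volume δ s :=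
    fun f hf ↦ hf.intervalIntegrable_of_Icc hδs
  have hi1 := hint (fun r ↦ r ^ k * v r ^ 2) (by fun_prop)
  have hi2 := hint (fun r ↦ r ^ (k + 2) * v' r ^ 2) (by fun_prop)
  have hi3 := hint (fun r ↦ (k + 1) * r ^ k * v r ^ 2 + r ^ (k + 1) * (2 * v r * v' r)) (by fun_prop)
  have hd : ∀ r ∈ uIcc δ s, HasDerivAt (fun r ↦ r ^ (k + 1) * v r ^ 2)
      ((k + 1) * r ^ k * v r ^ 2 + r ^ (k + 1) * (2 * v r * v' r)) r := by
    intro r hr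
    rw [uIcc_of_le hδs] at hr
    have h1 := (hasDerivAt_pow (k + 1) r).mul ((hv r hr).pow 2)
    refine h1.congr_deriv ?_
    push_cast
    simp
  have hftc := intervalIntegral.integral_eq_sub_of_hasDerivAt hd hi3
  rw [h0] at hftc
  -- The right-hand side is the derivative of `r^(k+1) v²`, so its integral is the boundary term at
  -- `s`. The mixed term is absorbed by completing the square, which leaves half of `r^k v²`; here
  -- `k + 1 ≥ 1` is enough.
  have hle : ∫ r in δ..s, (r ^ k * v r ^ 2 / 2 - 2 * (r ^ (k + 2) * v' r ^ 2)) ≤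
      ∫ r in δ..s, ((k + 1) * r ^ k * v r ^ 2 + r ^ (k + 1) * (2 * v r * v' r)) := by
    refine intervalIntegral.integral_mono_on hδs ((hi1.div_const 2).sub (hi2.const_mul 2)) hi3
      fun r hr ↦ ?_
    have hr0 : 0 ≤ r := hδ.le.trans hr.1
    have h1 : 0 ≤ r ^ k * (v r / 2 + r * v' r) ^ 2 * 2 := by positivity
    have h2 : 0 ≤ (k : ℝ) * (r ^ k * v r ^ 2) := by positivity
    have e1 : r ^ k * (v r / 2 + r * v' r) ^ 2 * 2 = r ^ k * v r ^ 2 / 2 +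
      2 * (r ^ (k + 1) * (v r * v' r)) + 2 * (r ^ (k + 2) * v' r ^ 2) := by ring
    nlinarith
  rw [intervalIntegral.integral_sub (hi1.div_const 2) (hi2.const_mul 2),
    intervalIntegral.integral_div, intervalIntegral.integral_const_mul, hftc] at hle
  simp only [ne_eq, OfNat.ofNat_ne_zero, not_false_eq_true, zero_pow, mul_zero, sub_zero] at hle
  linarith

/-- Hardy's inequality on an interval, for functions that vanish near zero. -/
theorem hardy_one_dim (k : ℕ) {ρ : ℝ} (hρ : 0 < ρ) :
    ∃ K : ℝ≥0, ∀ v v' : ℝ → ℝ, (∀ r ∈ Ioo 0 (2 * ρ), HasDerivAt v (v' r) r) →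
      ContinuousOn v' (Ioo 0 (2 * ρ)) → (∃ δ > 0, ∀ r ∈ Ioo 0 δ, v r = 0) →
      ∫⁻ r in Ioo 0 ρ, ENNReal.ofReal (r ^ k * v r ^ 2) ≤
        K * ∫⁻ r in Ioo 0 (2 * ρ), ENNReal.ofReal (r ^ (k + 2) * (v r ^ 2 + v' r ^ 2)) := by
  -- The boundary term at `s` costs `2/ρ` after `s^(k+1) ≤ s^(k+2)/ρ`, and averaging over an
  -- interval of length `ρ` costs another `1/ρ`. The `4` comes from `hardy_interval`.
  refine ⟨(2 / ρ ^ 2 + 4).toNNReal, fun v v' hv hv' hz ↦ ?_⟩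
  obtain ⟨δ₀, hδ₀, hz⟩ := hz
  -- Small enough that `v` vanishes on `(0, δ]` and that every `s > ρ` lies to the right of `δ`.
  set δ := min δ₀ ρ / 2
  have hm : 0 < min δ₀ ρ := lt_min hδ₀ hρ
  have hδ : 0 < δ := by positivity
  have hδδ₀ : δ < δ₀ := (half_lt_self hm).trans_le (min_le_left _ _)
  have hδρ : δ < ρ := (half_lt_self hm).trans_le (min_le_right _ _)
  set T := ∫⁻ r in Ioo 0 (2 * ρ), ENNReal.ofReal (r ^ (k + 2) * (v r ^ 2 + v' r ^ 2))
  have hvc : ContinuousOn v (Ioo 0 (2 * ρ)) := fun r hr ↦ (hv r hr).continuousAt.continuousWithinAt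
  have hsub : ∀ s ∈ Ioo ρ (2 * ρ), Icc δ s ⊆ Ioo 0 (2 * ρ) :=
    fun s hs r hr ↦ ⟨hδ.trans_le hr.1, hr.2.trans_lt hs.2⟩
  set A := ∫⁻ r in Ioo 0 ρ, ENNReal.ofReal (r ^ k * v r ^ 2)
  have key : ∀ s ∈ Ioo ρ (2 * ρ), A ≤ ENNReal.ofReal (2 / ρ) *
      ENNReal.ofReal (s ^ (k + 2) * (v s ^ 2 + v' s ^ 2)) + 4 * T := by
    intro s hs
    have hδs : δ ≤ s := (hδρ.trans hs.1).le
    have h1 := hardy_interval k hδ hδs (fun r hr ↦ hv r (hsub s hs hr)) (hv'.mono (hsub s hs))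
      (hz δ ⟨hδ, hδδ₀⟩)
    have hic : ∀ f : ℝ → ℝ, ContinuousOn f (Ioo 0 (2 * ρ)) → IntegrableOn f (Ioc δ s) :=
      fun f hf ↦ ((hf.mono (hsub s hs)).integrableOn_Icc).mono_set Ioc_subset_Icc_self
    have hA : A ≤ ENNReal.ofReal (∫ r in δ..s, r ^ k * v r ^ 2) := by
      rw [intervalIntegral.integral_of_le hδs, ofReal_integral_eq_lintegral_ofReal
        (hic _ (by fun_prop))]
      · calc A ≤ ∫⁻ r in Ioc δ s ∪ Ioc 0 δ, ENNReal.ofReal (r ^ k * v r ^ 2) := by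
              refine lintegral_mono_set fun r hr ↦ ?_
              rcases le_or_gt r δ with h | h
              · exact Or.inr ⟨hr.1, h⟩
              · exact Or.inl ⟨h, (hr.2.trans hs.1).le⟩
          _ ≤ _ + ∫⁻ r in Ioc 0 δ, ENNReal.ofReal (r ^ k * v r ^ 2) := lintegral_union_le _ _ _
          _ = _ := by
              have : ∫⁻ r in Ioc 0 δ, ENNReal.ofReal (r ^ k * v r ^ 2) = 0 := by
                rw [setLIntegral_congr_fun (g := fun _ ↦ 0) measurableSet_Ioc fun r hr ↦ by
                  simp [hz r ⟨hr.1, hr.2.trans_lt hδδ₀⟩]]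
                simp
              rw [this, add_zero]
      · filter_upwards [ae_restrict_mem measurableSet_Ioc] with r hr
        have : 0 < r := hδ.trans hr.1
        positivity
    have hT : ENNReal.ofReal (∫ r in δ..s, r ^ (k + 2) * v' r ^ 2) ≤ T := by
      rw [intervalIntegral.integral_of_le hδs, ofReal_integral_eq_lintegral_ofReal
        (hic _ (by fun_prop))]
      · calc _ ≤ ∫⁻ r in Ioc δ s, ENNReal.ofReal (r ^ (k + 2) * (v r ^ 2 + v' r ^ 2)) := by
              refine setLIntegral_mono' measurableSet_Ioc fun r hr ↦ ENNReal.ofReal_le_ofReal ?_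
              have : 0 < r := hδ.trans hr.1
              have : 0 ≤ r ^ (k + 2) * v r ^ 2 := by positivity
              linarith
          _ ≤ T := lintegral_mono_set (Ioc_subset_Icc_self.trans (hsub s hs))
      · filter_upwards [ae_restrict_mem measurableSet_Ioc] with r hr
        have : 0 < r := hδ.trans hr.1
        positivity
    have hs0 : 0 < s := hρ.trans hs.1
    have h2 : 2 * (s ^ (k + 1) * v s ^ 2) ≤ 2 / ρ * (s ^ (k + 2) * (v s ^ 2 + v' s ^ 2)) := by
      have e : s ^ (k + 1) ≤ s ^ (k + 2) / ρ := by
        rw [le_div_iff₀ hρ, pow_succ s (k + 1)]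
        exact mul_le_mul_of_nonneg_left hs.1.le (by positivity)
      calc 2 * (s ^ (k + 1) * v s ^ 2) ≤ 2 * (s ^ (k + 2) / ρ * (v s ^ 2 + v' s ^ 2)) := by
            gcongr
            exact le_add_of_nonneg_right (sq_nonneg _)
        _ = _ := by ring
    calc A ≤ ENNReal.ofReal (2 * (s ^ (k + 1) * v s ^ 2) +
          4 * ∫ r in δ..s, r ^ (k + 2) * v' r ^ 2) := hA.trans (ENNReal.ofReal_le_ofReal h1)
      _ ≤ ENNReal.ofReal (2 / ρ * (s ^ (k + 2) * (v s ^ 2 + v' s ^ 2))) +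
          ENNReal.ofReal (4 * ∫ r in δ..s, r ^ (k + 2) * v' r ^ 2) :=
        ENNReal.ofReal_add_le.trans (by gcongr)
      _ ≤ _ := by
        rw [ENNReal.ofReal_mul (p := 2 / ρ) (by positivity),
          ENNReal.ofReal_mul (p := 4) (by norm_num), ENNReal.ofReal_ofNat]
        exact add_le_add le_rfl (mul_le_mul_right hT 4)
  -- The functions need not vanish near `2ρ`, so the boundary term remains. Averaging over `s ∈ (ρ,
  -- 2ρ)` turns it into an integral over that interval.
  have hint : ∫⁻ _ in Ioo ρ (2 * ρ), A ≤ ∫⁻ s in Ioo ρ (2 * ρ), (ENNReal.ofReal (2 / ρ) *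
      ENNReal.ofReal (s ^ (k + 2) * (v s ^ 2 + v' s ^ 2)) + 4 * T) :=
    setLIntegral_mono' measurableSet_Ioo key
  rw [lintegral_add_right _ measurable_const, setLIntegral_const, setLIntegral_const,
    lintegral_const_mul' _ _ ENNReal.ofReal_ne_top, Real.volume_Ioo,
    show 2 * ρ - ρ = ρ by ring] at hint
  have hT' : ∫⁻ s in Ioo ρ (2 * ρ), ENNReal.ofReal (s ^ (k + 2) * (v s ^ 2 + v' s ^ 2)) ≤ T :=
    lintegral_mono_set (Ioo_subset_Ioo_left hρ.le)
  have hρ0 : ENNReal.ofReal ρ ≠ 0 := by simpa using hρ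
  have hfin : A * ENNReal.ofReal ρ ≤ ((2 / ρ ^ 2 + 4).toNNReal * T) * ENNReal.ofReal ρ := by
    calc _ ≤ ENNReal.ofReal (2 / ρ) * T + 4 * T * ENNReal.ofReal ρ := hint.trans (by gcongr)
      _ = _ := by
        have e1 : ENNReal.ofReal (2 / ρ) = ENNReal.ofReal (2 / ρ ^ 2) * ENNReal.ofReal ρ := by
          rw [← ENNReal.ofReal_mul (by positivity)]
          congr 1
          field_simp
        have e2 : (((2 / ρ ^ 2 + 4).toNNReal : ℝ≥0) : ℝ≥0∞) = ENNReal.ofReal (2 / ρ ^ 2) + 4 := by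
          rw [← ENNReal.ofReal, ENNReal.ofReal_add (by positivity) (by norm_num)]
          norm_num
        rw [e1, e2]
        ring
  exact (ENNReal.mul_le_mul_iff_left hρ0 ENNReal.ofReal_ne_top).1 hfin

end HardyOneDim

/-! ### Topology of cones and of cone charts. -/

section OpenCone

variable {L : Type u} (ε : Ioi (0 : ℝ))

/-- The radial coordinate of a cone. -/
def OpenCone.radius : OpenCone (ε : ℝ) L → ℝ :=
  Quotient.lift (s := coneSetoid (ε : ℝ) L) (fun p ↦ (p.1 : ℝ)) (by
    rintro a b (rfl | ⟨h, h'⟩)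
    · rfl
    · exact h.trans h'.symm)

variable {ε}

theorem OpenCone.mk_of_mem {r : ℝ} (hr : r ∈ Ico (0 : ℝ) ε) (x : L) :
    OpenCone.mk ε r x = Quotient.mk (coneSetoid ε L) (⟨r, hr⟩, x) := by
  rw [OpenCone.mk, dif_pos hr]

theorem OpenCone.radius_mk {r : ℝ} (hr : r ∈ Ico (0 : ℝ) ε) (x : L) :
    OpenCone.radius ε (OpenCone.mk ε r x) = r := by
  rw [OpenCone.mk_of_mem hr]
  rfl

theorem OpenCone.exists_mk (y : OpenCone (ε : ℝ) L) :
    ∃ r ∈ Ico (0 : ℝ) ε, ∃ x, y = OpenCone.mk ε r x := by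
  induction y using Quotient.ind with
  | _ a => exact ⟨a.1, a.1.2, a.2, (OpenCone.mk_of_mem a.1.2 a.2).symm⟩

theorem OpenCone.mk_inj {r r' : ℝ} (hr : r ∈ Ioo (0 : ℝ) ε) (hr' : r' ∈ Ioo (0 : ℝ) ε) {x x' : L}
    (h : OpenCone.mk ε r x = OpenCone.mk ε r' x') : r = r' ∧ x = x' := by
  rw [OpenCone.mk_of_mem (Ioo_subset_Ico_self hr), OpenCone.mk_of_mem (Ioo_subset_Ico_self hr')] at h
  rcases Quotient.exact (s := coneSetoid ε L) h with h | h
  · exact ⟨congrArg (fun p ↦ (p.1 : ℝ)) h, congrArg (fun p ↦ p.2) h⟩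
  · exact absurd h.1 hr.1.ne'

variable [TopologicalSpace L]

theorem OpenCone.continuous_radius :
    Continuous (OpenCone.radius ε : OpenCone (ε : ℝ) L → ℝ) :=
  (continuous_subtype_val.comp continuous_fst).quotient_lift _

theorem OpenCone.continuousOn_mk :
    ContinuousOn (fun p : ℝ × L ↦ OpenCone.mk ε p.1 p.2) (Ico 0 (ε : ℝ) ×ˢ univ) := by
  rw [continuousOn_iff_continuous_domRestrict]
  have : Continuous fun p : (Ico 0 (ε : ℝ) ×ˢ univ : Set (ℝ × L)) ↦
      (Quotient.mk (coneSetoid ε L) (⟨p.1.1, p.2.1⟩, p.1.2) : OpenCone ε L) :=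
    continuous_quot_mk.comp (by fun_prop)
  refine this.congr fun p ↦ ?_
  exact (OpenCone.mk_of_mem p.2.1 _).symm

/-- The open subset `{(r, x) : 0 < r, x ∈ O}` of a cone. -/
theorem OpenCone.isOpen_mk_image {O : Set L} (hO : IsOpen O) :
    IsOpen {y : OpenCone (ε : ℝ) L | ∃ r ∈ Ioo 0 (ε : ℝ), ∃ x ∈ O, y = OpenCone.mk ε r x} := by
  have h0 : IsOpen {a : Ico (0 : ℝ) ε × L | 0 < (a.1 : ℝ)} :=
    isOpen_lt continuous_const (by fun_prop)
  refine isOpen_coinduced.2 ?_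
  convert h0.inter (hO.preimage continuous_snd) using 1
  ext a
  constructor
  · rintro ⟨r, hr, x, hx, h⟩
    rw [OpenCone.mk_of_mem (Ioo_subset_Ico_self hr)] at h
    rcases Quotient.exact (s := coneSetoid ε L) h with h | h
    · rw [h]
      exact ⟨hr.1, hx⟩
    · exact absurd h.2 hr.1.ne'
  · rintro ⟨h, h'⟩
    exact ⟨a.1, ⟨h, a.1.2.2⟩, a.2, h', (OpenCone.mk_of_mem a.1.2 a.2).symm⟩

end OpenCone

namespace ConeChart

variable {Λ : Level.{u}} {X : StratSpace.{u}} (c : ConeChart Λ X)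

instance : CompactSpace c.link.carrier := c.link_compact

instance : T2Space c.link.carrier := c.link_t2

instance : Nonempty c.link.carrier := c.link_nonempty

theorem continuousOn_pt : ContinuousOn (fun z : EuclideanSpace ℝ (Fin c.h) × ℝ × c.link.carrier ↦
    c.pt z.1 z.2.1 z.2.2) (univ ×ˢ Ico 0 (c.ε : ℝ) ×ˢ univ) := by
  refine c.isOpenEmbedding.continuous.comp_continuousOn (continuousOn_fst.prodMk ?_)
  exact OpenCone.continuousOn_mk.comp continuousOn_snd fun z hz ↦ hz.2

theorem depth_pos : 0 < c.depth :=
  (Nat.zero_le _).trans_lt (c.link_depth_lt (Classical.arbitrary _))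

theorem pt_zero_mem_sing (b : EuclideanSpace ℝ (Fin c.h)) (x : c.link.carrier) :
    c.pt b 0 x ∈ X.sing := by
  change X.depth (c.toFun (b, OpenCone.mk c.ε 0 x)) ≠ 0
  rw [c.depth_apex b x]
  exact c.depth_pos.ne'

theorem reg_injOn : InjOn c.reg (univ ×ˢ Ioo (0 : ℝ) c.ε ×ˢ univ) := by
  rintro ⟨b, r, x⟩ hz ⟨b', r', x'⟩ hz' h
  have h1 := congrArg Subtype.val h
  rw [c.reg_eq b r hz.2.1 x, c.reg_eq b' r' hz'.2.1 x'] at h1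
  have h2 := c.isOpenEmbedding.injective h1
  obtain ⟨h3, h4⟩ := OpenCone.mk_inj hz.2.1 hz'.2.1 (congrArg Prod.snd h2)
  have h5 : b = b' := congrArg Prod.fst h2
  exact Prod.ext h5 (Prod.ext h3 (Subtype.ext h4))

/-- The regular points in the chart. -/
theorem exists_reg {b : EuclideanSpace ℝ (Fin c.h)} {r : ℝ} (hr : r ∈ Ico (0 : ℝ) c.ε)
    {x : c.link.carrier} {p : X.Reg} (hp : (p : X.carrier) = c.pt b r x) :
    0 < r ∧ ∃ x' : c.link.Reg, (x' : c.link.carrier) = x ∧ c.reg (b, r, x') = p := by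
  have hr0 : 0 < r := by
    refine hr.1.lt_of_ne fun h ↦ ?_
    subst h
    have := c.pt_zero_mem_sing b x
    rw [← hp] at this
    exact this p.2
  have hx : c.link.depth x = 0 := by
    rw [← c.depth_off_apex b r ⟨hr0, hr.2⟩ x]
    change X.depth (c.pt b r x) = 0
    rw [← hp]
    exact p.2
  refine ⟨hr0, ⟨x, hx⟩, rfl, Subtype.ext ?_⟩
  rw [c.reg_eq b r ⟨hr0, hr.2⟩, hp]
  rfl

/-- The part `{b ∈ U, r < s}` of the chart, as a subset of the space. -/
def nhd (U : Set (EuclideanSpace ℝ (Fin c.h))) (s : ℝ) : Set X.carrier :=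
  c.toFun '' {z | z.1 ∈ U ∧ OpenCone.radius c.ε z.2 < s}

theorem isOpen_nhd {U : Set (EuclideanSpace ℝ (Fin c.h))} (hU : IsOpen U) (s : ℝ) :
    IsOpen (c.nhd U s) :=
  c.isOpenEmbedding.isOpenMap _ ((hU.preimage continuous_fst).inter
    (isOpen_lt (OpenCone.continuous_radius.comp continuous_snd) continuous_const))

theorem mem_nhd_iff {U : Set (EuclideanSpace ℝ (Fin c.h))} {s : ℝ} {p : X.carrier} :
    p ∈ c.nhd U s ↔ ∃ b ∈ U, ∃ r ∈ Ico (0 : ℝ) c.ε, r < s ∧ ∃ x, p = c.pt b r x := by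
  constructor
  · rintro ⟨⟨b, y⟩, ⟨hb, hy⟩, rfl⟩
    obtain ⟨r, hr, x, rfl⟩ := OpenCone.exists_mk y
    exact ⟨b, hb, r, hr, by rwa [OpenCone.radius_mk hr] at hy, x, rfl⟩
  · rintro ⟨b, hb, r, hr, hrs, x, rfl⟩
    exact ⟨_, ⟨hb, by rwa [OpenCone.radius_mk hr]⟩, rfl⟩

theorem mem_nhd_reg {U : Set (EuclideanSpace ℝ (Fin c.h))} {s : ℝ} {p : X.Reg}
    (hp : (p : X.carrier) ∈ c.nhd U s) :
    ∃ b ∈ U, ∃ r ∈ Ioo (0 : ℝ) c.ε, r < s ∧ ∃ x, c.reg (b, r, x) = p := by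
  obtain ⟨b, hb, r, hr, hrs, x, h⟩ := c.mem_nhd_iff.1 hp
  obtain ⟨hr0, x', -, h'⟩ := c.exists_reg hr h
  exact ⟨b, hb, r, ⟨hr0, hr.2⟩, hrs, x', h'⟩

/-- The compact part of the chart over a compact set. -/
theorem isCompact_pt_image {Z : Set (EuclideanSpace ℝ (Fin c.h))} (hZ : IsCompact Z) {s : ℝ}
    (hs : s < c.ε) : IsCompact ((fun z : EuclideanSpace ℝ (Fin c.h) × ℝ × c.link.carrier ↦
      c.pt z.1 z.2.1 z.2.2) '' (Z ×ˢ Icc 0 s ×ˢ univ)) :=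
  (hZ.prod (isCompact_Icc.prod isCompact_univ)).image_of_continuousOn
    (c.continuousOn_pt.mono fun _ hz ↦ ⟨mem_univ _, ⟨hz.2.1.1, hz.2.1.2.trans_lt hs⟩, mem_univ _⟩)

/-- The corresponding set that includes the apex and the singular points of the link is compact,
hence closed in the whole space. Intersecting it with the smooth stratum removes exactly those extra
points. -/
theorem isClosed_reg_image [T2Space X.carrier] {Z : Set (EuclideanSpace ℝ (Fin c.h))}
    (hZ : IsCompact Z) {s : ℝ} (hs : s < c.ε) : IsClosed (c.reg '' (Z ×ˢ Ioc 0 s ×ˢ univ)) := by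
  have h := ((c.isCompact_pt_image hZ hs).isClosed).preimage
    (continuous_subtype_val (p := fun p ↦ X.depth p = 0))
  convert h using 1
  ext p
  constructor
  · rintro ⟨⟨b, r, x⟩, hz, rfl⟩
    exact ⟨(b, r, x), ⟨hz.1, Ioc_subset_Icc_self hz.2.1, mem_univ _⟩,
      (c.reg_eq b r ⟨hz.2.1.1, hz.2.1.2.trans_lt hs⟩ x).symm⟩
  · rintro ⟨⟨b, r, x⟩, hz, hp⟩
    obtain ⟨hr, x', rfl, h'⟩ := c.exists_reg ⟨hz.2.1.1, hz.2.1.2.trans_lt hs⟩ hp.symm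
    exact ⟨(b, r, x'), ⟨hz.1, ⟨hr, hz.2.1.2⟩, mem_univ _⟩, h'⟩

/-- A compact set of regular points does not meet the chart near the apex. -/
theorem exists_forall_reg_notMem [T2Space X.carrier] {K : Set X.Reg} (hK : IsCompact K)
    (b : EuclideanSpace ℝ (Fin c.h)) (x : c.link.Reg) :
    ∃ δ > 0, ∀ r ∈ Ioo 0 δ, c.reg (b, r, x) ∉ K := by
  have hK' : IsClosed (Subtype.val '' K) := (hK.image continuous_subtype_val).isClosed
  have hcont : ContinuousWithinAt (fun r ↦ c.pt b r (x : c.link.carrier)) (Ico 0 (c.ε : ℝ)) 0 :=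
    (c.continuousOn_pt.comp (g := fun z : EuclideanSpace ℝ (Fin c.h) × ℝ × c.link.carrier ↦
      c.pt z.1 z.2.1 z.2.2) (f := fun r : ℝ ↦ (b, r, (x : c.link.carrier)))
      (s := Ico 0 (c.ε : ℝ)) (by fun_prop)
      fun r hr ↦ ⟨mem_univ _, hr, mem_univ _⟩) 0 ⟨le_rfl, c.ε.2⟩
  -- Apex points are singular, so they lie outside the closed image of `K`, and so do the points
  -- with small `r`.
  have h0 : c.pt b 0 x.1 ∈ (Subtype.val '' K)ᶜ := by
    rintro ⟨p, -, hp⟩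
    have := c.pt_zero_mem_sing b x.1
    rw [← hp] at this
    exact this p.2
  have h1 := hcont (hK'.isOpen_compl.mem_nhds h0)
  obtain ⟨δ, hδ, hsub⟩ := Metric.mem_nhdsWithin_iff.1 h1
  refine ⟨min δ c.ε, lt_min hδ c.ε.2, fun r hr hmem ↦ ?_⟩
  have hr1 : r < c.ε := hr.2.trans_le (min_le_right _ _)
  refine hsub ⟨?_, hr.1.le, hr1⟩ ⟨_, hmem, c.reg_eq b r ⟨hr.1, hr1⟩ x⟩
  rw [Metric.mem_ball, Real.dist_eq, sub_zero, abs_of_pos hr.1]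
  exact hr.2.trans_le (min_le_left _ _)

/-- Slices of compact sets of regular points are compact. -/
theorem isCompact_slice [T2Space X.carrier] {K : Set X.Reg} (hK : IsCompact K)
    (b : EuclideanSpace ℝ (Fin c.h)) {r : ℝ} (hr : r ∈ Ioo (0 : ℝ) c.ε) :
    IsCompact {x : c.link.Reg | c.reg (b, r, x) ∈ K} := by
  have hK' : IsClosed (Subtype.val '' K) := (hK.image continuous_subtype_val).isClosed
  have hcont : Continuous fun x ↦ c.pt b r x :=
    c.continuousOn_pt.comp_continuous (f := fun x : c.link.carrier ↦ (b, r, x)) (by fun_prop)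
      fun x ↦ ⟨mem_univ _, Ioo_subset_Ico_self hr, mem_univ _⟩
  rw [Topology.IsEmbedding.subtypeVal.isCompact_iff]
  -- Compactness is tested in the full link, which is compact; a link point mapped into `K` is
  -- automatically regular, so nothing is lost.
  convert (hK'.preimage hcont).isCompact using 1
  ext x
  constructor
  · rintro ⟨x, hx, rfl⟩
    exact ⟨_, hx, c.reg_eq b r hr x⟩
  · rintro ⟨p, hp, hpx⟩
    obtain ⟨-, x', rfl, h'⟩ := c.exists_reg (Ioo_subset_Ico_self hr) hpx
    exact ⟨x', by rwa [mem_ofPred_eq, h'], rfl⟩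

end ConeChart

/-! ### Hardy's inequality on a cone with product measure. -/

section ConeModel

variable {B S : Type*} [MeasurableSpace B] [MeasurableSpace S]

/-- The measure `rˡ dr` on `(0, ρ)`. -/
def radialMeasure (l : ℕ) (ρ : ℝ) : Measure ℝ :=
  (volume.restrict (Ioo 0 ρ)).withDensity fun r ↦ ENNReal.ofReal (r ^ l)

theorem lintegral_radialMeasure (l : ℕ) (ρ : ℝ) {f : ℝ → ℝ≥0∞} (hf : Measurable f) :
    ∫⁻ r, f r ∂(radialMeasure l ρ) = ∫⁻ r in Ioo 0 ρ, ENNReal.ofReal (r ^ l) * f r := by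
  rw [radialMeasure, lintegral_withDensity_eq_lintegral_mul _ (by fun_prop) hf]
  rfl

theorem lintegral_radialMeasure_prod (l : ℕ) (ρ : ℝ) (ν : Measure S) [SFinite ν]
    {f : ℝ × S → ℝ≥0∞} (hf : Measurable f) :
    ∫⁻ z, f z ∂((radialMeasure l ρ).prod ν) =
      ∫⁻ r in Ioo 0 ρ, ∫⁻ x, ENNReal.ofReal (r ^ l) * f (r, x) ∂ν := by
  rw [lintegral_prod _ hf.aemeasurable, lintegral_radialMeasure _ _ hf.lintegral_prod_right']
  refine lintegral_congr fun r ↦ ?_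
  rw [lintegral_const_mul _ (by fun_prop)]

/-- Hardy's inequality on a cone, deduced from Hardy's inequality on the link and on the radial
intervals. -/
theorem lintegral_cone_le (k : ℕ) {ρ : ℝ} (ν : Measure S) [SFinite ν] {CL Ce K₁ : ℝ≥0}
    {F e : ℝ × S → ℝ} {w : S → ℝ} (hF : Measurable F) (he : Measurable e) (hw : Measurable w)
    (hρ : 0 < ρ) (he0 : ∀ z, 0 ≤ e z)
    (hlink : ∀ r ∈ Ioo 0 ρ, ∫⁻ x, ENNReal.ofReal (F (r, x) ^ 2 / w x ^ 2) ∂ν ≤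
      CL * ∫⁻ x, ENNReal.ofReal (F (r, x) ^ 2 + Ce * r ^ 2 * e (r, x)) ∂ν)
    (hrad : ∀ x, ∫⁻ r in Ioo 0 ρ, ENNReal.ofReal (r ^ k * F (r, x) ^ 2) ≤
      K₁ * ∫⁻ r in Ioo 0 (2 * ρ), ENNReal.ofReal (r ^ (k + 2) * (F (r, x) ^ 2 + Ce * e (r, x)))) :
    ∫⁻ z, ENNReal.ofReal (F z ^ 2 / (z.1 * w z.2) ^ 2) ∂((radialMeasure (k + 2) ρ).prod ν) ≤
      (CL * (K₁ * (1 + Ce) + Ce) : ℝ≥0) *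
        ∫⁻ z, ENNReal.ofReal (F z ^ 2 + e z) ∂((radialMeasure (k + 2) (2 * ρ)).prod ν) := by
  set T := ∫⁻ z, ENNReal.ofReal (F z ^ 2 + e z) ∂((radialMeasure (k + 2) (2 * ρ)).prod ν) with hT
  rw [lintegral_radialMeasure_prod _ _ _ (by fun_prop)]
  rw [lintegral_radialMeasure_prod _ _ _ (by fun_prop)] at hT
  -- At fixed radius, `r^(k+2)/(r w)² = r^k/w²`. The link inequality then applies with energy `Ce r²
  -- e`, and the factor `r²` restores the weight `r^(k+2)` in front of `e`.
  have h1 : ∀ r ∈ Ioo 0 ρ, ∫⁻ x, ENNReal.ofReal (r ^ (k + 2)) *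
      ENNReal.ofReal (F (r, x) ^ 2 / (r * w x) ^ 2) ∂ν ≤
      CL * ((∫⁻ x, ENNReal.ofReal (r ^ k * F (r, x) ^ 2) ∂ν) +
        Ce * ∫⁻ x, ENNReal.ofReal (r ^ (k + 2)) * ENNReal.ofReal (F (r, x) ^ 2 + e (r, x)) ∂ν) := by
    intro r hr
    have hr0 : 0 < r := hr.1
    have hk : 0 ≤ r ^ k := by positivity
    have hk2 : 0 ≤ r ^ (k + 2) := by positivity
    calc _ = ENNReal.ofReal (r ^ k) * ∫⁻ x, ENNReal.ofReal (F (r, x) ^ 2 / w x ^ 2) ∂ν := by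
          rw [← lintegral_const_mul _ (by fun_prop)]
          refine lintegral_congr fun x ↦ ?_
          rw [← ENNReal.ofReal_mul hk2, ← ENNReal.ofReal_mul hk]
          congr 1
          rw [mul_pow, pow_add, mul_div_assoc', mul_div_assoc', mul_comm (r ^ 2) (w x ^ 2),
            mul_right_comm, mul_div_mul_right _ _ (by positivity)]
      _ ≤ ENNReal.ofReal (r ^ k) *
          (CL * ∫⁻ x, ENNReal.ofReal (F (r, x) ^ 2 + Ce * r ^ 2 * e (r, x)) ∂ν) := by
          gcongr
          exact hlink r hr
      _ = CL * ∫⁻ x, ENNReal.ofReal (r ^ k * (F (r, x) ^ 2 + Ce * r ^ 2 * e (r, x))) ∂ν := by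
          rw [mul_left_comm, ← lintegral_const_mul _ (by fun_prop)]
          simp_rw [← ENNReal.ofReal_mul hk]
      _ ≤ CL * ∫⁻ x, (ENNReal.ofReal (r ^ k * F (r, x) ^ 2) + Ce * (ENNReal.ofReal (r ^ (k + 2)) *
            ENNReal.ofReal (F (r, x) ^ 2 + e (r, x)))) ∂ν := by
          gcongr with x
          rw [← ENNReal.ofReal_mul hk2, ← ENNReal.ofReal_coe_nnreal, ← ENNReal.ofReal_mul (NNReal.coe_nonneg Ce),
            ← ENNReal.ofReal_add (by positivity)
              (mul_nonneg (NNReal.coe_nonneg Ce) (mul_nonneg hk2 (add_nonneg (sq_nonneg _) (he0 _))))]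
          refine ENNReal.ofReal_le_ofReal ?_
          have : 0 ≤ (Ce : ℝ) * (r ^ (k + 2) * F (r, x) ^ 2) := by positivity
          linear_combination this
      _ = _ := by
          rw [lintegral_add_left (by fun_prop), lintegral_const_mul _ (by fun_prop)]
  have hm1 : Measurable fun r ↦ ∫⁻ x, ENNReal.ofReal (r ^ k * F (r, x) ^ 2) ∂ν :=
    Measurable.lintegral_prod_right' (f := fun z : ℝ × S ↦ ENNReal.ofReal (z.1 ^ k * F z ^ 2))
      (by fun_prop)
  have hm2 : Measurable fun r ↦ ∫⁻ x, ENNReal.ofReal (r ^ (k + 2)) *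
      ENNReal.ofReal (F (r, x) ^ 2 + e (r, x)) ∂ν :=
    Measurable.lintegral_prod_right' (f := fun z : ℝ × S ↦ ENNReal.ofReal (z.1 ^ (k + 2)) *
      ENNReal.ofReal (F z ^ 2 + e z)) (by fun_prop)
  -- After exchanging the integrals, the radial Hardy inequality applies at each link point. It
  -- raises the power of `r` from `k` to `k + 2` and enlarges the interval to `(0, 2ρ)`.
  have h2 : ∫⁻ r in Ioo 0 ρ, ∫⁻ x, ENNReal.ofReal (r ^ k * F (r, x) ^ 2) ∂ν ≤
      (K₁ * (1 + Ce) : ℝ≥0) * T := by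
    rw [lintegral_lintegral_swap (by fun_prop)]
    calc _ ≤ ∫⁻ x, K₁ * (∫⁻ r in Ioo 0 (2 * ρ),
          ENNReal.ofReal (r ^ (k + 2) * (F (r, x) ^ 2 + Ce * e (r, x)))) ∂ν :=
        lintegral_mono hrad
      _ ≤ ∫⁻ x, K₁ * (∫⁻ r in Ioo 0 (2 * ρ), (1 + Ce : ℝ≥0) * (ENNReal.ofReal (r ^ (k + 2)) *
          ENNReal.ofReal (F (r, x) ^ 2 + e (r, x)))) ∂ν := by
        refine lintegral_mono fun x ↦ mul_le_mul_right
          (setLIntegral_mono' measurableSet_Ioo fun r hr ↦ ?_) _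
        have hk2 : 0 ≤ r ^ (k + 2) := by have := hr.1; positivity
        rw [← ENNReal.ofReal_mul hk2, ← ENNReal.ofReal_coe_nnreal,
          ← ENNReal.ofReal_mul (NNReal.coe_nonneg _)]
        refine ENNReal.ofReal_le_ofReal ?_
        push_cast
        have h1 : 0 ≤ (Ce : ℝ) * (r ^ (k + 2) * F (r, x) ^ 2) := by positivity
        have h2 := mul_nonneg hk2 (he0 (r, x))
        linear_combination h1 + h2
      _ = _ := by
        rw [hT, lintegral_lintegral_swap (by fun_prop), ENNReal.coe_mul, mul_assoc,
          ← lintegral_const_mul _ (Measurable.lintegral_prod_right'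
            (f := fun z : S × ℝ ↦ ENNReal.ofReal (z.2 ^ (k + 2)) *
              ENNReal.ofReal (F (z.2, z.1) ^ 2 + e (z.2, z.1))) (by fun_prop)),
          ← lintegral_const_mul _ (Measurable.const_mul (Measurable.lintegral_prod_right'
            (f := fun z : S × ℝ ↦ ENNReal.ofReal (z.2 ^ (k + 2)) *
              ENNReal.ofReal (F (z.2, z.1) ^ 2 + e (z.2, z.1))) (by fun_prop)) _)]
        refine lintegral_congr fun x ↦ ?_
        rw [lintegral_const_mul _ (by fun_prop)]
  calc _ ≤ ∫⁻ r in Ioo 0 ρ, (CL * ((∫⁻ x, ENNReal.ofReal (r ^ k * F (r, x) ^ 2) ∂ν) +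
        Ce * ∫⁻ x, ENNReal.ofReal (r ^ (k + 2)) * ENNReal.ofReal (F (r, x) ^ 2 + e (r, x)) ∂ν)) :=
      setLIntegral_mono' measurableSet_Ioo h1
    _ = CL * ((∫⁻ r in Ioo 0 ρ, ∫⁻ x, ENNReal.ofReal (r ^ k * F (r, x) ^ 2) ∂ν) +
        Ce * ∫⁻ r in Ioo 0 ρ, ∫⁻ x, ENNReal.ofReal (r ^ (k + 2)) *
          ENNReal.ofReal (F (r, x) ^ 2 + e (r, x)) ∂ν) := by
      rw [lintegral_const_mul _ (by fun_prop), lintegral_add_left hm1, lintegral_const_mul _ hm2]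
    _ ≤ CL * ((K₁ * (1 + Ce) : ℝ≥0) * T + Ce * T) := by
      gcongr
      rw [hT]
      exact lintegral_mono_set (Ioo_subset_Ioo_right (by linarith))
    _ = _ := by
      push_cast
      ring

end ConeModel

/-! ### Differentials of functions, on the model space. -/

section ScalarDeriv

variable {E : Type*} [NormedAddCommGroup E] [NormedSpace ℝ E] {H : Type*} [TopologicalSpace H]
  (I : ModelWithCorners ℝ E H) {R : Type*} [TopologicalSpace R] [ChartedSpace H R]

/-- The differential of a function, on the model vector space. -/
def scalarDeriv (f : R → ℝ) (x : R) : E →L[ℝ] ℝ := mfderiv I 𝓘(ℝ, ℝ) f x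

variable {I}

variable (I) in
/-- The function `f` is differentiable at `x`, with differential `f'` on the model vector space. -/
def HasScalarDeriv (f : R → ℝ) (x : R) (f' : E →L[ℝ] ℝ) : Prop := HasMFDerivAt I 𝓘(ℝ, ℝ) f x f'

theorem hasScalarDeriv_iff {f : R → ℝ} {x : R} {f' : E →L[ℝ] ℝ} :
    HasScalarDeriv I f x f' ↔ ContinuousAt f x ∧
      HasFDerivWithinAt (f ∘ (extChartAt I x).symm) f' (range I) (extChartAt I x x) := Iff.rfl

theorem hasScalarDeriv_scalarDeriv {f : R → ℝ} {x : R} (hf : MDifferentiableAt I 𝓘(ℝ, ℝ) f x) :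
    HasScalarDeriv I f x (scalarDeriv I f x) := hf.hasMFDerivAt

theorem HasScalarDeriv.scalarDeriv_eq {f : R → ℝ} {x : R} {f' : E →L[ℝ] ℝ}
    (hf : HasScalarDeriv I f x f') : scalarDeriv I f x = f' := hf.mfderiv

theorem scalarDeriv_congr {f g : R → ℝ} {x : R} (h : f =ᶠ[𝓝 x] g) :
    scalarDeriv I f x = scalarDeriv I g x := h.mfderiv_eq

theorem scalarDeriv_const (a : ℝ) (x : R) : scalarDeriv I (fun _ ↦ a) x = 0 :=
  HasScalarDeriv.scalarDeriv_eq (hasMFDerivAt_const a x)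

/-- Composition with a function of one variable. -/
theorem HasScalarDeriv.comp_deriv {f : R → ℝ} {x : R} {f' : E →L[ℝ] ℝ} {G : ℝ → ℝ} {G' : ℝ}
    (hf : HasScalarDeriv I f x f') (hG : HasDerivAt G G' (f x)) :
    HasScalarDeriv I (fun y ↦ G (f y)) x (G' • f') := by
  rw [hasScalarDeriv_iff] at hf ⊢
  refine ⟨hG.continuousAt.comp hf.1, ?_⟩
  refine HasDerivAt.comp_hasFDerivWithinAt (h₂ := G) _ ?_ hf.2
  simpa using hG

theorem HasScalarDeriv.add {f g : R → ℝ} {x : R} {f' g' : E →L[ℝ] ℝ}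
    (hf : HasScalarDeriv I f x f') (hg : HasScalarDeriv I g x g') :
    HasScalarDeriv I (fun y ↦ f y + g y) x (f' + g') := HasMFDerivAt.add hf hg

end ScalarDeriv

/-! ### Hardy weights and their combination. -/

section HardyWeight

variable {X : StratSpace.{u}}

/-- A weight `w`, comparable from below to the distance to the singular points in `N`, with
`∫ u² / w² ≤ C ∫ (u² + |du|²)`. The norm of `du` is replaced by a measurable bound. -/
structure IsHardyWeightOn (X : StratSpace.{u})
    (q : X.Reg → EuclideanSpace ℝ (Fin X.dim) →L[ℝ] EuclideanSpace ℝ (Fin X.dim) →L[ℝ] ℝ)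
    (N : Set X.carrier) (w : X.Reg → ℝ) : Prop where
  contMDiff : ContMDiff X.I 𝓘(ℝ, ℝ) 1 w
  pos : ∀ x, 0 < w x
  le_one : ∀ x, w x ≤ 1
  deriv_le : ∃ K : ℝ, ∀ x ξ, scalarDeriv X.I w x ξ ^ 2 ≤ K * q x ξ ξ
  tendsto : ∀ p ∈ N, Tendsto w (comap Subtype.val (𝓝 p)) (𝓝 0)
  hardy : ∃ C : ℝ≥0, ∀ u e : X.Reg → ℝ, ContMDiff X.I 𝓘(ℝ, ℝ) 1 u → HasCompactSupport u →
    Measurable e → (∀ x, 0 ≤ e x) → (∀ x ξ, scalarDeriv X.I u x ξ ^ 2 ≤ e x * q x ξ ξ) →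
    ∫⁻ x, ENNReal.ofReal (u x ^ 2 / w x ^ 2) ∂(formVol X.I q) ≤
      C * ∫⁻ x, ENNReal.ofReal (u x ^ 2 + e x) ∂(formVol X.I q)

variable {q : X.Reg → EuclideanSpace ℝ (Fin X.dim) →L[ℝ] EuclideanSpace ℝ (Fin X.dim) →L[ℝ] ℝ}
  {N N₁ N₂ : Set X.carrier} {w w₁ w₂ : X.Reg → ℝ}

theorem IsHardyWeightOn.mono (h : IsHardyWeightOn X q N w) (hN : N₁ ⊆ N) :
    IsHardyWeightOn X q N₁ w :=
  { h with tendsto := fun p hp ↦ h.tendsto p (hN hp) }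

/-- This starts both inductions: the one on the depth, where a smooth manifold has no singular
points, and the one over the finitely many charts of a compact space, where it is the weight of the
empty set. -/
theorem isHardyWeightOn_one : IsHardyWeightOn X q ∅ fun _ ↦ 1 where
  contMDiff := contMDiff_const
  pos _ := one_pos
  le_one _ := le_rfl
  deriv_le := ⟨0, fun x ξ ↦ by simp [scalarDeriv_const]⟩
  tendsto p hp := absurd hp (notMem_empty p)
  hardy := by
    refine ⟨1, fun u e _ _ _ he _ ↦ ?_⟩
    rw [ENNReal.coe_one, one_mul]
    refine lintegral_mono fun x ↦ ENNReal.ofReal_le_ofReal ?_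
    simpa using he x

/-- The combined weight lies below both weights, hence tends to `0` where either does. Its
differential is `(w/w₁)² dw₁ + (w/w₂)² dw₂` with coefficients at most `1`. Finally `1/w = 1/w₁ +
1/w₂` gives `1/w² ≤ 2/w₁² + 2/w₂²`, so the two Hardy inequalities add up. -/
theorem IsHardyWeightOn.union (h₁ : IsHardyWeightOn X q N₁ w₁) (h₂ : IsHardyWeightOn X q N₂ w₂) :
    IsHardyWeightOn X q (N₁ ∪ N₂) fun x ↦ ((w₁ x)⁻¹ + (w₂ x)⁻¹)⁻¹ := by
  have hp₁ := h₁.pos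
  have hp₂ := h₂.pos
  have hpos : ∀ x, 0 < (w₁ x)⁻¹ + (w₂ x)⁻¹ :=
    fun x ↦ add_pos (inv_pos.2 (hp₁ x)) (inv_pos.2 (hp₂ x))
  have hle₁ : ∀ x, ((w₁ x)⁻¹ + (w₂ x)⁻¹)⁻¹ ≤ w₁ x := fun x ↦
    inv_le_of_inv_le₀ (hp₁ x) (le_add_of_nonneg_right (inv_pos.2 (hp₂ x)).le)
  have hle₂ : ∀ x, ((w₁ x)⁻¹ + (w₂ x)⁻¹)⁻¹ ≤ w₂ x := fun x ↦
    inv_le_of_inv_le₀ (hp₂ x) (le_add_of_nonneg_left (inv_pos.2 (hp₁ x)).le)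
  constructor
  · have hinv : ∀ {v : X.Reg → ℝ}, ContMDiff X.I 𝓘(ℝ, ℝ) 1 v → (∀ x, 0 < v x) →
        ContMDiff X.I 𝓘(ℝ, ℝ) 1 fun x ↦ (v x)⁻¹ := by
      intro v hv hv0 x
      exact ContMDiffAt.comp (g := fun t : ℝ ↦ t⁻¹) (I' := 𝓘(ℝ, ℝ)) x
        (contDiffAt_inv ℝ (hv0 x).ne').contMDiffAt (hv x)
    exact hinv ((hinv h₁.contMDiff hp₁).add (hinv h₂.contMDiff hp₂)) hpos
  · exact fun x ↦ inv_pos.2 (hpos x)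
  · exact fun x ↦ (hle₁ x).trans (h₁.le_one x)
  · obtain ⟨K₁, hK₁⟩ := h₁.deriv_le
    obtain ⟨K₂, hK₂⟩ := h₂.deriv_le
    refine ⟨2 * (K₁ + K₂), fun x ξ ↦ ?_⟩
    have d₁ := hasScalarDeriv_scalarDeriv (h₁.contMDiff.mdifferentiable one_ne_zero x)
    have d₂ := hasScalarDeriv_scalarDeriv (h₂.contMDiff.mdifferentiable one_ne_zero x)
    have i₁ := d₁.comp_deriv (hasDerivAt_inv (hp₁ x).ne')
    have i₂ := d₂.comp_deriv (hasDerivAt_inv (hp₂ x).ne')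
    have hd := ((i₁.add i₂).comp_deriv (hasDerivAt_inv (hpos x).ne')).scalarDeriv_eq
    rw [hd]
    have e : ((-((((w₁ x)⁻¹ + (w₂ x)⁻¹)) ^ 2)⁻¹) • ((-(w₁ x ^ 2)⁻¹) • scalarDeriv X.I w₁ x +
        (-(w₂ x ^ 2)⁻¹) • scalarDeriv X.I w₂ x)) ξ =
        (((w₁ x)⁻¹ + (w₂ x)⁻¹)⁻¹ / w₁ x) ^ 2 * scalarDeriv X.I w₁ x ξ +
        (((w₁ x)⁻¹ + (w₂ x)⁻¹)⁻¹ / w₂ x) ^ 2 * scalarDeriv X.I w₂ x ξ := by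
      simp only [FunLike.coe_smul, FunLike.coe_add, Pi.smul_apply,
        Pi.add_apply, smul_eq_mul, div_eq_mul_inv, mul_pow, ← inv_pow]
      ring
    rw [e]
    have t₁ : ((((w₁ x)⁻¹ + (w₂ x)⁻¹)⁻¹ / w₁ x) ^ 2) ^ 2 ≤ 1 :=
      pow_le_one₀ (by positivity) (pow_le_one₀ (div_nonneg (inv_pos.2 (hpos x)).le (hp₁ x).le)
        ((div_le_one (hp₁ x)).2 (hle₁ x)))
    have t₂ : ((((w₁ x)⁻¹ + (w₂ x)⁻¹)⁻¹ / w₂ x) ^ 2) ^ 2 ≤ 1 :=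
      pow_le_one₀ (by positivity) (pow_le_one₀ (div_nonneg (inv_pos.2 (hpos x)).le (hp₂ x).le)
        ((div_le_one (hp₂ x)).2 (hle₂ x)))
    calc _ ≤ 2 * (((((w₁ x)⁻¹ + (w₂ x)⁻¹)⁻¹ / w₁ x) ^ 2 * scalarDeriv X.I w₁ x ξ) ^ 2 +
        ((((w₁ x)⁻¹ + (w₂ x)⁻¹)⁻¹ / w₂ x) ^ 2 * scalarDeriv X.I w₂ x ξ) ^ 2) := add_sq_le
      _ ≤ 2 * (scalarDeriv X.I w₁ x ξ ^ 2 + scalarDeriv X.I w₂ x ξ ^ 2) := by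
        rw [mul_pow, mul_pow _ (scalarDeriv X.I w₂ x ξ)]
        gcongr
        · exact mul_le_of_le_one_left (sq_nonneg _) t₁
        · exact mul_le_of_le_one_left (sq_nonneg _) t₂
      _ ≤ 2 * (K₁ * q x ξ ξ + K₂ * q x ξ ξ) := by
        have := hK₁ x ξ
        have := hK₂ x ξ
        linarith
      _ = _ := by ring
  · rintro p (hp | hp)
    · exact squeeze_zero (fun x ↦ (inv_pos.2 (hpos x)).le) hle₁ (h₁.tendsto p hp)
    · exact squeeze_zero (fun x ↦ (inv_pos.2 (hpos x)).le) hle₂ (h₂.tendsto p hp)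
  · obtain ⟨C₁, hC₁⟩ := h₁.hardy
    obtain ⟨C₂, hC₂⟩ := h₂.hardy
    refine ⟨2 * (C₁ + C₂), fun u e hu hc hm he hd ↦ ?_⟩
    have hmeas : ∀ {v : X.Reg → ℝ}, Continuous v →
        Measurable fun x ↦ ENNReal.ofReal (u x ^ 2 / v x ^ 2) := fun hv ↦ by
      have := hv.measurable
      have := hu.continuous.measurable
      fun_prop
    calc _ ≤ ∫⁻ x, 2 * (ENNReal.ofReal (u x ^ 2 / w₁ x ^ 2) + ENNReal.ofReal (u x ^ 2 / w₂ x ^ 2))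
          ∂(formVol X.I q) := by
          refine lintegral_mono fun x ↦ ?_
          rw [← ENNReal.ofReal_add (by positivity) (by positivity), ← ENNReal.ofReal_ofNat,
            ← ENNReal.ofReal_mul (by norm_num)]
          refine ENNReal.ofReal_le_ofReal ?_
          have h := add_sq_le (a := (w₁ x)⁻¹) (b := (w₂ x)⁻¹)
          have h' := mul_le_mul_of_nonneg_left h (sq_nonneg (u x))
          simp only [div_eq_mul_inv, inv_pow, inv_inv] at h' ⊢
          linarith
      _ = 2 * ((∫⁻ x, ENNReal.ofReal (u x ^ 2 / w₁ x ^ 2) ∂(formVol X.I q)) +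
          ∫⁻ x, ENNReal.ofReal (u x ^ 2 / w₂ x ^ 2) ∂(formVol X.I q)) := by
          rw [lintegral_const_mul' _ _ (by norm_num),
            lintegral_add_left (hmeas h₁.contMDiff.continuous)]
      _ ≤ 2 * (C₁ * (∫⁻ x, ENNReal.ofReal (u x ^ 2 + e x) ∂(formVol X.I q)) +
          C₂ * ∫⁻ x, ENNReal.ofReal (u x ^ 2 + e x) ∂(formVol X.I q)) := by
          gcongr
          · exact hC₁ u e hu hc hm he hd
          · exact hC₂ u e hu hc hm he hd
      _ = _ := by
          push_cast
          ring

end HardyWeight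

/-! ### Hardy's inequality in a conical neighbourhood. -/

section Slices

variable {n h l : ℕ} {H HL : Type*} [TopologicalSpace H] [TopologicalSpace HL]
  {I : ModelWithCorners ℝ (EuclideanSpace ℝ (Fin n)) H}
  {J : ModelWithCorners ℝ (EuclideanSpace ℝ (Fin l)) HL}
  {R : Type*} [TopologicalSpace R] [ChartedSpace H R]
  {S : Type*} [TopologicalSpace S] [ChartedSpace HL S]
  {Φ : EuclideanSpace ℝ (Fin h) × ℝ × S → R} {u : R → ℝ}

theorem hasScalarDeriv_link_slice {b : EuclideanSpace ℝ (Fin h)} {r : ℝ} {x : S}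
    (hΦ : ContMDiffAt (𝓘(ℝ, EuclideanSpace ℝ (Fin h)).prod (𝓘(ℝ, ℝ).prod J)) I ∞ Φ (b, r, x))
    (hu : MDifferentiableAt I 𝓘(ℝ, ℝ) u (Φ (b, r, x))) :
    HasScalarDeriv J (fun x ↦ u (Φ (b, r, x))) x
      (((scalarDeriv I u (Φ (b, r, x))).comp (coneDeriv I J Φ (b, r, x))).comp
        ((ContinuousLinearMap.inr ℝ _ _).comp (.inr ℝ _ _))) := by
  have h1 : HasMFDerivAt J (𝓘(ℝ, EuclideanSpace ℝ (Fin h)).prod (𝓘(ℝ, ℝ).prod J))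
      (fun x ↦ (b, r, x)) x _ :=
    (hasMFDerivAt_const b x).prodMk ((hasMFDerivAt_const r x).prodMk (hasMFDerivAt_id x))
  have h2 := (hu.hasMFDerivAt.comp x ((hΦ.mdifferentiableAt (by simp)).hasMFDerivAt.comp x h1))
  exact h2

theorem hasDerivAt_radial_slice {b : EuclideanSpace ℝ (Fin h)} {r : ℝ} {x : S}
    (hΦ : ContMDiffAt (𝓘(ℝ, EuclideanSpace ℝ (Fin h)).prod (𝓘(ℝ, ℝ).prod J)) I ∞ Φ (b, r, x))
    (hu : MDifferentiableAt I 𝓘(ℝ, ℝ) u (Φ (b, r, x))) :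
    HasDerivAt (fun r ↦ u (Φ (b, r, x)))
      (scalarDeriv I u (Φ (b, r, x)) (coneDeriv I J Φ (b, r, x) (0, 1, 0))) r := by
  have h1 : HasMFDerivAt 𝓘(ℝ, ℝ) (𝓘(ℝ, EuclideanSpace ℝ (Fin h)).prod (𝓘(ℝ, ℝ).prod J))
      (fun r ↦ (b, r, x)) r _ :=
    (hasMFDerivAt_const b r).prodMk ((hasMFDerivAt_id r).prodMk (hasMFDerivAt_const x r))
  have h2 := (hu.hasMFDerivAt.comp r ((hΦ.mdifferentiableAt (by simp)).hasMFDerivAt.comp r h1))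
  have h3 : HasFDerivAt (fun r ↦ u (Φ (b, r, x)))
    ((((scalarDeriv I u (Φ (b, r, x))).comp (coneDeriv I J Φ (b, r, x))).comp
        ((ContinuousLinearMap.inr ℝ _ _).comp (.inl ℝ _ _)) : ℝ →L[ℝ] ℝ)) r := h2.hasFDerivAt
  exact h3.hasDerivAt

end Slices

section ConeHardy

variable {n h l : ℕ} {H HL : Type*} [TopologicalSpace H] [TopologicalSpace HL]
  {I : ModelWithCorners ℝ (EuclideanSpace ℝ (Fin n)) H}
  {J : ModelWithCorners ℝ (EuclideanSpace ℝ (Fin l)) HL}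
  {R : Type*} [TopologicalSpace R] [ChartedSpace H R] [IsManifold I ∞ R]
  {S : Type*} [TopologicalSpace S] [ChartedSpace HL S] [IsManifold J ∞ S]
  {q : R → EuclideanSpace ℝ (Fin n) →L[ℝ] EuclideanSpace ℝ (Fin n) →L[ℝ] ℝ}
  {p : S → EuclideanSpace ℝ (Fin l) →L[ℝ] EuclideanSpace ℝ (Fin l) →L[ℝ] ℝ}
  {Φ : EuclideanSpace ℝ (Fin h) × ℝ × S → R} {U : Set (EuclideanSpace ℝ (Fin h))} {ρ C : ℝ}

/-- Hardy's inequality in a conical neighbourhood, deduced from the one on the link. -/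
theorem IsConeParam.hardy [T2Space S] [SecondCountableTopology S] [MeasurableSpace S]
    [BorelSpace S] [T2Space R] [SecondCountableTopology R] [MeasurableSpace R]
    [BorelSpace R] (hΦ : IsConeParam I J q p Φ U (2 * ρ) C) (hρ : 0 < ρ) (hq : IsContForm I q)
    (hp : IsContForm J p) (hn : n = h + 1 + l) (hl : 2 ≤ l) {w : S → ℝ} (hw : Measurable w)
    {CL : ℝ≥0} (hL : ∀ u e : S → ℝ, ContMDiff J 𝓘(ℝ, ℝ) 1 u → HasCompactSupport u →
      Measurable e → (∀ x, 0 ≤ e x) → (∀ x ξ, scalarDeriv J u x ξ ^ 2 ≤ e x * p x ξ ξ) →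
      ∫⁻ x, ENNReal.ofReal (u x ^ 2 / w x ^ 2) ∂(formVol J p) ≤
        CL * ∫⁻ x, ENNReal.ofReal (u x ^ 2 + e x) ∂(formVol J p)) :
    ∃ K : ℝ≥0, ∀ u e : R → ℝ, ContMDiff I 𝓘(ℝ, ℝ) 1 u → Measurable e → (∀ x, 0 ≤ e x) →
      (∀ x ξ, scalarDeriv I u x ξ ^ 2 ≤ e x * q x ξ ξ) →
      (∀ b ∈ U, ∀ r ∈ Ioo 0 ρ, HasCompactSupport fun x ↦ u (Φ (b, r, x))) →
      (∀ b ∈ U, ∀ x, ∃ δ > 0, ∀ r ∈ Ioo 0 δ, u (Φ (b, r, x)) = 0) →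
      ∫⁻ z, ENNReal.ofReal (u (Φ z) ^ 2 / (z.2.1 * w z.2.2) ^ 2) ∂(coneMeasure J p U ρ) ≤
        K * ∫⁻ x, ENNReal.ofReal (u x ^ 2 + e x) ∂(formVol I q) := by
  classical
  have := isLocallyFiniteMeasure_formVol hp
  rcases isEmpty_or_nonempty R with hR | ⟨⟨x₀⟩⟩
  · have := Function.isEmpty Φ
    exact ⟨0, fun u e _ _ _ _ _ _ ↦ by simp [lintegral_of_isEmpty]⟩
  obtain ⟨Kv, -, hKv⟩ := hΦ.volume_comparison hq hp hn
  -- The exponent `k = l - 2` in the radial Hardy inequality is a natural number because the link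
  -- has dimension at least `2`.
  obtain ⟨k, rfl⟩ := Nat.exists_eq_add_of_le' hl
  obtain ⟨K₁, hK₁⟩ := hardy_one_dim k hρ
  set Ce : ℝ≥0 := ⟨C, hΦ.pos.le⟩
  refine ⟨CL * (K₁ * (1 + Ce) + Ce) * Kv, fun u e hu he he0 hd hcs hz ↦ ?_⟩
  set D := coneDomain S U (2 * ρ)
  have hD : MeasurableSet D := (isOpen_coneDomain hΦ.isOpen _).measurableSet
  -- `Φ` is controlled only on `D`; the modification is measurable everywhere, as the iterated
  -- integrals require.
  set Φ' := D.piecewise Φ fun _ ↦ x₀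
  have hΦ' : Measurable Φ' := hΦ.continuousOn.measurable_piecewise continuousOn_const hD
  have hEq : ∀ z ∈ D, Φ' z = Φ z := fun z hz ↦ piecewise_eq_of_mem _ _ _ hz
  have hum : Measurable u := hu.continuous.measurable
  have hmem : ∀ b ∈ U, ∀ r ∈ Ioo 0 (2 * ρ), ∀ x, (b, r, x) ∈ D :=
    fun b hb r hr x ↦ ⟨hb, hr, mem_univ _⟩
  have hρ2 : ∀ r ∈ Ioo 0 ρ, r ∈ Ioo 0 (2 * ρ) := fun r hr ↦ ⟨hr.1, by linarith [hr.2]⟩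
  have hslice : ∀ b ∈ U,
      ∫⁻ z, ENNReal.ofReal (u (Φ' (b, z)) ^ 2 / (z.1 * w z.2) ^ 2)
        ∂((radialMeasure (k + 2) ρ).prod (formVol J p)) ≤
      (CL * (K₁ * (1 + Ce) + Ce) : ℝ≥0) *
        ∫⁻ z, ENNReal.ofReal (u (Φ' (b, z)) ^ 2 + e (Φ' (b, z)))
          ∂((radialMeasure (k + 2) (2 * ρ)).prod (formVol J p)) := by
    intro b hb
    refine lintegral_cone_le k (formVol J p) (F := fun z ↦ u (Φ' (b, z)))
      (e := fun z ↦ e (Φ' (b, z))) (by fun_prop) (by fun_prop) hw hρ (fun z ↦ he0 _) ?_ ?_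
    · intro r hr
      have hmem' := fun x ↦ hmem b hb r (hρ2 r hr) x
      have e1 : ∀ x, u (Φ' (b, r, x)) = u (Φ (b, r, x)) := fun x ↦ by rw [hEq _ (hmem' x)]
      have e2 : (fun x ↦ u (Φ' (b, r, x))) = fun x ↦ u (Φ (b, r, x)) := funext e1
      -- A vector tangent to the link has squared length at most `C r² p` in the cone, so the energy
      -- on the slice is bounded by `C r² e`.
      refine hL (fun x ↦ u (Φ' (b, r, x))) (fun x ↦ Ce * r ^ 2 * e (Φ' (b, r, x))) ?_ ?_
        (by fun_prop) (fun x ↦ mul_nonneg (by positivity) (he0 _)) ?_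
      · rw [e2]
        intro x
        refine (hu _).comp x (((hΦ.contMDiffAt _ (hmem' x)).of_le (by simp)).comp x ?_)
        exact contMDiffAt_const.prodMk (contMDiffAt_const.prodMk contMDiffAt_id)
      · rw [e2]
        exact hcs b hb r hr
      · intro x ξ
        rw [e2, (hasScalarDeriv_link_slice (hΦ.contMDiffAt _ (hmem' x))
          (hu.mdifferentiable one_ne_zero _)).scalarDeriv_eq, hEq _ (hmem' x)]
        refine (hd _ _).trans ?_
        have h1 := hΦ.form_le _ (hmem' x) (0, 0, ξ)
        rw [coneForm_self] at h1
        simp only [norm_zero, ne_eq, OfNat.ofNat_ne_zero, not_false_eq_true, zero_pow,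
          zero_add] at h1
        refine (mul_le_mul_of_nonneg_left h1 (he0 _)).trans_eq ?_
        change _ = C * r ^ 2 * e (Φ (b, r, x)) * p x ξ ξ
        ring
    · intro x
      have hd1 : ∀ r ∈ Ioo 0 (2 * ρ), HasDerivAt (fun r ↦ u (Φ (b, r, x)))
          (scalarDeriv I u (Φ (b, r, x)) (coneDeriv I J Φ (b, r, x) (0, 1, 0))) r :=
        fun r hr ↦ hasDerivAt_radial_slice (hΦ.contMDiffAt _ (hmem b hb r hr x))
          (hu.mdifferentiable one_ne_zero _)
      have hd2 : ContinuousOn (deriv fun r ↦ u (Φ (b, r, x))) (Ioo 0 (2 * ρ)) := by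
        refine ContDiffOn.continuousOn_deriv_of_isOpen (n := 1) ?_ isOpen_Ioo le_rfl
        rw [← contMDiffOn_iff_contDiffOn]
        intro r hr
        refine ContMDiffAt.contMDiffWithinAt ?_
        refine (hu _).comp r (((hΦ.contMDiffAt _ (hmem b hb r hr x)).of_le (by simp)).comp r ?_)
        exact contMDiffAt_const.prodMk (contMDiffAt_id.prodMk contMDiffAt_const)
      have h1 := hK₁ (fun r ↦ u (Φ (b, r, x))) (deriv fun r ↦ u (Φ (b, r, x)))
        (fun r hr ↦ (hd1 r hr).differentiableAt.hasDerivAt) hd2 (hz b hb x)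
      have h2 : ∫⁻ r in Ioo 0 ρ, ENNReal.ofReal (r ^ k * u (Φ' (b, r, x)) ^ 2) =
          ∫⁻ r in Ioo 0 ρ, ENNReal.ofReal (r ^ k * u (Φ (b, r, x)) ^ 2) := by
        refine setLIntegral_congr_fun measurableSet_Ioo fun r hr ↦ ?_
        simp only [hEq _ (hmem b hb r (hρ2 r hr) x)]
      rw [h2]
      refine h1.trans (mul_le_mul_right (setLIntegral_mono' measurableSet_Ioo fun r hr ↦
        ENNReal.ofReal_le_ofReal (mul_le_mul_of_nonneg_left ?_ (pow_nonneg hr.1.le _))) _)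
      rw [hEq _ (hmem b hb r hr x), (hd1 r hr).deriv]
      refine add_le_add le_rfl ((hd _ _).trans ?_)
      -- The radial unit vector has cone length one, so the squared radial derivative is at most `C
      -- e`.
      have h1 := hΦ.form_le _ (hmem b hb r hr x) (0, 1, 0)
      rw [coneForm_self] at h1
      simp only [norm_zero, ne_eq, OfNat.ofNat_ne_zero, not_false_eq_true, zero_pow,
          zero_add, one_pow, map_zero, mul_zero, add_zero, mul_one] at h1
      refine (mul_le_mul_of_nonneg_left h1 (he0 _)).trans_eq ?_
      change _ = C * e (Φ (b, r, x))
      ring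
  have hae : ∀ s ≤ 2 * ρ, ∀ᵐ z ∂(coneMeasure J p U s), Φ z = Φ' z := by
    intro s hs
    filter_upwards [compl_mem_ae_iff.2 (coneMeasure_compl_coneDomain (J := J) (p := p) (ρ := s)
      hΦ.isOpen.measurableSet)] with z hz
    replace hz : z ∈ coneDomain S U s := not_not.1 hz
    exact (hEq z ⟨hz.1, ⟨hz.2.1.1, hz.2.1.2.trans_le hs⟩, hz.2.2⟩).symm
  calc ∫⁻ z, ENNReal.ofReal (u (Φ z) ^ 2 / (z.2.1 * w z.2.2) ^ 2) ∂(coneMeasure J p U ρ)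
      = ∫⁻ z, ENNReal.ofReal (u (Φ' z) ^ 2 / (z.2.1 * w z.2.2) ^ 2) ∂(coneMeasure J p U ρ) := by
        refine lintegral_congr_ae ?_
        filter_upwards [hae ρ (by linarith)] with z hz
        rw [hz]
    _ = ∫⁻ b in U, ∫⁻ z, ENNReal.ofReal (u (Φ' (b, z)) ^ 2 / (z.1 * w z.2) ^ 2)
        ∂((radialMeasure (k + 2) ρ).prod (formVol J p)) := by
        rw [coneMeasure, lintegral_prod _ (by fun_prop)]
        rfl
    _ ≤ ∫⁻ b in U, (CL * (K₁ * (1 + Ce) + Ce) : ℝ≥0) *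
        ∫⁻ z, ENNReal.ofReal (u (Φ' (b, z)) ^ 2 + e (Φ' (b, z)))
          ∂((radialMeasure (k + 2) (2 * ρ)).prod (formVol J p)) :=
        setLIntegral_mono' hΦ.isOpen.measurableSet hslice
    _ = (CL * (K₁ * (1 + Ce) + Ce) : ℝ≥0) *
        ∫⁻ z, ENNReal.ofReal (u (Φ' z) ^ 2 + e (Φ' z)) ∂(coneMeasure J p U (2 * ρ)) := by
        rw [lintegral_const_mul' _ _ ENNReal.coe_ne_top, coneMeasure, lintegral_prod _ (by fun_prop)]
        rfl
    _ = (CL * (K₁ * (1 + Ce) + Ce) : ℝ≥0) *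
        ∫⁻ x, ENNReal.ofReal (u x ^ 2 + e x) ∂((coneMeasure J p U (2 * ρ)).map Φ) := by
        rw [Measure.map_congr (hae (2 * ρ) le_rfl), lintegral_map (by fun_prop) hΦ']
    _ ≤ (CL * (K₁ * (1 + Ce) + Ce) : ℝ≥0) *
        ∫⁻ x, ENNReal.ofReal (u x ^ 2 + e x) ∂(Kv • formVol I q) := by
        gcongr
    _ = _ := by
        rw [lintegral_smul_measure, ENNReal.smul_def, smul_eq_mul, ← mul_assoc]
        norm_cast

end ConeHardy

/-! ### The cut-off weight on a cone and its gradient bound. -/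

section ScalarDerivMul

variable {E : Type*} [NormedAddCommGroup E] [NormedSpace ℝ E] {H : Type*} [TopologicalSpace H]
  {I : ModelWithCorners ℝ E H} {R : Type*} [TopologicalSpace R] [ChartedSpace H R]

theorem HasScalarDeriv.mul {f g : R → ℝ} {x : R} {f' g' : E →L[ℝ] ℝ}
    (hf : HasScalarDeriv I f x f') (hg : HasScalarDeriv I g x g') :
    HasScalarDeriv I (fun y ↦ f y * g y) x (f x • g' + g x • f') := HasMFDerivAt.mul hf hg

theorem HasScalarDeriv.congr {f g : R → ℝ} {x : R} {f' : E →L[ℝ] ℝ}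
    (hf : HasScalarDeriv I f x f') (h : g =ᶠ[𝓝 x] f) : HasScalarDeriv I g x f' :=
  HasMFDerivAt.congr_of_eventuallyEq hf h

theorem hasScalarDeriv_clm (L : E →L[ℝ] ℝ) (x : E) : HasScalarDeriv 𝓘(ℝ, E) L x L :=
  L.hasMFDerivAt

theorem HasFDerivAt.hasScalarDeriv {f : E → ℝ} {x : E} {f' : E →L[ℝ] ℝ} (h : HasFDerivAt f f' x) :
    HasScalarDeriv 𝓘(ℝ, E) f x f' := h.hasMFDerivAt

variable {E' : Type*} [NormedAddCommGroup E'] [NormedSpace ℝ E'] {H' : Type*} [TopologicalSpace H']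
  {I' : ModelWithCorners ℝ E' H'} {R' : Type*} [TopologicalSpace R'] [ChartedSpace H' R']

theorem HasScalarDeriv.comp_fst {f : R → ℝ} {z : R × R'} {f' : E →L[ℝ] ℝ}
    (hf : HasScalarDeriv I f z.1 f') :
    HasScalarDeriv (I.prod I') (fun z ↦ f z.1) z (f'.comp (.fst ℝ E E')) :=
  HasMFDerivAt.comp (I' := I) z hf (hasMFDerivAt_fst z)

theorem HasScalarDeriv.comp_snd {f : R' → ℝ} {z : R × R'} {f' : E' →L[ℝ] ℝ}
    (hf : HasScalarDeriv I' f z.2 f') :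
    HasScalarDeriv (I.prod I') (fun z ↦ f z.2) z (f'.comp (.snd ℝ E E')) :=
  HasMFDerivAt.comp (I' := I') z hf (hasMFDerivAt_snd z)

end ScalarDerivMul

section ConeWeight

variable {h l : ℕ} {HL : Type*} [TopologicalSpace HL]
  {J : ModelWithCorners ℝ (EuclideanSpace ℝ (Fin l)) HL}
  {S : Type*} [TopologicalSpace S] [ChartedSpace HL S]
  {b₀ : EuclideanSpace ℝ (Fin h)} {r₀ : ℝ}

/-- The function `(b, r, x) ↦ r w(x)`, cut off by `1` far from the point `b = b₀, r = r₀`. -/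
def coneWeight (χ₁ : ContDiffBump b₀) (χ₂ : ContDiffBump r₀) (w : S → ℝ)
    (z : EuclideanSpace ℝ (Fin h) × ℝ × S) : ℝ :=
  1 + -(χ₁ z.1 * (χ₂ z.2.1 * (1 + -(z.2.1 * w z.2.2))))

variable {χ₁ : ContDiffBump b₀} {χ₂ : ContDiffBump r₀} {w : S → ℝ}

omit [TopologicalSpace S] in
theorem coneWeight_le_one {z : EuclideanSpace ℝ (Fin h) × ℝ × S} (hz : z.2.1 * w z.2.2 ≤ 1) :
    coneWeight χ₁ χ₂ w z ≤ 1 := by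
  have := mul_nonneg (χ₁.nonneg (x := z.1)) (mul_nonneg (χ₂.nonneg (x := z.2.1)) (sub_nonneg.2 hz))
  unfold coneWeight
  linarith

omit [TopologicalSpace S] in
-- The weight is the convex combination of `1` and `r w` with coefficient `χ₁ χ₂`, and therefore
-- lies between them.
theorem le_coneWeight {z : EuclideanSpace ℝ (Fin h) × ℝ × S} (hz : z.2.1 * w z.2.2 ≤ 1) :
    z.2.1 * w z.2.2 ≤ coneWeight χ₁ χ₂ w z := by
  have h1 : χ₁ z.1 * χ₂ z.2.1 ≤ 1 := mul_le_one₀ χ₁.le_one χ₂.nonneg χ₂.le_one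
  have h2 := mul_nonneg (sub_nonneg.2 h1) (sub_nonneg.2 hz)
  unfold coneWeight
  linear_combination h2

theorem contMDiffAt_coneWeight {z : EuclideanSpace ℝ (Fin h) × ℝ × S} (hw : ContMDiff J 𝓘(ℝ, ℝ) 1 w) :
    ContMDiffAt (𝓘(ℝ, EuclideanSpace ℝ (Fin h)).prod (𝓘(ℝ, ℝ).prod J)) 𝓘(ℝ, ℝ) 1
      (coneWeight χ₁ χ₂ w) z := by
  have h1 : ContMDiff (𝓘(ℝ, EuclideanSpace ℝ (Fin h)).prod (𝓘(ℝ, ℝ).prod J)) 𝓘(ℝ, ℝ) 1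
      fun z : EuclideanSpace ℝ (Fin h) × ℝ × S ↦ χ₁ z.1 := χ₁.contDiff.contMDiff.comp contMDiff_fst
  have h2 : ContMDiff (𝓘(ℝ, EuclideanSpace ℝ (Fin h)).prod (𝓘(ℝ, ℝ).prod J)) 𝓘(ℝ, ℝ) 1
      fun z : EuclideanSpace ℝ (Fin h) × ℝ × S ↦ χ₂ z.2.1 :=
    χ₂.contDiff.contMDiff.comp (contMDiff_fst.comp contMDiff_snd)
  have h3 : ContMDiff (𝓘(ℝ, EuclideanSpace ℝ (Fin h)).prod (𝓘(ℝ, ℝ).prod J)) 𝓘(ℝ, ℝ) 1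
      fun z : EuclideanSpace ℝ (Fin h) × ℝ × S ↦ z.2.1 := contMDiff_fst.comp contMDiff_snd
  have h4 : ContMDiff (𝓘(ℝ, EuclideanSpace ℝ (Fin h)).prod (𝓘(ℝ, ℝ).prod J)) 𝓘(ℝ, ℝ) 1
      fun z : EuclideanSpace ℝ (Fin h) × ℝ × S ↦ w z.2.2 :=
    hw.comp (contMDiff_snd.comp contMDiff_snd)
  exact (contMDiff_const.add (h1.mul (h2.mul (contMDiff_const.add (h3.mul h4).neg))).neg) z

/-- The differential of the weight is bounded in terms of the form `|db|² + dr² + r² p`. -/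
theorem exists_hasScalarDeriv_coneWeight
    {p : S → EuclideanSpace ℝ (Fin l) →L[ℝ] EuclideanSpace ℝ (Fin l) →L[ℝ] ℝ}
    (hw : ContMDiff J 𝓘(ℝ, ℝ) 1 w) (hw0 : ∀ x, 0 < w x) (hw1 : ∀ x, w x ≤ 1) {K : ℝ}
    (hp : ∀ x ξ, 0 ≤ p x ξ ξ) (hK : ∀ x ξ, scalarDeriv J w x ξ ^ 2 ≤ K * p x ξ ξ) :
    ∃ M : ℝ, 0 ≤ M ∧ ∀ z : EuclideanSpace ℝ (Fin h) × ℝ × S, z.2.1 ∈ Ioo 0 1 → ∃ f',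
      HasScalarDeriv (𝓘(ℝ, EuclideanSpace ℝ (Fin h)).prod (𝓘(ℝ, ℝ).prod J))
        (coneWeight χ₁ χ₂ w) z f' ∧ ∀ V, f' V ^ 2 ≤ M * coneForm z.2.1 (p z.2.2) V V := by
  obtain ⟨M₁, hM₁⟩ := (χ₁.hasCompactSupport.fderiv (𝕜 := ℝ)).exists_bound_of_continuous
    (χ₁.contDiff (n := 1).continuous_fderiv one_ne_zero)
  obtain ⟨M₂, hM₂⟩ := χ₂.hasCompactSupport.deriv.exists_bound_of_continuous
    (χ₂.contDiff (n := 1).continuous_deriv le_rfl)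
  -- The differential has four terms: from `dχ₁`, `dχ₂`, `w dr` and `r dw`, bounded by `M₁² |db|²`,
  -- `M₂² dr²`, `dr²` and `|K| r² p`. The leading `4` comes from the square of a sum of four terms.
  refine ⟨4 * (M₁ ^ 2 + (M₂ ^ 2 + 1) + |K|), by positivity, fun z hr ↦ ?_⟩
  have d1 : HasScalarDeriv (𝓘(ℝ, EuclideanSpace ℝ (Fin h)).prod (𝓘(ℝ, ℝ).prod J))
      (fun z ↦ χ₁ z.1) z _ :=
    (HasFDerivAt.hasScalarDeriv
      (χ₁.contDiff (n := 1).differentiable one_ne_zero z.1).hasFDerivAt).comp_fst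
  have d3 : HasScalarDeriv (𝓘(ℝ, EuclideanSpace ℝ (Fin h)).prod (𝓘(ℝ, ℝ).prod J))
      (fun z ↦ z.2.1) z _ := (hasScalarDeriv_clm (.id ℝ ℝ) z.2.1).comp_fst.comp_snd
  have d2 := d3.comp_deriv (G := χ₂)
    (χ₂.contDiff (n := 1).differentiable one_ne_zero z.2.1).hasDerivAt
  have d4 : HasScalarDeriv (𝓘(ℝ, EuclideanSpace ℝ (Fin h)).prod (𝓘(ℝ, ℝ).prod J))
      (fun z ↦ w z.2.2) z _ :=
    (hasScalarDeriv_scalarDeriv (hw.mdifferentiable one_ne_zero z.2.2)).comp_snd.comp_snd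
  have d5 := (d3.mul d4).comp_deriv (G := fun t ↦ 1 + -t) ((hasDerivAt_neg _).const_add 1)
  have d6 := (d1.mul (d2.mul d5)).comp_deriv (G := fun t ↦ 1 + -t) ((hasDerivAt_neg _).const_add 1)
  refine ⟨_, d6, fun V ↦ ?_⟩
  set W := w z.2.2
  set r := z.2.1
  have e : ∀ A B A' B' t σ : ℝ, -1 * (A * (B * (-1 * (r * σ + W * t)) + (1 + -(r * W)) * B') +
      (B * (1 + -(r * W))) * A') = -(B * (1 - r * W)) * A' + -(A * (1 - r * W)) * B' + A * B * W * t
      + A * B * (r * σ) := by intros; ring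
  have hW0 := (hw0 z.2.2).le
  have hW1 := hw1 z.2.2
  have hr0 := hr.1.le
  have hr1 := hr.2.le
  have hrW0 : 0 ≤ 1 - r * W := sub_nonneg.2 (mul_le_one₀ hr1 hW0 hW1)
  have hrW1 : 1 - r * W ≤ 1 := sub_le_self _ (mul_nonneg hr0 hW0)
  have hA0 : 0 ≤ χ₁ z.1 := χ₁.nonneg
  have hA1 : χ₁ z.1 ≤ 1 := χ₁.le_one
  have hB0 : 0 ≤ χ₂ r := χ₂.nonneg
  have hB1 : χ₂ r ≤ 1 := χ₂.le_one
  have hsq : ∀ {a y : ℝ}, 0 ≤ a → a ≤ 1 → (a * y) ^ 2 ≤ y ^ 2 := fun {a y} h0 h1 ↦ by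
    rw [mul_pow]
    exact mul_le_of_le_one_left (sq_nonneg _) (pow_le_one₀ h0 h1)
  have hfour : ∀ a b c d : ℝ, (a + b + c + d) ^ 2 ≤ 4 * (a ^ 2 + b ^ 2 + c ^ 2 + d ^ 2) := by
    intro a b c d
    nlinarith [sq_nonneg (a - b), sq_nonneg (a - c), sq_nonneg (a - d), sq_nonneg (b - c),
      sq_nonneg (b - d), sq_nonneg (c - d)]
  rw [coneForm_self]
  have hb1 : (fderiv ℝ χ₁ z.1 V.1) ^ 2 ≤ M₁ ^ 2 * ‖V.1‖ ^ 2 := by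
    rw [← mul_pow, ← sq_abs, ← Real.norm_eq_abs]
    refine pow_le_pow_left₀ (norm_nonneg _) ?_ 2
    exact (ContinuousLinearMap.le_opNorm _ _).trans
      (mul_le_mul_of_nonneg_right (hM₁ z.1) (norm_nonneg _))
  have hb2 : (deriv χ₂ r * V.2.1) ^ 2 ≤ M₂ ^ 2 * V.2.1 ^ 2 := by
    rw [mul_pow]
    refine mul_le_mul_of_nonneg_right ?_ (sq_nonneg _)
    rw [← sq_abs, ← Real.norm_eq_abs]
    exact pow_le_pow_left₀ (norm_nonneg _) (hM₂ r) 2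
  have hb3 : (r * scalarDeriv J w z.2.2 V.2.2) ^ 2 ≤ |K| * (r ^ 2 * p z.2.2 V.2.2 V.2.2) := by
    rw [mul_pow, mul_left_comm]
    refine mul_le_mul_of_nonneg_left ((hK _ _).trans ?_) (sq_nonneg _)
    exact mul_le_mul_of_nonneg_right (le_abs_self K) (hp _ _)
  have hp' : 0 ≤ r ^ 2 * p z.2.2 V.2.2 V.2.2 := mul_nonneg (sq_nonneg _) (hp _ _)
  calc _ = (-(χ₂ r * (1 - r * W)) * (fderiv ℝ χ₁ z.1 V.1) +
        -(χ₁ z.1 * (1 - r * W)) * (deriv χ₂ r * V.2.1) + χ₁ z.1 * χ₂ r * W * V.2.1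
      + χ₁ z.1 * χ₂ r * (r * scalarDeriv J w z.2.2 V.2.2)) ^ 2 := by
        rw [← e]
        rfl
    _ ≤ 4 * ((fderiv ℝ χ₁ z.1 V.1) ^ 2 + (deriv χ₂ r * V.2.1) ^ 2 + V.2.1 ^ 2 +
        (r * scalarDeriv J w z.2.2 V.2.2) ^ 2) := by
        refine (hfour _ _ _ _).trans ?_
        rw [neg_mul, neg_mul, neg_sq, neg_sq]
        refine mul_le_mul_of_nonneg_left (add_le_add (add_le_add (add_le_add ?_ ?_) ?_) ?_)
          (by norm_num)
        · exact hsq (by positivity) (mul_le_one₀ hB1 hrW0 hrW1)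
        · exact hsq (by positivity) (mul_le_one₀ hA1 hrW0 hrW1)
        · exact hsq (by positivity) (mul_le_one₀ (mul_le_one₀ hA1 hB0 hB1) hW0 hW1)
        · exact hsq (by positivity) (mul_le_one₀ hA1 hB0 hB1)
    _ ≤ 4 * (M₁ ^ 2 * ‖V.1‖ ^ 2 + M₂ ^ 2 * V.2.1 ^ 2 + V.2.1 ^ 2 +
        |K| * (r ^ 2 * p z.2.2 V.2.2 V.2.2)) := by gcongr
    _ ≤ _ := by
        have i1 : 0 ≤ (M₂ ^ 2 + 1 + |K|) * ‖V.1‖ ^ 2 := by positivity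
        have i2 : 0 ≤ (M₁ ^ 2 + |K|) * V.2.1 ^ 2 := by positivity
        have i3 : 0 ≤ (M₁ ^ 2 + M₂ ^ 2 + 1) * (r ^ 2 * p z.2.2 V.2.2 V.2.2) :=
          mul_nonneg (by positivity) hp'
        linear_combination 4 * (i1 + i2 + i3)

end ConeWeight

theorem IsPosForm.nonneg {E : Type*} [NormedAddCommGroup E] [NormedSpace ℝ E] {Q : E →L[ℝ] E →L[ℝ] ℝ}
    (hQ : IsPosForm Q) (v : E) : 0 ≤ Q v v := by
  by_cases h : v = 0
  · simp [h]
  · exact (hQ.pos v h).le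

/-! ### A Hardy weight near one singular point. -/

section LocalDiffeo

variable {E : Type*} [NormedAddCommGroup E] [NormedSpace ℝ E] {H : Type*} [TopologicalSpace H]
  {I : ModelWithCorners ℝ E H} {R : Type*} [TopologicalSpace R] [ChartedSpace H R]
  {E' : Type*} [NormedAddCommGroup E'] [NormedSpace ℝ E'] {H' : Type*} [TopologicalSpace H']
  {J : ModelWithCorners ℝ E' H'} {S : Type*} [TopologicalSpace S] [ChartedSpace H' S]
  {Φ : S → R} {z : S}

theorem contMDiffAt_of_comp_isLocalDiffeomorphAt (hΦ : IsLocalDiffeomorphAt J I ∞ Φ z)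
    {f : R → ℝ} (hf : ContMDiffAt J 𝓘(ℝ, ℝ) 1 (fun x ↦ f (Φ x)) z) :
    ContMDiffAt I 𝓘(ℝ, ℝ) 1 f (Φ z) := by
  have hz : hΦ.localInverse (Φ z) = z := hΦ.localInverse_left_inv hΦ.localInverse_mem_target
  have h1 : ContMDiffAt I 𝓘(ℝ, ℝ) 1 ((fun x ↦ f (Φ x)) ∘ hΦ.localInverse) (Φ z) :=
    ContMDiffAt.comp _ (hz.symm ▸ hf) (hΦ.localInverse_contMDiffAt.of_le (by simp))
  refine h1.congr_of_eventuallyEq ?_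
  filter_upwards [hΦ.localInverse_eventuallyEq_right] with y hy
  exact congrArg f hy.symm

theorem exists_mfderiv_eq (hΦ : IsLocalDiffeomorphAt J I ∞ Φ z) (ξ : E) :
    ∃ V : E', (mfderiv J I Φ z V : E) = ξ :=
  (hΦ.mfderivToContinuousLinearEquiv (by simp)).surjective ξ

end LocalDiffeo

section LocalWeight

variable {n h l : ℕ} {H HL : Type*} [TopologicalSpace H] [TopologicalSpace HL]
  {I : ModelWithCorners ℝ (EuclideanSpace ℝ (Fin n)) H}
  {J : ModelWithCorners ℝ (EuclideanSpace ℝ (Fin l)) HL}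
  {R : Type*} [TopologicalSpace R] [ChartedSpace H R]
  {S : Type*} [TopologicalSpace S] [ChartedSpace HL S]
  {q : R → EuclideanSpace ℝ (Fin n) →L[ℝ] EuclideanSpace ℝ (Fin n) →L[ℝ] ℝ}
  {p : S → EuclideanSpace ℝ (Fin l) →L[ℝ] EuclideanSpace ℝ (Fin l) →L[ℝ] ℝ}
  {Φ : EuclideanSpace ℝ (Fin h) × ℝ × S → R} {U : Set (EuclideanSpace ℝ (Fin h))} {ρ ρ' C : ℝ}

theorem IsConeParam.mono (hΦ : IsConeParam I J q p Φ U ρ C) (h : ρ' ≤ ρ) :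
    IsConeParam I J q p Φ U ρ' C := by
  have hsub : coneDomain S U ρ' ⊆ coneDomain S U ρ :=
    prod_mono le_rfl (prod_mono (Ioo_subset_Ioo_right h) le_rfl)
  exact ⟨hΦ.isOpen, fun z hz ↦ hΦ.contMDiffAt z (hsub hz), hΦ.injOn.mono hsub,
    fun V hV ↦ hΦ.isOpen_image V (hV.trans hsub), hΦ.pos, fun z hz ↦ hΦ.le_form z (hsub hz),
    fun z hz ↦ hΦ.form_le z (hsub hz)⟩

namespace ConeChart

variable {Λ : Level.{u}} {X : StratSpace.{u}} (c : ConeChart Λ X)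
  {q : X.Reg → EuclideanSpace ℝ (Fin X.dim) →L[ℝ] EuclideanSpace ℝ (Fin X.dim) →L[ℝ] ℝ}
  {p : c.link.Reg → EuclideanSpace ℝ (Fin c.link.dim) →L[ℝ]
    EuclideanSpace ℝ (Fin c.link.dim) →L[ℝ] ℝ} {U : Set (EuclideanSpace ℝ (Fin c.h))}
  {b₀ : EuclideanSpace ℝ (Fin c.h)}

theorem isConeParam (hU : IsOpen U) (hρ : ρ ≤ c.ε) (hC : 0 < C)
    (le_form : ∀ z ∈ coneDomain c.link.Reg U ρ, ∀ V, coneForm z.2.1 (p z.2.2) V V ≤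
      C * q (c.reg z) (coneDeriv X.I c.link.I c.reg z V) (coneDeriv X.I c.link.I c.reg z V))
    (form_le : ∀ z ∈ coneDomain c.link.Reg U ρ, ∀ V,
      q (c.reg z) (coneDeriv X.I c.link.I c.reg z V) (coneDeriv X.I c.link.I c.reg z V) ≤
        C * coneForm z.2.1 (p z.2.2) V V) :
    IsConeParam X.I c.link.I q p c.reg U ρ C := by
  have hsub : coneDomain c.link.Reg U ρ ⊆ univ ×ˢ Ioo (0 : ℝ) c.ε ×ˢ univ :=
    prod_mono (subset_univ _) (prod_mono (Ioo_subset_Ioo_right hρ) le_rfl)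
  refine ⟨hU, fun z hz ↦ (c.reg_diffeo ⟨z, hsub hz⟩).contMDiffAt, c.reg_injOn.mono hsub,
    fun V hV hVo ↦ ?_, hC, le_form, form_le⟩
  rw [isOpen_iff_mem_nhds]
  rintro _ ⟨z, hz, rfl⟩
  rw [← c.reg_diffeo.isLocalHomeomorphOn.map_nhds_eq (hsub (hV hz))]
  exact image_mem_map (hVo.mem_nhds hz)

variable [T2Space X.carrier] [SecondCountableTopology X.Reg] [SecondCountableTopology c.link.Reg]

-- The function `r wL(x)` is transported by the chart and cut off to `1`, so it extends to the whole
-- smooth stratum. Its Hardy inequality is `IsConeParam.hardy` where `r < ρ` in the chart, and is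
-- trivial elsewhere, since the weight is `1` there.
open Classical in
theorem exists_isHardyWeightOn (hq : IsContForm X.I q) (hp : IsContForm c.link.I p)
    (hl : 2 ≤ c.link.dim) (hρ : 0 < ρ) (hρ1 : 2 * ρ ≤ 1) (hρε : 2 * ρ ≤ c.ε)
    (hΦ : IsConeParam X.I c.link.I q p c.reg (Metric.ball b₀ (2 * ρ)) (2 * ρ) C)
    {wL : c.link.Reg → ℝ} (hL : IsHardyWeightOn c.link p c.link.sing wL) :
    ∃ w, IsHardyWeightOn X q (c.nhd (Metric.ball b₀ (ρ / 2)) (ρ / 2) ∩ X.sing) w := by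
  set U := Metric.ball b₀ (2 * ρ)
  set D := coneDomain c.link.Reg U (2 * ρ)
  have hDo : IsOpen D := isOpen_coneDomain hΦ.isOpen _
  have hDε : D ⊆ univ ×ˢ Ioo (0 : ℝ) c.ε ×ˢ univ :=
    prod_mono (subset_univ _) (prod_mono (Ioo_subset_Ioo_right hρε) le_rfl)
  have hρ2 : ρ < 2 * ρ := by linarith
  set χ₁ : ContDiffBump b₀ := ⟨ρ / 2, ρ, half_pos hρ, half_lt_self hρ⟩
  set χ₂ : ContDiffBump (0 : ℝ) := ⟨ρ / 2, ρ, half_pos hρ, half_lt_self hρ⟩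
  set f := coneWeight χ₁ χ₂ wL
  have hp0 : ∀ x ξ, 0 ≤ p x ξ ξ := fun x ξ ↦ (hp.isPosForm x).nonneg ξ
  have hq0 : ∀ x ξ, 0 ≤ q x ξ ξ := fun x ξ ↦ (hq.isPosForm x).nonneg ξ
  have hrw : ∀ z ∈ D, 0 < z.2.1 * wL z.2.2 ∧ z.2.1 * wL z.2.2 ≤ 1 := fun z hz ↦
    ⟨mul_pos hz.2.1.1 (hL.pos _),
      mul_le_one₀ (hz.2.1.2.le.trans hρ1) (hL.pos _).le (hL.le_one _)⟩
  -- The chosen preimage is unique because the chart is injective on `D`, so `w` is `f` in the chart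
  -- and `1` outside.
  set w : X.Reg → ℝ := fun x ↦ if hx : ∃ z ∈ D, c.reg z = x then f hx.choose else 1 with hw
  have hw_in : ∀ z ∈ D, w (c.reg z) = f z := by
    intro z hz
    have hx : ∃ z' ∈ D, c.reg z' = c.reg z := ⟨z, hz, rfl⟩
    simp only [hw]
    rw [dif_pos hx, hΦ.injOn hx.choose_spec.1 hz hx.choose_spec.2]
  have hw_out : ∀ x, (∀ z ∈ D, c.reg z = x → z.1 ∉ Metric.ball b₀ ρ ∨ ρ ≤ z.2.1) → w x = 1 := by
    intro x hx
    by_cases h : ∃ z ∈ D, c.reg z = x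
    · obtain ⟨z, hz, rfl⟩ := h
      rw [hw_in z hz]
      rcases hx z hz rfl with h1 | h1
      · have : χ₁ z.1 = 0 := χ₁.zero_of_le_dist (not_lt.1 h1)
        simp [f, coneWeight, this]
      · have : χ₂ z.2.1 = 0 := by
          refine χ₂.zero_of_le_dist ?_
          rw [Real.dist_eq, sub_zero]
          exact h1.trans (le_abs_self _)
        simp [f, coneWeight, this]
    · simp only [hw]
      rw [dif_neg h]
  have hw_inner : ∀ z : EuclideanSpace ℝ (Fin c.h) × ℝ × c.link.Reg,
      z.1 ∈ Metric.ball b₀ (ρ / 2) → z.2.1 ∈ Ioo 0 (ρ / 2) →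
      w (c.reg z) = z.2.1 * wL z.2.2 := by
    intro z hz1 hz2
    have hz : z ∈ D := ⟨Metric.ball_subset_ball (by linarith) hz1,
      ⟨hz2.1, by linarith [hz2.2]⟩, mem_univ _⟩
    have h1 : χ₁ z.1 = 1 := χ₁.one_of_mem_closedBall (Metric.ball_subset_closedBall hz1)
    have h2 : χ₂ z.2.1 = 1 := by
      refine χ₂.one_of_mem_closedBall ?_
      rw [Metric.mem_closedBall, Real.dist_eq, sub_zero, abs_of_pos hz2.1]
      exact hz2.2.le
    rw [hw_in z hz]
    simp only [f, coneWeight, h1, h2]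
    ring
  set Z := c.reg '' (Metric.closedBall b₀ ρ ×ˢ Ioc 0 ρ ×ˢ univ)
  have hZ : IsClosed Z :=
    c.isClosed_reg_image (isCompact_closedBall b₀ ρ) (hρ2.trans_le hρε)
  have hw_Z : ∀ x ∉ Z, w x = 1 := by
    refine fun x hx ↦ hw_out x fun z hz hzx ↦ ?_
    by_contra! hcon
    exact hx ⟨z, ⟨Metric.ball_subset_closedBall hcon.1, ⟨hz.2.1.1, hcon.2.le⟩, mem_univ _⟩, hzx⟩
  -- The support of the cut-off lies over the relatively closed set `Z`, which is contained in the
  -- image of `D`. Every point therefore is in the chart or has a neighbourhood on which the weight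
  -- is constant.
  have hcases : ∀ x, (∃ z ∈ D, c.reg z = x) ∨ w =ᶠ[𝓝 x] fun _ ↦ 1 := by
    intro x
    by_cases hx : x ∈ Z
    · obtain ⟨z, hz, rfl⟩ := hx
      exact Or.inl ⟨z, ⟨Metric.closedBall_subset_ball hρ2 hz.1,
        ⟨hz.2.1.1, hz.2.1.2.trans_lt hρ2⟩, mem_univ _⟩, rfl⟩
    · right
      filter_upwards [hZ.isOpen_compl.mem_nhds hx] with y hy using hw_Z y hy
  have hw_ev : ∀ z ∈ D, (fun z ↦ w (c.reg z)) =ᶠ[𝓝 z] f := by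
    intro z hz
    filter_upwards [hDo.mem_nhds hz] with z' hz' using hw_in z' hz'
  have hwC : ContMDiff X.I 𝓘(ℝ, ℝ) 1 w := by
    intro x
    rcases hcases x with ⟨z, hz, rfl⟩ | hx
    · exact contMDiffAt_of_comp_isLocalDiffeomorphAt (c.reg_diffeo ⟨z, hDε hz⟩)
        ((contMDiffAt_coneWeight hL.contMDiff).congr_of_eventuallyEq (hw_ev z hz))
    · exact contMDiffAt_const.congr_of_eventuallyEq hx
  have hw_pos : ∀ x, 0 < w x := by
    intro x
    rcases hcases x with ⟨z, hz, rfl⟩ | hx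
    · rw [hw_in z hz]
      exact (hrw z hz).1.trans_le (le_coneWeight (hrw z hz).2)
    · rw [hx.eq_of_nhds]
      exact one_pos
  refine ⟨w, hwC, hw_pos, fun x ↦ ?_, ?_, ?_, ?_⟩
  · rcases hcases x with ⟨z, hz, rfl⟩ | hx
    · rw [hw_in z hz]
      exact coneWeight_le_one (hrw z hz).2
    · exact hx.eq_of_nhds.le
  · obtain ⟨K, hK⟩ := hL.deriv_le
    obtain ⟨M, hM0, hM⟩ := exists_hasScalarDeriv_coneWeight (χ₁ := χ₁) (χ₂ := χ₂)
      hL.contMDiff hL.pos hL.le_one hp0 hK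
    refine ⟨M * C, fun x ξ ↦ ?_⟩
    rcases hcases x with ⟨z, hz, rfl⟩ | hx
    · obtain ⟨f', hf', hle⟩ := hM z ⟨hz.2.1.1, hz.2.1.2.trans_le hρ1⟩
      obtain ⟨V, rfl⟩ := exists_mfderiv_eq (c.reg_diffeo ⟨z, hDε hz⟩) ξ
      have h1 : HasMFDerivAt _ X.I c.reg z _ :=
        ((hΦ.contMDiffAt z hz).mdifferentiableAt (by simp)).hasMFDerivAt
      have h2 := (hwC.mdifferentiable one_ne_zero (c.reg z)).hasMFDerivAt.comp z h1
      have h3 := hasMFDerivAt_unique h2 (hf'.congr (hw_ev z hz))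
      have h4 : scalarDeriv X.I w (c.reg z) (coneDeriv X.I c.link.I c.reg z V) = f' V :=
        congr($h3 V)
      change scalarDeriv X.I w (c.reg z) (coneDeriv X.I c.link.I c.reg z V) ^ 2 ≤
        M * C * q (c.reg z) (coneDeriv X.I c.link.I c.reg z V) (coneDeriv X.I c.link.I c.reg z V)
      rw [h4, mul_assoc]
      exact (hle V).trans (mul_le_mul_of_nonneg_left (hΦ.le_form z hz V) hM0)
    · rw [scalarDeriv_congr hx, scalarDeriv_const]
      have := mul_nonneg (mul_nonneg hM0 hΦ.pos.le) (hq0 x ξ)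
      simpa using this
  · rintro y ⟨hy, hys⟩
    rw [Metric.tendsto_nhds]
    intro δ hδ
    have hball : IsOpen (Metric.ball b₀ (ρ / 2)) := Metric.isOpen_ball
    simp_rw [dist_zero_right, Real.norm_eq_abs, abs_of_pos (hw_pos _)]
    have hreg : ∀ x : X.Reg, (x : X.carrier) ∈ c.nhd (Metric.ball b₀ (ρ / 2)) (ρ / 2) →
        ∃ b ∈ Metric.ball b₀ (ρ / 2), ∃ r ∈ Ioo (0 : ℝ) c.ε, r ≤ 1 ∧ ∃ x',
          c.reg (b, r, x') = x ∧ w x = r * wL x' := by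
      intro x hx
      obtain ⟨b, hb, r, hr, hrρ, x', rfl⟩ := c.mem_nhd_reg hx
      exact ⟨b, hb, r, hr, by linarith, x', rfl, hw_inner (b, r, x') hb ⟨hr.1, hrρ⟩⟩
    obtain ⟨b', hb', r', hr', hrs', x', rfl⟩ := c.mem_nhd_iff.1 hy
    -- At an apex the factor `r` makes the weight small. At other singular points of the chart the
    -- link coordinate is singular, and the factor `wL` tends to `0`.
    rcases hr'.1.eq_or_lt with h0 | h0
    · subst h0
      refine mem_comap.2 ⟨c.nhd (Metric.ball b₀ (ρ / 2)) (min δ (ρ / 2)),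
        (c.isOpen_nhd hball _).mem_nhds (c.mem_nhd_iff.2 ⟨b', hb', 0, hr',
          lt_min hδ (half_pos hρ), x', rfl⟩), fun x hx ↦ ?_⟩
      obtain ⟨b, hb, r, hr, hrρ, x', rfl⟩ := c.mem_nhd_reg hx
      have h1 : w (c.reg (b, r, x')) = r * wL x' :=
        hw_inner (b, r, x') hb ⟨hr.1, hrρ.trans_le (min_le_right _ _)⟩
      change w _ < δ
      rw [h1]
      exact (mul_le_of_le_one_right hr.1.le (hL.le_one _)).trans_lt
        (hrρ.trans_le (min_le_left _ _))
    · have hx' : x' ∈ c.link.sing := by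
        change c.link.depth x' ≠ 0
        rw [← c.depth_off_apex b' r' ⟨h0, hr'.2⟩ x']
        exact hys
      have h1 := (hL.tendsto x' hx').eventually (gt_mem_nhds hδ)
      obtain ⟨O, hO, hOsub⟩ := mem_comap.1 h1
      obtain ⟨O', hO'O, hO', hxO'⟩ := mem_nhds_iff.1 hO
      have hopen : IsOpen (c.toFun '' (univ ×ˢ {y | ∃ r ∈ Ioo 0 (c.ε : ℝ), ∃ x ∈ O',
          y = OpenCone.mk c.ε r x})) :=
        c.isOpenEmbedding.isOpenMap _ (isOpen_univ.prod (OpenCone.isOpen_mk_image hO'))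
      refine mem_comap.2 ⟨c.nhd (Metric.ball b₀ (ρ / 2)) (ρ / 2) ∩ _,
        ((c.isOpen_nhd hball _).inter hopen).mem_nhds
        ⟨hy, _, ⟨mem_univ _, r', ⟨h0, hr'.2⟩, x', hxO', rfl⟩, rfl⟩, ?_⟩
      rintro x ⟨hx, ⟨b₂, y₂⟩, ⟨-, r₂, hr₂, x₂, hx₂, hy₂⟩, hxy⟩
      obtain ⟨b, hb, r, hr, hr1, x'', rfl, hwx⟩ := hreg x hx
      rw [c.reg_eq b r hr] at hxy
      have h3 := congrArg Prod.snd (c.isOpenEmbedding.injective hxy)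
      change y₂ = OpenCone.mk c.ε r x''.1 at h3
      change y₂ = _ at hy₂
      rw [hy₂] at h3
      obtain ⟨-, h4⟩ := OpenCone.mk_inj hr₂ hr h3
      have h5 : wL x'' < δ := hOsub (hO'O (h4 ▸ hx₂) : (x'' : c.link.carrier) ∈ O)
      change w _ < δ
      rw [hwx]
      exact (mul_le_of_le_one_left (hL.pos _).le hr1).trans_lt h5
  · obtain ⟨CL, hCL⟩ := hL.hardy
    obtain ⟨K, hK⟩ := hΦ.hardy hρ hq hp c.dim_eq hl hL.contMDiff.continuous.measurable hCL
    have hΦρ := hΦ.mono hρ2.le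
    obtain ⟨Kv, hKv, -⟩ := hΦρ.volume_comparison hq hp c.dim_eq
    have := isLocallyFiniteMeasure_formVol hp
    -- The ball `U` in the base keeps the larger radius `2ρ`; only `r` is restricted to `(0, ρ)`,
    -- the range in which the cone inequality bounds the left-hand side.
    set A := c.reg '' coneDomain c.link.Reg U ρ
    have hA : IsOpen A := hΦρ.isOpen_image _ le_rfl (isOpen_coneDomain hΦ.isOpen _)
    refine ⟨Kv * K + 1, fun u e hu hc he he0 hd ↦ ?_⟩
    set T := ∫⁻ x, ENNReal.ofReal (u x ^ 2 + e x) ∂(formVol X.I q)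
    have hum := hu.continuous.measurable
    have hwm := hwC.continuous.measurable
    rw [← lintegral_add_compl _ hA.measurableSet, ENNReal.coe_add, add_mul, ENNReal.coe_one,
      one_mul]
    refine add_le_add ?_ ?_
    · calc _ ≤ ∫⁻ x, ENNReal.ofReal (u x ^ 2 / w x ^ 2)
            ∂(Kv • (coneMeasure c.link.I p U ρ).map c.reg) := lintegral_mono' hKv le_rfl
        _ = Kv * ∫⁻ z, ENNReal.ofReal (u (c.reg z) ^ 2 / w (c.reg z) ^ 2)
            ∂(coneMeasure c.link.I p U ρ) := by
          rw [lintegral_smul_measure, lintegral_map' (by fun_prop) hΦρ.aemeasurable]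
          rfl
        _ ≤ Kv * ∫⁻ z, ENNReal.ofReal (u (c.reg z) ^ 2 / (z.2.1 * wL z.2.2) ^ 2)
            ∂(coneMeasure c.link.I p U ρ) := by
          refine mul_le_mul_right (lintegral_mono_ae ?_) _
          filter_upwards [compl_mem_ae_iff.2 (coneMeasure_compl_coneDomain (J := c.link.I) (p := p)
            (ρ := ρ) hΦ.isOpen.measurableSet)] with z hz
          replace hz : z ∈ coneDomain c.link.Reg U ρ := not_not.1 hz
          have hzD : z ∈ D := ⟨hz.1, ⟨hz.2.1.1, hz.2.1.2.trans hρ2⟩, hz.2.2⟩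
          have h1 := (hrw z hzD).1
          have h2 : z.2.1 * wL z.2.2 ≤ w (c.reg z) := by
            rw [hw_in z hzD]
            exact le_coneWeight (hrw z hzD).2
          gcongr
        _ ≤ Kv * (K * T) := by
          refine mul_le_mul_right (hK u e hu he he0 hd ?_ ?_) _
          · intro b hb r hr
            have hr' : r ∈ Ioo (0 : ℝ) c.ε := ⟨hr.1, (hr.2.trans hρ2).trans_le hρε⟩
            exact HasCompactSupport.intro (c.isCompact_slice hc b hr') fun x hx ↦
              image_eq_zero_of_notMem_tsupport hx
          · intro b hb x
            obtain ⟨δ, hδ, h⟩ := c.exists_forall_reg_notMem hc b x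
            exact ⟨δ, hδ, fun r hr ↦ image_eq_zero_of_notMem_tsupport (h r hr)⟩
        _ = _ := by
          rw [ENNReal.coe_mul, mul_assoc]
    · calc _ ≤ ∫⁻ x in Aᶜ, ENNReal.ofReal (u x ^ 2 + e x) ∂(formVol X.I q) := by
            refine setLIntegral_mono' hA.measurableSet.compl fun x hx ↦
              ENNReal.ofReal_le_ofReal ?_
            rw [hw_out x fun z hz hzx ↦ Or.inr (not_lt.1 fun h ↦
              hx ⟨z, ⟨hz.1, ⟨hz.2.1.1, h⟩, hz.2.2⟩, hzx⟩)]
            simpa using he0 x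
        _ ≤ T := setLIntegral_le_lintegral _ _

end ConeChart

end LocalWeight

/-! ### From local weights to a weight on the whole singular stratum. -/

section Globalize

variable {X : StratSpace.{u}}
  {q : X.Reg → EuclideanSpace ℝ (Fin X.dim) →L[ℝ] EuclideanSpace ℝ (Fin X.dim) →L[ℝ] ℝ}

theorem StratSpace.isOpenMap_val (X : StratSpace.{u}) :
    IsOpenMap (Subtype.val : X.Reg → X.carrier) := X.isOpen_smooth.isOpenMap_subtype_val

theorem isCompact_sing (X : StratSpace.{u}) [CompactSpace X.carrier] : IsCompact X.sing :=
  (isClosed_compl_iff.2 (X.isOpen_smooth) : IsClosed {p | X.depth p = 0}ᶜ).isCompact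

/-- The form `q` is comparable near the point `p` to the form of a cone over a link with a Hardy
weight. -/
def HasHardyChartAt (X : StratSpace.{u})
    (q : X.Reg → EuclideanSpace ℝ (Fin X.dim) →L[ℝ] EuclideanSpace ℝ (Fin X.dim) →L[ℝ] ℝ)
    (p : X.carrier) : Prop :=
  ∃ (Λ : Level.{u}) (c : ConeChart Λ X) (b₀ : EuclideanSpace ℝ (Fin c.h)) (x₀ : c.link.carrier)
    (pL : c.link.Reg → EuclideanSpace ℝ (Fin c.link.dim) →L[ℝ]
      EuclideanSpace ℝ (Fin c.link.dim) →L[ℝ] ℝ) (η C : ℝ),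
    c.pt b₀ 0 x₀ = p ∧ SecondCountableTopology c.link.Reg ∧ 2 ≤ c.link.dim ∧
    IsContForm c.link.I pL ∧ (∃ w, IsHardyWeightOn c.link pL c.link.sing w) ∧ 0 < η ∧ η ≤ c.ε ∧
    IsConeParam X.I c.link.I q pL c.reg (Metric.ball b₀ η) η C

theorem IsConeParam.mono_set {n h l : ℕ} {H HL : Type*} [TopologicalSpace H] [TopologicalSpace HL]
    {I : ModelWithCorners ℝ (EuclideanSpace ℝ (Fin n)) H}
    {J : ModelWithCorners ℝ (EuclideanSpace ℝ (Fin l)) HL}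
    {R : Type*} [TopologicalSpace R] [ChartedSpace H R]
    {S : Type*} [TopologicalSpace S] [ChartedSpace HL S]
    {q : R → EuclideanSpace ℝ (Fin n) →L[ℝ] EuclideanSpace ℝ (Fin n) →L[ℝ] ℝ}
    {p : S → EuclideanSpace ℝ (Fin l) →L[ℝ] EuclideanSpace ℝ (Fin l) →L[ℝ] ℝ}
    {Φ : EuclideanSpace ℝ (Fin h) × ℝ × S → R} {U U' : Set (EuclideanSpace ℝ (Fin h))} {ρ C : ℝ}
    (hΦ : IsConeParam I J q p Φ U ρ C) (hU' : IsOpen U') (h : U' ⊆ U) :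
    IsConeParam I J q p Φ U' ρ C := by
  have hsub : coneDomain S U' ρ ⊆ coneDomain S U ρ := prod_mono h le_rfl
  exact ⟨hU', fun z hz ↦ hΦ.contMDiffAt z (hsub hz), hΦ.injOn.mono hsub,
    fun V hV ↦ hΦ.isOpen_image V (hV.trans hsub), hΦ.pos, fun z hz ↦ hΦ.le_form z (hsub hz),
    fun z hz ↦ hΦ.form_le z (hsub hz)⟩

/-- Having a weight is inherited by smaller sets and by unions, and holds near each singular point.
Compactness of the singular stratum therefore gives a single weight. -/
theorem exists_isHardyWeightOn_sing [CompactSpace X.carrier] [T2Space X.carrier]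
    [SecondCountableTopology X.Reg] (hq : IsContForm X.I q)
    (h : ∀ p ∈ X.sing, HasHardyChartAt X q p) : ∃ w, IsHardyWeightOn X q X.sing w := by
  have key : ∃ w, IsHardyWeightOn X q (X.sing ∩ X.sing) w := by
    refine (isCompact_sing X).induction_on (p := fun s ↦ ∃ w, IsHardyWeightOn X q (s ∩ X.sing) w)
      ⟨_, by simpa using isHardyWeightOn_one⟩ ?_ ?_ ?_
    · rintro s t hst ⟨w, hw⟩
      exact ⟨w, hw.mono (inter_subset_inter_left _ hst)⟩
    · rintro s t ⟨w, hw⟩ ⟨w', hw'⟩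
      rw [union_inter_distrib_right]
      exact ⟨_, hw.union hw'⟩
    · intro p hp
      obtain ⟨Λ, c, b₀, x₀, pL, η, C, rfl, hsc, hl, hpL, ⟨w, hw⟩, hη, hηε, hΦ⟩ := h p hp
      -- The chart must contain the domain of radius `2ρ`, and `2ρ ≤ 1` keeps `r wL ≤ 1`.
      set ρ := min η 1 / 2
      have hm : 0 < min η 1 := lt_min hη one_pos
      have hρ : 0 < ρ := half_pos hm
      have hρ2 : 2 * ρ = min η 1 := by simp only [ρ]; ring
      have hρη : 2 * ρ ≤ η := hρ2 ▸ min_le_left _ _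
      refine ⟨c.nhd (Metric.ball b₀ (ρ / 2)) (ρ / 2), mem_nhdsWithin_of_mem_nhds
        ((c.isOpen_nhd Metric.isOpen_ball _).mem_nhds (c.mem_nhd_iff.2 ⟨b₀,
          Metric.mem_ball_self (half_pos hρ), 0, ⟨le_rfl, c.ε.2⟩, half_pos hρ, x₀, rfl⟩)), ?_⟩
      exact c.exists_isHardyWeightOn hq hpL hl hρ (hρ2 ▸ min_le_right _ _) (hρη.trans hηε)
        ((hΦ.mono hρη).mono_set Metric.isOpen_ball (Metric.ball_subset_ball hρη)) hw
  rwa [inter_self] at key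

end Globalize

/-! ### Second countability of the smooth stratum. -/

section SecondCountable

theorem ConeChart.isOpen_reg_image {Λ : Level.{u}} {X : StratSpace.{u}} (c : ConeChart Λ X)
    {V : Set (EuclideanSpace ℝ (Fin c.h) × ℝ × c.link.Reg)}
    (hV : V ⊆ univ ×ˢ Ioo (0 : ℝ) c.ε ×ˢ univ) (hVo : IsOpen V) : IsOpen (c.reg '' V) := by
  rw [isOpen_iff_mem_nhds]
  rintro _ ⟨z, hz, rfl⟩
  rw [← c.reg_diffeo.isLocalHomeomorphOn.map_nhds_eq (hV hz)]
  exact image_mem_map (hVo.mem_nhds hz)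

theorem ConeChart.secondCountableTopology_range {Λ : Level.{u}} {X : StratSpace.{u}}
    (c : ConeChart Λ X) [SecondCountableTopology c.link.Reg] :
    SecondCountableTopology (c.reg '' (univ ×ˢ Ioo (0 : ℝ) c.ε ×ˢ univ)) := by
  set D : Set (EuclideanSpace ℝ (Fin c.h) × ℝ × c.link.Reg) := univ ×ˢ Ioo (0 : ℝ) c.ε ×ˢ univ
  have hD : IsOpen D := isOpen_univ.prod (isOpen_Ioo.prod isOpen_univ)
  have hcont : ContinuousOn c.reg D :=
    fun z hz ↦ (c.reg_diffeo ⟨z, hz⟩).contMDiffAt.continuousAt.continuousWithinAt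
  have hemb : IsOpenEmbedding (D.domRestrict c.reg) := by
    refine .of_continuous_injective_isOpenMap hcont.domRestrict c.reg_injOn.injective fun V hV ↦ ?_
    rw [show D.domRestrict c.reg '' V = c.reg '' (Subtype.val '' V) by rw [image_image]; rfl]
    exact c.isOpen_reg_image (Subtype.coe_image_subset D V) (hD.isOpenMap_subtype_val V hV)
  have h := hemb.isEmbedding.toHomeomorph.symm.secondCountableTopology
  rw [range_domRestrict] at h
  exact h

/-- The smooth stratum itself is not compact, but the ambient space is: finitely many neighbourhoods
suffice. Each meets the smooth stratum in a smooth chart domain or in a chart image `ℝʰ × (0, ε) ×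
L.Reg`, both second countable. -/
theorem secondCountableTopology_reg_of_cover {X : StratSpace.{u}} [CompactSpace X.carrier]
    (h : ∀ p ∈ X.sing, ∃ (Λ : Level.{u}) (c : ConeChart Λ X) (b : EuclideanSpace ℝ (Fin c.h))
      (x : c.link.carrier), c.pt b 0 x = p ∧ SecondCountableTopology c.link.Reg) :
    SecondCountableTopology X.Reg := by
  have key : ∃ F : Set (Set X.Reg), F.Countable ∧
      (∀ O ∈ F, IsOpen O ∧ SecondCountableTopology O) ∧ Subtype.val ⁻¹' univ ⊆ ⋃₀ F := by
    refine isCompact_univ.induction_on (p := fun s : Set X.carrier ↦ ∃ F : Set (Set X.Reg),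
      F.Countable ∧ (∀ O ∈ F, IsOpen O ∧ SecondCountableTopology O) ∧
        Subtype.val ⁻¹' s ⊆ ⋃₀ F) ⟨∅, by simp⟩ ?_ ?_ ?_
    · rintro s t hst ⟨F, h1, h2, h3⟩
      exact ⟨F, h1, h2, (preimage_mono hst).trans h3⟩
    · rintro s t ⟨F, h1, h2, h3⟩ ⟨F', h1', h2', h3'⟩
      refine ⟨F ∪ F', h1.union h1', fun O hO ↦ hO.elim (h2 O) (h2' O), ?_⟩
      rw [preimage_union, sUnion_union]
      exact union_subset_union h3 h3'
    · intro p _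
      rw [nhdsWithin_univ]
      by_cases hp : X.depth p = 0
      · have ho := (chartAt X.H (⟨p, hp⟩ : X.Reg)).open_source
        refine ⟨Subtype.val '' (chartAt X.H (⟨p, hp⟩ : X.Reg)).source,
          (X.isOpenMap_val _ ho).mem_nhds ⟨_, mem_chart_source _ _, rfl⟩,
          {(chartAt X.H (⟨p, hp⟩ : X.Reg)).source}, countable_singleton _, ?_, ?_⟩
        · rintro O rfl
          have := X.I.secondCountableTopology
          exact ⟨ho, (chartAt X.H
            (⟨p, hp⟩ : X.Reg)).toHomeomorphSourceTarget.secondCountableTopology⟩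
        · rw [sUnion_singleton, preimage_image_eq _ Subtype.val_injective]
      · obtain ⟨Λ, c, b, x, rfl, hsc⟩ := h p hp
        refine ⟨c.nhd univ c.ε, (c.isOpen_nhd isOpen_univ _).mem_nhds (c.mem_nhd_iff.2
          ⟨b, mem_univ _, 0, ⟨le_rfl, c.ε.2⟩, c.ε.2, x, rfl⟩), {c.reg '' (univ ×ˢ Ioo (0 : ℝ) c.ε ×ˢ univ)},
          countable_singleton _, ?_, ?_⟩
        · rintro O rfl
          exact ⟨c.isOpen_reg_image le_rfl (isOpen_univ.prod (isOpen_Ioo.prod isOpen_univ)),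
            c.secondCountableTopology_range⟩
        · intro y hy
          obtain ⟨b, hb, r, hr, -, x, rfl⟩ := c.mem_nhd_reg hy
          exact ⟨_, rfl, (b, r, x), ⟨hb, hr, mem_univ _⟩, rfl⟩
  obtain ⟨F, h1, h2, h3⟩ := key
  have := h1.to_subtype
  have : ∀ O : F, SecondCountableTopology (O : Set X.Reg) := fun O ↦ (h2 O O.2).2
  refine TopologicalSpace.secondCountableTopology_of_countable_cover
    (U := fun O : F ↦ (O : Set X.Reg)) (fun O ↦ (h2 O O.2).1) ?_
  rw [← sUnion_eq_iUnion]
  exact univ_subset_iff.1 h3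

/-- The smooth stratum of a compact space with conical singularities is second countable. -/
theorem secondCountableTopology_reg : ∀ (m : ℕ) {X : StratSpace.{u}}, (level.{u} m).Str X →
    ∀ [CompactSpace X.carrier], SecondCountableTopology X.Reg
  | 0, X, A, _ => secondCountableTopology_reg_of_cover fun p hp ↦ absurd (A.2 p) hp
  | m + 1, X, A, _ => by
    refine secondCountableTopology_reg_of_cover fun p hp ↦ ?_
    obtain ⟨c, hc, -, b, x, hx⟩ := ConeAtlas.cover A p hp
    exact ⟨_, c, b, x, hx, secondCountableTopology_reg m c.str⟩

end SecondCountable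

/-! ### Conic metrics are comparable to the model form of a cone. -/

section FormEquiv

variable {E : Type*} [NormedAddCommGroup E] [NormedSpace ℝ E] [FiniteDimensional ℝ E]

/-- The constant is the minimum of the form on the compact unit sphere. -/
theorem IsPosForm.exists_bounds {Q : E →L[ℝ] E →L[ℝ] ℝ} (hQ : IsPosForm Q) :
    ∃ c > 0, ∀ v, c * ‖v‖ ^ 2 ≤ Q v v := by
  rcases subsingleton_or_nontrivial E with h | h
  · exact ⟨1, one_pos, fun v ↦ by simp [Subsingleton.elim v 0]⟩
  obtain ⟨v₀, hv₀, hmin⟩ := (isCompact_sphere (0 : E) 1).exists_isMinOn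
    (NormedSpace.sphere_nonempty.2 zero_le_one) (f := fun v ↦ Q v v)
    (Q.continuous.clm_apply continuous_id).continuousOn
  have hne : v₀ ≠ 0 := fun h0 ↦ by simp [h0] at hv₀
  refine ⟨Q v₀ v₀, hQ.pos _ hne, fun v ↦ ?_⟩
  rcases eq_or_ne v 0 with rfl | hv
  · simp
  have hn : 0 < ‖v‖ := norm_pos_iff.2 hv
  have h1 : Q v₀ v₀ ≤ Q (‖v‖⁻¹ • v) (‖v‖⁻¹ • v) := hmin (by simp [norm_smul, hn.ne'])
  rw [map_smul, map_smul, FunLike.coe_smul, Pi.smul_apply, smul_eq_mul, smul_eq_mul] at h1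
  calc _ ≤ (‖v‖⁻¹ * (‖v‖⁻¹ * Q v v)) * ‖v‖ ^ 2 := by gcongr
    _ = _ := by field_simp

omit [FiniteDimensional ℝ E] in
theorem exists_form_le (Q : E →L[ℝ] E →L[ℝ] ℝ) : ∃ C, 0 ≤ C ∧ ∀ v, Q v v ≤ C * ‖v‖ ^ 2 := by
  refine ⟨‖Q‖, Q.opNorm_nonneg, fun v ↦ ?_⟩
  rw [pow_two, ← mul_assoc]
  exact (le_abs_self _).trans (Q.le_opNorm₂ v v)

omit [FiniteDimensional ℝ E] in
theorem eventually_abs_form_sub_le {T : Type*} {l : Filter T} {q : T → E →L[ℝ] E →L[ℝ] ℝ}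
    {Q : E →L[ℝ] E →L[ℝ] ℝ} (hq : Tendsto q l (𝓝 Q)) {c : ℝ} (hc : 0 < c) :
    ∀ᶠ t in l, ∀ v, |q t v v - Q v v| ≤ c * ‖v‖ ^ 2 := by
  have hq' : Tendsto (fun t ↦ ‖q t - Q‖) l (𝓝 0) :=
    (tendsto_iff_norm_sub_tendsto_zero (E := E →L[ℝ] E →L[ℝ] ℝ)).1 hq
  filter_upwards [hq'.eventually (gt_mem_nhds hc)] with t ht v
  calc _ ≤ ‖q t - Q‖ * ‖v‖ * ‖v‖ := (q t - Q).le_opNorm₂ v v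
    _ ≤ c * ‖v‖ * ‖v‖ := by gcongr
    _ = _ := by ring

/-- Near a point, a continuous field of positive forms is comparable to the norm. -/
theorem exists_eventually_form_bounds {T : Type*} {l : Filter T} {q : T → E →L[ℝ] E →L[ℝ] ℝ}
    {Q : E →L[ℝ] E →L[ℝ] ℝ} (hQ : IsPosForm Q) (hq : Tendsto q l (𝓝 Q)) :
    ∃ C > 0, ∀ᶠ t in l, ∀ v, ‖v‖ ^ 2 ≤ C * q t v v ∧ q t v v ≤ C * ‖v‖ ^ 2 := by
  obtain ⟨c, hc, hcQ⟩ := hQ.exists_bounds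
  obtain ⟨D, hD, hDQ⟩ := exists_form_le Q
  refine ⟨max (2 / c) (D + c / 2), lt_max_of_lt_left (by positivity), ?_⟩
  filter_upwards [eventually_abs_form_sub_le hq (half_pos hc)] with t h1 v
  obtain ⟨h2, h3⟩ := abs_le.1 (h1 v)
  have h4 := hcQ v
  have h5 : c / 2 * ‖v‖ ^ 2 ≤ q t v v := by linarith
  have h6 : 0 ≤ q t v v := le_trans (by positivity) h5
  constructor
  · calc ‖v‖ ^ 2 = 2 / c * (c / 2 * ‖v‖ ^ 2) := by field_simp
      _ ≤ 2 / c * q t v v := by gcongr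
      _ ≤ _ := by
        gcongr
        exact le_max_left _ _
  · have h7 := hDQ v
    calc q t v v ≤ (D + c / 2) * ‖v‖ ^ 2 := by linarith
      _ ≤ _ := by
        gcongr
        exact le_max_right _ _

end FormEquiv


section Conic

variable {B : Type} [NormedAddCommGroup B] [NormedSpace ℝ B]

theorem dsymm_model (b₀ b : B) : dsymm 𝓘(ℝ, B) b₀ b = .id ℝ B := by
  unfold dsymm
  simp only [modelWithCornersSelf_coe, range_id, mfderivWithin_univ]
  exact mfderiv_id

theorem BaseMetric.continuous_form [FiniteDimensional ℝ B] (gB : BaseMetric B) :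
    Continuous (Metric.form (R := B) gB) := by
  have h := (Metric.isContForm (R := B) gB).continuousOn 0
  rw [extChartAt_model_space_eq_id, PartialEquiv.refl_target, continuousOn_univ] at h
  refine h.congr fun b ↦ ?_
  ext v w
  rw [chartForm_apply, dsymm_model, extChartAt_model_space_eq_id]
  rfl

/-- Bounds for the warping function of a conic metric. -/
theorem exists_eventually_warping_bounds {β : B → ℝ → ℝ} {a : B → ℝ} {ε : ℝ} (hε : 0 < ε)
    (hβ : ContDiffOn ℝ ∞ (fun q : B × ℝ ↦ β q.1 q.2) (univ ×ˢ Ioo 0 ε))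
    (ha : ∀ b, 0 < a b ∧ IsLittleO₂ (fun b r ↦ β b r - a b * r) 1 b) (b₀ : B) :
    ∃ c > 0, ∃ C, ∀ᶠ z : B × ℝ in 𝓝 b₀ ×ˢ 𝓝[>] 0, c * z.2 ≤ β z.1 z.2 ∧ β z.1 z.2 ≤ C * z.2 ∧
      c ≤ deriv (β z.1) z.2 ∧ deriv (β z.1) z.2 ≤ C := by
  obtain ⟨ha₀, hlit⟩ := ha b₀
  have hη : 0 < a b₀ / 8 := by positivity
  have hr : ∀ᶠ r : ℝ in 𝓝[>] 0, r ∈ Ioo 0 ε := Ioo_mem_nhdsGT hε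
  have hopen : IsOpen (univ ×ˢ Ioo 0 ε : Set (B × ℝ)) := isOpen_univ.prod isOpen_Ioo
  have h0 := (hlit 0 (by norm_num)).def hη
  have h1 := (hlit 1 (by norm_num)).def hη
  have h0' : ∀ᶠ z : B × ℝ in 𝓝 b₀ ×ˢ 𝓝[>] 0, z.2 ∈ Ioo 0 ε ∧
      |β z.1 z.2 - a z.1 * z.2| ≤ a b₀ / 8 * z.2 := by
    filter_upwards [h0, hr.prod_inr (𝓝 b₀)] with z hz hzr
    rw [pow_zero, one_mul, iteratedDeriv_zero, pow_one, Real.norm_eq_abs, Real.norm_eq_abs,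
      abs_of_pos hzr.1] at hz
    exact ⟨hzr, hz⟩
  have h1' : ∀ᶠ z : B × ℝ in 𝓝 b₀ ×ˢ 𝓝[>] 0, |deriv (β z.1) z.2 - a z.1| ≤ a b₀ / 8 := by
    filter_upwards [h1, hr.prod_inr (𝓝 b₀)] with z hz hzr
    have hd : DifferentiableAt ℝ (β z.1) z.2 := by
      have h2 : ContDiffAt ℝ ∞ (fun q : B × ℝ ↦ β q.1 q.2) (z.1, z.2) :=
        hβ.contDiffAt (hopen.mem_nhds ⟨mem_univ _, hzr⟩)
      exact (h2.differentiableAt (by simp)).comp z.2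
        ((differentiableAt_const z.1).prodMk differentiableAt_id)
    have hd' : HasDerivAt (fun r ↦ β z.1 r - a z.1 * r) (deriv (β z.1) z.2 - a z.1) z.2 := by
      have h3 := hd.hasDerivAt.sub ((hasDerivAt_id z.2).const_mul (a z.1))
      rw [mul_one] at h3
      exact h3
    rw [pow_one, iteratedDeriv_one, hd'.deriv, norm_mul, mul_comm] at hz
    exact le_of_mul_le_mul_right hz (norm_pos_iff.2 hzr.1.ne')
  -- The slope `a` is not assumed continuous. At a fixed small radius `r₁` it is within `a b₀ / 8`
  -- of `β(·, r₁)/r₁`, which is continuous; this gives three errors of that size.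
  have hab : ∀ᶠ b in 𝓝 b₀, |a b - a b₀| ≤ 3 * (a b₀ / 8) := by
    obtain ⟨pa, hpa, pb, hpb, hp⟩ := eventually_prod_iff.1 h0'
    obtain ⟨r₁, hr₁⟩ := hpb.exists
    have h2 := fun b hb ↦ hp (x := b) hb hr₁
    have hr₁0 : 0 < r₁ := (h2 b₀ hpa.self_of_nhds).1.1
    have hcont : ContinuousAt (fun b ↦ β b r₁) b₀ := by
      have h3 : ContDiffAt ℝ ∞ (fun q : B × ℝ ↦ β q.1 q.2) (b₀, r₁) :=
        hβ.contDiffAt (hopen.mem_nhds ⟨mem_univ _, (h2 b₀ hpa.self_of_nhds).1⟩)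
      exact ContinuousAt.comp (f := fun b ↦ (b, r₁)) (g := fun q : B × ℝ ↦ β q.1 q.2)
        h3.continuousAt (by fun_prop)
    filter_upwards [hpa, Metric.tendsto_nhds.1 hcont _ (mul_pos hη hr₁0)] with b hb hb'
    rw [Real.dist_eq] at hb'
    have e1 := abs_le.1 (h2 b hb).2
    have e2 := abs_le.1 (h2 b₀ hpa.self_of_nhds).2
    have e3 := abs_lt.1 hb'
    simp only at e1 e2
    rw [abs_le]
    constructor
    · refine le_of_mul_le_mul_right ?_ hr₁0
      linarith
    · refine le_of_mul_le_mul_right ?_ hr₁0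
      linarith
  -- `a b` lies between `5/8` and `11/8` of `a b₀`, and a further error of `1/8` is allowed.
  refine ⟨a b₀ / 2, by positivity, 3 / 2 * a b₀, ?_⟩
  filter_upwards [h0', h1', hab.prod_inl (𝓝[>] 0)] with z hz0 hz1 hz2
  have e0 := abs_le.1 hz0.2
  have e1 := abs_le.1 hz1
  have e2 := abs_le.1 hz2
  have hz : 0 < z.2 := hz0.1.1
  have e3 : (a b₀ - 3 * (a b₀ / 8)) * z.2 ≤ a z.1 * z.2 := by gcongr; linarith
  have e4 : a z.1 * z.2 ≤ (a b₀ + 3 * (a b₀ / 8)) * z.2 := by gcongr; linarith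
  refine ⟨by linarith, by linarith, by linarith, by linarith⟩

variable {L : StratSpace.{u}} {E : Type*} [NormedAddCommGroup E] [NormedSpace ℝ E] {H : Type*}
    [TopologicalSpace H] {J : ModelWithCorners ℝ E H} {N : Type*} [TopologicalSpace N]
    [ChartedSpace H N] [IsManifold J ∞ N] {G : Metric J N} {Φ : B × ℝ × L.Reg → N} {ε : ℝ}
    {gB : BaseMetric B} {gL : ProdMetric B L}

/-- A conic metric is comparable to `|db|² + dr² + r² g_L(b)`. -/
theorem IsConicForm.exists_bounds [FiniteDimensional ℝ B] (h : IsConicForm G Φ ε gB gL)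
    (hε : 0 < ε) (b₀ : B) :
    ∃ C > 0, ∀ᶠ z : B × ℝ in 𝓝 b₀ ×ˢ 𝓝[>] 0,
      ∀ (x : L.Reg) (V : B × ℝ × EuclideanSpace ℝ (Fin L.dim)),
        ‖V.1‖ ^ 2 + V.2.1 ^ 2 + z.2 ^ 2 * gL.inner (z.1, x) ((0 : B), V.2.2) ((0 : B), V.2.2) ≤
          C * pullbackForm G Φ z.1 z.2 x V V ∧
        pullbackForm G Φ z.1 z.2 x V V ≤ C * (‖V.1‖ ^ 2 + V.2.1 ^ 2 +
          z.2 ^ 2 * gL.inner (z.1, x) ((0 : B), V.2.2) ((0 : B), V.2.2)) := by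
  obtain ⟨-, β, a, hβ, ha, herr⟩ := h
  obtain ⟨c, hc, C, hbd⟩ := exists_eventually_warping_bounds hε hβ ha b₀
  obtain ⟨D, hD, hB⟩ := exists_eventually_form_bounds ((Metric.isPosForm (R := B) gB) b₀)
    ((BaseMetric.continuous_form gB).tendsto b₀)
  -- `κ S` is a lower bound for the model metric, and an error of `κ/2` times `S` is affordable.
  set κ := min 1 (c ^ 2)
  have hκ : 0 < κ := lt_min one_pos (by positivity)
  have hκ1 : κ ≤ 1 := min_le_left _ _
  have hκc : κ ≤ c ^ 2 := min_le_right _ _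
  set M := 1 + C ^ 2
  have hM : 0 < M := by positivity
  set D' := max D 1
  have hD' : 1 ≤ D' := le_max_right _ _
  refine ⟨max (2 * D' / κ) ((M + κ) * D'), lt_max_of_lt_left (by positivity), ?_⟩
  have hr : ∀ᶠ r : ℝ in 𝓝[>] 0, r ∈ Ioo (0 : ℝ) 1 := Ioo_mem_nhdsGT one_pos
  filter_upwards [hbd, herr b₀ 0 (by norm_num) (κ / 2) (by positivity), hB.prod_inl (𝓝[>] 0),
    hr.prod_inr (𝓝 b₀)] with z hz hzerr hzB hzr x V
  set gb := gB.inner z.1 V.1 V.1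
  set gl := gL.inner (z.1, x) ((0 : B), V.2.2) ((0 : B), V.2.2)
  have hgb0 : 0 ≤ gb := ((Metric.isPosForm (R := B) gB) z.1).nonneg V.1
  have hgl0 : 0 ≤ gl := ((Metric.isPosForm (R := B × L.Reg) gL) (z.1, x)).nonneg ((0 : B), V.2.2)
  obtain ⟨hgb1, hgb2⟩ := hzB V.1
  change _ ≤ D * gb at hgb1
  change gb ≤ _ at hgb2
  have hr0 := hzr.1
  have hrsq : z.2 ^ 2 ≤ 1 := pow_le_one₀ hr0.le hzr.2.le
  set S := gb + V.2.1 ^ 2 + z.2 ^ 2 * gl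
  have hS0 : 0 ≤ S := by positivity
  have hmodel : coneModel gB gL β z.1 z.2 x V V =
      gb + deriv (β z.1) z.2 ^ 2 * V.2.1 ^ 2 + β z.1 z.2 ^ 2 * gl := by
    simp only [coneModel, pow_two]
    rfl
  have e := hzerr x V V
  rw [pow_zero, one_mul, iteratedDeriv_zero, Real.mul_self_sqrt
    (by unfold refNormSq; positivity : 0 ≤ refNormSq gB gL z.1 x V)] at e
  -- The error is small relative to `r²` times the reference metric, which for `r ≤ 1` is dominated
  -- by the cone metric, also in the link directions where the cone metric degenerates. Only the
  -- undifferentiated error estimate is used.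
  have eref : z.2 ^ 2 * refNormSq gB gL z.1 x V ≤ S := by
    have i1 : z.2 ^ 2 * gb ≤ gb := mul_le_of_le_one_left hgb0 hrsq
    have i2 : z.2 ^ 2 * V.2.1 ^ 2 ≤ V.2.1 ^ 2 := mul_le_of_le_one_left (sq_nonneg _) hrsq
    calc _ = z.2 ^ 2 * gb + z.2 ^ 2 * V.2.1 ^ 2 + z.2 ^ 2 * gl := by
          simp only [refNormSq]
          ring
      _ ≤ S := by simp only [S]; linarith
  have e' : |pullbackForm G Φ z.1 z.2 x V V - coneModel gB gL β z.1 z.2 x V V| ≤ κ / 2 * S := by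
    refine e.trans ?_
    rw [mul_assoc]
    gcongr
  obtain ⟨e1, e2⟩ := abs_le.1 e'
  have hβ0 : 0 ≤ β z.1 z.2 := le_trans (by positivity) hz.1
  have hd0 : 0 ≤ deriv (β z.1) z.2 := hc.le.trans hz.2.2.1
  have m1 : κ * S ≤ coneModel gB gL β z.1 z.2 x V V := by
    rw [hmodel]
    have i1 : κ * gb ≤ gb := mul_le_of_le_one_left hgb0 hκ1
    have i2 : κ * V.2.1 ^ 2 ≤ deriv (β z.1) z.2 ^ 2 * V.2.1 ^ 2 := by
      gcongr
      exact hκc.trans (pow_le_pow_left₀ hc.le hz.2.2.1 2)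
    have i3 : κ * (z.2 ^ 2 * gl) ≤ β z.1 z.2 ^ 2 * gl := by
      rw [← mul_assoc]
      gcongr
      calc κ * z.2 ^ 2 ≤ c ^ 2 * z.2 ^ 2 := by gcongr
        _ = (c * z.2) ^ 2 := by ring
        _ ≤ _ := pow_le_pow_left₀ (by positivity) hz.1 2
    simp only [S]
    linarith
  have m2 : coneModel gB gL β z.1 z.2 x V V ≤ M * S := by
    rw [hmodel]
    have i1 : gb ≤ M * gb := le_mul_of_one_le_left hgb0 (by simp only [M]; nlinarith [sq_nonneg C])
    have i2 : deriv (β z.1) z.2 ^ 2 * V.2.1 ^ 2 ≤ M * V.2.1 ^ 2 := by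
      gcongr
      exact (pow_le_pow_left₀ hd0 hz.2.2.2 2).trans (by simp only [M]; linarith)
    have i3 : β z.1 z.2 ^ 2 * gl ≤ M * (z.2 ^ 2 * gl) := by
      rw [← mul_assoc]
      gcongr
      calc β z.1 z.2 ^ 2 ≤ (C * z.2) ^ 2 := pow_le_pow_left₀ hβ0 hz.2.1 2
        _ = C ^ 2 * z.2 ^ 2 := by ring
        _ ≤ _ := by gcongr; simp only [M]; linarith
    simp only [S]
    linarith
  have hrest : 0 ≤ V.2.1 ^ 2 + z.2 ^ 2 * gl := by positivity
  constructor
  · have j1 : ‖V.1‖ ^ 2 + V.2.1 ^ 2 + z.2 ^ 2 * gl ≤ D' * S := by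
      have k1 : D * gb ≤ D' * gb := by gcongr; exact le_max_left _ _
      have k2 : V.2.1 ^ 2 + z.2 ^ 2 * gl ≤ D' * (V.2.1 ^ 2 + z.2 ^ 2 * gl) :=
        le_mul_of_one_le_left hrest hD'
      simp only [S]
      linarith
    have j2 : S ≤ 2 / κ * pullbackForm G Φ z.1 z.2 x V V := by
      have : κ / 2 * S ≤ pullbackForm G Φ z.1 z.2 x V V := by linarith
      calc S = 2 / κ * (κ / 2 * S) := by field_simp
        _ ≤ _ := by gcongr
    have j3 : 0 ≤ pullbackForm G Φ z.1 z.2 x V V := by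
      have : 0 ≤ κ / 2 * S := by positivity
      linarith
    calc _ ≤ D' * S := j1
      _ ≤ D' * (2 / κ * pullbackForm G Φ z.1 z.2 x V V) := by gcongr
      _ = 2 * D' / κ * pullbackForm G Φ z.1 z.2 x V V := by ring
      _ ≤ _ := by gcongr; exact le_max_left _ _
  · have j1 : S ≤ D' * (‖V.1‖ ^ 2 + V.2.1 ^ 2 + z.2 ^ 2 * gl) := by
      have k1 : D * ‖V.1‖ ^ 2 ≤ D' * ‖V.1‖ ^ 2 := by gcongr; exact le_max_left _ _
      have k2 : V.2.1 ^ 2 + z.2 ^ 2 * gl ≤ D' * (V.2.1 ^ 2 + z.2 ^ 2 * gl) :=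
        le_mul_of_one_le_left hrest hD'
      simp only [S]
      linarith
    have hκS : 0 ≤ κ * S := by positivity
    calc pullbackForm G Φ z.1 z.2 x V V ≤ (M + κ) * S := by linarith
      _ ≤ (M + κ) * (D' * (‖V.1‖ ^ 2 + V.2.1 ^ 2 + z.2 ^ 2 * gl)) := by gcongr
      _ = (M + κ) * D' * (‖V.1‖ ^ 2 + V.2.1 ^ 2 + z.2 ^ 2 * gl) := by ring
      _ ≤ _ := by gcongr; exact le_max_right _ _

end Conic

/-! ### Restrictions of product metrics to slices, and freezing the base point. -/

section Slice

variable {P : Type} [NormedAddCommGroup P] [NormedSpace ℝ P] {X : StratSpace.{u}}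

/-- The restriction of a metric on `P × X` to the slice `{t} × X`. -/
def sliceForm (G : ProdMetric P X) (t : P) (x : X.Reg) :
    EuclideanSpace ℝ (Fin X.dim) →L[ℝ] EuclideanSpace ℝ (Fin X.dim) →L[ℝ] ℝ :=
  (Metric.form (R := P × X.Reg) G (t, x)).bilinearComp (.inr ℝ P _) (.inr ℝ P _)

theorem sliceForm_apply (G : ProdMetric P X) (t : P) (x : X.Reg)
    (ξ ξ' : EuclideanSpace ℝ (Fin X.dim)) :
    sliceForm G t x ξ ξ' = G.inner (t, x) ((0 : P), ξ) ((0 : P), ξ') := rfl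

theorem extChartAt_prod_symm_apply (t₀ t : P) (x₀ : X.Reg) (y : EuclideanSpace ℝ (Fin X.dim)) :
    (extChartAt (𝓘(ℝ, P).prod X.I) ((t₀, x₀) : P × X.Reg)).symm (t, y) =
      (t, (extChartAt X.I x₀).symm y) := by
  rw [extChartAt_prod]
  rfl

theorem mem_extChartAt_prod_target {t₀ t : P} {x₀ : X.Reg} {y : EuclideanSpace ℝ (Fin X.dim)} :
    (t, y) ∈ (extChartAt (𝓘(ℝ, P).prod X.I) ((t₀, x₀) : P × X.Reg)).target ↔
      y ∈ (extChartAt X.I x₀).target := by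
  rw [extChartAt_prod, PartialEquiv.prod_target, mem_prod, extChartAt_model_space_eq_id]
  exact ⟨And.right, fun h ↦ ⟨mem_univ _, h⟩⟩

/-- The inverse of the product chart, restricted to a slice, is `y ↦ (t, φ⁻¹ y)`; the claim compares
its differentials computed in two ways, which agree since `range X.I` has unique derivatives. -/
theorem dsymm_prod {t₀ t : P} {x₀ : X.Reg} {y : EuclideanSpace ℝ (Fin X.dim)}
    (hy : y ∈ (extChartAt X.I x₀).target) (v : EuclideanSpace ℝ (Fin X.dim)) :
    dsymm (𝓘(ℝ, P).prod X.I) ((t₀, x₀) : P × X.Reg) (t, y) (0, v) = (0, dsymm X.I x₀ y v) := by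
  have : IsManifold X.I 1 X.Reg := IsManifold.of_le (n := ∞) (by norm_cast)
  have : IsManifold (𝓘(ℝ, P).prod X.I) 1 (P × X.Reg) := IsManifold.of_le (n := ∞) (by norm_cast)
  set φ := extChartAt X.I x₀
  have hyr : y ∈ range X.I := extChartAt_target_subset_range x₀ hy
  have h1 : HasMFDerivWithinAt 𝓘(ℝ, P × EuclideanSpace ℝ (Fin X.dim)) (𝓘(ℝ, P).prod X.I)
      (extChartAt (𝓘(ℝ, P).prod X.I) ((t₀, x₀) : P × X.Reg)).symm (range (𝓘(ℝ, P).prod X.I))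
      (t, y) (dsymm (𝓘(ℝ, P).prod X.I) ((t₀, x₀) : P × X.Reg) (t, y)) :=
    (mdifferentiableWithinAt_extChartAt_symm (mem_extChartAt_prod_target.2 hy)).hasMFDerivWithinAt
  have h2 : HasMFDerivWithinAt 𝓘(ℝ, EuclideanSpace ℝ (Fin X.dim))
      𝓘(ℝ, P × EuclideanSpace ℝ (Fin X.dim)) (fun y ↦ (t, y)) (range X.I) y
      (ContinuousLinearMap.inr ℝ P (EuclideanSpace ℝ (Fin X.dim))) :=
    (hasFDerivAt_prodMk_right t y).hasFDerivWithinAt.hasMFDerivWithinAt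
  have h3 := h1.comp y h2 fun y' hy' ↦ by
    obtain ⟨z, rfl⟩ := hy'
    exact ⟨(t, z), rfl⟩
  set D := dsymm X.I x₀ y
  have h4 : HasMFDerivWithinAt 𝓘(ℝ, EuclideanSpace ℝ (Fin X.dim)) X.I φ.symm (range X.I) y D :=
    (mdifferentiableWithinAt_extChartAt_symm hy).hasMFDerivWithinAt
  have h5 := ((hasMFDerivAt_const (I := X.I) (I' := 𝓘(ℝ, P)) t (φ.symm y)).prodMk
    (hasMFDerivAt_id (I := X.I) (φ.symm y))).comp_hasMFDerivWithinAt y h4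
  have h6 := h3.congr_of_eventuallyEq (f₁ := fun y ↦ (t, φ.symm y))
    (Eventually.of_forall fun y' ↦ (extChartAt_prod_symm_apply t₀ t x₀ y').symm)
    (extChartAt_prod_symm_apply t₀ t x₀ y).symm
  have hu : UniqueMDiffWithinAt 𝓘(ℝ, EuclideanSpace ℝ (Fin X.dim)) (range X.I) y :=
    (X.I.uniqueDiffOn y hyr).uniqueMDiffWithinAt
  have h7 := hu.eq h6 h5
  exact congr($h7 v)

theorem chartForm_sliceForm (G : ProdMetric P X) {t₀ t : P} {x₀ : X.Reg}
    {y : EuclideanSpace ℝ (Fin X.dim)} (hy : y ∈ (extChartAt X.I x₀).target) :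
    chartForm X.I (sliceForm G t) x₀ y =
      (chartForm (𝓘(ℝ, P).prod X.I) (Metric.form (R := P × X.Reg) G) (t₀, x₀) (t, y)).bilinearComp
        (.inr ℝ P _) (.inr ℝ P _) := by
  ext v w
  have e : ∀ v, (ContinuousLinearMap.inr ℝ P (EuclideanSpace ℝ (Fin X.dim))) v = (0, v) :=
    fun v ↦ rfl
  rw [ContinuousLinearMap.bilinearComp_apply, chartForm_apply, chartForm_apply, e, e,
    dsymm_prod hy, dsymm_prod hy, extChartAt_prod_symm_apply]
  rfl

variable [FiniteDimensional ℝ P]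

theorem continuousOn_chartForm_sliceForm (G : ProdMetric P X) (x₀ : X.Reg) :
    ContinuousOn (fun z : P × EuclideanSpace ℝ (Fin X.dim) ↦
      chartForm X.I (sliceForm G z.1) x₀ z.2) (univ ×ˢ (extChartAt X.I x₀).target) := by
  have h := (Metric.isContForm (R := P × X.Reg) G).continuousOn (0, x₀)
  have h' : ContinuousOn (chartForm (𝓘(ℝ, P).prod X.I) (Metric.form (R := P × X.Reg) G) (0, x₀))
      (univ ×ˢ (extChartAt X.I x₀).target) :=
    h.mono fun z hz ↦ mem_extChartAt_prod_target.2 hz.2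
  have h2 : ContinuousOn (fun z : P × EuclideanSpace ℝ (Fin X.dim) ↦
      (chartForm (𝓘(ℝ, P).prod X.I) (Metric.form (R := P × X.Reg) G) (0, x₀) z).bilinearComp
        (.inr ℝ P _) (.inr ℝ P _)) (univ ×ˢ (extChartAt X.I x₀).target) := by
    rw [continuousOn_clm_apply]
    intro v
    rw [continuousOn_clm_apply]
    intro w
    exact (h'.clm_apply continuousOn_const).clm_apply continuousOn_const
  exact h2.congr fun z hz ↦ chartForm_sliceForm G hz.2

theorem isContForm_sliceForm (G : ProdMetric P X) (t : P) : IsContForm X.I (sliceForm G t) where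
  isPosForm x := ((Metric.isPosForm (R := P × X.Reg) G) (t, x)).comp fun v w h ↦
    congrArg Prod.snd h
  continuousOn x₀ := (continuousOn_chartForm_sliceForm G x₀).comp (f := fun y ↦ (t, y))
    (by fun_prop) fun y hy ↦ ⟨mem_univ _, hy⟩

/-- The forms are comparable. -/
def FormsEquiv {E : Type*} [NormedAddCommGroup E] [NormedSpace ℝ E] (C : ℝ)
    (Q Q' : E →L[ℝ] E →L[ℝ] ℝ) : Prop :=
  ∀ v, Q v v ≤ C * Q' v v ∧ Q' v v ≤ C * Q v v

theorem FormsEquiv.mono {E : Type*} [NormedAddCommGroup E] [NormedSpace ℝ E] {C C' : ℝ}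
    {Q Q' : E →L[ℝ] E →L[ℝ] ℝ} (h : FormsEquiv C Q Q') (hQ : IsPosForm Q) (hQ' : IsPosForm Q')
    (hC : C ≤ C') : FormsEquiv C' Q Q' := fun v ↦
  ⟨(h v).1.trans (mul_le_mul_of_nonneg_right hC (hQ'.nonneg v)),
    (h v).2.trans (mul_le_mul_of_nonneg_right hC (hQ.nonneg v))⟩

/-- The chart expressions are jointly continuous in the parameter and the point. Near `(t₀, x₀)` all
slice forms are thus comparable to one Euclidean norm in the chart, and hence to each other. -/
theorem exists_nhds_sliceForm_equiv (G : ProdMetric P X) (t₀ : P) (x₀ : X.Reg) :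
    ∃ C > 0, ∃ O ∈ 𝓝 x₀, ∀ᶠ t in 𝓝 t₀, ∀ x ∈ O,
      FormsEquiv C (sliceForm G t x) (sliceForm G t₀ x) := by
  set φ := extChartAt X.I x₀
  have hy₀ : φ x₀ ∈ φ.target := mem_extChartAt_target x₀
  have hcont := continuousOn_chartForm_sliceForm G x₀ (t₀, φ x₀) ⟨mem_univ _, hy₀⟩
  rw [ContinuousWithinAt, nhdsWithin_prod_eq, nhdsWithin_univ] at hcont
  obtain ⟨C, hC, hev⟩ := exists_eventually_form_bounds
    ((isContForm_sliceForm G t₀).isPosForm_chartForm hy₀) hcont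
  obtain ⟨pa, hpa, pb, hpb, hp⟩ := eventually_prod_iff.1 hev
  have hO : {x | x ∈ φ.source ∧ pb (φ x)} ∈ 𝓝 x₀ := by
    refine inter_mem (extChartAt_source_mem_nhds x₀) ?_
    have h1 : Tendsto φ (𝓝 x₀) (𝓝[φ.target] (φ x₀)) := by
      refine tendsto_nhdsWithin_iff.2 ⟨continuousAt_extChartAt x₀, ?_⟩
      filter_upwards [extChartAt_source_mem_nhds (I := X.I) x₀] with x hx using φ.map_source hx
    exact h1.eventually hpb
  refine ⟨C * C, mul_pos hC hC, _, hO, ?_⟩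
  filter_upwards [hpa] with t ht x hx
  have key : ∀ s, pa s → ∀ v, ‖dchart X.I x₀ x v‖ ^ 2 ≤ C * sliceForm G s x v v ∧
      sliceForm G s x v v ≤ C * ‖dchart X.I x₀ x v‖ ^ 2 := by
    intro s hs v
    have h1 := hp (x := s) hs hx.2 (dchart X.I x₀ x v)
    simp only [chartForm_apply] at h1
    rw [dsymm_comp_dchart hx.1, (extChartAt X.I x₀).left_inv hx.1] at h1
    exact h1
  intro v
  obtain ⟨h1, h2⟩ := key t ht v
  obtain ⟨h3, h4⟩ := key t₀ hpa.self_of_nhds v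
  constructor
  · calc _ ≤ C * ‖dchart X.I x₀ x v‖ ^ 2 := h2
      _ ≤ C * (C * sliceForm G t₀ x v v) := by gcongr
      _ = _ := by ring
  · calc _ ≤ C * ‖dchart X.I x₀ x v‖ ^ 2 := h4
      _ ≤ C * (C * sliceForm G t x v v) := by gcongr
      _ = _ := by ring

end Slice

section ProdForm

variable {P : Type} [NormedAddCommGroup P] [NormedSpace ℝ P] {Λ : Level.{u}} {X : StratSpace.{u}}
  (c : ConeChart Λ X)

/-- The parameter direction is inert: on vectors without `P`-component the differential of `(t,
reg)` is `(0, d reg)`. Conic estimates on `P × X` thus restrict to the slices. -/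
theorem ConeChart.pullbackForm_prod (G : ProdMetric P X) (t : P)
    {z : EuclideanSpace ℝ (Fin c.h) × ℝ × c.link.Reg} (hr : z.2.1 ∈ Ioo (0 : ℝ) c.ε)
    (V : EuclideanSpace ℝ (Fin c.h) × ℝ × EuclideanSpace ℝ (Fin c.link.dim)) :
    pullbackForm (B := P × EuclideanSpace ℝ (Fin c.h)) (N := P × X.Reg) G
      (fun z ↦ (z.1.1, c.reg (z.1.2, z.2.1, z.2.2))) (t, z.1) z.2.1 z.2.2
      (((0 : P), V.1), V.2.1, V.2.2) (((0 : P), V.1), V.2.1, V.2.2) =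
    sliceForm G t (c.reg z) (coneDeriv X.I c.link.I c.reg z V)
      (coneDeriv X.I c.link.I c.reg z V) := by
  obtain ⟨b, r, x⟩ := z
  have hreg : HasMFDerivAt (𝓘(ℝ, EuclideanSpace ℝ (Fin c.h)).prod (𝓘(ℝ, ℝ).prod c.link.I)) X.I
      c.reg (b, r, x) (coneDeriv X.I c.link.I c.reg (b, r, x)) :=
    ((c.reg_diffeo ⟨(b, r, x), mem_univ _, hr, mem_univ _⟩).contMDiffAt.mdifferentiableAt
      (by simp)).hasMFDerivAt
  have h1 : HasMFDerivAt
      (𝓘(ℝ, P × EuclideanSpace ℝ (Fin c.h)).prod (𝓘(ℝ, ℝ).prod c.link.I)) 𝓘(ℝ, P)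
      (fun z : (P × EuclideanSpace ℝ (Fin c.h)) × ℝ × c.link.Reg ↦ z.1.1) ((t, b), r, x)
      ((ContinuousLinearMap.fst ℝ P _).comp (.fst ℝ (P × EuclideanSpace ℝ (Fin c.h))
        (ℝ × EuclideanSpace ℝ (Fin c.link.dim)))) :=
    (ContinuousLinearMap.fst ℝ P _).hasMFDerivAt.comp ((t, b), r, x) (hasMFDerivAt_fst _)
  have h2 : HasMFDerivAt
      (𝓘(ℝ, P × EuclideanSpace ℝ (Fin c.h)).prod (𝓘(ℝ, ℝ).prod c.link.I))
      𝓘(ℝ, EuclideanSpace ℝ (Fin c.h))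
      (fun z : (P × EuclideanSpace ℝ (Fin c.h)) × ℝ × c.link.Reg ↦ z.1.2) ((t, b), r, x)
      ((ContinuousLinearMap.snd ℝ P _).comp (.fst ℝ (P × EuclideanSpace ℝ (Fin c.h))
        (ℝ × EuclideanSpace ℝ (Fin c.link.dim)))) :=
    (ContinuousLinearMap.snd ℝ P _).hasMFDerivAt.comp ((t, b), r, x) (hasMFDerivAt_fst _)
  have h3 : HasMFDerivAt
      (𝓘(ℝ, P × EuclideanSpace ℝ (Fin c.h)).prod (𝓘(ℝ, ℝ).prod c.link.I))
      (𝓘(ℝ, ℝ).prod c.link.I)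
      (fun z : (P × EuclideanSpace ℝ (Fin c.h)) × ℝ × c.link.Reg ↦ z.2) ((t, b), r, x)
      (ContinuousLinearMap.snd ℝ (P × EuclideanSpace ℝ (Fin c.h))
        (ℝ × EuclideanSpace ℝ (Fin c.link.dim))) := hasMFDerivAt_snd _
  have h4 := hreg.comp ((t, b), r, x) (h2.prodMk h3)
  have h5 := (h1.prodMk h4).mfderiv
  rw [pullbackForm, sliceForm_apply]
  have h6 := congr($h5 (((0 : P), V.1), V.2.1, V.2.2))
  have h7 : (mfderiv (𝓘(ℝ, P × EuclideanSpace ℝ (Fin c.h)).prod (𝓘(ℝ, ℝ).prod c.link.I))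
      (𝓘(ℝ, P).prod X.I) (fun z : (P × EuclideanSpace ℝ (Fin c.h)) × ℝ × c.link.Reg ↦
        (z.1.1, c.reg (z.1.2, z.2.1, z.2.2))) ((t, b), r, x) (((0 : P), V.1), V.2.1, V.2.2) :
          P × EuclideanSpace ℝ (Fin X.dim)) =
      ((0 : P), coneDeriv X.I c.link.I c.reg (b, r, x) V) := h6
  exact congr(G.inner (t, c.reg (b, r, x)) $h7 $h7)

/-- `IsConicForm.exists_bounds` involves the link metric at the moving base point, and `hL` replaces
it by the one at `(t₀, b₀)`. The bounds are uniform for `t` near `t₀`, as the induction in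
`exists_sliceForm_equiv` requires. -/
theorem IsConicForm.exists_coneForm_bounds [FiniteDimensional ℝ P] {G : ProdMetric P X}
    {gB : BaseMetric (P × EuclideanSpace ℝ (Fin c.h))}
    {gL : ProdMetric (P × EuclideanSpace ℝ (Fin c.h)) c.link}
    (hG : IsConicForm G (fun z ↦ (z.1.1, c.reg (z.1.2, z.2.1, z.2.2))) c.ε gB gL) (t₀ : P)
    (b₀ : EuclideanSpace ℝ (Fin c.h))
    (hL : ∃ C > 0, ∀ᶠ t in 𝓝 (t₀, b₀), ∀ x,
      FormsEquiv C (sliceForm gL t x) (sliceForm gL (t₀, b₀) x)) :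
    ∃ C > 0, ∃ η > 0, η ≤ (c.ε : ℝ) ∧ ∀ᶠ t in 𝓝 t₀,
      ∀ z ∈ coneDomain c.link.Reg (Metric.ball b₀ η) η, ∀ V,
        coneForm z.2.1 (sliceForm gL (t₀, b₀) z.2.2) V V ≤
          C * sliceForm G t (c.reg z) (coneDeriv X.I c.link.I c.reg z V)
            (coneDeriv X.I c.link.I c.reg z V) ∧
        sliceForm G t (c.reg z) (coneDeriv X.I c.link.I c.reg z V)
            (coneDeriv X.I c.link.I c.reg z V) ≤
          C * coneForm z.2.1 (sliceForm gL (t₀, b₀) z.2.2) V V := by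
  obtain ⟨C₁, hC₁, hev⟩ := hG.exists_bounds c.ε.2 (t₀, b₀)
  obtain ⟨C₂, hC₂, hev₂⟩ := hL
  obtain ⟨pa, hpa, pb, hpb, hp⟩ := eventually_prod_iff.1 hev
  have hboth := hpa.and hev₂
  rw [nhds_prod_eq] at hboth
  obtain ⟨qa, hqa, qb, hqb, hq⟩ := eventually_prod_iff.1 hboth
  obtain ⟨η₁, hη₁, hη₁b⟩ := Metric.eventually_nhds_iff_ball.1 hqb
  obtain ⟨η₂, hη₂, hη₂b⟩ := mem_nhdsGT_iff_exists_Ioo_subset.1 hpb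
  replace hη₂ : 0 < η₂ := hη₂
  -- At least `1`, so that the same factor can also be put in front of the `db` and `dr` terms.
  set C₃ := max C₂ 1
  have hC₃1 : 1 ≤ C₃ := le_max_right _ _
  have hC₃ : 0 < C₃ := one_pos.trans_le hC₃1
  refine ⟨C₁ * C₃, mul_pos hC₁ hC₃, min c.ε (min η₁ η₂),
    lt_min c.ε.2 (lt_min hη₁ hη₂), min_le_left _ _, ?_⟩
  filter_upwards [hqa] with t ht z hz V
  have hzb := hη₁b z.1 (Metric.ball_subset_ball ((min_le_right _ _).trans (min_le_left _ _)) hz.1)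
  have hzr : z.2.1 ∈ Ioo 0 η₂ :=
    ⟨hz.2.1.1, hz.2.1.2.trans_le ((min_le_right _ _).trans (min_le_right _ _))⟩
  have hzε : z.2.1 ∈ Ioo (0 : ℝ) c.ε := ⟨hz.2.1.1, hz.2.1.2.trans_le (min_le_left _ _)⟩
  obtain ⟨h1, h2⟩ := hq ht hzb
  obtain ⟨h3, h4⟩ := hp h1 (hη₂b hzr) z.2.2 (((0 : P), V.1), V.2.1, V.2.2)
  rw [c.pullbackForm_prod G t hzε] at h3 h4
  set Q := sliceForm G t (c.reg z) (coneDeriv X.I c.link.I c.reg z V)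
    (coneDeriv X.I c.link.I c.reg z V)
  have hQ : 0 ≤ Q := ((isContForm_sliceForm G t).isPosForm _).nonneg _
  have hn : ‖((0 : P), V.1)‖ = ‖V.1‖ := by simp
  have e1 : gL.inner ((t, z.1), z.2.2) ((0 : P × EuclideanSpace ℝ (Fin c.h)), V.2.2)
    ((0 : P × EuclideanSpace ℝ (Fin c.h)), V.2.2) = sliceForm gL (t, z.1) z.2.2 V.2.2 V.2.2 := rfl
  simp only [hn] at h3 h4
  rw [e1] at h3 h4
  obtain ⟨h5, h6⟩ := h2 z.2.2 V.2.2
  rw [coneForm_self]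
  set s := sliceForm gL (t, z.1) z.2.2 V.2.2 V.2.2
  set s₀ := sliceForm gL (t₀, b₀) z.2.2 V.2.2 V.2.2
  have hs : 0 ≤ s := ((isContForm_sliceForm gL _).isPosForm _).nonneg _
  have hs₀ : 0 ≤ s₀ := ((isContForm_sliceForm gL _).isPosForm _).nonneg _
  have h5' : s ≤ C₃ * s₀ := h5.trans (by gcongr; exact le_max_left _ _)
  have h6' : s₀ ≤ C₃ * s := h6.trans (by gcongr; exact le_max_left _ _)
  have hA : 0 ≤ ‖V.1‖ ^ 2 + V.2.1 ^ 2 := by positivity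
  have hr2 : 0 ≤ z.2.1 ^ 2 := sq_nonneg _
  have hAC : ‖V.1‖ ^ 2 + V.2.1 ^ 2 ≤ C₃ * (‖V.1‖ ^ 2 + V.2.1 ^ 2) := le_mul_of_one_le_left hA hC₃1
  constructor
  · calc _ ≤ C₃ * (‖V.1‖ ^ 2 + V.2.1 ^ 2) + z.2.1 ^ 2 * (C₃ * s) := by gcongr
      _ = C₃ * (‖V.1‖ ^ 2 + V.2.1 ^ 2 + z.2.1 ^ 2 * s) := by ring
      _ ≤ C₃ * (C₁ * Q) := by gcongr
      _ = _ := by ring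
  · calc Q ≤ C₁ * (‖V.1‖ ^ 2 + V.2.1 ^ 2 + z.2.1 ^ 2 * s) := h4
      _ ≤ C₁ * (C₃ * (‖V.1‖ ^ 2 + V.2.1 ^ 2) + z.2.1 ^ 2 * (C₃ * s₀)) := by gcongr
      _ = _ := by ring

theorem exists_sliceForm_equiv_of_cover [CompactSpace X.carrier] (G : ProdMetric P X) (t₀ : P)
    (h : ∀ p, ∃ C > 0, ∃ O ∈ 𝓝 p, ∀ᶠ t in 𝓝 t₀, ∀ x : X.Reg, (x : X.carrier) ∈ O →
      FormsEquiv C (sliceForm G t x) (sliceForm G t₀ x)) [FiniteDimensional ℝ P] :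
    ∃ C > 0, ∀ᶠ t in 𝓝 t₀, ∀ x, FormsEquiv C (sliceForm G t x) (sliceForm G t₀ x) := by
  have key : ∃ C > 0, ∀ᶠ t in 𝓝 t₀, ∀ x : X.Reg, (x : X.carrier) ∈ (univ : Set X.carrier) →
      FormsEquiv C (sliceForm G t x) (sliceForm G t₀ x) := by
    refine isCompact_univ.induction_on (p := fun s ↦ ∃ C > 0, ∀ᶠ t in 𝓝 t₀, ∀ x : X.Reg,
      (x : X.carrier) ∈ s → FormsEquiv C (sliceForm G t x) (sliceForm G t₀ x))
      ⟨1, one_pos, Eventually.of_forall fun t x hx ↦ hx.elim⟩ ?_ ?_ ?_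
    · rintro s s' hs ⟨C, hC, h⟩
      exact ⟨C, hC, h.mono fun t ht x hx ↦ ht x (hs hx)⟩
    · rintro s s' ⟨C, hC, h⟩ ⟨C', hC', h'⟩
      refine ⟨max C C', lt_max_of_lt_left hC, ?_⟩
      filter_upwards [h, h'] with t ht ht' x hx
      have hp := (isContForm_sliceForm G t).isPosForm x
      have hp' := (isContForm_sliceForm G t₀).isPosForm x
      rcases hx with hx | hx
      · exact (ht x hx).mono hp hp' (le_max_left _ _)
      · exact (ht' x hx).mono hp hp' (le_max_right _ _)
    · intro p _
      obtain ⟨C, hC, O, hO, h⟩ := h p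
      exact ⟨O, mem_nhdsWithin_of_mem_nhds hO, C, hC, h⟩
  obtain ⟨C, hC, h⟩ := key
  exact ⟨C, hC, h.mono fun t ht x ↦ ht x (mem_univ _)⟩

theorem exists_nhds_carrier_sliceForm_equiv [FiniteDimensional ℝ P] (G : ProdMetric P X) (t₀ : P)
    (x₀ : X.Reg) : ∃ C > 0, ∃ O ∈ 𝓝 (x₀ : X.carrier), ∀ᶠ t in 𝓝 t₀, ∀ x : X.Reg,
      (x : X.carrier) ∈ O → FormsEquiv C (sliceForm G t x) (sliceForm G t₀ x) := by
  obtain ⟨C, hC, O, hO, h⟩ := exists_nhds_sliceForm_equiv G t₀ x₀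
  refine ⟨C, hC, _, X.isOpenMap_val.image_mem_nhds hO, h.mono fun t ht x hx ↦ ?_⟩
  obtain ⟨y, hy, hyx⟩ := hx
  exact Subtype.ext hyx ▸ ht y hy

end ProdForm

/-- The forms induced by a product metric on the slices `{t} × X` are comparable, locally uniformly
in `t` and uniformly on `X`. -/
theorem exists_sliceForm_equiv : ∀ (m : ℕ) {X : StratSpace.{u}} (A : (level.{u} m).Str X)
    [CompactSpace X.carrier] {P : Type} [NormedAddCommGroup P] [NormedSpace ℝ P]
    [FiniteDimensional ℝ P] {G : ProdMetric P X}, (level.{u} m).IsProdMetric A P G → ∀ t₀ : P,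
    ∃ C > 0, ∀ᶠ t in 𝓝 t₀, ∀ x, FormsEquiv C (sliceForm G t x) (sliceForm G t₀ x)
  | 0, X, A, _, P, _, _, _, G, _, t₀ => exists_sliceForm_equiv_of_cover G t₀ fun p ↦
      exists_nhds_carrier_sliceForm_equiv G t₀ ⟨p, A.2 p⟩
  | m + 1, X, A, _, P, _, _, _, G, hG, t₀ => by
    refine exists_sliceForm_equiv_of_cover G t₀ fun p ↦ ?_
    by_cases hp : X.depth p = 0
    · exact exists_nhds_carrier_sliceForm_equiv G t₀ ⟨p, hp⟩
    obtain ⟨c, hc, -, b₀, x₀, rfl⟩ := ConeAtlas.cover A p hp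
    obtain ⟨gB, -, hgL⟩ := hG
    obtain ⟨gL, hcon, hprod⟩ := hgL c hc
    -- The base coordinates of the chart join the parameters: the induction hypothesis is applied to
    -- the link with parameter space `P × ℝʰ`. The slices at `t` and at `t₀` are then compared with
    -- the same frozen cone form.
    obtain ⟨C, hC, η, hη, hηε, hev⟩ := hcon.exists_coneForm_bounds c t₀ b₀
      (exists_sliceForm_equiv m c.str hprod (t₀, b₀))
    refine ⟨C * C, mul_pos hC hC, c.nhd (Metric.ball b₀ η) η,
      (c.isOpen_nhd Metric.isOpen_ball η).mem_nhds (c.mem_nhd_iff.2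
        ⟨b₀, Metric.mem_ball_self hη, 0, ⟨le_rfl, c.ε.2⟩, hη, x₀, rfl⟩), ?_⟩
    filter_upwards [hev] with t ht x hx ξ
    obtain ⟨b, hb, r, hr, hrη, y, rfl⟩ := c.mem_nhd_reg hx
    obtain ⟨V, hV⟩ := exists_mfderiv_eq (c.reg_diffeo ⟨(b, r, y), mem_univ _, hr, mem_univ _⟩) ξ
    replace hV : coneDeriv X.I c.link.I c.reg (b, r, y) V = ξ := hV
    have hz : (b, r, y) ∈ coneDomain c.link.Reg (Metric.ball b₀ η) η := ⟨hb, ⟨hr.1, hrη⟩, mem_univ _⟩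
    obtain ⟨h1, h2⟩ := ht _ hz V
    obtain ⟨h3, h4⟩ := hev.self_of_nhds _ hz V
    rw [hV] at h1 h2 h3 h4
    constructor
    · calc _ ≤ C * _ := h2
        _ ≤ C * (C * sliceForm G t₀ (c.reg (b, r, y)) ξ ξ) := by gcongr
        _ = _ := by ring
    · calc _ ≤ C * _ := h4
        _ ≤ C * (C * sliceForm G t (c.reg (b, r, y)) ξ ξ) := by gcongr
        _ = _ := by ring

/-! ### Existence of Hardy weights, by induction on the depth. -/

theorem exists_isHardyWeightOn_levelZero {X : StratSpace.{u}} (A : (level.{u} 0).Str X)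
    (q : X.Reg → EuclideanSpace ℝ (Fin X.dim) →L[ℝ] EuclideanSpace ℝ (Fin X.dim) →L[ℝ] ℝ) :
    ∃ w, IsHardyWeightOn X q X.sing w := by
  have : X.sing = ∅ := eq_empty_of_forall_notMem fun p hp ↦ hp (A.2 p)
  exact ⟨_, this ▸ isHardyWeightOn_one⟩

/-- The slices of a product metric have Hardy weights. -/
theorem exists_isHardyWeightOn_sliceForm : ∀ (m : ℕ) {X : StratSpace.{u}}
    (A : (level.{u} m).Str X) [CompactSpace X.carrier] [T2Space X.carrier],
    (level.{u} m).LinkDimGE A 2 → ∀ {P : Type} [NormedAddCommGroup P] [NormedSpace ℝ P]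
    [FiniteDimensional ℝ P] {G : ProdMetric P X}, (level.{u} m).IsProdMetric A P G → ∀ t : P,
    ∃ w, IsHardyWeightOn X (sliceForm G t) X.sing w
  | 0, X, A, _, _, _, P, _, _, _, G, _, t => exists_isHardyWeightOn_levelZero A _
  | m + 1, X, A, _, _, hd, P, _, _, _, G, hG, t => by
    have := secondCountableTopology_reg (m + 1) A
    refine exists_isHardyWeightOn_sing (isContForm_sliceForm G t) fun p hp ↦ ?_
    obtain ⟨c, hc, -, b₀, x₀, rfl⟩ := ConeAtlas.cover A p hp
    obtain ⟨gB, -, hgL⟩ := hG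
    obtain ⟨gL, hcon, hprod⟩ := hgL c hc
    obtain ⟨C, hC, η, hη, hηε, hev⟩ := hcon.exists_coneForm_bounds c t b₀
      (exists_sliceForm_equiv m c.str hprod (t, b₀))
    exact ⟨_, c, b₀, x₀, sliceForm gL (t, b₀), η, C, rfl, secondCountableTopology_reg m c.str,
      (hd c hc).1, isContForm_sliceForm _ _,
      exists_isHardyWeightOn_sliceForm m c.str (hd c hc).2 hprod _, hη, hηε,
      c.isConeParam Metric.isOpen_ball hηε hC (fun z hz V ↦ (hev.self_of_nhds z hz V).1)
        fun z hz V ↦ (hev.self_of_nhds z hz V).2⟩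

/-- The analogue of `IsConicForm.exists_coneForm_bounds` for the metric of the space itself, without
parameters: conic bounds, followed by freezing the link metric at `b₀`. -/
theorem IsConicForm.exists_isConeParam {Λ : Level.{u}} {X : StratSpace.{u}} (c : ConeChart Λ X)
    {g : Metric X.I X.Reg} {gB : BaseMetric (EuclideanSpace ℝ (Fin c.h))}
    {gL : ProdMetric (EuclideanSpace ℝ (Fin c.h)) c.link}
    (hg : IsConicForm g c.reg c.ε gB gL) (b₀ : EuclideanSpace ℝ (Fin c.h))
    (hL : ∃ C > 0, ∀ᶠ b in 𝓝 b₀, ∀ x, FormsEquiv C (sliceForm gL b x) (sliceForm gL b₀ x)) :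
    ∃ C, ∃ η > 0, η ≤ (c.ε : ℝ) ∧
      IsConeParam X.I c.link.I g.form (sliceForm gL b₀) c.reg (Metric.ball b₀ η) η C := by
  obtain ⟨C₁, hC₁, hev⟩ := hg.exists_bounds c.ε.2 b₀
  obtain ⟨C₂, hC₂, hev₂⟩ := hL
  obtain ⟨pa, hpa, pb, hpb, hp⟩ := eventually_prod_iff.1 hev
  obtain ⟨η₁, hη₁, hη₁b⟩ := Metric.eventually_nhds_iff_ball.1 (hpa.and hev₂)
  obtain ⟨η₂, hη₂, hη₂b⟩ := mem_nhdsGT_iff_exists_Ioo_subset.1 hpb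
  replace hη₂ : 0 < η₂ := hη₂
  set C₃ := max C₂ 1
  have hC₃1 : 1 ≤ C₃ := le_max_right _ _
  have hC₃ : 0 < C₃ := one_pos.trans_le hC₃1
  have key : ∀ z ∈ coneDomain c.link.Reg (Metric.ball b₀ (min (c.ε : ℝ) (min η₁ η₂)))
      (min (c.ε : ℝ) (min η₁ η₂)), ∀ V, coneForm z.2.1 (sliceForm gL b₀ z.2.2) V V ≤
          C₁ * C₃ * g.form (c.reg z) (coneDeriv X.I c.link.I c.reg z V)
            (coneDeriv X.I c.link.I c.reg z V) ∧
        g.form (c.reg z) (coneDeriv X.I c.link.I c.reg z V)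
            (coneDeriv X.I c.link.I c.reg z V) ≤
          C₁ * C₃ * coneForm z.2.1 (sliceForm gL b₀ z.2.2) V V := by
    intro z hz V
    obtain ⟨h1, h2⟩ :=
      hη₁b z.1 (Metric.ball_subset_ball ((min_le_right _ _).trans (min_le_left _ _)) hz.1)
    have hzr : z.2.1 ∈ Ioo 0 η₂ :=
      ⟨hz.2.1.1, hz.2.1.2.trans_le ((min_le_right _ _).trans (min_le_right _ _))⟩
    obtain ⟨h3, h4⟩ := hp h1 (hη₂b hzr) z.2.2 V
    have e0 : pullbackForm g c.reg z.1 z.2.1 z.2.2 V V = g.form (c.reg z)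
      (coneDeriv X.I c.link.I c.reg z V) (coneDeriv X.I c.link.I c.reg z V) := rfl
    rw [e0] at h3 h4
    set Q := g.form (c.reg z) (coneDeriv X.I c.link.I c.reg z V)
      (coneDeriv X.I c.link.I c.reg z V)
    have e1 : gL.inner (z.1, z.2.2) ((0 : EuclideanSpace ℝ (Fin c.h)), V.2.2)
      ((0 : EuclideanSpace ℝ (Fin c.h)), V.2.2) = sliceForm gL z.1 z.2.2 V.2.2 V.2.2 := rfl
    rw [e1] at h3 h4
    obtain ⟨h5, h6⟩ := h2 z.2.2 V.2.2
    rw [coneForm_self]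
    set s := sliceForm gL z.1 z.2.2 V.2.2 V.2.2
    set s₀ := sliceForm gL b₀ z.2.2 V.2.2 V.2.2
    have hs : 0 ≤ s := ((isContForm_sliceForm gL _).isPosForm _).nonneg _
    have hs₀ : 0 ≤ s₀ := ((isContForm_sliceForm gL _).isPosForm _).nonneg _
    have h5' : s ≤ C₃ * s₀ := h5.trans (by gcongr; exact le_max_left _ _)
    have h6' : s₀ ≤ C₃ * s := h6.trans (by gcongr; exact le_max_left _ _)
    have hA : 0 ≤ ‖V.1‖ ^ 2 + V.2.1 ^ 2 := by positivity
    have hr2 : 0 ≤ z.2.1 ^ 2 := sq_nonneg _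
    have hAC : ‖V.1‖ ^ 2 + V.2.1 ^ 2 ≤ C₃ * (‖V.1‖ ^ 2 + V.2.1 ^ 2) :=
      le_mul_of_one_le_left hA hC₃1
    constructor
    · calc _ ≤ C₃ * (‖V.1‖ ^ 2 + V.2.1 ^ 2) + z.2.1 ^ 2 * (C₃ * s) := by gcongr
        _ = C₃ * (‖V.1‖ ^ 2 + V.2.1 ^ 2 + z.2.1 ^ 2 * s) := by ring
        _ ≤ C₃ * (C₁ * Q) := by gcongr
        _ = _ := by ring
    · calc Q ≤ C₁ * (‖V.1‖ ^ 2 + V.2.1 ^ 2 + z.2.1 ^ 2 * s) := h4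
        _ ≤ C₁ * (C₃ * (‖V.1‖ ^ 2 + V.2.1 ^ 2) + z.2.1 ^ 2 * (C₃ * s₀)) := by gcongr
        _ = _ := by ring
  exact ⟨C₁ * C₃, _, lt_min c.ε.2 (lt_min hη₁ hη₂), min_le_left _ _,
    c.isConeParam Metric.isOpen_ball (min_le_left _ _) (mul_pos hC₁ hC₃)
      (fun z hz V ↦ (key z hz V).1) fun z hz V ↦ (key z hz V).2⟩

/-- Compact spaces with iterated conical singularities and links of dimension at least `2` have
Hardy weights. -/
theorem exists_isHardyWeightOn_form : ∀ (m : ℕ) {X : StratSpace.{u}} (A : (level.{u} m).Str X)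
    [CompactSpace X.carrier] [T2Space X.carrier], (level.{u} m).LinkDimGE A 2 →
    ∀ {g : Metric X.I X.Reg}, (level.{u} m).IsMetric A g → ∃ w, IsHardyWeightOn X g.form X.sing w
  | 0, X, A, _, _, _, g, _ => exists_isHardyWeightOn_levelZero A _
  | m + 1, X, A, _, _, hd, g, hg => by
    have := secondCountableTopology_reg (m + 1) A
    refine exists_isHardyWeightOn_sing (Metric.isContForm g) fun p hp ↦ ?_
    obtain ⟨c, hc, -, b₀, x₀, rfl⟩ := ConeAtlas.cover A p hp
    obtain ⟨gB, -, hgL⟩ := hg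
    obtain ⟨gL, hcon, hprod⟩ := hgL c hc
    obtain ⟨C, η, hη, hηε, hΦ⟩ := hcon.exists_isConeParam c b₀
      (exists_sliceForm_equiv m c.str hprod b₀)
    exact ⟨_, c, b₀, x₀, sliceForm gL b₀, η, C, rfl, secondCountableTopology_reg m c.str,
      (hd c hc).1, isContForm_sliceForm _ _,
      exists_isHardyWeightOn_sliceForm m c.str (hd c hc).2 hprod _, hη, hηε, hΦ⟩

/-! ### Lengths of paths and the distance to the singular stratum. -/

section PathLength

variable {n : ℕ} {H : Type*} [TopologicalSpace H]
  {I : ModelWithCorners ℝ (EuclideanSpace ℝ (Fin n)) H}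
  {R : Type*} [TopologicalSpace R] [ChartedSpace H R] [IsManifold I ∞ R]

theorem enorm_tangent_eq (g : Metric I R) {x : R} (v : TangentSpace I x) :
    letI : RiemannianBundle (fun x : R ↦ TangentSpace I x) := ⟨g.toRiemannianMetric⟩
    ‖v‖ₑ = ENNReal.ofReal (√(g.inner x v v)) := by
  let _ : RiemannianBundle (fun x : R ↦ TangentSpace I x) := ⟨g.toRiemannianMetric⟩
  rw [← ofReal_norm, norm_eq_sqrt_real_inner]
  rfl

theorem pathLength_eq_pathELength (g : Metric I R) (γ : ℝ → R) :
    letI : RiemannianBundle (fun x : R ↦ TangentSpace I x) := ⟨g.toRiemannianMetric⟩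
    pathLength g γ = Manifold.pathELength I γ 0 1 := by
  let _ : RiemannianBundle (fun x : R ↦ TangentSpace I x) := ⟨g.toRiemannianMetric⟩
  rw [Manifold.pathELength_eq_lintegral_mfderiv_Ioo]
  exact lintegral_congr fun t ↦ (enorm_tangent_eq g _).symm

/-- The function makes a path wait at time `1/3` and then catch up by time `7/12`, so that it can be
joined smoothly to a path that is constant near its end. -/
theorem exists_monotone_reparam : ∃ η : ℝ → ℝ, ContDiff ℝ ∞ η ∧ MonotoneOn η (Ici (1 / 3)) ∧
    (∀ t ≤ 5 / 12, η t = 1 / 3) ∧ ∀ t ≥ 7 / 12, η t = t := by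
  refine ⟨fun t ↦ 1 / 3 + (t - 1 / 3) * Real.smoothTransition (6 * t - 5 / 2), ?_, ?_, ?_, ?_⟩
  · exact contDiff_const.add ((contDiff_id.sub contDiff_const).mul
      (Real.smoothTransition.contDiff.comp ((contDiff_const.mul contDiff_id).sub contDiff_const)))
  · intro s hs t ht hst
    have h1 : Real.smoothTransition (6 * s - 5 / 2) ≤ Real.smoothTransition (6 * t - 5 / 2) :=
      Real.smoothTransition.monotone (by linarith)
    have h2 := Real.smoothTransition.nonneg (6 * s - 5 / 2)
    have h3 : (0 : ℝ) ≤ t - 1 / 3 := sub_nonneg.2 ht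
    beta_reduce
    gcongr
  · intro t ht
    simp [Real.smoothTransition.zero_of_nonpos (show 6 * t - 5 / 2 ≤ 0 by linarith)]
  · intro t ht
    simp [Real.smoothTransition.one_of_one_le (show 1 ≤ 6 * t - 5 / 2 by linarith)]

/-- The starting point of a path can be moved slightly without increasing the length by much, or
changing the end of the path. -/
theorem eventually_exists_path (g : Metric I R) {γ : ℝ → R}
    (hγ : ContMDiffOn 𝓘(ℝ, ℝ) I 1 γ (Ico 0 1)) {c : ℝ≥0∞} (hc : pathLength g γ < c) :
    ∀ᶠ p in 𝓝 (γ 0), ∃ γ' : ℝ → R, γ' 0 = p ∧ ContMDiffOn 𝓘(ℝ, ℝ) I 1 γ' (Ico 0 1) ∧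
      pathLength g γ' < c ∧ γ' =ᶠ[𝓝[<] 1] γ := by
  let _ : RiemannianBundle (fun x : R ↦ TangentSpace I x) := ⟨g.toRiemannianMetric⟩
  have : IsManifold I 1 R := IsManifold.of_le (n := ∞) (by norm_cast)
  have : IsContMDiffRiemannianBundle I ∞ (EuclideanSpace ℝ (Fin n))
    (fun x : R ↦ TangentSpace I x) := ⟨⟨g.inner, g.contMDiff, fun _ _ _ ↦ rfl⟩⟩
  have : IsContinuousRiemannianBundle (EuclideanSpace ℝ (Fin n))
    (fun x : R ↦ TangentSpace I x) := ⟨⟨g.inner, g.contMDiff.continuous, fun _ _ _ ↦ rfl⟩⟩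
  rw [pathLength_eq_pathELength] at hc
  obtain ⟨η, hη, hmono, hη1, hη2⟩ := exists_monotone_reparam
  set a := Manifold.pathELength I γ 0 (1 / 3)
  set b := Manifold.pathELength I γ (1 / 3) 1
  have hab : a + b = Manifold.pathELength I γ 0 1 :=
    Manifold.pathELength_add (by norm_num) (by norm_num)
  have hb : b ≠ ⊤ := fun h ↦ by
    rw [← hab, h, add_top] at hc
    exact not_top_lt hc
  have hac : a < c - b := lt_tsub_iff_right.2 (hab ▸ hc)
  have ha : a ≠ ⊤ := (hac.trans_le le_top).ne
  have hδ : 0 < c - b - a := tsub_pos_of_lt hac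
  -- The slack `c - b - a` left by the length of `γ` pays for the way from `p` to `γ 0`.
  filter_upwards [eventually_riemannianEDist_lt I (γ 0) hδ] with p hp
  have hγ3 : Manifold.riemannianEDist I (γ 0) (γ (1 / 3)) ≤ a :=
    Manifold.riemannianEDist_le_pathELength
      (hγ.mono fun t ht ↦ ⟨ht.1, ht.2.trans_lt (by norm_num)⟩) rfl rfl (by norm_num)
  have hp3 : Manifold.riemannianEDist I p (γ (1 / 3)) < c - b := by
    calc _ ≤ Manifold.riemannianEDist I p (γ 0) + Manifold.riemannianEDist I (γ 0) (γ (1 / 3)) :=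
          Manifold.riemannianEDist_triangle
      _ ≤ Manifold.riemannianEDist I p (γ 0) + a := by gcongr
      _ < c - b - a + a := by
        rw [Manifold.riemannianEDist_comm]
        exact ENNReal.add_lt_add_right ha hp
      _ = c - b := tsub_add_cancel_of_le hac.le
  obtain ⟨α, hα0, hα1, hα, hαlen, -, hαc⟩ :=
    Manifold.exists_lt_locally_constant_of_riemannianEDist_lt hp3
      (show (0 : ℝ) < 1 / 3 by norm_num)
  have hη3 : ∀ t ≥ 1 / 3, 1 / 3 ≤ η t := fun t ht ↦
    (hη1 (1 / 3) (by norm_num)).symm.le.trans (hmono self_mem_Ici ht ht)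
  have hηlt : ∀ t ≥ 1 / 3, t < 1 → η t < 1 := fun t ht ht1 ↦ by
    rcases le_or_gt (7 / 12) t with h | h
    · rwa [hη2 t h]
    · refine (hmono ht (b := 7 / 12) ?_ h.le).trans_lt (by rw [hη2 _ le_rfl]; norm_num)
      exact mem_Ici.2 (by norm_num)
  have hγat : ∀ t ∈ Ioo (0 : ℝ) 1, ContMDiffAt 𝓘(ℝ, ℝ) I 1 γ t := fun t ht ↦
    (hγ t ⟨ht.1.le, ht.2⟩).contMDiffAt (Ico_mem_nhds ht.1 ht.2)
  -- The new path runs from `p` to `γ(1/3)` along `α`, then follows `γ` with the waiting time. Both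
  -- pieces are constant near `1/3`, so the junction is C¹.
  set Γ : ℝ → R := fun t ↦ if t < 1 / 3 then α t else γ (η t)
  have hΓ1 : ∀ t < 1 / 3, Γ t = α t := fun t ht ↦ if_pos ht
  have hΓ2 : ∀ t ≥ 1 / 3, Γ t = γ (η t) := fun t ht ↦ if_neg ht.not_gt
  refine ⟨Γ, (hΓ1 0 (by norm_num)).trans hα0, ?_, ?_, ?_⟩
  · intro t ht
    refine ContMDiffAt.contMDiffWithinAt ?_
    rcases lt_trichotomy t (1 / 3) with h | rfl | h
    · refine (hα t).congr_of_eventuallyEq ?_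
      filter_upwards [Iio_mem_nhds h] with s hs using hΓ1 s hs
    · refine (contMDiffAt_const (c := γ (1 / 3))).congr_of_eventuallyEq ?_
      filter_upwards [hαc, Iio_mem_nhds (show (1 / 3 : ℝ) < 5 / 12 by norm_num)] with s hs hs'
      rcases lt_or_ge s (1 / 3) with h | h
      · rw [hΓ1 s h, hs]
      · rw [hΓ2 s h, hη1 s (le_of_lt hs')]
    · have h1 : ContMDiffAt 𝓘(ℝ, ℝ) I 1 (γ ∘ η) t :=
        (hγat (η t) ⟨by linarith [hη3 t h.le], hηlt t h.le ht.2⟩).comp t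
          (hη.contMDiff.contMDiffAt.of_le (by norm_cast))
      refine h1.congr_of_eventuallyEq ?_
      filter_upwards [Ioi_mem_nhds h] with s hs using hΓ2 s (le_of_lt hs)
  · rw [pathLength_eq_pathELength, ← Manifold.pathELength_add (b := 1 / 3) (by norm_num)
      (by norm_num), ← Manifold.pathELength_add (a := 1 / 3) (b := 7 / 12) (by norm_num)
      (by norm_num)]
    have e1 : Manifold.pathELength I Γ 0 (1 / 3) = Manifold.pathELength I α 0 (1 / 3) :=
      Manifold.pathELength_congr_Ioo fun t ht ↦ hΓ1 t ht.2
    have e2 : Manifold.pathELength I Γ (1 / 3) (7 / 12) =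
        Manifold.pathELength I γ (1 / 3) (7 / 12) := by
      -- Length is invariant under the monotone reparametrization, so waiting costs nothing.
      rw [Manifold.pathELength_congr_Ioo (γ' := γ ∘ η) fun t ht ↦ hΓ2 t ht.1.le,
        Manifold.pathELength_comp_of_monotoneOn (by norm_num) (hmono.mono Icc_subset_Ici_self)
          (hη.differentiable (by simp)).differentiableOn, hη1 _ (by norm_num), hη2 _ le_rfl]
      rw [hη1 _ (by norm_num), hη2 _ le_rfl]
      exact fun t ht ↦ ((hγat t ⟨by linarith [ht.1], by linarith [ht.2]⟩).mdifferentiableAt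
        (by simp)).mdifferentiableWithinAt
    have e3 : Manifold.pathELength I Γ (7 / 12) 1 = Manifold.pathELength I γ (7 / 12) 1 :=
      Manifold.pathELength_congr_Ioo fun t ht ↦ by
        rw [hΓ2 t (by linarith [ht.1]), hη2 t ht.1.le]
    rw [e1, e2, e3, Manifold.pathELength_add (by norm_num) (by norm_num)]
    exact lt_tsub_iff_right.1 hαlen
  · filter_upwards [mem_nhdsWithin_of_mem_nhds (Ioi_mem_nhds (show (7 / 12 : ℝ) < 1 by norm_num))]
      with t ht
    rw [hΓ2 t (by linarith [mem_Ioi.1 ht]), hη2 t (le_of_lt ht)]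

end PathLength

variable {X : StratSpace.{u}}

/-- A path of length less than `c` from `p` can be given any nearby starting point without losing
this bound, and near time `1` it is unchanged, so its singular endpoint stays. -/
theorem isOpen_singDist_lt (g : Metric X.I X.Reg) (c : ℝ≥0∞) :
    IsOpen {p : X.Reg | singDist g p < c} := by
  rw [isOpen_iff_mem_nhds]
  intro p hp
  obtain ⟨γ, hγ⟩ := iInf_lt_iff.1 (show singDist g p < c from hp)
  obtain ⟨⟨rfl, hγs, q, hq, hlim⟩, hlen⟩ := iInf_lt_iff.1 hγ
  filter_upwards [eventually_exists_path g hγs hlen] with p' ⟨γ', h0, h1, h2, h3⟩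
  refine (iInf₂_le γ' ⟨h0, h1, q, hq, hlim.congr' ?_⟩).trans_lt h2
  filter_upwards [h3] with t ht
  rw [ht]

theorem measurable_singDist (g : Metric X.I X.Reg) : Measurable (singDist g) :=
  measurable_of_Iio fun c ↦ (isOpen_singDist_lt g c).measurableSet

/-- A Hardy weight is bounded by the distance to the singular stratum. -/
theorem IsHardyWeightOn.le_singDist {g : Metric X.I X.Reg} {w : X.Reg → ℝ}
    (hw : IsHardyWeightOn X g.form X.sing w) :
    ∃ K : ℝ≥0, 0 < K ∧ ∀ p, ENNReal.ofReal (w p) ≤ K * singDist g p := by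
  obtain ⟨K, hK⟩ := hw.deriv_le
  -- The summand `1` makes the constant positive, so that it can be divided by.
  set K' : ℝ≥0 := NNReal.sqrt (Real.toNNReal K) + 1
  have hK' : 0 < K' := by positivity
  refine ⟨K', hK', fun p ↦ ?_⟩
  have hK0 : (K' : ℝ≥0∞) ≠ 0 := by simpa using hK'.ne'
  rw [mul_comm, ← ENNReal.div_le_iff_le_mul (Or.inl hK0) (Or.inl ENNReal.coe_ne_top)]
  refine le_iInf₂ fun γ hγ ↦ ?_
  obtain ⟨rfl, hγs, q, hq, hlim⟩ := hγ
  rw [ENNReal.div_le_iff_le_mul (Or.inl hK0) (Or.inl ENNReal.coe_ne_top), mul_comm]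
  have hγat : ∀ t ∈ Ioo (0 : ℝ) 1, ContMDiffAt 𝓘(ℝ, ℝ) X.I 1 γ t := fun t ht ↦
    (hγs t ⟨ht.1.le, ht.2⟩).contMDiffAt (Ico_mem_nhds ht.1 ht.2)
  have hwγ : ContDiffOn ℝ 1 (w ∘ γ) (Ico 0 1) := by
    rw [← contMDiffOn_iff_contDiffOn]
    exact hw.contMDiff.comp_contMDiffOn hγs
  have hbound : ∀ s ∈ Ioo (0 : ℝ) 1, ‖w (γ s) - w (γ 0)‖ₑ ≤ K' * pathLength g γ := by
    intro s hs
    have h1 := enorm_sub_le_lintegral_deriv_of_contDiffOn_Icc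
      (hwγ.mono fun t ht ↦ ⟨ht.1, ht.2.trans_lt hs.2⟩) hs.1.le
    refine h1.trans ?_
    rw [← restrict_Ioo_eq_restrict_Icc, pathLength, ← lintegral_const_mul' _ _ ENNReal.coe_ne_top]
    refine (lintegral_mono_set (Ioo_subset_Ioo_right hs.2.le)).trans ?_
    refine setLIntegral_mono' measurableSet_Ioo fun t ht ↦ ?_
    set D : ℝ →L[ℝ] EuclideanSpace ℝ (Fin X.dim) := mfderiv 𝓘(ℝ, ℝ) X.I γ t
    have hd : HasMFDerivAt 𝓘(ℝ, ℝ) X.I γ t D :=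
      ((hγat t ht).mdifferentiableAt (by simp)).hasMFDerivAt
    have hwd : HasMFDerivAt X.I 𝓘(ℝ, ℝ) w (γ t) (scalarDeriv X.I w (γ t)) :=
      (hw.contMDiff.mdifferentiableAt (by simp)).hasMFDerivAt
    have h3 : HasFDerivAt (w ∘ γ) ((scalarDeriv X.I w (γ t)).comp D) t :=
      hasMFDerivAt_iff_hasFDerivAt.1 (hwd.comp t hd)
    have h4 : deriv (w ∘ γ) t = scalarDeriv X.I w (γ t) (D 1) := h3.hasDerivAt.deriv
    have h6 : |scalarDeriv X.I w (γ t) (D 1)| ≤ √K * √(g.form (γ t) (D 1) (D 1)) := by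
      rw [← Real.sqrt_mul' _ ((g.isPosForm (γ t)).nonneg _)]
      exact Real.abs_le_sqrt (hK (γ t) (D 1))
    rw [h4, Real.enorm_eq_ofReal_abs]
    change _ ≤ (K' : ℝ≥0∞) * ENNReal.ofReal (√(g.form (γ t) (D 1) (D 1)))
    refine (ENNReal.ofReal_le_ofReal h6).trans ?_
    rw [ENNReal.ofReal_mul (Real.sqrt_nonneg _)]
    gcongr
    rw [← ENNReal.ofReal_coe_nnreal]
    refine ENNReal.ofReal_le_ofReal ?_
    simp only [K', NNReal.coe_add, Real.coe_sqrt, NNReal.coe_one, Real.coe_toNNReal']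
    linarith [Real.sqrt_le_sqrt (le_max_left K 0)]
  -- The bound on `[0, s]` passes to `s → 1`, where the weight tends to `0` since the path ends at a
  -- singular point.
  have hlimw : Tendsto (fun t ↦ w (γ t)) (𝓝[<] 1) (𝓝 0) :=
    (hw.tendsto q hq).comp (tendsto_comap_iff.2 hlim)
  have hlim2 : Tendsto (fun s ↦ ‖w (γ s) - w (γ 0)‖ₑ) (𝓝[<] 1) (𝓝 ‖0 - w (γ 0)‖ₑ) :=
    (hlimw.sub_const _).enorm
  have h2 : ‖0 - w (γ 0)‖ₑ = ENNReal.ofReal (w (γ 0)) := by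
    rw [zero_sub, enorm_neg, Real.enorm_of_nonneg (hw.pos _).le]
  rw [← h2]
  refine le_of_tendsto hlim2 ?_
  filter_upwards [Ioo_mem_nhdsLT one_pos] with s hs using hbound s hs

/-! ### Hilbert–Schmidt norms with respect to a form. -/

section HilbertSchmidt

variable {n : ℕ} {W : Type*} [NormedAddCommGroup W] [InnerProductSpace ℝ W]

/-- The squared Hilbert–Schmidt norm of `D` with respect to the inner product `Q`. -/
def formHS (Q : EuclideanSpace ℝ (Fin n) →L[ℝ] EuclideanSpace ℝ (Fin n) →L[ℝ] ℝ)
    (D : EuclideanSpace ℝ (Fin n) →L[ℝ] W) : ℝ :=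
  ∑ i, ∑ j, (formMatrix Q)⁻¹ i j *
    inner ℝ (D (EuclideanSpace.single i 1)) (D (EuclideanSpace.single j 1))

theorem IsPosForm.exists_transpose_mul_self
    {Q : EuclideanSpace ℝ (Fin n) →L[ℝ] EuclideanSpace ℝ (Fin n) →L[ℝ] ℝ} (hQ : IsPosForm Q) :
    ∃ S : Matrix (Fin n) (Fin n) ℝ, IsUnit S.det ∧ (formMatrix Q)⁻¹ = S.transpose * S := by
  obtain ⟨S, hS⟩ : ∃ S, (formMatrix Q)⁻¹ = star S * S := by
    open scoped MatrixOrder in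
    exact CStarAlgebra.nonneg_iff_eq_star_mul_self.1 hQ.posDef.inv.posSemidef.nonneg
  have h : (formMatrix Q)⁻¹ = S.transpose * S := by
    rwa [Matrix.star_eq_conjTranspose, Matrix.conjTranspose_eq_transpose_of_trivial] at hS
  refine ⟨S, isUnit_iff_ne_zero.2 fun h0 ↦ ?_, h⟩
  have := hQ.posDef.inv.det_pos
  rw [h, Matrix.det_mul, h0, mul_zero] at this
  exact lt_irrefl _ this

/-- A frame which is orthonormal for `Q`. -/
theorem IsPosForm.exists_frame
    {Q : EuclideanSpace ℝ (Fin n) →L[ℝ] EuclideanSpace ℝ (Fin n) →L[ℝ] ℝ} (hQ : IsPosForm Q) :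
    ∃ f : Fin n → EuclideanSpace ℝ (Fin n),
      (∀ ξ, ∃ c : Fin n → ℝ, ξ = ∑ k, c k • f k ∧ Q ξ ξ = ∑ k, c k ^ 2) ∧
      ∀ {W : Type*} [NormedAddCommGroup W] [InnerProductSpace ℝ W]
        (D : EuclideanSpace ℝ (Fin n) →L[ℝ] W), formHS Q D = ∑ k, ‖D (f k)‖ ^ 2 := by
  obtain ⟨S, hdet, hS⟩ := hQ.exists_transpose_mul_self
  -- Writing the inverse Gram matrix as `SᵀS`, the rows of `S` are an orthonormal frame.
  refine ⟨fun k ↦ WithLp.toLp 2 (S k), fun ξ ↦ ⟨(S⁻¹).transpose.mulVec ξ, ?_, ?_⟩, fun D ↦ ?_⟩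
  · ext i
    have h1 : (ξ : Fin n → ℝ) = S.transpose.mulVec ((S⁻¹).transpose.mulVec ξ) := by
      rw [Matrix.mulVec_mulVec, ← Matrix.transpose_mul, Matrix.nonsing_inv_mul _ hdet]
      simp
    conv_lhs => rw [h1]
    simp [Matrix.mulVec, dotProduct, mul_comm]
  · have hG : formMatrix Q = S⁻¹ * (S⁻¹).transpose := by
      have h2 : IsUnit (formMatrix Q).det := isUnit_iff_ne_zero.2 hQ.posDef.det_pos.ne'
      rw [← Matrix.nonsing_inv_nonsing_inv _ h2, hS, Matrix.mul_inv_rev, Matrix.transpose_nonsing_inv]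
    rw [form_apply_eq, hG, ← Matrix.mulVec_mulVec, Matrix.dotProduct_mulVec]
    simp only [dotProduct, sq]
    refine Finset.sum_congr rfl fun k _ ↦ ?_
    rw [← Matrix.vecMul_transpose, Matrix.transpose_transpose]
  · have h1 : ∀ k, D (WithLp.toLp 2 (S k)) = ∑ i, S k i • D (EuclideanSpace.single i 1) := by
      intro k
      conv_lhs => rw [sum_smul_single (WithLp.toLp 2 (S k))]
      simp
    simp only [formHS, hS, h1, ← real_inner_self_eq_norm_sq, sum_inner, inner_sum,
      real_inner_smul_left, real_inner_smul_right, Matrix.mul_apply, Matrix.transpose_apply,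
      Finset.sum_mul]
    calc _ = ∑ i, ∑ k, ∑ j, S k i * S k j * inner ℝ (D (EuclideanSpace.single i 1))
          (D (EuclideanSpace.single j 1)) := Finset.sum_congr rfl fun i _ ↦ Finset.sum_comm
      _ = ∑ k, ∑ i, ∑ j, S k i * S k j * inner ℝ (D (EuclideanSpace.single i 1))
          (D (EuclideanSpace.single j 1)) := Finset.sum_comm
      _ = _ := by
        refine Finset.sum_congr rfl fun k _ ↦ ?_
        simp only [mul_assoc]
        rw [Finset.sum_comm]
        refine Finset.sum_congr rfl fun i _ ↦ Finset.sum_congr rfl fun j _ ↦ ?_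
        rw [real_inner_comm]
        ring

theorem formHS_nonneg {Q : EuclideanSpace ℝ (Fin n) →L[ℝ] EuclideanSpace ℝ (Fin n) →L[ℝ] ℝ}
    (hQ : IsPosForm Q) (D : EuclideanSpace ℝ (Fin n) →L[ℝ] W) : 0 ≤ formHS Q D := by
  obtain ⟨f, -, hf⟩ := hQ.exists_frame
  rw [hf]
  positivity

theorem norm_sq_le_formHS {Q : EuclideanSpace ℝ (Fin n) →L[ℝ] EuclideanSpace ℝ (Fin n) →L[ℝ] ℝ}
    (hQ : IsPosForm Q) (D : EuclideanSpace ℝ (Fin n) →L[ℝ] W) (ξ : EuclideanSpace ℝ (Fin n)) :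
    ‖D ξ‖ ^ 2 ≤ formHS Q D * Q ξ ξ := by
  obtain ⟨f, hc, hf⟩ := hQ.exists_frame
  obtain ⟨c, hξ, hq⟩ := hc ξ
  have h1 : ‖D ξ‖ ≤ ∑ k, |c k| * ‖D (f k)‖ := by
    rw [hξ, map_sum]
    refine (norm_sum_le _ _).trans (Finset.sum_le_sum fun k _ ↦ ?_)
    rw [map_smul, norm_smul, Real.norm_eq_abs]
  calc ‖D ξ‖ ^ 2 ≤ (∑ k, |c k| * ‖D (f k)‖) ^ 2 := by gcongr
    _ ≤ (∑ k, |c k| ^ 2) * ∑ k, ‖D (f k)‖ ^ 2 := Finset.sum_mul_sq_le_sq_mul_sq _ _ _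
    _ = _ := by rw [hf D, hq]; simp only [sq_abs]; ring

/-- The triangle inequality for the norm `√(‖v‖² + |D|²)`. -/
theorem sqrt_norm_sq_add_formHS_le
    {Q : EuclideanSpace ℝ (Fin n) →L[ℝ] EuclideanSpace ℝ (Fin n) →L[ℝ] ℝ} (hQ : IsPosForm Q)
    (v v' : W) (D D' : EuclideanSpace ℝ (Fin n) →L[ℝ] W) :
    √(‖v + v'‖ ^ 2 + formHS Q (D + D')) ≤ √(‖v‖ ^ 2 + formHS Q D) + √(‖v'‖ ^ 2 + formHS Q D') := by
  obtain ⟨f, -, hf⟩ := hQ.exists_frame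
  -- In an orthonormal frame the quantity is the norm of a vector in an `ℓ²` sum; the extra index of
  -- `Option` carries `v`.
  have key : ∀ (v : W) (D : EuclideanSpace ℝ (Fin n) →L[ℝ] W), √(‖v‖ ^ 2 + formHS Q D) =
      ‖(WithLp.toLp 2 fun k : Option (Fin n) ↦ k.elim v fun k ↦ D (f k) :
        PiLp 2 fun _ : Option (Fin n) ↦ W)‖ := by
    intro v D
    rw [PiLp.norm_eq_of_L2, Fintype.sum_option, hf]
    rfl
  rw [key, key, key]
  refine le_of_eq_of_le ?_ (norm_add_le _ _)
  congr 1
  ext k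
  cases k <;> rfl

/-- The norm is the trace of the inverse Gram matrix times the matrix of inner products of the
images. Under a change of frame by `A` both matrices become `Aᵀ (·) A`, and the factors cancel under
the trace. -/
theorem formHS_comp {Q : EuclideanSpace ℝ (Fin n) →L[ℝ] EuclideanSpace ℝ (Fin n) →L[ℝ] ℝ}
    (T : EuclideanSpace ℝ (Fin n) →L[ℝ] EuclideanSpace ℝ (Fin n)) (hT : Function.Injective T)
    (D : EuclideanSpace ℝ (Fin n) →L[ℝ] W) :
    formHS (Q.bilinearComp T T) (D.comp T) = formHS Q D := by
  set N : Matrix (Fin n) (Fin n) ℝ := Matrix.of fun i j ↦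
    inner ℝ (D (EuclideanSpace.single i 1)) (D (EuclideanSpace.single j 1))
  set A : Matrix (Fin n) (Fin n) ℝ := Matrix.of fun i j ↦ T (EuclideanSpace.single j 1) i
  have hTA : ∀ v, (T v : Fin n → ℝ) = A.mulVec v := by
    intro v
    conv_lhs => rw [sum_smul_single v]
    ext i
    simp [A, Matrix.mulVec, dotProduct, mul_comm]
  have hA : IsUnit A.det := by
    rw [← Matrix.isUnit_iff_isUnit_det, ← Matrix.mulVec_injective_iff_isUnit]
    intro v w h
    have h1 : T (WithLp.toLp 2 v) = T (WithLp.toLp 2 w) := by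
      ext i
      rw [hTA, hTA]
      exact congrFun h i
    simpa using hT h1
  have hT1 : ∀ i, T (EuclideanSpace.single i 1) = ∑ k, A k i • EuclideanSpace.single k (1 : ℝ) :=
    fun i ↦ sum_smul_single _
  have hQA : formMatrix (Q.bilinearComp T T) = A.transpose * formMatrix Q * A := by
    ext i j
    simp only [formMatrix, Matrix.of_apply, ContinuousLinearMap.bilinearComp_apply, hT1, map_sum,
      map_smul, sum_apply, smul_apply, smul_eq_mul, Matrix.mul_apply, Matrix.transpose_apply,
      Finset.sum_mul, Finset.mul_sum]
    refine Finset.sum_congr rfl fun k _ ↦ Finset.sum_congr rfl fun l _ ↦ ?_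
    ring
  have hNA : (Matrix.of fun i j ↦ inner ℝ (D.comp T (EuclideanSpace.single i 1))
      (D.comp T (EuclideanSpace.single j 1)) : Matrix (Fin n) (Fin n) ℝ) =
      A.transpose * N * A := by
    ext i j
    simp only [N, Matrix.of_apply, ContinuousLinearMap.comp_apply, hT1, map_sum,
      map_smul, sum_inner, inner_sum, real_inner_smul_left, real_inner_smul_right,
      Matrix.mul_apply, Matrix.transpose_apply, Finset.sum_mul]
    refine Finset.sum_congr rfl fun k _ ↦ Finset.sum_congr rfl fun l _ ↦ ?_
    ring
  have htr : ∀ (Q : EuclideanSpace ℝ (Fin n) →L[ℝ] EuclideanSpace ℝ (Fin n) →L[ℝ] ℝ)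
      (D : EuclideanSpace ℝ (Fin n) →L[ℝ] W), formHS Q D = ((formMatrix Q)⁻¹ *
        (Matrix.of fun i j ↦ inner ℝ (D (EuclideanSpace.single i 1))
          (D (EuclideanSpace.single j 1)) : Matrix (Fin n) (Fin n) ℝ).transpose).trace :=
    fun Q D ↦ by simp [formHS, Matrix.trace, Matrix.mul_apply]
  have hAt : (A.transpose)⁻¹ * A.transpose = 1 :=
    Matrix.nonsing_inv_mul _ (by rwa [Matrix.det_transpose])
  rw [htr, htr, hQA, hNA, Matrix.mul_inv_rev, Matrix.mul_inv_rev, Matrix.transpose_mul,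
    Matrix.transpose_mul, Matrix.transpose_transpose]
  rw [show A⁻¹ * ((formMatrix Q)⁻¹ * (A.transpose)⁻¹) * (A.transpose * (N.transpose * A)) =
    A⁻¹ * ((formMatrix Q)⁻¹ * ((A.transpose)⁻¹ * A.transpose) * (N.transpose * A)) by
      simp only [Matrix.mul_assoc], hAt, Matrix.trace_mul_comm, Matrix.mul_one, ← Matrix.mul_assoc,
    Matrix.mul_assoc _ A, Matrix.mul_nonsing_inv _ hA, Matrix.mul_one]

end HilbertSchmidt

-- Covariant derivatives of sections, and Kato's inequality.

attribute [local instance] InnerProductSpace.complexToReal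

namespace HermitianBundle

variable {n : ℕ} {H : Type*} [TopologicalSpace H]
  {I : ModelWithCorners ℝ (EuclideanSpace ℝ (Fin n)) H}
  {R : Type*} [TopologicalSpace R] [ChartedSpace H R] [IsManifold I ∞ R]
  (𝓔 : HermitianBundle.{w} I R) {σ τ : 𝓔.Sec}

theorem contMDiff_normSq (hσ : ContMDiff I (I.prod 𝓘(ℝ, 𝓔.F)) ∞ (𝓔.graph σ)) :
    ContMDiff I 𝓘(ℝ, ℝ) ∞ fun x ↦ ‖σ x‖ ^ 2 := by
  have h := ContMDiff.inner_bundle (IB := I) (F := 𝓔.F) (E := 𝓔.V) (v := σ) (w := σ) (b := id)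
    (n := ∞) hσ hσ
  exact h.congr fun x ↦ (real_inner_self_eq_norm_sq _).symm

/-- The covariant derivative as a linear map on the model space. -/
def connDeriv (σ : 𝓔.Sec) (x : R) : EuclideanSpace ℝ (Fin n) →L[ℝ] 𝓔.V x := 𝓔.conn σ x

theorem hsNormSq_conn (g : Metric I R) (σ : 𝓔.Sec) (x : R) :
    hsNormSq g x (𝓔.conn σ x) = formHS (g.form x) (𝓔.connDeriv σ x) := rfl

theorem scalarDeriv_normSq (hσ : ContMDiff I (I.prod 𝓘(ℝ, 𝓔.F)) ∞ (𝓔.graph σ)) (x : R)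
    (ξ : EuclideanSpace ℝ (Fin n)) :
    scalarDeriv I (fun x ↦ ‖σ x‖ ^ 2) x ξ = 2 * inner ℝ (𝓔.connDeriv σ x ξ) (σ x) := by
  have : ContMDiffVectorBundle 1 𝓔.F 𝓔.V I := ContMDiffVectorBundle.of_le (n := ∞) (by norm_cast)
  have hd : MDifferentiableAt I (I.prod 𝓘(ℝ, 𝓔.F)) (fun y ↦ TotalSpace.mk' 𝓔.F y (σ y)) x :=
    hσ.mdifferentiableAt (by simp)
  have h := 𝓔.conn_metric.mvfderiv_inner_eq (x := x) (fun _ ↦ ξ) hd hd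
  have h1 : (fun x ↦ ‖σ x‖ ^ 2) = fun x ↦ inner ℝ (σ x) (σ x) :=
    funext fun x ↦ (real_inner_self_eq_norm_sq _).symm
  rw [h1]
  have h2 : scalarDeriv I (fun x ↦ inner ℝ (σ x) (σ x)) x ξ =
    inner ℝ (𝓔.connDeriv σ x ξ) (σ x) + inner ℝ (σ x) (𝓔.connDeriv σ x ξ) := h
  rw [h2, real_inner_comm (𝓔.connDeriv σ x ξ)]
  ring

theorem connDeriv_add (hσ : ContMDiff I (I.prod 𝓘(ℝ, 𝓔.F)) ∞ (𝓔.graph σ))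
    (hτ : ContMDiff I (I.prod 𝓘(ℝ, 𝓔.F)) ∞ (𝓔.graph τ)) (x : R) :
    𝓔.connDeriv (σ + τ) x = 𝓔.connDeriv σ x + 𝓔.connDeriv τ x :=
  𝓔.conn.isCovariantDerivativeOnUniv.add (hσ.mdifferentiableAt (by simp))
    (hτ.mdifferentiableAt (by simp)) (mem_univ x)

theorem connDeriv_eq_zero (hσ : ContMDiff I (I.prod 𝓘(ℝ, 𝓔.F)) ∞ (𝓔.graph σ)) {x : R}
    (h : ∀ᶠ y in 𝓝 x, σ y = 0) : 𝓔.connDeriv σ x = 0 := by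
  have h1 := 𝓔.conn.isCovariantDerivativeOnUniv.congr_of_eventuallyEq (σ' := 0)
    (hσ.mdifferentiableAt (by simp)) (Bundle.mdifferentiableAt_zeroSection ..) univ_mem h
  have h2 : 𝓔.conn σ x = 0 := h1.trans (𝓔.conn.isCovariantDerivativeOnUniv.zero (mem_univ x))
  exact h2

theorem continuousOn_connDeriv (hσ : ContMDiff I (I.prod 𝓘(ℝ, 𝓔.F)) ∞ (𝓔.graph σ)) (x₀ : R)
    (v w : EuclideanSpace ℝ (Fin n)) :
    ContinuousOn (fun x ↦ (inner ℝ (𝓔.connDeriv σ x (dsymm I x₀ (extChartAt I x₀ x) v))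
      (𝓔.connDeriv σ x (dsymm I x₀ (extChartAt I x₀ x) w)) : ℝ)) (chartAt H x₀).source := by
  have : IsManifold I 1 R := IsManifold.of_le (n := ∞) (by norm_cast)
  set e := trivializationAt (EuclideanSpace ℝ (Fin n)) (TangentSpace I) x₀
  have hconn := (𝓔.smoothConn.contMDiff.contMDiff (σ := σ) (hσ.contMDiffOn))
  have hsec : ∀ v : EuclideanSpace ℝ (Fin n), ContMDiffOn I (I.prod 𝓘(ℝ, 𝓔.F)) 0
      (fun x ↦ TotalSpace.mk' 𝓔.F x (𝓔.conn σ x (e.symm x v : TangentSpace I x)))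
      (chartAt H x₀).source := by
    intro v
    have h1 := (Bundle.Trivialization.contMDiffOn_symm (IB := I) (n := 0) e).comp
      (t := e.target) (s := (chartAt H x₀).source) (f := fun x : R ↦ (x, v))
      (contMDiffOn_id.prodMk contMDiffOn_const) (fun x hx ↦ by simpa [e, e.mem_target] using hx)
    have h2 : ContMDiffOn I (I.prod 𝓘(ℝ, EuclideanSpace ℝ (Fin n))) 0
      (fun x ↦ TotalSpace.mk' (EuclideanSpace ℝ (Fin n)) x (e.symm x v : TangentSpace I x))
      (chartAt H x₀).source := by
      refine h1.congr fun x hx ↦ ?_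
      exact e.mk_symm (by simpa [e] using hx) v
    exact ContMDiffOn.clm_bundle_apply ((hconn.of_le (by simp)).mono (subset_univ _)) h2
  have h3 := ContMDiffOn.inner_bundle (IB := I) (F := 𝓔.F) (E := 𝓔.V) (b := id)
    (n := 0) (hsec v) (hsec w)
  refine h3.continuousOn.congr fun y hy ↦ ?_
  rw [dsymm_eq_symmL hy, dsymm_eq_symmL hy]
  rfl

/-- The definition uses coordinate vectors of the preferred chart at each point, which may jump.
Near `x₀` the norm is computed in the frame of the single chart at `x₀`, where all entries are
continuous; `formHS_comp` allows the change of frame. -/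
theorem continuous_hsNormSq_conn (g : Metric I R)
    (hσ : ContMDiff I (I.prod 𝓘(ℝ, 𝓔.F)) ∞ (𝓔.graph σ)) :
    Continuous fun x ↦ formHS (g.form x) (𝓔.connDeriv σ x) := by
  rw [continuous_iff_continuousAt]
  intro x₀
  have hs : (chartAt H x₀).source ∈ 𝓝 x₀ := chart_source_mem_nhds H x₀
  set Q : R → EuclideanSpace ℝ (Fin n) →L[ℝ] EuclideanSpace ℝ (Fin n) →L[ℝ] ℝ := fun x ↦
    (g.form x).bilinearComp (dsymm I x₀ (extChartAt I x₀ x)) (dsymm I x₀ (extChartAt I x₀ x))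
  have hQ : ContinuousAt (fun x ↦ formMatrix (Q x)) x₀ := by
    refine continuousAt_pi.2 fun i ↦ continuousAt_pi.2 fun j ↦ ?_
    exact (g.continuousOn_form x₀ _ _).continuousAt hs
  have hinj : ∀ x ∈ (chartAt H x₀).source,
      Function.Injective (dsymm I x₀ (extChartAt I x₀ x)) := fun x hx ↦
    dsymm_injective ((extChartAt I x₀).map_source (by simpa using hx))
  have hQp : IsPosForm (Q x₀) := (g.isPosForm x₀).comp (hinj x₀ (mem_chart_source H x₀))
  have hinv : ContinuousAt (fun x ↦ (formMatrix (Q x))⁻¹) x₀ := by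
    have : ContinuousAt (fun A : Matrix (Fin n) (Fin n) ℝ ↦ A⁻¹) (formMatrix (Q x₀)) := by
      simp only [Matrix.inv_def, Ring.inverse_eq_inv']
      exact (continuous_id.matrix_det.continuousAt.inv₀ hQp.posDef.det_pos.ne').smul
        continuous_id.matrix_adjugate.continuousAt
    exact ContinuousAt.comp (g := fun A : Matrix (Fin n) (Fin n) ℝ ↦ A⁻¹) this hQ
  have h1 : ContinuousAt (fun x ↦ formHS (Q x)
      ((𝓔.connDeriv σ x).comp (dsymm I x₀ (extChartAt I x₀ x)))) x₀ := by
    unfold formHS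
    refine tendsto_finsetSum _ fun i _ ↦ tendsto_finsetSum _ fun j _ ↦ ?_
    refine Tendsto.mul ?_ ?_
    · exact ((continuous_apply_apply i j).continuousAt).comp hinv
    · exact (𝓔.continuousOn_connDeriv hσ x₀ _ _).continuousAt hs
  refine h1.congr ?_
  filter_upwards [hs] with x hx
  exact formHS_comp _ (hinj x hx) _

end HermitianBundle

attribute [local instance] InnerProductSpace.complexToReal

/-- `|σ|` may fail to be differentiable at zeros of `σ`, so the scalar inequality is applied to
`√(|σ|² + δ²) - δ` with `e = |∇σ|²`, and `δ → 0`. The constant is that of the scalar inequality and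
does not see the bundle. -/
theorem IsHardyWeightOn.hardy_section {X : StratSpace.{u}} [T2Space X.Reg] {g : Metric X.I X.Reg}
    {N : Set X.carrier} {w : X.Reg → ℝ} (hw : IsHardyWeightOn X g.form N w) :
    ∃ C : ℝ≥0, ∀ (𝓔 : HermitianBundle.{w} X.I X.Reg) (σ : 𝓔.Sec), 𝓔.IsTest σ →
      ∫⁻ x, ENNReal.ofReal (‖σ x‖ ^ 2 / w x ^ 2) ∂riemVolume g ≤
        C * ∫⁻ x, ENNReal.ofReal (‖σ x‖ ^ 2 + formHS (g.form x) (𝓔.connDeriv σ x))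
          ∂riemVolume g := by
  obtain ⟨C, hC⟩ := hw.hardy
  refine ⟨C, fun 𝓔 σ ⟨hσ, K, hK, hσK⟩ ↦ ?_⟩
  set e : X.Reg → ℝ := fun x ↦ formHS (g.form x) (𝓔.connDeriv σ x)
  have hf := 𝓔.contMDiff_normSq hσ
  have hem : Measurable e := (𝓔.continuous_hsNormSq_conn g hσ).measurable
  have he0 : ∀ x, 0 ≤ e x := fun x ↦ formHS_nonneg (g.isPosForm x) _
  have hnn : ∀ x, (0 : ℝ) ≤ ‖σ x‖ ^ 2 := fun x ↦ sq_nonneg _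
  set δ : ℕ → ℝ := fun k ↦ 1 / ((k : ℝ) + 1)
  have hδ : ∀ k, 0 < δ k := fun k ↦ Nat.one_div_pos_of_nat
  have hpos : ∀ k x, 0 < ‖σ x‖ ^ 2 + δ k ^ 2 := fun k x ↦
    add_pos_of_nonneg_of_pos (hnn x) (pow_pos (hδ k) 2)
  -- Subtracting `δ k` makes the regularization vanish where `σ` does, which keeps the support
  -- compact.
  set u : ℕ → X.Reg → ℝ := fun k x ↦ √(‖σ x‖ ^ 2 + δ k ^ 2) - δ k
  have hu : ∀ k, ContMDiff X.I 𝓘(ℝ, ℝ) 1 (u k) := fun k x ↦ by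
    have h1 : ContDiffAt ℝ 1 (fun t ↦ √(t + δ k ^ 2) - δ k) (‖σ x‖ ^ 2) :=
      ((contDiffAt_id.add contDiffAt_const).sqrt (hpos k x).ne').sub contDiffAt_const
    exact h1.contMDiffAt.comp x ((hf x).of_le (by norm_cast))
  have husupp : ∀ k, HasCompactSupport (u k) := fun k ↦
    HasCompactSupport.intro hK fun x hx ↦ by
      simp [u, hσK x hx, Real.sqrt_sq (hδ k).le]
  have hu0 : ∀ k x, 0 ≤ u k x := fun k x ↦ by
    refine sub_nonneg.2 (Real.le_sqrt_of_sq_le ?_)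
    linarith [hnn x]
  have hule : ∀ k x, u k x ≤ ‖σ x‖ := fun k x ↦ by
    refine sub_le_iff_le_add.2 (Real.sqrt_le_iff.2 ⟨by positivity [hδ k], ?_⟩)
    nlinarith [norm_nonneg (σ x), hδ k, mul_nonneg (norm_nonneg (σ x)) (hδ k).le]
  -- Kato's inequality: metric compatibility gives `2⟨∇σ, σ⟩` as differential of `|σ|²`, and the
  -- denominator `|σ|² + δ²` absorbs `|σ|²` after Cauchy–Schwarz.
  have hderiv : ∀ k x ξ, scalarDeriv X.I (u k) x ξ ^ 2 ≤ e x * g.form x ξ ξ := fun k x ξ ↦ by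
    have h1 : HasDerivAt (fun t ↦ √(t + δ k ^ 2) - δ k)
        (1 / (2 * √(‖σ x‖ ^ 2 + δ k ^ 2))) (‖σ x‖ ^ 2) :=
      (((hasDerivAt_id (‖σ x‖ ^ 2)).add_const _).sqrt (hpos k x).ne').sub_const _
    have h2 := ((hasScalarDeriv_scalarDeriv
      (hf.mdifferentiableAt (x := x) (by simp))).comp_deriv h1).scalarDeriv_eq
    have h3 : scalarDeriv X.I (u k) x ξ =
        1 / (2 * √(‖σ x‖ ^ 2 + δ k ^ 2)) * (2 * inner ℝ (𝓔.connDeriv σ x ξ) (σ x)) := by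
      rw [← 𝓔.scalarDeriv_normSq hσ, ← smul_eq_mul]
      exact congr($h2 ξ)
    have h4 : scalarDeriv X.I (u k) x ξ ^ 2 =
        (inner ℝ (𝓔.connDeriv σ x ξ) (σ x)) ^ 2 / (‖σ x‖ ^ 2 + δ k ^ 2) := by
      rw [h3, ← Real.sq_sqrt (hpos k x).le, Real.sqrt_sq (Real.sqrt_nonneg _)]
      field_simp
    rw [h4, div_le_iff₀ (hpos k x)]
    have h5 := norm_sq_le_formHS (g.isPosForm x) (𝓔.connDeriv σ x) ξ
    calc (inner ℝ (𝓔.connDeriv σ x ξ) (σ x)) ^ 2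
        ≤ (‖𝓔.connDeriv σ x ξ‖ * ‖σ x‖) ^ 2 := by
          rw [← sq_abs]
          gcongr
          exact abs_real_inner_le_norm _ _
      _ = ‖𝓔.connDeriv σ x ξ‖ ^ 2 * ‖σ x‖ ^ 2 := mul_pow _ _ _
      _ ≤ e x * g.form x ξ ξ * (‖σ x‖ ^ 2 + δ k ^ 2) := by
          gcongr
          · exact (sq_nonneg _).trans h5
          · exact le_add_of_nonneg_right (sq_nonneg _)
  have hbound : ∀ k, ∫⁻ x, ENNReal.ofReal (u k x ^ 2 / w x ^ 2) ∂riemVolume g ≤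
      C * ∫⁻ x, ENNReal.ofReal (‖σ x‖ ^ 2 + e x) ∂riemVolume g := fun k ↦ by
    refine (hC (u k) e (hu k) (husupp k) hem he0 (hderiv k)).trans ?_
    refine mul_le_mul_right (lintegral_mono fun x ↦ ENNReal.ofReal_le_ofReal ?_) _
    have := hu0 k x
    have := hule k x
    gcongr
  have hlim : ∀ x, Tendsto (fun k ↦ ENNReal.ofReal (u k x ^ 2 / w x ^ 2)) atTop
      (𝓝 (ENNReal.ofReal (‖σ x‖ ^ 2 / w x ^ 2))) := fun x ↦ by
    have hδ0 : Tendsto δ atTop (𝓝 0) := tendsto_one_div_add_atTop_nhds_zero_nat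
    have h1 : Tendsto (fun k ↦ u k x) atTop (𝓝 (√(‖σ x‖ ^ 2 + 0 ^ 2) - 0)) :=
      ((hδ0.pow 2).const_add _).sqrt.sub hδ0
    have h2 : √(‖σ x‖ ^ 2 + 0 ^ 2) - 0 = ‖σ x‖ := by
      simp [Real.sqrt_sq (norm_nonneg (σ x))]
    rw [h2] at h1
    exact (ENNReal.continuous_ofReal.tendsto _).comp ((h1.pow 2).div_const _)
  calc _ = ∫⁻ x, liminf (fun k ↦ ENNReal.ofReal (u k x ^ 2 / w x ^ 2)) atTop ∂riemVolume g :=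
        lintegral_congr fun x ↦ (hlim x).liminf_eq.symm
    _ ≤ liminf (fun k ↦ ∫⁻ x, ENNReal.ofReal (u k x ^ 2 / w x ^ 2) ∂riemVolume g) atTop :=
        lintegral_liminf_le fun k ↦ (((hu k).continuous.measurable.pow_const 2).div
          (hw.contMDiff.continuous.measurable.pow_const 2)).ennreal_ofReal
    _ ≤ _ := by
        refine liminf_le_of_le ?_ fun b hb ↦ ?_
        · isBoundedDefault
        · obtain ⟨k, hk⟩ := hb.exists
          exact hk.trans (hbound k)

-- Measurability of sections through local trivializations.

attribute [local instance] InnerProductSpace.complexToReal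

namespace HermitianBundle

variable {n : ℕ} {H : Type*} [TopologicalSpace H]
  {I : ModelWithCorners ℝ (EuclideanSpace ℝ (Fin n)) H}
  {R : Type*} [TopologicalSpace R] [ChartedSpace H R] [IsManifold I ∞ R]
  (𝓔 : HermitianBundle.{w} I R) {s t : 𝓔.Sec}

/-- The section `s` is almost everywhere equal to a Borel measurable section. -/
def AEMeas [MeasurableSpace R] (μ : Measure R) (s : 𝓔.Sec) : Prop :=
  @AEMeasurable R (TotalSpace 𝓔.F 𝓔.V) (borel _) _ (𝓔.graph s) μ

/-- The expression of a section in the local trivialization at `x₀`. -/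
def localRep (x₀ : R) (s : 𝓔.Sec) (x : R) : 𝓔.F :=
  (trivializationAt 𝓔.F 𝓔.V x₀ (𝓔.graph s x)).2

variable {𝓔}

theorem localRep_eq {x₀ x : R} (hx : x ∈ (trivializationAt 𝓔.F 𝓔.V x₀).baseSet) (s : 𝓔.Sec) :
    𝓔.localRep x₀ s x =
      (trivializationAt 𝓔.F 𝓔.V x₀).continuousLinearEquivAt ℝ x hx (s x) := rfl

variable [MeasurableSpace R] {μ : Measure R}

theorem AEMeas.enorm (hs : 𝓔.AEMeas μ s) : AEMeasurable (fun x ↦ ‖s x‖ₑ) μ := by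
  let _ : MeasurableSpace (TotalSpace 𝓔.F 𝓔.V) := borel _
  have : BorelSpace (TotalSpace 𝓔.F 𝓔.V) := ⟨rfl⟩
  have : IsContinuousRiemannianBundle 𝓔.F 𝓔.V := by
    obtain ⟨g, hg, h⟩ := 𝓔.smoothMetric.exists_contMDiff
    exact ⟨g, hg.continuous, h⟩
  have h1 : Continuous fun z : TotalSpace 𝓔.F 𝓔.V ↦ (inner ℝ z.2 z.2 : ℝ) :=
    Continuous.inner_bundle (F := 𝓔.F) (E := 𝓔.V) (b := TotalSpace.proj) (v := fun z ↦ z.2)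
      (w := fun z ↦ z.2) continuous_id continuous_id
  have h2 : Continuous fun z : TotalSpace 𝓔.F 𝓔.V ↦ ‖z.2‖ₑ := by
    have h3 : (fun z : TotalSpace 𝓔.F 𝓔.V ↦ ‖z.2‖ₑ) =
        fun z ↦ ENNReal.ofReal (√(inner ℝ z.2 z.2)) := by
      ext z
      rw [← norm_eq_sqrt_real_inner, ofReal_norm]
    rw [h3]
    exact ENNReal.continuous_ofReal.comp h1.sqrt
  exact h2.measurable.comp_aemeasurable hs

variable [BorelSpace R]

theorem AEMeas.localRep (hs : 𝓔.AEMeas μ s) (x₀ : R) :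
    @AEMeasurable R 𝓔.F (borel _) _ (𝓔.localRep x₀ s)
      (μ.restrict (trivializationAt 𝓔.F 𝓔.V x₀).baseSet) := by
  let _ : MeasurableSpace 𝓔.F := borel _
  have : BorelSpace 𝓔.F := ⟨rfl⟩
  let _ : MeasurableSpace (TotalSpace 𝓔.F 𝓔.V) := borel _
  have : BorelSpace (TotalSpace 𝓔.F 𝓔.V) := ⟨rfl⟩
  classical
  set e := trivializationAt 𝓔.F 𝓔.V x₀
  have h1 : Measurable (e.source.piecewise (fun z ↦ (e z).2) fun _ ↦ 0) :=
    ContinuousOn.measurable_piecewise (continuous_snd.comp_continuousOn e.continuousOn_toFun)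
      continuousOn_const e.open_source.measurableSet
  refine (h1.comp_aemeasurable (AEMeasurable.mono_measure hs Measure.restrict_le_self)).congr ?_
  filter_upwards [ae_restrict_mem e.open_baseSet.measurableSet] with x hx
  exact Set.piecewise_eq_of_mem _ _ _ (e.mem_source.2 hx)

/-- Countably many trivialization domains cover the base, and over each of them the section is the
image of its local representative under the continuous inverse trivialization. Algebraic operations
and limits can thus be treated in a fixed vector space. -/
theorem aeMeas_of_localRep [SecondCountableTopology R]
    (h : ∀ x₀, @AEMeasurable R 𝓔.F (borel _) _ (𝓔.localRep x₀ s)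
      (μ.restrict (trivializationAt 𝓔.F 𝓔.V x₀).baseSet)) : 𝓔.AEMeas μ s := by
  let _ : MeasurableSpace 𝓔.F := borel _
  have : BorelSpace 𝓔.F := ⟨rfl⟩
  have := FiniteDimensional.proper ℝ 𝓔.F
  let _ : MeasurableSpace (TotalSpace 𝓔.F 𝓔.V) := borel _
  have : BorelSpace (TotalSpace 𝓔.F 𝓔.V) := ⟨rfl⟩
  classical
  obtain ⟨T, hT, hcov⟩ := TopologicalSpace.countable_cover_nhds
    (f := fun x₀ : R ↦ (trivializationAt 𝓔.F 𝓔.V x₀).baseSet) fun x₀ ↦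
      (trivializationAt 𝓔.F 𝓔.V x₀).open_baseSet.mem_nhds (mem_baseSet_trivializationAt _ _ _)
  have := hT.to_subtype
  unfold AEMeas
  rw [← Measure.restrict_univ (μ := μ), ← hcov, biUnion_eq_iUnion, aemeasurable_iUnion_iff]
  rintro ⟨x₀, hx₀⟩
  set e := trivializationAt 𝓔.F 𝓔.V x₀
  have h1 : Measurable (e.target.piecewise e.toOpenPartialHomeomorph.symm
      fun _ ↦ 𝓔.graph s x₀) :=
    ContinuousOn.measurable_piecewise e.continuousOn_invFun
      continuousOn_const e.open_target.measurableSet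
  refine (h1.comp_aemeasurable (aemeasurable_id.prodMk (h x₀))).congr ?_
  filter_upwards [ae_restrict_mem e.open_baseSet.measurableSet] with x hx
  have h2 : (x, 𝓔.localRep x₀ s x) = e (𝓔.graph s x) := by
    refine Prod.ext ?_ rfl
    exact (e.coe_fst' (x := 𝓔.graph s x) hx).symm
  have h3 : 𝓔.graph s x ∈ e.source := e.mem_source.2 hx
  rw [Function.comp_apply, id, h2]
  refine (Set.piecewise_eq_of_mem _ _ _ (e.map_source h3)).trans ?_
  exact e.toOpenPartialHomeomorph.left_inv h3

theorem AEMeas.add [SecondCountableTopology R] (hs : 𝓔.AEMeas μ s) (ht : 𝓔.AEMeas μ t) :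
    𝓔.AEMeas μ (s + t) := by
  let _ : MeasurableSpace 𝓔.F := borel _
  have : BorelSpace 𝓔.F := ⟨rfl⟩
  have := FiniteDimensional.proper ℝ 𝓔.F
  refine aeMeas_of_localRep fun x₀ ↦ ((hs.localRep x₀).add (ht.localRep x₀)).congr ?_
  filter_upwards [ae_restrict_mem (trivializationAt 𝓔.F 𝓔.V x₀).open_baseSet.measurableSet]
    with x hx
  rw [Pi.add_apply, localRep_eq hx, localRep_eq hx, localRep_eq hx, ← map_add]
  rfl

theorem AEMeas.smul [SecondCountableTopology R] (hs : 𝓔.AEMeas μ s) {c : R → ℝ}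
    (hc : Measurable c) : 𝓔.AEMeas μ (fun x ↦ c x • s x) := by
  let _ : MeasurableSpace 𝓔.F := borel _
  have : BorelSpace 𝓔.F := ⟨rfl⟩
  have := FiniteDimensional.proper ℝ 𝓔.F
  refine aeMeas_of_localRep fun x₀ ↦ (hc.aemeasurable.smul (hs.localRep x₀)).congr ?_
  filter_upwards [ae_restrict_mem (trivializationAt 𝓔.F 𝓔.V x₀).open_baseSet.measurableSet]
    with x hx
  rw [Pi.smul_apply', localRep_eq hx, localRep_eq hx, ← map_smul]

theorem AEMeas.sub [SecondCountableTopology R] (hs : 𝓔.AEMeas μ s) (ht : 𝓔.AEMeas μ t) :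
    𝓔.AEMeas μ (s - t) := by
  have h := hs.add (ht.smul (measurable_const (a := (-1 : ℝ))))
  convert h using 1
  ext x
  simp [sub_eq_add_neg]

theorem aeMeas_of_tendsto [SecondCountableTopology R] {u : ℕ → 𝓔.Sec}
    (hu : ∀ k, 𝓔.AEMeas μ (u k)) (h : ∀ᵐ x ∂μ, Tendsto (fun k ↦ u k x) atTop (𝓝 (s x))) :
    𝓔.AEMeas μ s := by
  let _ : MeasurableSpace 𝓔.F := borel _
  have : BorelSpace 𝓔.F := ⟨rfl⟩
  refine aeMeas_of_localRep fun x₀ ↦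
    aemeasurable_of_tendsto_metrizable_ae atTop (fun k ↦ (hu k).localRep x₀) ?_
  filter_upwards [ae_restrict_mem (trivializationAt 𝓔.F 𝓔.V x₀).open_baseSet.measurableSet,
    ae_restrict_of_ae h] with x hx hlim
  exact (((trivializationAt 𝓔.F 𝓔.V x₀).continuousLinearEquivAt ℝ x hx).continuous.tendsto
    (s x)).comp hlim

theorem aeMeas_of_continuous (h : Continuous (𝓔.graph s)) : 𝓔.AEMeas μ s := by
  let _ : MeasurableSpace (TotalSpace 𝓔.F 𝓔.V) := borel _
  have : BorelSpace (TotalSpace 𝓔.F 𝓔.V) := ⟨rfl⟩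
  exact h.measurable.aemeasurable

instance (x : R) : CompleteSpace (𝓔.V x) := by
  have := ((trivializationAt 𝓔.F 𝓔.V x).continuousLinearEquivAt ℝ x
    (mem_baseSet_trivializationAt _ _ _)).symm.toLinearEquiv.finiteDimensional
  exact FiniteDimensional.complete ℝ _

end HermitianBundle

-- Limits of sections in `L²`.

attribute [local instance] InnerProductSpace.complexToReal

namespace HermitianBundle

variable {n : ℕ} {H : Type*} [TopologicalSpace H]
  {I : ModelWithCorners ℝ (EuclideanSpace ℝ (Fin n)) H}
  {R : Type*} [TopologicalSpace R] [ChartedSpace H R] [IsManifold I ∞ R]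
  {𝓔 : HermitianBundle.{w} I R} {s t σ τ : 𝓔.Sec} [MeasurableSpace R]
  {g : Metric I R}

theorem l2Norm_sq (s : 𝓔.Sec) : 𝓔.l2Norm g s ^ 2 = ∫⁻ x, ‖s x‖ₑ ^ 2 ∂(riemVolume g) := by
  rw [l2Norm, ← ENNReal.rpow_natCast, ← ENNReal.rpow_mul]
  norm_num

theorem l2Norm_le_iff {B : ℝ≥0∞} :
    𝓔.l2Norm g s ≤ B ↔ ∫⁻ x, ‖s x‖ₑ ^ 2 ∂(riemVolume g) ≤ B ^ 2 := by
  rw [← l2Norm_sq, ENNReal.pow_le_pow_left_iff two_ne_zero]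

theorem l2Norm_le_h1Norm (s : 𝓔.Sec) : 𝓔.l2Norm g s ≤ 𝓔.h1Norm g s :=
  ENNReal.rpow_le_rpow le_self_add (by norm_num)

/-- Fatou's lemma for the pointwise squared norms. -/
theorem l2Norm_le_of_tendsto {v : ℕ → 𝓔.Sec} (hv : ∀ j, 𝓔.AEMeas (riemVolume g) (v j))
    (hlim : ∀ᵐ x ∂(riemVolume g), Tendsto (fun j ↦ v j x) atTop (𝓝 (s x))) {B : ℝ≥0∞}
    (hB : ∀ᶠ j in atTop, 𝓔.l2Norm g (v j) ≤ B) : 𝓔.l2Norm g s ≤ B := by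
  rw [l2Norm_le_iff]
  calc _ = ∫⁻ x, liminf (fun j ↦ ‖v j x‖ₑ ^ 2) atTop ∂(riemVolume g) := by
        refine lintegral_congr_ae ?_
        filter_upwards [hlim] with x hx
        exact (((ENNReal.continuous_pow 2).tendsto _).comp hx.enorm).liminf_eq.symm
    _ ≤ liminf (fun j ↦ ∫⁻ x, ‖v j x‖ₑ ^ 2 ∂(riemVolume g)) atTop :=
        lintegral_liminf_le' fun j ↦ (hv j).enorm.pow_const 2
    _ ≤ B ^ 2 := by
        refine liminf_le_of_le (by isBoundedDefault) fun b hb ↦ ?_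
        obtain ⟨j, hj, hj'⟩ := (hb.and hB).exists
        exact hj.trans (l2Norm_le_iff.1 hj')

/-- Since `4^j * 8^(-j) = 2^(-j)` is summable, the function `∑ 4^j f_j²` is integrable, hence finite
almost everywhere. Its square root bounds `2^j f_j` for every `j`. -/
theorem ae_le_geometric {f : ℕ → R → ℝ≥0∞}
    (hf : ∀ k, AEMeasurable (f k) (riemVolume g))
    (h : ∀ j, ∫⁻ x, f j x ^ 2 ∂(riemVolume g) ≤ (8⁻¹ : ℝ≥0∞) ^ j) :
    ∀ᵐ x ∂(riemVolume g), ∃ C : ℝ, ∀ j, f j x ≤ ENNReal.ofReal (C * (1 / 2) ^ j) := by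
  have h1 : ∫⁻ x, ∑' j, (4 : ℝ≥0∞) ^ j * f j x ^ 2 ∂(riemVolume g) < ⊤ := by
    rw [lintegral_tsum fun j ↦ ((hf j).pow_const 2).const_mul _]
    calc _ ≤ ∑' j, (2⁻¹ : ℝ≥0∞) ^ j := by
          refine ENNReal.tsum_le_tsum fun j ↦ ?_
          rw [lintegral_const_mul'' _ ((hf j).pow_const 2)]
          calc _ ≤ (4 : ℝ≥0∞) ^ j * 8⁻¹ ^ j := mul_le_mul_right (h j) _
            _ = 2⁻¹ ^ j := by
              rw [← mul_pow, ← ENNReal.toReal_eq_toReal_iff' (by finiteness) (by finiteness)]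
              norm_num [ENNReal.toReal_mul]
      _ < ⊤ := by rw [ENNReal.tsum_geometric]; norm_num
  have h2 := ae_lt_top' (AEMeasurable.tsum fun j ↦
    ((hf j).pow_const 2).const_mul ((4 : ℝ≥0∞) ^ j)) h1.ne
  filter_upwards [h2] with x hx
  set A := ∑' j, (4 : ℝ≥0∞) ^ j * f j x ^ 2
  refine ⟨√A.toReal, fun j ↦ ?_⟩
  have h3 : (4 : ℝ≥0∞) ^ j * f j x ^ 2 ≤ A := ENNReal.le_tsum j
  rw [← ENNReal.pow_le_pow_left_iff two_ne_zero, ← ENNReal.ofReal_pow (by positivity), mul_pow,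
    Real.sq_sqrt ENNReal.toReal_nonneg, ENNReal.ofReal_mul ENNReal.toReal_nonneg,
    ENNReal.ofReal_toReal hx.ne]
  have h4 : (4 : ℝ≥0∞) ^ j * ENNReal.ofReal (((1 / 2 : ℝ) ^ j) ^ 2) = 1 := by
    rw [← pow_mul, mul_comm j 2, pow_mul, ENNReal.ofReal_pow (by positivity), ← mul_pow]
    have : (4 : ℝ≥0∞) = ENNReal.ofReal 4 := by simp
    rw [this, ← ENNReal.ofReal_mul (by norm_num)]
    norm_num
  calc f j x ^ 2 = (4 : ℝ≥0∞) ^ j * f j x ^ 2 * ENNReal.ofReal (((1 / 2 : ℝ) ^ j) ^ 2) := by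
        rw [mul_right_comm, h4, one_mul]
    _ ≤ _ := mul_le_mul_left h3 _

variable [BorelSpace R] [SecondCountableTopology R]

theorem exists_subseq_tendsto {u : ℕ → 𝓔.Sec} (hu : ∀ k, 𝓔.AEMeas (riemVolume g) (u k))
    (hs : 𝓔.AEMeas (riemVolume g) s)
    (h : Tendsto (fun k ↦ 𝓔.l2Norm g (u k - s)) atTop (𝓝 0)) :
    ∃ φ : ℕ → ℕ, StrictMono φ ∧
      ∀ᵐ x ∂(riemVolume g), Tendsto (fun j ↦ u (φ j) x) atTop (𝓝 (s x)) := by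
  have h1 : ∀ j : ℕ, ∀ᶠ k in atTop,
      ∫⁻ x, ‖(u k - s) x‖ₑ ^ 2 ∂(riemVolume g) ≤ (8⁻¹ : ℝ≥0∞) ^ j := fun j ↦ by
    have h2 : Tendsto (fun k ↦ 𝓔.l2Norm g (u k - s) ^ 2) atTop (𝓝 (0 ^ 2)) :=
      ((ENNReal.continuous_pow 2).tendsto 0).comp h
    simp only [l2Norm_sq, ne_eq, OfNat.ofNat_ne_zero, not_false_eq_true, zero_pow] at h2
    exact h2.eventually_le_const (by simp [pos_iff_ne_zero])
  obtain ⟨φ, hφ, hφ'⟩ := extraction_forall_of_eventually h1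
  refine ⟨φ, hφ, ?_⟩
  filter_upwards [ae_le_geometric (fun j ↦ ((hu (φ j)).sub hs).enorm) hφ']
    with x ⟨C, hC⟩
  rw [tendsto_iff_edist_tendsto_0]
  have h3 : Tendsto (fun j : ℕ ↦ ENNReal.ofReal (C * (1 / 2) ^ j)) atTop (𝓝 0) := by
    have h4 : Tendsto (fun j : ℕ ↦ C * (1 / 2 : ℝ) ^ j) atTop (𝓝 (C * 0)) :=
      (tendsto_pow_atTop_nhds_zero_of_lt_one (by norm_num) (by norm_num)).const_mul C
    rw [mul_zero] at h4
    have h5 := (ENNReal.continuous_ofReal.tendsto _).comp h4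
    rwa [ENNReal.ofReal_zero] at h5
  refine tendsto_of_tendsto_of_tendsto_of_le_of_le tendsto_const_nhds h3 (fun _ ↦ zero_le)
    fun j ↦ ?_
  rw [edist_eq_enorm_sub]
  exact hC j

/-- The Riesz–Fischer argument: along a fast subsequence the differences are almost everywhere
bounded by a geometric series, so the values converge in the complete fibres. -/
theorem exists_subseq_tendsto_of_cauchy {u : ℕ → 𝓔.Sec}
    (hu : ∀ k, 𝓔.AEMeas (riemVolume g) (u k))
    (h : Tendsto (fun p : ℕ × ℕ ↦ 𝓔.l2Norm g (u p.1 - u p.2)) atTop (𝓝 0)) :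
    ∃ s : 𝓔.Sec, ∃ φ : ℕ → ℕ, StrictMono φ ∧
      ∀ᵐ x ∂(riemVolume g), Tendsto (fun j ↦ u (φ j) x) atTop (𝓝 (s x)) := by
  have h1 : ∀ j : ℕ, ∀ᶠ k in atTop, ∀ l ≥ k,
      ∫⁻ x, ‖(u l - u k) x‖ₑ ^ 2 ∂(riemVolume g) ≤ (8⁻¹ : ℝ≥0∞) ^ j := fun j ↦ by
    have h2 : Tendsto (fun p : ℕ × ℕ ↦ 𝓔.l2Norm g (u p.1 - u p.2) ^ 2) atTop (𝓝 (0 ^ 2)) :=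
      ((ENNReal.continuous_pow 2).tendsto 0).comp h
    simp only [l2Norm_sq, ne_eq, OfNat.ofNat_ne_zero, not_false_eq_true, zero_pow] at h2
    obtain ⟨⟨N, M⟩, hN⟩ := eventually_atTop.1
      (h2.eventually_le_const (u := (8⁻¹ : ℝ≥0∞) ^ j) (by simp [pos_iff_ne_zero]))
    filter_upwards [eventually_ge_atTop (max N M)] with k hk l hl
    exact hN (l, k) ⟨(le_max_left _ _).trans (hk.trans hl), (le_max_right _ _).trans hk⟩
  obtain ⟨φ, hφ, hφ'⟩ := extraction_forall_of_eventually h1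
  have h2 : ∀ᵐ x ∂(riemVolume g), ∃ y, Tendsto (fun j ↦ u (φ j) x) atTop (𝓝 y) := by
    filter_upwards [ae_le_geometric
      (fun j ↦ ((hu (φ (j + 1))).sub (hu (φ j))).enorm)
      fun j ↦ hφ' j _ (hφ.monotone j.le_succ)] with x ⟨C, hC⟩
    refine cauchySeq_tendsto_of_complete (cauchySeq_of_le_geometric (1 / 2) (max C 0)
      (by norm_num) fun j ↦ ?_)
    rw [dist_comm, dist_eq_norm, ← ENNReal.ofReal_le_ofReal_iff (by positivity), ofReal_norm]
    exact (hC j).trans (ENNReal.ofReal_le_ofReal (by gcongr; exact le_max_left _ _))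
  classical
  refine ⟨fun x ↦ if h : ∃ y, Tendsto (fun j ↦ u (φ j) x) atTop (𝓝 y) then h.choose else 0,
    φ, hφ, ?_⟩
  filter_upwards [h2] with x hx
  rw [dif_pos hx]
  exact hx.choose_spec

end HermitianBundle

-- The `H¹`-norm and Cauchy sequences of test sections.

attribute [local instance] InnerProductSpace.complexToReal

namespace HermitianBundle

variable {n : ℕ} {H : Type*} [TopologicalSpace H]
  {I : ModelWithCorners ℝ (EuclideanSpace ℝ (Fin n)) H}
  {R : Type*} [TopologicalSpace R] [ChartedSpace H R] [IsManifold I ∞ R]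
  {𝓔 : HermitianBundle.{w} I R} {s t σ τ : 𝓔.Sec} {g : Metric I R}

theorem IsTest.sub (hσ : 𝓔.IsTest σ) (hτ : 𝓔.IsTest τ) : 𝓔.IsTest (σ - τ) := by
  obtain ⟨h1, K, hK, hσK⟩ := hσ
  obtain ⟨h2, K', hK', hτK⟩ := hτ
  refine ⟨ContMDiff.sub_section h1 h2, K ∪ K', hK.union hK', fun x hx ↦ ?_⟩
  rw [Pi.sub_apply, hσK x fun h ↦ hx (Or.inl h), hτK x fun h ↦ hx (Or.inr h), sub_zero]

theorem continuous_norm_sq (hσ : ContMDiff I (I.prod 𝓘(ℝ, 𝓔.F)) ∞ (𝓔.graph σ)) :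
    Continuous fun x ↦ ‖σ x‖ ^ 2 := (𝓔.contMDiff_normSq hσ).continuous

/-- The pointwise `H¹`-norm. -/
def h1Density (g : Metric I R) (σ : 𝓔.Sec) (x : R) : ℝ :=
  ‖σ x‖ ^ 2 + formHS (g.form x) (𝓔.connDeriv σ x)

theorem h1Density_nonneg (x : R) : 0 ≤ h1Density g σ x :=
  add_nonneg (sq_nonneg _) (formHS_nonneg (g.isPosForm x) _)

theorem continuous_h1Density (hσ : ContMDiff I (I.prod 𝓘(ℝ, 𝓔.F)) ∞ (𝓔.graph σ)) :
    Continuous (h1Density g σ) :=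
  (continuous_norm_sq hσ).add (𝓔.continuous_hsNormSq_conn g hσ)

theorem hasCompactSupport_h1Density [T2Space R] (hσ : 𝓔.IsTest σ) :
    HasCompactSupport (h1Density g σ) := by
  obtain ⟨hs, K, hK, hσK⟩ := hσ
  refine HasCompactSupport.intro hK fun x hx ↦ ?_
  have h1 : 𝓔.connDeriv σ x = 0 := 𝓔.connDeriv_eq_zero hs <| by
    filter_upwards [hK.isClosed.isOpen_compl.mem_nhds hx] with y hy using hσK y hy
  simp [h1Density, h1, hσK x hx, formHS]

variable [MeasurableSpace R]

theorem IsH1Cauchy.tendsto_l2Norm {u : ℕ → 𝓔.Sec} (hu : 𝓔.IsH1Cauchy g u) :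
    Tendsto (fun p : ℕ × ℕ ↦ 𝓔.l2Norm g (u p.1 - u p.2)) atTop (𝓝 0) :=
  tendsto_of_tendsto_of_tendsto_of_le_of_le tendsto_const_nhds hu.2 (fun _ ↦ zero_le)
    fun _ ↦ l2Norm_le_h1Norm _

variable [BorelSpace R]

theorem h1Norm_eq (hσ : ContMDiff I (I.prod 𝓘(ℝ, 𝓔.F)) ∞ (𝓔.graph σ)) :
    𝓔.h1Norm g σ =
      (∫⁻ x, ENNReal.ofReal (h1Density g σ x) ∂(riemVolume g)) ^ (1 / 2 : ℝ) := by
  have h0 : ∀ x, hsNormSq g x (𝓔.conn σ x) = formHS (g.form x) (𝓔.connDeriv σ x) :=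
    𝓔.hsNormSq_conn g σ
  simp only [h1Norm, h0]
  rw [← lintegral_add_right _ (𝓔.continuous_hsNormSq_conn g hσ).measurable.ennreal_ofReal]
  congr 1
  refine lintegral_congr fun x ↦ ?_
  rw [h1Density, ENNReal.ofReal_add (sq_nonneg _) (formHS_nonneg (g.isPosForm x) _),
    ENNReal.ofReal_pow (norm_nonneg _), ofReal_norm]

theorem h1Norm_sq (hσ : ContMDiff I (I.prod 𝓘(ℝ, 𝓔.F)) ∞ (𝓔.graph σ)) :
    𝓔.h1Norm g σ ^ 2 = ∫⁻ x, ENNReal.ofReal (h1Density g σ x) ∂(riemVolume g) := by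
  rw [h1Norm_eq hσ, ← ENNReal.rpow_natCast, ← ENNReal.rpow_mul]
  norm_num

/-- The density is continuous with compact support, and the volume measure is locally finite. -/
theorem h1Norm_lt_top [T2Space R] (hσ : 𝓔.IsTest σ) : 𝓔.h1Norm g σ < ⊤ := by
  rw [h1Norm_eq hσ.1]
  refine ENNReal.rpow_lt_top_of_nonneg (by norm_num) (ne_of_lt ?_)
  have : IsLocallyFiniteMeasure (riemVolume g) :=
    isLocallyFiniteMeasure_formVol (Metric.isContForm g)
  have h := (continuous_h1Density hσ.1).integrable_of_hasCompactSupport (μ := riemVolume g)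
    (hasCompactSupport_h1Density (g := g) hσ)
  exact h.lintegral_lt_top

/-- Minkowski's inequality, after the pointwise triangle inequality for `√(|σ|² + |∇σ|²)`. -/
theorem h1Norm_add_le (hσ : ContMDiff I (I.prod 𝓘(ℝ, 𝓔.F)) ∞ (𝓔.graph σ))
    (hτ : ContMDiff I (I.prod 𝓘(ℝ, 𝓔.F)) ∞ (𝓔.graph τ)) :
    𝓔.h1Norm g (σ + τ) ≤ 𝓔.h1Norm g σ + 𝓔.h1Norm g τ := by
  have key : ∀ {ρ : 𝓔.Sec}, ContMDiff I (I.prod 𝓘(ℝ, 𝓔.F)) ∞ (𝓔.graph ρ) → 𝓔.h1Norm g ρ =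
      (∫⁻ x, ENNReal.ofReal (√(h1Density g ρ x)) ^ (2 : ℝ) ∂(riemVolume g)) ^ (1 / 2 : ℝ) := by
    intro ρ hρ
    rw [h1Norm_eq hρ]
    congr 1
    refine lintegral_congr fun x ↦ ?_
    rw [ENNReal.ofReal_rpow_of_nonneg (Real.sqrt_nonneg _) (by norm_num), Real.rpow_two,
      Real.sq_sqrt (h1Density_nonneg x)]
  have hm : ∀ {ρ : 𝓔.Sec}, ContMDiff I (I.prod 𝓘(ℝ, 𝓔.F)) ∞ (𝓔.graph ρ) →
      AEMeasurable (fun x ↦ ENNReal.ofReal (√(h1Density g ρ x))) (riemVolume g) := fun hρ ↦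
    (continuous_h1Density hρ).sqrt.measurable.ennreal_ofReal.aemeasurable
  rw [key hσ, key hτ, key (ContMDiff.add_section hσ hτ)]
  refine le_trans ?_ (ENNReal.lintegral_Lp_add_le (hm hσ) (hm hτ) (by norm_num))
  refine ENNReal.rpow_le_rpow (lintegral_mono fun x ↦ ENNReal.rpow_le_rpow ?_ (by norm_num))
    (by norm_num)
  rw [Pi.add_apply, ← ENNReal.ofReal_add (Real.sqrt_nonneg _) (Real.sqrt_nonneg _)]
  refine ENNReal.ofReal_le_ofReal ?_
  rw [h1Density, 𝓔.connDeriv_add hσ hτ]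
  exact sqrt_norm_sq_add_formHS_le (g.isPosForm x) _ _ _ _

theorem IsTest.aeMeas (hσ : 𝓔.IsTest σ) : 𝓔.AEMeas (riemVolume g) σ :=
  aeMeas_of_continuous hσ.1.continuous

theorem IsTest.h1Norm_le [T2Space R] (hσ : 𝓔.IsTest σ) (hτ : 𝓔.IsTest τ) :
    𝓔.h1Norm g σ ≤ 𝓔.h1Norm g τ + 𝓔.h1Norm g (σ - τ) := by
  have h := h1Norm_add_le (g := g) hτ.1 (hσ.sub hτ).1
  rwa [add_sub_cancel] at h

/-- The norms of a Cauchy sequence converge. -/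
theorem IsH1Cauchy.exists_tendsto_h1Norm [T2Space R] {u : ℕ → 𝓔.Sec} (hu : 𝓔.IsH1Cauchy g u) :
    ∃ N < ⊤, Tendsto (fun k ↦ 𝓔.h1Norm g (u k)) atTop (𝓝 N) := by
  have hfin : ∀ k, 𝓔.h1Norm g (u k) ≠ ⊤ := fun k ↦ (h1Norm_lt_top (hu.1 k)).ne
  have hle : ∀ k l, (𝓔.h1Norm g (u k)).toReal ≤
      (𝓔.h1Norm g (u l)).toReal + (𝓔.h1Norm g (u k - u l)).toReal := fun k l ↦
    ENNReal.toReal_le_add ((hu.1 k).h1Norm_le (hu.1 l)) (hfin l)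
      (h1Norm_lt_top ((hu.1 k).sub (hu.1 l))).ne
  have hc : CauchySeq fun k ↦ (𝓔.h1Norm g (u k)).toReal := by
    rw [Metric.cauchySeq_iff]
    intro ε hε
    have h1 := (ENNReal.tendsto_toReal ENNReal.zero_ne_top).comp hu.2
    obtain ⟨⟨N, M⟩, hN⟩ := eventually_atTop.1
      (h1.eventually (gt_mem_nhds (show ENNReal.toReal 0 < ε by simpa using hε)))
    refine ⟨max N M, fun k hk l hl ↦ ?_⟩
    have h2 : (𝓔.h1Norm g (u k - u l)).toReal < ε :=
      hN (k, l) ⟨(le_max_left _ _).trans hk, (le_max_right _ _).trans hl⟩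
    have h3 : (𝓔.h1Norm g (u l - u k)).toReal < ε :=
      hN (l, k) ⟨(le_max_left _ _).trans hl, (le_max_right _ _).trans hk⟩
    rw [Real.dist_eq, abs_lt]
    constructor <;> linarith [hle k l, hle l k]
  obtain ⟨r, hr⟩ := cauchySeq_tendsto_of_complete hc
  refine ⟨ENNReal.ofReal r, ENNReal.ofReal_lt_top, ?_⟩
  exact ((ENNReal.continuous_ofReal.tendsto r).comp hr).congr fun k ↦ ENNReal.ofReal_toReal (hfin k)

variable [SecondCountableTopology R]

/-- If a double sequence is small and the second index tends to a limit almost everywhere, then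
the limit is approximated in `L²`. -/
theorem tendsto_l2Norm_sub {v : ℕ → 𝓔.Sec} (hv : ∀ k, 𝓔.AEMeas (riemVolume g) (v k))
    {φ : ℕ → ℕ} (hφ : StrictMono φ)
    (hs : ∀ᵐ x ∂(riemVolume g), Tendsto (fun j ↦ v (φ j) x) atTop (𝓝 (s x)))
    (h : Tendsto (fun p : ℕ × ℕ ↦ 𝓔.l2Norm g (v p.1 - v p.2)) atTop (𝓝 0)) :
    Tendsto (fun k ↦ 𝓔.l2Norm g (v k - s)) atTop (𝓝 0) := by
  rw [ENNReal.tendsto_nhds_zero] at h ⊢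
  intro ε hε
  obtain ⟨⟨N, M⟩, hN⟩ := eventually_atTop.1 (h ε hε)
  filter_upwards [eventually_ge_atTop N] with k hk
  refine l2Norm_le_of_tendsto (v := fun j ↦ v k - v (φ j)) (fun j ↦ (hv k).sub (hv _)) ?_ ?_
  · filter_upwards [hs] with x hx using hx.const_sub _
  · filter_upwards [hφ.tendsto_atTop.eventually_ge_atTop M] with j hj using hN (k, φ j) ⟨hk, hj⟩

variable [T2Space R]

/-- An `H¹`-Cauchy sequence is also Cauchy in `L²`, so a subsequence converges almost everywhere.
Fatou's lemma bounds the limit and shows that the whole sequence tends to it. -/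
theorem IsH1Cauchy.exists_representsH1 {u : ℕ → 𝓔.Sec} (hu : 𝓔.IsH1Cauchy g u) :
    ∃ s N, N < ⊤ ∧ 𝓔.RepresentsH1 g u s N := by
  have hm : ∀ k, 𝓔.AEMeas (riemVolume g) (u k) := fun k ↦ (hu.1 k).aeMeas
  obtain ⟨N, hN, hlim⟩ := hu.exists_tendsto_h1Norm
  obtain ⟨s, φ, hφ, hs⟩ := exists_subseq_tendsto_of_cauchy hm hu.tendsto_l2Norm
  refine ⟨s, N, hN, hu, ⟨aeMeas_of_tendsto (fun j ↦ hm (φ j)) hs, ?_⟩,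
    tendsto_l2Norm_sub hm hφ hs hu.tendsto_l2Norm, hlim⟩
  have h1 : N < N + 1 := ENNReal.lt_add_right hN.ne one_ne_zero
  refine (l2Norm_le_of_tendsto (fun j ↦ hm (φ j)) hs (B := N + 1) ?_).trans_lt
    (ENNReal.add_lt_top.2 ⟨hN, ENNReal.one_lt_top⟩)
  filter_upwards [hφ.tendsto_atTop.eventually (hlim.eventually_lt_const h1)] with j hj
  exact (l2Norm_le_h1Norm _).trans hj.le

end HermitianBundle

-- Extension of multiplication operators to the completion.

attribute [local instance] InnerProductSpace.complexToReal

namespace HermitianBundle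

variable {n : ℕ} {H : Type*} [TopologicalSpace H]
  {I : ModelWithCorners ℝ (EuclideanSpace ℝ (Fin n)) H}
  {R : Type*} [TopologicalSpace R] [ChartedSpace H R] [IsManifold I ∞ R]
  {𝓔 : HermitianBundle.{w} I R} {s : 𝓔.Sec} {g : Metric I R}
  [MeasurableSpace R] [BorelSpace R] [SecondCountableTopology R] [T2Space R]

/-- A multiplication operator which is bounded on test sections is bounded on `H¹`. -/
theorem RepresentsH1.smul {c : R → ℝ} (hc : Measurable c) {C : ℝ≥0}
    (hC : ∀ σ, 𝓔.IsTest σ → 𝓔.l2Norm g (fun x ↦ c x • σ x) ≤ C * 𝓔.h1Norm g σ)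
    {u : ℕ → 𝓔.Sec} {N : ℝ≥0∞} (h : 𝓔.RepresentsH1 g u s N) :
    𝓔.MemL2 g (fun x ↦ c x • s x) ∧ 𝓔.l2Norm g (fun x ↦ c x • s x) ≤ C * N ∧
      Tendsto (fun k ↦ 𝓔.l2Norm g ((fun x ↦ c x • u k x) - fun x ↦ c x • s x)) atTop (𝓝 0) := by
  obtain ⟨N', hN, hN'⟩ := h.cauchy.exists_tendsto_h1Norm
  obtain rfl := tendsto_nhds_unique h.tendsto_norm hN'
  have hm : ∀ k, 𝓔.AEMeas (riemVolume g) (u k) := fun k ↦ (h.cauchy.1 k).aeMeas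
  -- Pointwise convergence survives multiplication by the possibly unbounded function `c`, whereas
  -- `L²` convergence need not. Fatou's lemma then recovers the norm estimates.
  obtain ⟨φ, hφ, hs⟩ := exists_subseq_tendsto hm h.memL2.1 h.tendsto_l2
  have hm' : ∀ k, 𝓔.AEMeas (riemVolume g) fun x ↦ c x • u k x := fun k ↦ (hm k).smul hc
  have hs' : ∀ᵐ x ∂(riemVolume g), Tendsto (fun j ↦ c x • u (φ j) x) atTop (𝓝 (c x • s x)) := by
    filter_upwards [hs] with x hx using hx.const_smul _
  have hsub : ∀ k l, (fun x ↦ c x • u k x) - (fun x ↦ c x • u l x) =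
      fun x ↦ c x • (u k - u l) x := fun k l ↦ by
    ext x
    exact (smul_sub _ _ _).symm
  have hle : 𝓔.l2Norm g (fun x ↦ c x • s x) ≤ C * N := by
    have h1 : Tendsto (fun j ↦ (C : ℝ≥0∞) * 𝓔.h1Norm g (u (φ j))) atTop (𝓝 (C * N)) :=
      ENNReal.Tendsto.const_mul (h.tendsto_norm.comp hφ.tendsto_atTop)
        (Or.inr ENNReal.coe_ne_top)
    refine le_of_forall_gt fun B hB ↦ ?_
    obtain ⟨B', hB', hB''⟩ := exists_between hB
    refine (l2Norm_le_of_tendsto (fun j ↦ hm' (φ j)) hs' (B := B') ?_).trans_lt hB''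
    filter_upwards [h1.eventually_lt_const hB'] with j hj
    exact (hC _ (h.cauchy.1 _)).trans hj.le
  refine ⟨⟨AEMeas.smul (𝓔 := 𝓔) h.memL2.1 hc, hle.trans_lt (ENNReal.mul_lt_top ENNReal.coe_lt_top hN)⟩, hle,
    tendsto_l2Norm_sub hm' hφ hs' ?_⟩
  have h2 : Tendsto (fun p : ℕ × ℕ ↦ (C : ℝ≥0∞) * 𝓔.h1Norm g (u p.1 - u p.2)) atTop
      (𝓝 (C * 0)) := ENNReal.Tendsto.const_mul h.cauchy.2 (Or.inr ENNReal.coe_ne_top)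
  rw [mul_zero] at h2
  refine tendsto_of_tendsto_of_tendsto_of_le_of_le tendsto_const_nhds h2 (fun _ ↦ zero_le)
    fun p ↦ ?_
  change 𝓔.l2Norm g ((fun x ↦ c x • u p.1 x) - fun x ↦ c x • u p.2 x) ≤ _
  rw [hsub]
  exact hC _ ((h.cauchy.1 _).sub (h.cauchy.1 _))

end HermitianBundle

variable {X : StratSpace.{u}}

/-- Where the Hardy inequality holds, multiplication by the inverse distance is bounded on test
sections. -/
theorem IsHardyWeightOn.exists_l2Norm_smul_le [T2Space X.Reg] {g : Metric X.I X.Reg}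
    {w : X.Reg → ℝ} (hw : IsHardyWeightOn X g.form X.sing w) :
    ∃ C : ℝ≥0, ∀ (𝓔 : HermitianBundle.{w} X.I X.Reg) (σ : 𝓔.Sec), 𝓔.IsTest σ →
      𝓔.l2Norm g (fun x ↦ ((singDist g x)⁻¹).toReal • σ x) ≤ C * 𝓔.h1Norm g σ := by
  obtain ⟨K, hK, hKd⟩ := hw.le_singDist
  obtain ⟨C, hC⟩ := hw.hardy_section
  refine ⟨K * NNReal.sqrt C, fun 𝓔 σ hσ ↦ HermitianBundle.l2Norm_le_iff.2 ?_⟩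
  -- Inverting `w ≤ K d` in the extended reals also covers `d = ∞`, where the multiplier is `0`.
  have hc : ∀ x, ((singDist g x)⁻¹).toReal ≤ K / w x := fun x ↦ by
    refine ENNReal.toReal_le_of_le_ofReal (div_nonneg K.2 (hw.pos x).le) ?_
    rw [ENNReal.ofReal_div_of_pos (hw.pos x), ENNReal.ofReal_coe_nnreal]
    rw [ENNReal.inv_le_iff_inv_le, ENNReal.inv_div (Or.inr ENNReal.coe_ne_top)
      (Or.inr (by simpa using hK.ne'))]
    exact ENNReal.div_le_of_le_mul' (hKd x)
  have hsq : ((K * NNReal.sqrt C : ℝ≥0) : ℝ≥0∞) ^ 2 = (K : ℝ≥0∞) ^ 2 * C := by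
    rw [← ENNReal.coe_pow, mul_pow, NNReal.sq_sqrt, ENNReal.coe_mul, ENNReal.coe_pow]
  rw [mul_pow, HermitianBundle.h1Norm_sq hσ.1, hsq, mul_assoc]
  refine le_trans ?_ (mul_le_mul_right (hC 𝓔 σ hσ) _)
  rw [← lintegral_const_mul' _ _ (by finiteness)]
  refine lintegral_mono fun x ↦ ?_
  beta_reduce
  have h0 : ‖((singDist g x)⁻¹).toReal • σ x‖ ≤ K * (‖σ x‖ / w x) := by
    rw [norm_smul, Real.norm_of_nonneg ENNReal.toReal_nonneg]
    calc _ ≤ K / w x * ‖σ x‖ := by gcongr; exact hc x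
      _ = _ := by ring
  rw [← ofReal_norm, ← div_pow, ENNReal.ofReal_pow (div_nonneg (norm_nonneg _) (hw.pos x).le),
    ← mul_pow]
  gcongr
  rw [← ENNReal.ofReal_coe_nnreal, ← ENNReal.ofReal_mul (NNReal.coe_nonneg K)]
  exact ENNReal.ofReal_le_ofReal h0

end IACS

end

/-- Elements of `H¹` are represented by Cauchy sequences of test sections. The estimates hold for
every section and norm represented by such a sequence, and every Cauchy sequence represents some
element, so the extension is defined on all of the completion. The convergence identifies it as the
continuous extension from test sections. -/
theorem mainTheorem5 (M : IACS.IACSManifold.{u}) [CompactSpace M.space.carrier]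
    [T2Space M.space.carrier] (hlink : M.LinkDimGE 2) :
    (∀ p, 0 < M.singDist p) ∧
    ∃ C : ℝ≥0, ∀ 𝓔 : IACS.HermitianBundle.{w} M.space.I M.space.Reg,
      (∀ σ, 𝓔.IsTest σ → 𝓔.MemL2 M.metric (M.divDist 𝓔 σ) ∧
        𝓔.l2Norm M.metric (M.divDist 𝓔 σ) ≤ C * 𝓔.h1Norm M.metric σ) ∧
      ∀ u, 𝓔.IsH1Cauchy M.metric u →
        (∃ s N, N < ⊤ ∧ 𝓔.RepresentsH1 M.metric u s N) ∧
        ∀ s N, 𝓔.RepresentsH1 M.metric u s N →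
          𝓔.MemL2 M.metric (M.divDist 𝓔 s) ∧
          𝓔.l2Norm M.metric (M.divDist 𝓔 s) ≤ C * N ∧
          Tendsto (fun k ↦ 𝓔.l2Norm M.metric (M.divDist 𝓔 (u k) - M.divDist 𝓔 s)) atTop (𝓝 0) := by
  have : T2Space M.space.Reg := inferInstanceAs (T2Space {p : M.space.carrier // _})
  have := IACS.secondCountableTopology_reg M.depth M.str
  obtain ⟨w, hw⟩ := IACS.exists_isHardyWeightOn_form M.depth M.str hlink M.isMetric
  obtain ⟨C, hC⟩ := hw.exists_l2Norm_smul_le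
  have hm : Measurable fun p ↦ ((M.singDist p)⁻¹).toReal :=
    (IACS.measurable_singDist M.metric).inv.ennreal_toReal
  refine ⟨fun p ↦ ?_, C, fun 𝓔 ↦ ⟨fun σ hσ ↦ ⟨⟨?_, ?_⟩, hC 𝓔 σ hσ⟩, fun u hu ↦
    ⟨hu.exists_representsH1, fun s N h ↦ h.smul hm fun σ hσ ↦ hC 𝓔 σ hσ⟩⟩⟩
  -- Where the distance vanishes the positive weight would have to vanish too.
  · obtain ⟨K, -, hK⟩ := hw.le_singDist
    refine pos_iff_ne_zero.2 fun h ↦ ?_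
    have h1 := hK p
    rw [show IACS.singDist M.metric p = 0 from h, mul_zero] at h1
    exact (ENNReal.ofReal_pos.2 (hw.pos p)).not_ge h1
  · exact IACS.HermitianBundle.AEMeas.smul (𝓔 := 𝓔) hσ.aeMeas hm
  · exact (hC 𝓔 σ hσ).trans_lt
      (ENNReal.mul_lt_top ENNReal.coe_lt_top (IACS.HermitianBundle.h1Norm_lt_top hσ))
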